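/- **Theorem.** Let $\Gamma$ be a countable group and let $\Gamma\curvearrowright(X,\mu)$ be a free, ergodic, measure preserving action by Borel automorphisms on a standard probability space (a standard Borel space $X$ with a non-atomic Borel probability measure $\mu$), where free means that for every $\gamma\ne e$ one has $\gamma x\neq x$ for $\mu$-almost every $x$. Let $M=L^\infty(X,\mu)\rtimes\Gamma$ be the crossed product, i.e. the von Neumann algebra on $L^2(X,\mu)\mathbin{\overline\otimes}\ell^2\Gamma$ generated by the operators $L_f(g\otimes\delta_{\gamma'})=fg\otimes\delta_{\gamma'}$ ($f\in L^\infty(X,\mu)$) and $u_\gamma(g\otimes\delta_{\gamma'})=(g\circ\gamma^{-1})\otimes\delta_{\gamma\gamma'}$ ($\gamma\in\Gamma$), with trace $\tau(y)=\langle y(1\otimes\delta_e),1\otimes\delta_e\rangle$; identify $L^\infty(X,\mu)$ with $\{L_f\}\subset M$. A Hilbert $M$-bimodule is a Hilbert space with commuting normal unital left and right actions of $M$. The action is called *rigid* if for every $\varepsilon>0$ there are a finite set $F\subset M$ and $\delta>0$ such that for every Hilbert $M$-bimodule $\mathcal H$ and every unit vector $\xi\in\mathcal H$ with $\langle x\xi,\xi\rangle=\langle\xi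 x,\xi\rangle=\tau(x)$ for all $x\in M$ and $\|x\xi-\xi x\|\le\delta$ for all $x\in F$, there is $\eta\in\mathcal H$ with $f\eta=\eta f$ for all $f\in L^\infty(X,\mu)$ and $\|\eta-\xi\|\le\varepsilon$. Let $\Delta=\{(x,x):x\in X\}$, let $p^1,p^2:X\times X\to X$ be the coordinate projections, and let $\Gamma$ act diagonally on $X\times X$. Write $\|\nu-\nu'\|=\sup|\int f\,d\nu-\int f\,d\nu'|$, the supremum being over complex Borel functions $f$ with $|f|\le1$. For a sequence $(\nu_n)$ of Borel probability measures on $X\times X$ consider the conditions * (0) $p^1_*\nu_n=p^2_*\nu_n=\mu$ for all $n$; * (i) $\int_{X\times X} f_1(x)f_2(y)\,d\nu_n(x,y)\to\int_X f_1f_2\,d\mu$ for all bounded Borel functions $f_1,f_2:X\to\mathbb C$; * (ii) $\|\gamma_*\nu_n-\nu_n\|\to0$ for every $\gamma\in\Gamma$; * (ii′) $\gamma_*\nu_n=\nu_n$ for every $n$ and every $\gamma\in\Gamma$. Then the following are equivalent: * (a) the action $\Gamma\curvearrowright(X,\mu)$ is rigid; * (b) there is no sequence $(\nu_n)$ satisfying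 (0), (i), (ii) and $\nu_n(\Delta)=0$ for all $n$; * (c) every sequence $(\nu_n)$ satisfying (0), (i), (ii) has $\nu_n(\Delta)\to1$. Moreover, if $\Gamma$ has property (T) (every unitary representation of $\Gamma$ with almost invariant unit vectors has a nonzero invariant vector), then (a) is equivalent to each of the statements obtained from (b) and (c) by replacing (ii) with (ii′). -/

import Mathlib

open MeasureTheory Filter Topology
open scoped ENNReal

universe u v w

noncomputable section

/-! ### Von Neumann algebras, Hilbert bimodules, rigid inclusions -/

section VonNeumann

variable {H : Type u} [NormedAddCommGroup H] [InnerProductSpace ℂ H] [CompleteSpace H]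

/-- The von Neumann algebra generated by a set `S` of bounded operators: the double commutant
of `S ∪ S*`. -/
def vonNeumannGenerated (S : Set (H →L[ℂ] H)) : VonNeumannAlgebra H where
  toStarSubalgebra := StarSubalgebra.centralizer ℂ
    ((StarSubalgebra.centralizer ℂ S : StarSubalgebra ℂ (H →L[ℂ] H)) : Set (H →L[ℂ] H))
  centralizer_centralizer' := by
    change Set.centralizer (Set.centralizer ((StarSubalgebra.centralizer ℂ
      ((StarSubalgebra.centralizer ℂ S : StarSubalgebra ℂ (H →L[ℂ] H)) : Set (H →L[ℂ] H)) :
        StarSubalgebra ℂ (H →L[ℂ] H)) : Set (H →L[ℂ] H))) = _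
    rw [StarSubalgebra.coe_centralizer, Set.centralizer_centralizer_centralizer]
    exact (StarSubalgebra.coe_centralizer ℂ _).symm

theorem subset_vonNeumannGenerated (S : Set (H →L[ℂ] H)) {x : H →L[ℂ] H} (hx : x ∈ S) :
    x ∈ (vonNeumannGenerated S).toStarSubalgebra := by
  change x ∈ StarSubalgebra.centralizer ℂ
    ((StarSubalgebra.centralizer ℂ S : StarSubalgebra ℂ (H →L[ℂ] H)) : Set (H →L[ℂ] H))
  rw [StarSubalgebra.mem_centralizer_iff]
  intro g hg
  rw [SetLike.mem_coe, StarSubalgebra.mem_centralizer_iff] at hg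
  obtain ⟨h1, h2⟩ := hg x hx
  refine ⟨h1.symm, ?_⟩
  have h3 := congrArg star h2
  simpa [star_mul] using h3

/-- A map `π` from a von Neumann algebra `M ⊆ B(H)` to `B(K)` is normal if it is continuous on
the unit ball of `M` for the weak operator topologies. -/
def IsNormalMap (M : VonNeumannAlgebra H) {K : Type w} [NormedAddCommGroup K]
    [InnerProductSpace ℂ K] (π : M.toStarSubalgebra → (K →L[ℂ] K)) : Prop :=
  ∀ (l : Filter M.toStarSubalgebra) (x : M.toStarSubalgebra),
    (∀ᶠ y : M.toStarSubalgebra in l, ‖(y : H →L[ℂ] H)‖ ≤ 1) →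
    (∀ a b : H, Tendsto (fun y : M.toStarSubalgebra => inner ℂ a ((y : H →L[ℂ] H) b)) l
      (𝓝 (inner ℂ a ((x : H →L[ℂ] H) b)))) →
    ∀ η ζ : K, Tendsto (fun y => inner ℂ η (π y ζ)) l (𝓝 (inner ℂ η (π x ζ)))

/-- A Hilbert `M`-bimodule structure on the Hilbert space `K`: commuting normal unital
`*`-representations of `M` (the left action `x, ζ ↦ x ζ`) and of the opposite algebra of `M`
(the right action `x, ζ ↦ ζ x`). -/
structure HilbertBimodule (M : VonNeumannAlgebra H) (K : Type w) [NormedAddCommGroup K]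
    [InnerProductSpace ℂ K] [CompleteSpace K] where
  left : M.toStarSubalgebra →⋆ₐ[ℂ] (K →L[ℂ] K)
  right : (M.toStarSubalgebra)ᵐᵒᵖ →⋆ₐ[ℂ] (K →L[ℂ] K)
  commute : ∀ x y, Commute (left x) (right y)
  left_normal : IsNormalMap M (fun x => left x)
  right_normal : IsNormalMap M (fun x => right (MulOpposite.op x))

/-- The inclusion `B ⊆ M`, where `M` carries the trace `τ`, is rigid (has relative property (T)).
The bimodules range over Hilbert spaces in the universe of the space on which `M` acts; this
universe contains, up to isomorphism, every bimodule generated by a single vector. -/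
def IsRigidInclusion (M : VonNeumannAlgebra H) (B : StarSubalgebra ℂ (H →L[ℂ] H))
    (τ : M.toStarSubalgebra → ℂ) : Prop :=
  ∀ ε : ℝ, 0 < ε → ∃ (F : Finset M.toStarSubalgebra) (δ : ℝ), 0 < δ ∧
    ∀ (K : Type u) [NormedAddCommGroup K] [InnerProductSpace ℂ K] [CompleteSpace K]
      (β : HilbertBimodule M K) (ξ : K), ‖ξ‖ = 1 →
      (∀ x, inner ℂ ξ (β.left x ξ) = τ x ∧ inner ℂ ξ (β.right (MulOpposite.op x) ξ) = τ x) →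
      (∀ x ∈ F, ‖β.left x ξ - β.right (MulOpposite.op x) ξ‖ ≤ δ) →
      ∃ η : K, (∀ b : M.toStarSubalgebra, (b : H →L[ℂ] H) ∈ B →
          β.left b η = β.right (MulOpposite.op b) η) ∧ ‖η - ξ‖ ≤ ε

end VonNeumann

/-! ### The crossed product `L^∞(X, μ) ⋊ Γ` -/

section CrossedProduct

variable {X : Type u} [MeasurableSpace X]

/-- Multiplication by `f ∈ L^∞(X, μ)` on `L²(X, μ)`. -/
def mulL2 (μ : Measure X) (f : Lp ℂ ∞ μ) : Lp ℂ 2 μ →L[ℂ] Lp ℂ 2 μ :=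
  (ContinuousLinearMap.mul ℂ ℂ).holderL μ ∞ 2 2 f

theorem coeFn_mulL2 (μ : Measure X) (f : Lp ℂ ∞ μ) (g : Lp ℂ 2 μ) :
    mulL2 μ f g =ᵐ[μ] fun x => f x * g x :=
  ContinuousLinearMap.coeFn_holder (ContinuousLinearMap.mul ℂ ℂ) f g

/-- The Hilbert space `L²(X, μ) ⊗ ℓ²Γ`, realised as `ℓ²(Γ, L²(X, μ))`. -/
abbrev CrossedL2 (Γ : Type v) (μ : Measure X) : Type (max u v) :=
  lp (fun _ : Γ => Lp ℂ 2 μ) 2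

/-- The operator `L_f` on `L²(X, μ) ⊗ ℓ²Γ`: `L_f (g ⊗ δ_γ) = f g ⊗ δ_γ`. -/
def crossedMul (Γ : Type v) (μ : Measure X) (f : Lp ℂ ∞ μ) :
    CrossedL2 Γ μ →L[ℂ] CrossedL2 Γ μ :=
  lp.mapCLM 2 (fun _ : Γ => mulL2 μ f) (norm_nonneg (mulL2 μ f)) (fun _ => le_rfl)

@[simp]
theorem crossedMul_apply (Γ : Type v) (μ : Measure X) (f : Lp ℂ ∞ μ) (ξ : CrossedL2 Γ μ) (γ : Γ) :
    crossedMul Γ μ f ξ γ = mulL2 μ f (ξ γ) := rfl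

/-- The `*`-algebra `{L_f | f ∈ L^∞(X, μ)}` of operators on `L²(X, μ) ⊗ ℓ²Γ`. -/
def crossedLinfty (Γ : Type v) (μ : Measure X) [IsFiniteMeasure μ] :
    StarSubalgebra ℂ (CrossedL2 Γ μ →L[ℂ] CrossedL2 Γ μ) where
  carrier := Set.range (crossedMul Γ μ)
  mul_mem' := by
    rintro _ _ ⟨f, rfl⟩ ⟨g, rfl⟩
    refine ⟨(ContinuousLinearMap.mul ℂ ℂ).holder ∞ f g, ?_⟩
    ext1 ξ
    refine lp.ext (funext fun γ => ?_)
    change mulL2 μ _ (ξ γ) = mulL2 μ f (mulL2 μ g (ξ γ))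
    apply Lp.ext
    filter_upwards [coeFn_mulL2 μ ((ContinuousLinearMap.mul ℂ ℂ).holder ∞ f g) (ξ γ),
      coeFn_mulL2 μ f (mulL2 μ g (ξ γ)), coeFn_mulL2 μ g (ξ γ),
      ContinuousLinearMap.coeFn_holder (r := ∞) (ContinuousLinearMap.mul ℂ ℂ) f g]
      with x h1 h2 h3 h4
    rw [h1, h2, h3, h4]
    simp [mul_assoc]
  add_mem' := by
    rintro _ _ ⟨f, rfl⟩ ⟨g, rfl⟩
    refine ⟨f + g, ?_⟩
    ext1 ξ
    refine lp.ext (funext fun γ => ?_)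
    change mulL2 μ (f + g) (ξ γ) = mulL2 μ f (ξ γ) + mulL2 μ g (ξ γ)
    simp only [mulL2, map_add, add_apply]
  algebraMap_mem' := by
    intro c
    refine ⟨Lp.const ∞ μ c, ?_⟩
    ext1 ξ
    refine lp.ext (funext fun γ => ?_)
    change mulL2 μ _ (ξ γ) = c • ξ γ
    apply Lp.ext
    filter_upwards [coeFn_mulL2 μ (Lp.const ∞ μ c) (ξ γ), Lp.coeFn_const (p := ∞) (μ := μ) c,
      Lp.coeFn_smul c (ξ γ)] with x h1 h2 h3
    rw [h1, h2, h3]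
    simp
  star_mem' := by
    rintro _ ⟨f, rfl⟩
    refine ⟨star f, ?_⟩
    rw [ContinuousLinearMap.star_eq_adjoint, ContinuousLinearMap.eq_adjoint_iff]
    intro ξ ζ
    rw [lp.inner_eq_tsum, lp.inner_eq_tsum]
    refine tsum_congr fun γ => ?_
    change inner ℂ (mulL2 μ (star f) (ξ γ)) (ζ γ) = inner ℂ (ξ γ) (mulL2 μ f (ζ γ))
    rw [L2.inner_def, L2.inner_def]
    refine integral_congr_ae ?_
    filter_upwards [coeFn_mulL2 μ (star f) (ξ γ), coeFn_mulL2 μ f (ζ γ), Lp.coeFn_star f]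
      with x h1 h2 h3
    rw [h1, h2, h3]
    simp [RCLike.inner_apply]
    ring

variable {Γ : Type v} [Group Γ] [MulAction Γ X] [MeasurableConstSMul Γ X]

/-- The unitary `g ↦ g ∘ γ⁻¹` on `L²(X, μ)`. -/
def koopman (μ : Measure X) [SMulInvariantMeasure Γ X μ] (γ : Γ) : Lp ℂ 2 μ →ₗᵢ[ℂ] Lp ℂ 2 μ :=
  Lp.compMeasurePreservingₗᵢ ℂ (fun x => γ⁻¹ • x) (measurePreserving_smul γ⁻¹ μ)

/-- The unitary `u_γ` on `L²(X, μ) ⊗ ℓ²Γ`: `u_γ (g ⊗ δ_γ') = (g ∘ γ⁻¹) ⊗ δ_{γ γ'}`. -/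
def crossedUnitary (μ : Measure X) [SMulInvariantMeasure Γ X μ] (γ : Γ) :
    CrossedL2 Γ μ →L[ℂ] CrossedL2 Γ μ :=
  LinearMap.mkContinuous
    { toFun := fun ξ => ⟨fun γ' => koopman μ γ (ξ (γ⁻¹ * γ')), by
        have h := (memℓp_gen_iff (p := 2) (by norm_num)).1 (lp.memℓp ξ)
        refine (memℓp_gen_iff (p := 2) (by norm_num)).2 ?_
        simpa [Function.comp_def, LinearIsometry.norm_map] using
          (Equiv.mulLeft γ⁻¹).summable_iff.2 h⟩
      map_add' := fun ξ ζ => lp.ext (funext fun γ' => (koopman μ γ).map_add _ _)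
      map_smul' := fun c ξ => lp.ext (funext fun γ' => (koopman μ γ).map_smul _ _) }
    1 (fun ξ => by
      rw [one_mul]
      refine lp.norm_le_of_tsum_le (p := 2) (by norm_num) (norm_nonneg _) ?_
      rw [lp.norm_rpow_eq_tsum (p := 2) (by norm_num)]
      refine le_of_eq ?_
      refine Eq.trans ?_ ((Equiv.mulLeft γ⁻¹).tsum_eq
        fun γ' => ‖ξ γ'‖ ^ (2 : ℝ≥0∞).toReal)
      exact tsum_congr fun γ' => congrArg (· ^ (2 : ℝ≥0∞).toReal)
        ((koopman μ γ).norm_map (ξ (γ⁻¹ * γ'))))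

@[simp]
theorem crossedUnitary_apply (μ : Measure X) [SMulInvariantMeasure Γ X μ] (γ : Γ)
    (ξ : CrossedL2 Γ μ) (γ' : Γ) :
    crossedUnitary μ γ ξ γ' = koopman μ γ (ξ (γ⁻¹ * γ')) := rfl

/-- The crossed product von Neumann algebra `L^∞(X, μ) ⋊ Γ`, generated on `L²(X, μ) ⊗ ℓ²Γ` by the
operators `L_f` and `u_γ`. -/
def crossedProduct (Γ : Type v) [Group Γ] [MulAction Γ X] [MeasurableConstSMul Γ X]
    (μ : Measure X) [SMulInvariantMeasure Γ X μ] : VonNeumannAlgebra (CrossedL2 Γ μ) :=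
  vonNeumannGenerated
    (Set.range (crossedMul Γ μ) ∪ Set.range (crossedUnitary μ : Γ → _))

theorem crossedLinfty_le (μ : Measure X) [IsFiniteMeasure μ] [SMulInvariantMeasure Γ X μ] :
    crossedLinfty Γ μ ≤ (crossedProduct Γ μ).toStarSubalgebra :=
  fun _ hx => subset_vonNeumannGenerated _ (Or.inl hx)

open Classical in
/-- The unit vector `1 ⊗ δ_e`. -/
def crossedVacuum (Γ : Type v) [Group Γ] (μ : Measure X) [IsFiniteMeasure μ] : CrossedL2 Γ μ :=
  lp.single 2 (1 : Γ) (Lp.const 2 μ (1 : ℂ))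

/-- The trace `τ(y) = ⟨y (1 ⊗ δ_e), 1 ⊗ δ_e⟩` on `L^∞(X, μ) ⋊ Γ`. -/
def crossedTrace (Γ : Type v) [Group Γ] [MulAction Γ X] [MeasurableConstSMul Γ X]
    (μ : Measure X) [IsFiniteMeasure μ] [SMulInvariantMeasure Γ X μ] :
    (crossedProduct Γ μ).toStarSubalgebra → ℂ :=
  fun y => inner ℂ (crossedVacuum Γ μ)
    ((y : CrossedL2 Γ μ →L[ℂ] CrossedL2 Γ μ) (crossedVacuum Γ μ))

/-- The action `Γ ↷ (X, μ)` is rigid: the inclusion `L^∞(X, μ) ⊆ L^∞(X, μ) ⋊ Γ` is rigid. -/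
def IsRigidAction (Γ : Type v) [Group Γ] [MulAction Γ X] [MeasurableConstSMul Γ X]
    (μ : Measure X) [IsFiniteMeasure μ] [SMulInvariantMeasure Γ X μ] : Prop :=
  IsRigidInclusion (crossedProduct Γ μ) (crossedLinfty Γ μ) (crossedTrace Γ μ)

end CrossedProduct

/-! ### Actions, property (T), sequences of measures -/

/-- The action is (essentially) free: for `γ ≠ e`, almost every point is moved by `γ`. -/
def IsFreeAction (Γ : Type v) {X : Type u} [Group Γ] [MulAction Γ X] [MeasurableSpace X]
    (μ : Measure X) : Prop :=
  ∀ γ : Γ, γ ≠ 1 → ∀ᵐ x ∂μ, γ • x ≠ x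

/-- Kazhdan's property (T) for a discrete group: every unitary representation with almost invariant
vectors has a nonzero invariant vector. The representations are on Hilbert spaces in an arbitrary
universe `w`; for a countable group the choice of `w` does not matter. -/
def HasPropertyT (Γ : Type v) [Group Γ] : Prop :=
  ∀ (K : Type w) [NormedAddCommGroup K] [InnerProductSpace ℂ K] [CompleteSpace K]
    (π : Γ →* unitary (K →L[ℂ] K)),
    (∀ (F : Finset Γ) (ε : ℝ), 0 < ε →
      ∃ ξ : K, ‖ξ‖ = 1 ∧ ∀ γ ∈ F, ‖(π γ : K →L[ℂ] K) ξ - ξ‖ < ε) →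
    ∃ η : K, η ≠ 0 ∧ ∀ γ : Γ, (π γ : K →L[ℂ] K) η = η

/-- The norm `‖μ - ν‖ = sup |∫ f dμ - ∫ f dν|` over complex Borel functions `f` with `|f| ≤ 1`. -/
def measureDist {Y : Type u} [MeasurableSpace Y] (μ ν : Measure Y) : ℝ :=
  sSup {r : ℝ | ∃ f : Y → ℂ, Measurable f ∧ (∀ y, ‖f y‖ ≤ 1) ∧
    r = ‖(∫ y, f y ∂μ) - ∫ y, f y ∂ν‖}

section Sequences

variable {X : Type u} [MeasurableSpace X]

/-- `ν n` are probability measures on `X × X` with both marginals `μ`, and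
`∫ f₁(x) f₂(y) dν_n(x, y) → ∫ f₁ f₂ dμ` for all bounded Borel functions `f₁, f₂ : X → ℂ`. -/
structure IsApproxDiagonal (μ : Measure X) (ν : ℕ → Measure (X × X)) : Prop where
  isProbabilityMeasure : ∀ n, IsProbabilityMeasure (ν n)
  map_fst : ∀ n, (ν n).map Prod.fst = μ
  map_snd : ∀ n, (ν n).map Prod.snd = μ
  tendsto_integral : ∀ f₁ f₂ : X → ℂ, Measurable f₁ → Measurable f₂ →
    (∃ C : ℝ, ∀ x, ‖f₁ x‖ ≤ C) → (∃ C : ℝ, ∀ x, ‖f₂ x‖ ≤ C) →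
    Tendsto (fun n => ∫ p, f₁ p.1 * f₂ p.2 ∂(ν n)) atTop (𝓝 (∫ x, f₁ x * f₂ x ∂μ))

/-- `‖γ_* ν_n - ν_n‖ → 0` for every `γ ∈ Γ`, for the diagonal action of `Γ` on `X × X`. -/
def IsAsymptoticallyInvariant (Γ : Type v) [Group Γ] [MulAction Γ X]
    (ν : ℕ → Measure (X × X)) : Prop :=
  ∀ γ : Γ, Tendsto (fun n => measureDist ((ν n).map fun p => (γ • p.1, γ • p.2)) (ν n))
    atTop (𝓝 0)

/-- Every `ν_n` is invariant under the diagonal action of `Γ` on `X × X`. -/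
def IsInvariantSeq (Γ : Type v) [Group Γ] [MulAction Γ X] (ν : ℕ → Measure (X × X)) : Prop :=
  ∀ n, ∀ γ : Γ, (ν n).map (fun p => (γ • p.1, γ • p.2)) = ν n

end Sequences

end

/-! The proof is a dictionary between couplings of `μ` with itself and tracial vectors in bimodules
over `M`. If both vector states of `ξ` are `τ`, then `∫ f(x) g(y) dν = ⟨f ξ g, ξ⟩` defines a
probability measure `ν` on `X × X` with marginals `μ`. Here `‖f ξ - ξ f‖² = ∫ |f(x) - f(y)|² dν`, so
almost commuting with `L^∞` means that `ν` is close to the diagonal. Conjugating `ξ` by `u_γ`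
translates `ν` by `γ`, so almost commuting with `u_γ` gives almost invariance. Applying to `ξ` the
spectral projection of the diagonal gives a vector commuting with `L^∞` at distance `ν(Δᶜ)^{1/2}`.

(a) implies (c). Symmetrizing `ν_n` under the flip and averaging over `Γ` with positive summable
weights makes it symmetric and quasi-invariant, at vanishing total variation cost and without
changing `ν_n(Δ)`. Then `ℓ²(Γ, L²(ν_n))` is an `M`-bimodule. The left action is extended from the
generators by intertwiners with the standard representation (`IsIntertwiningFamily.extend`), and the
right action is its conjugate by an antiunitary involution (`IsBimoduleCoupling.bimodule`). The
vector `1 ⊗ δ_e` is tracial and asymptotically commutes with the generators, hence with all of `M`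
(`tendsto_commutator`). Rigidity supplies a nearby vector commuting with `L^∞`; its component at `e`
is supported on `Δ`, which forces `ν_n(Δ) → 1` (`IsRigidAction.tendsto_diagonal`).

(c) implies (b) because mass zero does not tend to one.

Failure of (a) contradicts (b). Without rigidity the dictionary, realized by the spectral measure of
the normal operator `t ⊗ 1 + i (1 ⊗ t)` for an injective coordinate `t`, gives couplings as
invariant and as close to the diagonal as desired, with off-diagonal mass at least a fixed `ε > 0`
(`exists_isCoupling_of_not_isRigidAction`). This mass is then raised to one. Let `ρ` be an
off-diagonal partial coupling, `w` the density of the missing part of its marginal, and `κ` the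
off-diagonal part of a much finer coupling. Then `ρ + w(x) w(y) κ` still has marginals at most `μ`.
Ergodicity makes the marginal of `κ` look like a multiple of `μ` to `w`, so the gain is about `κ(X ×
X) ∫ w² dμ ≥ ε (1 - ρ(X × X))²` (`HasPartialCouplings.add_mul_sq`). Masses arbitrarily close to one
are therefore reached, and the small remainder is filled by an off-diagonal product measure, `μ`
having no atoms.

Property (T). In the Koopman representations on `L²(ν_n)` the vector `1` is almost invariant, hence
close to an invariant vector `g`. The normalization of `|g|² ν_n` is invariant and absolutely
continuous with respect to `ν_n`, so it does not charge `Δ`; by ergodicity its marginals are `μ`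
(`exists_invariant_isCoupling`). -/

noncomputable section

set_option linter.unusedSectionVars false

/-! ### Normal representations determined by their values on generators -/

section NormalExtension

open ContinuousLinearMap

variable {H : Type u} [NormedAddCommGroup H] [InnerProductSpace ℂ H] [CompleteSpace H]
variable {K : Type w} [NormedAddCommGroup K] [InnerProductSpace ℂ K] [CompleteSpace K]

/-- `c` commutes with every element of the von Neumann algebra generated by `S` as soon as it
commutes with `S` and `S*`. -/
theorem commute_of_mem_vonNeumannGenerated {S : Set (H →L[ℂ] H)} {c : H →L[ℂ] H}
    (h1 : ∀ a ∈ S, a * c = c * a) (h2 : ∀ a ∈ S, star a * c = c * star a)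
    {y : H →L[ℂ] H} (hy : y ∈ (vonNeumannGenerated S).toStarSubalgebra) : y * c = c * y := by
  change y ∈ StarSubalgebra.centralizer ℂ
    ((StarSubalgebra.centralizer ℂ S : StarSubalgebra ℂ (H →L[ℂ] H)) : Set (H →L[ℂ] H)) at hy
  rw [StarSubalgebra.mem_centralizer_iff] at hy
  refine ((hy c ?_).1).symm
  rw [SetLike.mem_coe, StarSubalgebra.mem_centralizer_iff]
  exact fun a ha => ⟨h1 a ha, h2 a ha⟩

/-- A family of bounded operators `V i : H → K` with jointly dense range, intertwining every
`a ∈ S` (and its adjoint) with some operator on `K` (and its adjoint). -/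
structure IsIntertwiningFamily {ι : Type*} (S : Set (H →L[ℂ] H)) (V : ι → H →L[ℂ] K) : Prop where
  intertwine : ∀ a ∈ S, ∃ b : K →L[ℂ] K, ∀ i, V i ∘L a = b ∘L V i ∧ V i ∘L star a = star b ∘L V i
  dense : ∀ U : Submodule ℂ K, IsClosed (U : Set K) → (∀ i x, V i x ∈ U) → U = ⊤

namespace IsIntertwiningFamily

variable {ι : Type*} {S : Set (H →L[ℂ] H)} {V : ι → H →L[ℂ] K}

theorem exists_adjoint_comp (hV : IsIntertwiningFamily S V) {a : H →L[ℂ] H} (ha : a ∈ S) :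
    ∃ b : K →L[ℂ] K, (∀ i, V i ∘L a = b ∘L V i ∧ V i ∘L star a = star b ∘L V i) ∧
      ∀ i, adjoint (V i) ∘L b = a ∘L adjoint (V i) ∧
        adjoint (V i) ∘L star b = star a ∘L adjoint (V i) := by
  obtain ⟨b, hb⟩ := hV.intertwine a ha
  refine ⟨b, hb, fun i => ?_⟩
  have h1 := congrArg adjoint (hb i).1
  have h2 := congrArg adjoint (hb i).2
  rw [adjoint_comp, adjoint_comp] at h1 h2
  simp only [star_eq_adjoint, adjoint_adjoint] at h1 h2 ⊢
  exact ⟨h2.symm, h1.symm⟩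

/-- Each generator passes through `V i`, then `c`, then the adjoint of `V j`, and so does its
adjoint; hence the composite lies in the commutant of the generated algebra. For `c = 1` these are
the Gram operators of the family. -/
theorem commute_adjoint_comp_comp (hV : IsIntertwiningFamily S V) {c : K →L[ℂ] K}
    (hc : ∀ a ∈ S, ∀ b : K →L[ℂ] K,
      (∀ i, V i ∘L a = b ∘L V i ∧ V i ∘L star a = star b ∘L V i) →
      b * c = c * b ∧ star b * c = c * star b)
    {y : H →L[ℂ] H} (hy : y ∈ (vonNeumannGenerated S).toStarSubalgebra) (i j : ι) :
    y * (adjoint (V j) ∘L c ∘L V i) = (adjoint (V j) ∘L c ∘L V i) * y := by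
  refine commute_of_mem_vonNeumannGenerated (S := S) (fun a ha => ?_) (fun a ha => ?_) hy
  · obtain ⟨b, hb, hb'⟩ := hV.exists_adjoint_comp ha
    obtain ⟨h1, h2⟩ := hc a ha b hb
    calc a * (adjoint (V j) ∘L c ∘L V i) = (a ∘L adjoint (V j)) ∘L c ∘L V i := rfl
      _ = adjoint (V j) ∘L (b * c) ∘L V i := by rw [← (hb' j).1]; rfl
      _ = adjoint (V j) ∘L c ∘L (b ∘L V i) := by rw [h1]; rfl
      _ = _ := by rw [← (hb i).1]; rfl
  · obtain ⟨b, hb, hb'⟩ := hV.exists_adjoint_comp ha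
    obtain ⟨h1, h2⟩ := hc a ha b hb
    calc star a * (adjoint (V j) ∘L c ∘L V i) = (star a ∘L adjoint (V j)) ∘L c ∘L V i := rfl
      _ = adjoint (V j) ∘L (star b * c) ∘L V i := by rw [← (hb' j).2]; rfl
      _ = adjoint (V j) ∘L c ∘L (star b ∘L V i) := by rw [h2]; rfl
      _ = _ := by rw [← (hb i).2]; rfl

theorem commute_gram (hV : IsIntertwiningFamily S V)
    {y : H →L[ℂ] H} (hy : y ∈ (vonNeumannGenerated S).toStarSubalgebra) (i j : ι) :
    y * (adjoint (V j) ∘L V i) = (adjoint (V j) ∘L V i) * y :=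
  hV.commute_adjoint_comp_comp (c := 1) (fun _ _ _ _ => by simp) hy i j

/-- The operator `⨁ᵢ H → K`, `ξ ↦ ∑ V i (y (ξ i))`. -/
def sumMap (V : ι → H →L[ℂ] K) (y : H →L[ℂ] H) : (ι →₀ H) →ₗ[ℂ] K :=
  Finsupp.lsum ℂ fun i => ((V i ∘L y : H →L[ℂ] K) : H →ₗ[ℂ] K)

theorem sumMap_single (V : ι → H →L[ℂ] K) (y : H →L[ℂ] H) (i : ι) (x : H) :
    sumMap V y (Finsupp.single i x) = V i (y x) := by
  simp [sumMap]

theorem sumMap_apply (V : ι → H →L[ℂ] K) (y : H →L[ℂ] H) (ξ : ι →₀ H) :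
    sumMap V y ξ = ∑ i ∈ ξ.support, V i (y (ξ i)) := by
  simp [sumMap, Finsupp.sum]

/-- An operator commuting with all Gram operators can be moved across the sesquilinear form that
they define. Well-definedness of the extension thereby becomes an inequality between such forms. -/
theorem inner_sumMap (y z : H →L[ℂ] H)
    (hy : ∀ i j, y * (adjoint (V j) ∘L V i) = (adjoint (V j) ∘L V i) * y) (ξ ζ : ι →₀ H) :
    inner ℂ (sumMap V (star y) ξ) (sumMap V z ζ) = inner ℂ (sumMap V 1 ξ) (sumMap V (y * z) ζ) := by
  simp only [sumMap_apply, sum_inner, inner_sum]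
  refine Finset.sum_congr rfl fun i _ => Finset.sum_congr rfl fun j _ => ?_
  rw [← adjoint_inner_right (V j), ← adjoint_inner_right (V j), star_eq_adjoint,
    adjoint_inner_left]
  exact congrArg (inner ℂ (ξ j)) (DFunLike.congr_fun (hy i j) (z (ζ i)))

/-- The positive operator `‖y‖² - y*y` has a square root `z` which again commutes with the Gram
operators. So `‖y‖² ‖∑ V i ξ i‖² - ‖∑ V i (y ξ i)‖²` equals `‖∑ V i (z ξ i)‖²` and is nonnegative.
-/
theorem norm_sumMap_le (hV : IsIntertwiningFamily S V) {y : H →L[ℂ] H}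
    (hy : y ∈ (vonNeumannGenerated S).toStarSubalgebra) (ξ : ι →₀ H) :
    ‖sumMap V y ξ‖ ≤ ‖y‖ * ‖sumMap V 1 ξ‖ := by
  have hcy := hV.commute_gram hy
  have hcy' := hV.commute_gram (star_mem hy)
  set p : H →L[ℂ] H := algebraMap ℝ (H →L[ℂ] H) (‖y‖ ^ 2) - star y * y with hp
  have hp0 : 0 ≤ p := by
    rw [hp, sub_nonneg]
    have h := IsSelfAdjoint.le_algebraMap_norm_self (a := star y * y)
      (IsSelfAdjoint.star_mul_self y)
    rwa [CStarRing.norm_star_mul_self, ← sq] at h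
  set z := CFC.sqrt p
  have hz : z * z = p := CFC.sqrt_mul_sqrt_self p hp0
  have hzs : star z = z := (CFC.sqrt_nonneg p).isSelfAdjoint.star_eq
  have hcz : ∀ i j, z * (adjoint (V j) ∘L V i) = (adjoint (V j) ∘L V i) * z := by
    intro i j
    have hcp : Commute p (adjoint (V j) ∘L V i) := by
      refine Commute.sub_left (Algebra.commutes _ _) ?_
      exact Commute.mul_left (hcy' i j) (hcy i j)
    have : z = cfc NNReal.sqrt p := CFC.sqrt_eq_cfc
    rw [this]
    exact hcp.cfc_nnreal _
  have h1 : inner ℂ (sumMap V z ξ) (sumMap V z ξ) = inner ℂ (sumMap V 1 ξ) (sumMap V p ξ) := by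
    have := inner_sumMap z z hcz ξ ξ
    rwa [hzs, hz] at this
  have h2 : inner ℂ (sumMap V y ξ) (sumMap V y ξ)
      = inner ℂ (sumMap V 1 ξ) (sumMap V (star y * y) ξ) := by
    have := inner_sumMap (star y) y hcy' ξ ξ
    rwa [star_star] at this
  have h3 : sumMap V p ξ = ((‖y‖ ^ 2 : ℝ) : ℂ) • sumMap V 1 ξ - sumMap V (star y * y) ξ := by
    simp only [sumMap_apply, Finset.smul_sum, ← Finset.sum_sub_distrib]
    refine Finset.sum_congr rfl fun i _ => ?_
    rw [hp, sub_apply, map_sub, Algebra.algebraMap_eq_smul_one, ← Complex.coe_smul]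
    simp
  rw [h3, inner_sub_right, inner_smul_right, ← h2] at h1
  simp only [inner_self_eq_norm_sq_to_K] at h1
  have h4 : ‖sumMap V z ξ‖ ^ 2 = ‖y‖ ^ 2 * ‖sumMap V 1 ξ‖ ^ 2 - ‖sumMap V y ξ‖ ^ 2 := by
    apply Complex.ofReal_injective
    push_cast at h1 ⊢
    exact h1
  refine le_of_sq_le_sq ?_ (by positivity)
  nlinarith [sq_nonneg ‖sumMap V z ξ‖]

theorem denseRange_sumMap (hV : IsIntertwiningFamily S V) : DenseRange (sumMap V 1) := by
  have h := hV.dense (LinearMap.range (sumMap V 1)).topologicalClosure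
    (Submodule.isClosed_topologicalClosure _) fun i x =>
      Submodule.le_topologicalClosure _ ⟨Finsupp.single i x, by simp [sumMap_single]⟩
  have h2 := (Submodule.dense_iff_topologicalClosure_eq_top).2 h
  simpa [DenseRange, LinearMap.coe_range] using h2

theorem ext_clm (hV : IsIntertwiningFamily S V) {A B : K →L[ℂ] K}
    (h : ∀ i x, A (V i x) = B (V i x)) : A = B := by
  have h1 := hV.dense (LinearMap.eqLocus A.toLinearMap B.toLinearMap)
    (isClosed_eq A.continuous B.continuous) h
  ext x
  have : x ∈ LinearMap.eqLocus A.toLinearMap B.toLinearMap := h1 ▸ Submodule.mem_top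
  exact this

variable (V) in
/-- The extension to `vonNeumannGenerated S` of the representation on `K` determined by an
intertwining family. -/
def extendFun (y : H →L[ℂ] H) : K →L[ℂ] K := (sumMap V y).extendOfNorm (sumMap V 1)

theorem extendFun_apply (hV : IsIntertwiningFamily S V) {y : H →L[ℂ] H}
    (hy : y ∈ (vonNeumannGenerated S).toStarSubalgebra) (i : ι) (x : H) :
    extendFun V y (V i x) = V i (y x) := by
  have := LinearMap.extendOfNorm_eq (f := sumMap V y) hV.denseRange_sumMap
    ⟨‖y‖, hV.norm_sumMap_le hy⟩ (Finsupp.single i x)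
  simpa only [sumMap_single, one_apply_eq_self, extendFun] using this

theorem norm_extendFun_le (hV : IsIntertwiningFamily S V) {y : H →L[ℂ] H}
    (hy : y ∈ (vonNeumannGenerated S).toStarSubalgebra) : ‖extendFun V y‖ ≤ ‖y‖ :=
  ContinuousLinearMap.opNorm_le_bound _ (norm_nonneg _)
    (LinearMap.norm_extendOfNorm_apply_le hV.denseRange_sumMap _ (hV.norm_sumMap_le hy))

/-- The normal representation of `vonNeumannGenerated S` on `K` determined by an intertwining
family. -/
def extend (hV : IsIntertwiningFamily S V) :
    (vonNeumannGenerated S).toStarSubalgebra →⋆ₐ[ℂ] (K →L[ℂ] K) where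
  toFun y := extendFun V y
  map_one' := hV.ext_clm fun i x => by
    simpa using hV.extendFun_apply (one_mem (vonNeumannGenerated S).toStarSubalgebra) i x
  map_mul' y z := hV.ext_clm fun i x => by
    rw [mul_apply_eq_comp, hV.extendFun_apply z.2, hV.extendFun_apply y.2,
      hV.extendFun_apply (y * z).2]
    rfl
  map_zero' := hV.ext_clm fun i x => by
    simpa using hV.extendFun_apply (zero_mem (vonNeumannGenerated S).toStarSubalgebra) i x
  map_add' y z := hV.ext_clm fun i x => by
    rw [add_apply, hV.extendFun_apply z.2, hV.extendFun_apply y.2,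
      hV.extendFun_apply (y + z).2, ← map_add]
    rfl
  commutes' c := hV.ext_clm fun i x => by
    rw [hV.extendFun_apply (algebraMap ℂ (vonNeumannGenerated S).toStarSubalgebra c).2]
    rw [Algebra.algebraMap_eq_smul_one, Algebra.algebraMap_eq_smul_one]
    simp
  map_star' y := hV.ext_clm fun i x => by
    rw [hV.extendFun_apply (star y).2, ← sub_eq_zero]
    set A : K →L[ℂ] K := extendFun V (y : H →L[ℂ] H)
    -- The difference of the two candidates is orthogonal to every `V j z`, hence to itself.
    have h1 := hV.dense (ℂ ∙ (V i (((star y : (vonNeumannGenerated S).toStarSubalgebra) :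
      H →L[ℂ] H) x) - star A (V i x)))ᗮ (Submodule.isClosed_orthogonal _) ?_
    · have h2 : (V i (((star y : (vonNeumannGenerated S).toStarSubalgebra) :
        H →L[ℂ] H) x) - star A (V i x)) ∈ (ℂ ∙ (V i (((star y :
        (vonNeumannGenerated S).toStarSubalgebra) : H →L[ℂ] H) x) - star A (V i x)))ᗮ :=
        h1 ▸ Submodule.mem_top
      rw [Submodule.mem_orthogonal_singleton_iff_inner_right] at h2
      exact inner_self_eq_zero.1 h2
    · intro j z
      rw [Submodule.mem_orthogonal_singleton_iff_inner_right, inner_sub_left, star_eq_adjoint,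
        adjoint_inner_left, hV.extendFun_apply y.2]
      have h3 := inner_sumMap (V := V) (y : H →L[ℂ] H) 1 (hV.commute_gram y.2)
        (Finsupp.single i x) (Finsupp.single j z)
      simp only [sumMap_single] at h3
      exact sub_eq_zero.2 h3

theorem extend_apply (hV : IsIntertwiningFamily S V)
    (y : (vonNeumannGenerated S).toStarSubalgebra) (i : ι) (x : H) :
    hV.extend y (V i x) = V i ((y : H →L[ℂ] H) x) :=
  hV.extendFun_apply y.2 i x

theorem norm_extend_le (hV : IsIntertwiningFamily S V)
    (y : (vonNeumannGenerated S).toStarSubalgebra) : ‖hV.extend y‖ ≤ ‖(y : H →L[ℂ] H)‖ :=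
  hV.norm_extendFun_le y.2

/-- The extension takes the prescribed values on generators. -/
theorem extend_eq (hV : IsIntertwiningFamily S V) (y : (vonNeumannGenerated S).toStarSubalgebra)
    {b : K →L[ℂ] K} (hb : ∀ i, V i ∘L (y : H →L[ℂ] H) = b ∘L V i) : hV.extend y = b :=
  hV.ext_clm fun i x => (hV.extend_apply y i x).trans (DFunLike.congr_fun (hb i) x)

/-- Tested between vectors `V i x` and `V j z`, the commutator involves only the adjoint of `V j`
composed with `c` and `V i`, which commutes with the whole algebra. This later propagates
commutation of the left and right actions from generators. -/
theorem commute_extend (hV : IsIntertwiningFamily S V) {c : K →L[ℂ] K}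
    (hc : ∀ a (ha : a ∈ S), Commute (hV.extend ⟨a, subset_vonNeumannGenerated S ha⟩) c ∧
      Commute (star (hV.extend ⟨a, subset_vonNeumannGenerated S ha⟩)) c)
    (y : (vonNeumannGenerated S).toStarSubalgebra) : Commute (hV.extend y) c := by
  refine hV.ext_clm fun i x => ?_
  rw [mul_apply_eq_comp, mul_apply_eq_comp, hV.extend_apply, ← sub_eq_zero]
  set d := hV.extend y (c (V i x)) - c (V i ((y : H →L[ℂ] H) x)) with hd
  have h1 := hV.dense (ℂ ∙ d)ᗮ (Submodule.isClosed_orthogonal _) ?_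
  · have h2 : d ∈ (ℂ ∙ d)ᗮ := h1 ▸ Submodule.mem_top
    rw [Submodule.mem_orthogonal_singleton_iff_inner_right] at h2
    exact inner_self_eq_zero.1 h2
  · intro j z
    have h3 := hV.commute_adjoint_comp_comp (c := c) (fun a ha b hb => by
      have := hV.extend_eq ⟨a, subset_vonNeumannGenerated S ha⟩ (fun i => (hb i).1)
      rw [← this]
      exact ⟨(hc a ha).1, (hc a ha).2⟩) y.2 i j
    have h4 : adjoint (V j) (c (V i ((y : H →L[ℂ] H) x)))
        = (y : H →L[ℂ] H) (adjoint (V j) (c (V i x))) := (DFunLike.congr_fun h3 x).symm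
    have h5 : star (hV.extend y) = hV.extend (star y) := (map_star _ _).symm
    rw [Submodule.mem_orthogonal_singleton_iff_inner_right, hd, inner_sub_left,
      ← adjoint_inner_right (hV.extend y), ← star_eq_adjoint, h5, hV.extend_apply,
      ← adjoint_inner_left (V j), ← adjoint_inner_left (V j), h4, sub_eq_zero]
    change inner ℂ _ (star (y : H →L[ℂ] H) z) = _
    rw [star_eq_adjoint, adjoint_inner_right]

end IsIntertwiningFamily

/-- Weak operator convergence along bounded operators may be checked on a total set of vectors. -/
theorem tendsto_inner_of_dense {α : Type*} {l : Filter α} {A : α → K →L[ℂ] K} {B : K →L[ℂ] K}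
    (hA : ∀ᶠ y in l, ‖A y‖ ≤ 1) (η : K) {T : Set K}
    (hT : ∀ U : Submodule ℂ K, IsClosed (U : Set K) → T ⊆ U → U = ⊤)
    (h : ∀ ζ ∈ T, Tendsto (fun y => inner ℂ η (A y ζ)) l (𝓝 (inner ℂ η (B ζ)))) (ζ : K) :
    Tendsto (fun y => inner ℂ η (A y ζ)) l (𝓝 (inner ℂ η (B ζ))) := by
  let U : Submodule ℂ K :=
    { carrier := {ζ | Tendsto (fun y => inner ℂ η (A y ζ)) l (𝓝 (inner ℂ η (B ζ)))}
      add_mem' := fun {a b} ha hb => by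
        simpa only [Set.mem_ofPred_eq, map_add, inner_add_right] using ha.add hb
      zero_mem' := by simpa using tendsto_const_nhds
      smul_mem' := fun c a ha => by
        simpa only [Set.mem_ofPred_eq, map_smul, inner_smul_right] using ha.const_mul c }
  have hU : IsClosed (U : Set K) := by
    refine isClosed_of_closure_subset fun ζ hζ => ?_
    change Tendsto _ _ _
    rw [Metric.tendsto_nhds]
    intro ε hε
    -- `‖η‖ (1 + ‖B‖)` bounds the two coefficient errors per unit distance from `ζ` to `ζ'`; the
    -- summand `1` only keeps `C` positive.
    set C : ℝ := ‖η‖ * (1 + ‖B‖) + 1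
    have hC : 0 < C := by positivity
    obtain ⟨ζ', hζ', hd⟩ := Metric.mem_closure_iff.1 hζ (ε / (2 * C)) (by positivity)
    have h1 := (Metric.tendsto_nhds.1 (show Tendsto _ _ _ from hζ')) (ε / 2) (by positivity)
    filter_upwards [h1, hA] with y hy hAy
    rw [dist_eq_norm] at hy hd ⊢
    have e : inner ℂ η (A y ζ) - inner ℂ η (B ζ) = (inner ℂ η (A y ζ') - inner ℂ η (B ζ'))
        + (inner ℂ η (A y (ζ - ζ')) - inner ℂ η (B (ζ - ζ'))) := by
      simp only [map_sub, inner_sub_right]; ring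
    have b1 : ‖(inner ℂ η (A y (ζ - ζ')) : ℂ)‖ ≤ ‖η‖ * (1 * ‖ζ - ζ'‖) :=
      (norm_inner_le_norm _ _).trans (by gcongr; exact (A y).le_of_opNorm_le hAy _)
    have b2 : ‖(inner ℂ η (B (ζ - ζ')) : ℂ)‖ ≤ ‖η‖ * (‖B‖ * ‖ζ - ζ'‖) :=
      (norm_inner_le_norm _ _).trans (by gcongr; exact B.le_opNorm _)
    have b3 : C * ‖ζ - ζ'‖ ≤ ε / 2 := by
      have := mul_le_mul_of_nonneg_left hd.le hC.le
      calc _ ≤ _ := this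
        _ = ε / 2 := by field_simp
    rw [e]
    calc _ ≤ _ := norm_add_le _ _
      _ < ε / 2 + ε / 2 := by
        refine add_lt_add_of_lt_of_le hy ((norm_sub_le _ _).trans ?_)
        refine le_trans ?_ b3
        have := norm_nonneg (ζ - ζ')
        simp only [C]
        nlinarith
      _ = ε := by ring
  have h1 := hT U hU h
  have h2 : ζ ∈ U := h1 ▸ Submodule.mem_top
  exact h2

/-- Density of the ranges is used twice, for the operators and for their adjoints, to reduce both
vectors to the form `V i z`. Such coefficients are coefficients of the original representation on
`H`, where convergence is assumed. -/
theorem IsIntertwiningFamily.isNormalMap_extend {ι : Type*} {S : Set (H →L[ℂ] H)}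
    {V : ι → H →L[ℂ] K} (hV : IsIntertwiningFamily S V) :
    IsNormalMap (vonNeumannGenerated S) (fun y => hV.extend y) := by
  intro l x hl hw η ζ
  have hl' : ∀ᶠ y in l, ‖hV.extend y‖ ≤ 1 := hl.mono fun y hy => (hV.norm_extend_le y).trans hy
  have hT : ∀ U : Submodule ℂ K, IsClosed (U : Set K) → {k | ∃ i x, V i x = k} ⊆ U → U = ⊤ :=
    fun U hU h => hV.dense U hU fun i x => h ⟨i, x, rfl⟩
  refine tendsto_inner_of_dense hl' η hT ?_ ζ
  rintro _ ⟨i, z, rfl⟩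
  have key := tendsto_inner_of_dense (A := fun y => star (hV.extend y))
    (B := star (hV.extend x)) (l := l) (by simpa using hl') (V i z) hT ?_ η
  · have := (Complex.continuous_conj.tendsto _).comp key
    simpa only [Function.comp_def, inner_conj_symm, star_eq_adjoint, adjoint_inner_left] using this
  · rintro _ ⟨j, z', rfl⟩
    have h1 := hw (adjoint (V i) (V j z')) z
    have h2 := (Complex.continuous_conj.tendsto _).comp h1
    simpa only [Function.comp_def, inner_conj_symm, star_eq_adjoint, adjoint_inner_right,
      hV.extend_apply] using h2

end NormalExtension

/-! ### Total variation -/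

section TotalVariation

variable {Y : Type u} [MeasurableSpace Y]

/-- `μ` and `ν` are at total variation distance at most `δ`, tested on real functions. -/
def TVLe (μ ν : Measure Y) (δ : ℝ) : Prop :=
  ∀ f : Y → ℝ, Measurable f → (∀ y, |f y| ≤ 1) → |(∫ y, f y ∂μ) - ∫ y, f y ∂ν| ≤ δ

theorem integrable_of_bound {E : Type*} [NormedAddCommGroup E] [MeasurableSpace E] [BorelSpace E]
    [SecondCountableTopology E] {μ : Measure Y} [IsFiniteMeasure μ]
    {f : Y → E} (hf : Measurable f) {C : ℝ} (hC : ∀ y, ‖f y‖ ≤ C) : Integrable f μ :=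
  Integrable.of_bound hf.aestronglyMeasurable C (Eventually.of_forall hC)

theorem TVLe.symm {μ ν : Measure Y} {δ : ℝ} (h : TVLe μ ν δ) : TVLe ν μ δ :=
  fun f hf h1 => by rw [abs_sub_comm]; exact h f hf h1

theorem TVLe.trans {μ ν ρ : Measure Y} {δ δ' : ℝ} (h : TVLe μ ν δ) (h' : TVLe ν ρ δ') :
    TVLe μ ρ (δ + δ') :=
  fun f hf h1 => (abs_sub_le _ _ _).trans (add_le_add (h f hf h1) (h' f hf h1))

theorem TVLe.mono {μ ν : Measure Y} {δ δ' : ℝ} (h : TVLe μ ν δ) (hd : δ ≤ δ') : TVLe μ ν δ' :=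
  fun f hf h1 => (h f hf h1).trans hd

theorem TVLe.refl (μ : Measure Y) : TVLe μ μ 0 := fun f _ _ => by simp

theorem TVLe.map {Z : Type v} [MeasurableSpace Z] {μ ν : Measure Y} {δ : ℝ} (h : TVLe μ ν δ)
    {g : Y → Z} (hg : Measurable g) : TVLe (μ.map g) (ν.map g) δ := fun f hf h1 => by
  rw [integral_map hg.aemeasurable hf.aestronglyMeasurable,
    integral_map hg.aemeasurable hf.aestronglyMeasurable]
  exact h _ (hf.comp hg) fun y => h1 _

/-- Multiplying `f` by the phase that makes the difference of the integrals nonnegative and taking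
real parts reduces to a real test function. Real and complex test functions therefore give the same
constant. -/
theorem TVLe.norm_integral_sub_le {μ ν : Measure Y} [IsFiniteMeasure μ] [IsFiniteMeasure ν] {δ : ℝ}
    (h : TVLe μ ν δ) {f : Y → ℂ} (hf : Measurable f) (h1 : ∀ y, ‖f y‖ ≤ 1) :
    ‖(∫ y, f y ∂μ) - ∫ y, f y ∂ν‖ ≤ δ := by
  set z := (∫ y, f y ∂μ) - ∫ y, f y ∂ν with hz
  have hδ : 0 ≤ δ := by simpa using h (fun _ => 0) measurable_const (by simp)
  by_cases hz0 : z = 0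
  · simpa [hz0] using hδ
  set c : ℂ := (starRingEnd ℂ z) / ‖z‖
  have hn : (‖z‖ : ℂ) ≠ 0 := by simpa using hz0
  have hc : ‖c‖ = 1 := by simp [c, hz0]
  have hcz : c * z = (‖z‖ : ℂ) := by
    simp only [c]
    rw [div_mul_eq_mul_div, mul_comm, Complex.mul_conj, Complex.normSq_eq_norm_sq]
    push_cast
    field_simp
  have hi : ∀ m : Measure Y, IsFiniteMeasure m → ∫ y, (c * f y).re ∂m = (c * ∫ y, f y ∂m).re := by
    intro m hm
    rw [← integral_const_mul]
    exact integral_re ((integrable_of_bound hf h1).const_mul c)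
  have h2 := h (fun y => (c * f y).re) (Complex.measurable_re.comp (hf.const_mul c)) fun y =>
    (Complex.abs_re_le_norm _).trans (by rw [norm_mul, hc, one_mul]; exact h1 y)
  rw [hi μ inferInstance, hi ν inferInstance, ← Complex.sub_re, ← mul_sub, ← hz, hcz,
    Complex.ofReal_re, abs_of_nonneg (norm_nonneg _)] at h2
  exact h2

theorem measureDist_le {μ ν : Measure Y} [IsFiniteMeasure μ] [IsFiniteMeasure ν] {δ : ℝ}
    (h : TVLe μ ν δ) : measureDist μ ν ≤ δ := by
  refine csSup_le ⟨_, fun _ => 0, measurable_const, by simp, rfl⟩ ?_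
  rintro r ⟨f, hf, h1, rfl⟩
  exact h.norm_integral_sub_le hf h1

theorem norm_integral_le_measureReal {μ : Measure Y} [IsFiniteMeasure μ] {f : Y → ℂ}
    (h1 : ∀ y, ‖f y‖ ≤ 1) : ‖∫ y, f y ∂μ‖ ≤ μ.real Set.univ := by
  simpa using norm_integral_le_of_norm_le_const (μ := μ) (f := f) (Eventually.of_forall h1)

/-- The real `sSup` of an unbounded set is `0`, so boundedness is needed before `measureDist`
dominates its test values. -/
theorem bddAbove_measureDist (μ ν : Measure Y) [IsFiniteMeasure μ] [IsFiniteMeasure ν] :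
    BddAbove {r : ℝ | ∃ f : Y → ℂ, Measurable f ∧ (∀ y, ‖f y‖ ≤ 1) ∧
      r = ‖(∫ y, f y ∂μ) - ∫ y, f y ∂ν‖} := by
  refine ⟨μ.real Set.univ + ν.real Set.univ, ?_⟩
  rintro r ⟨f, hf, h1, rfl⟩
  exact (norm_sub_le _ _).trans
    (add_le_add (norm_integral_le_measureReal h1) (norm_integral_le_measureReal h1))

theorem tvLe_measureDist (μ ν : Measure Y) [IsFiniteMeasure μ] [IsFiniteMeasure ν] :
    TVLe μ ν (measureDist μ ν) := by
  intro f hf h1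
  refine le_csSup (bddAbove_measureDist μ ν) ⟨fun y => (f y : ℂ),
    Complex.measurable_ofReal.comp hf, fun y => by simpa using h1 y, ?_⟩
  simp only []
  rw [integral_complex_ofReal, integral_complex_ofReal, ← Complex.ofReal_sub, Complex.norm_real, Real.norm_eq_abs]

theorem measureDist_nonneg (μ ν : Measure Y) : 0 ≤ measureDist μ ν :=
  Real.sSup_nonneg (by rintro r ⟨f, -, -, rfl⟩; exact norm_nonneg _)

end TotalVariation

/-! ### Couplings close to the diagonal -/

section Couplings

/-- A bounded measurable embedding of a standard Borel space into the real line. -/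
def realCoord (X : Type u) [MeasurableSpace X] [StandardBorelSpace X] (x : X) : ℝ :=
  (unitInterval.sigmoid (embeddingReal X x) : ℝ)

variable {X : Type u} [MeasurableSpace X]

/-- `ν` is a probability measure on `X × X` with both marginals equal to `μ`. -/
structure IsCoupling (μ : Measure X) (ν : Measure (X × X)) : Prop where
  isProbabilityMeasure : IsProbabilityMeasure ν
  map_fst : ν.map Prod.fst = μ
  map_snd : ν.map Prod.snd = μ

theorem IsApproxDiagonal.isCoupling {μ : Measure X} {ν : ℕ → Measure (X × X)}
    (h : IsApproxDiagonal μ ν) (n : ℕ) : IsCoupling μ (ν n) :=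
  ⟨h.isProbabilityMeasure n, h.map_fst n, h.map_snd n⟩

namespace IsCoupling

variable {μ : Measure X} {ν : Measure (X × X)}

theorem measurePreserving_fst (h : IsCoupling μ ν) : MeasurePreserving Prod.fst ν μ :=
  ⟨measurable_fst, h.map_fst⟩

theorem measurePreserving_snd (h : IsCoupling μ ν) : MeasurePreserving Prod.snd ν μ :=
  ⟨measurable_snd, h.map_snd⟩

theorem integral_fst {E : Type*} [NormedAddCommGroup E] [NormedSpace ℝ E] [MeasurableSpace E]
    [BorelSpace E] [SecondCountableTopology E] (h : IsCoupling μ ν) {f : X → E}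
    (hf : Measurable f) : ∫ p, f p.1 ∂ν = ∫ x, f x ∂μ := by
  rw [← h.map_fst, integral_map measurable_fst.aemeasurable hf.aestronglyMeasurable]

theorem integral_snd {E : Type*} [NormedAddCommGroup E] [NormedSpace ℝ E] [MeasurableSpace E]
    [BorelSpace E] [SecondCountableTopology E] (h : IsCoupling μ ν) {f : X → E}
    (hf : Measurable f) : ∫ p, f p.2 ∂ν = ∫ x, f x ∂μ := by
  rw [← h.map_snd, integral_map measurable_snd.aemeasurable hf.aestronglyMeasurable]

end IsCoupling

/-- The square is expanded and both square terms are integrated through the marginals. Condition (i)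
for `f` and its conjugate then says that the right-hand side tends to zero. -/
theorem integral_norm_sq_fst_sub_snd {μ : Measure X} {ν : Measure (X × X)} (h : IsCoupling μ ν)
    {f : X → ℂ} (hf : Measurable f) {C : ℝ} (hC : ∀ x, ‖f x‖ ≤ C) :
    ∫ p, ‖f p.1 - f p.2‖ ^ 2 ∂ν = 2 * (∫ x, f x * starRingEnd ℂ (f x) ∂μ).re
      - 2 * (∫ p, f p.1 * starRingEnd ℂ (f p.2) ∂ν).re := by
  have := h.isProbabilityMeasure
  have hf1 : Measurable fun p : X × X => f p.1 := hf.comp measurable_fst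
  have hf2 : Measurable fun p : X × X => f p.2 := hf.comp measurable_snd
  have hcf : Measurable fun x : X => starRingEnd ℂ (f x) := Complex.continuous_conj.measurable.comp hf
  have hg : Measurable fun x : X => f x * starRingEnd ℂ (f x) := hf.mul hcf
  have hm : Measurable fun p : X × X => f p.1 * starRingEnd ℂ (f p.2) :=
    hf1.mul (hcf.comp measurable_snd)
  have hb : ∀ x y, ‖f x * starRingEnd ℂ (f y)‖ ≤ C * C := fun x y => by
    rw [norm_mul, RCLike.norm_conj]
    exact mul_le_mul (hC _) (hC _) (norm_nonneg _) ((norm_nonneg _).trans (hC x))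
  have e : ∀ p : X × X, ‖f p.1 - f p.2‖ ^ 2 = (f p.1 * starRingEnd ℂ (f p.1)).re +
      (f p.2 * starRingEnd ℂ (f p.2)).re - 2 * (f p.1 * starRingEnd ℂ (f p.2)).re := by
    intro p
    rw [← Complex.normSq_eq_norm_sq, Complex.normSq_sub, Complex.mul_conj, Complex.mul_conj]
    simp
  have i1 : Integrable (fun p : X × X => f p.1 * starRingEnd ℂ (f p.1)) ν :=
    integrable_of_bound (hg.comp measurable_fst) fun p => hb _ _
  have i2 : Integrable (fun p : X × X => f p.2 * starRingEnd ℂ (f p.2)) ν :=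
    integrable_of_bound (hg.comp measurable_snd) fun p => hb _ _
  have i3 : Integrable (fun p : X × X => f p.1 * starRingEnd ℂ (f p.2)) ν :=
    integrable_of_bound hm fun p => hb _ _
  have r1 : ∫ p, (f p.1 * starRingEnd ℂ (f p.1)).re ∂ν = _ := integral_re i1
  have r2 : ∫ p, (f p.2 * starRingEnd ℂ (f p.2)).re ∂ν = _ := integral_re i2
  have r3 : ∫ p, (f p.1 * starRingEnd ℂ (f p.2)).re ∂ν = _ := integral_re i3
  simp_rw [e]
  have j1 : Integrable (fun p : X × X => (f p.1 * starRingEnd ℂ (f p.1)).re) ν := i1.re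
  have j2 : Integrable (fun p : X × X => (f p.2 * starRingEnd ℂ (f p.2)).re) ν := i2.re
  have j3 : Integrable (fun p : X × X => 2 * (f p.1 * starRingEnd ℂ (f p.2)).re) ν :=
    i3.re.const_mul 2
  have j12 : Integrable (fun p : X × X => (f p.1 * starRingEnd ℂ (f p.1)).re +
    (f p.2 * starRingEnd ℂ (f p.2)).re) ν := j1.add j2
  rw [integral_sub j12 j3, integral_add j1 j2, integral_const_mul, r1, r2, r3]
  rw [h.integral_fst hg, h.integral_snd hg]
  simp only [RCLike.re_to_complex]
  ring

theorem IsApproxDiagonal.tendsto_integral_norm_sq {μ : Measure X}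
    {ν : ℕ → Measure (X × X)} (h : IsApproxDiagonal μ ν) {f : X → ℂ} (hf : Measurable f) {C : ℝ}
    (hC : ∀ x, ‖f x‖ ≤ C) :
    Tendsto (fun n => ∫ p, ‖f p.1 - f p.2‖ ^ 2 ∂(ν n)) atTop (𝓝 0) := by
  have h1 := h.tendsto_integral f (fun x => starRingEnd ℂ (f x)) hf
    (Complex.continuous_conj.measurable.comp hf) ⟨C, hC⟩
    ⟨C, fun x => by rw [RCLike.norm_conj]; exact hC x⟩
  have h2 := ((Complex.continuous_re.tendsto _).comp h1).const_mul (-2)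
  have h3 := h2.const_add (2 * (∫ x, f x * starRingEnd ℂ (f x) ∂μ).re)
  rw [neg_mul, add_neg_cancel] at h3
  refine h3.congr fun n => ?_
  rw [integral_norm_sq_fst_sub_snd (h.isCoupling n) hf hC]
  simp only [Function.comp]
  ring

theorem sq_integral_le {Y : Type u} [MeasurableSpace Y] {ν : Measure Y} [IsProbabilityMeasure ν]
    {f : Y → ℝ} (hf : Measurable f) {C : ℝ} (hC : ∀ y, |f y| ≤ C) :
    (∫ y, f y ∂ν) ^ 2 ≤ ∫ y, f y ^ 2 ∂ν := by
  set c := ∫ y, f y ∂ν with hc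
  have i1 : Integrable f ν := integrable_of_bound hf hC
  have i2 : Integrable (fun y => f y ^ 2) ν := integrable_of_bound (C := C ^ 2) (hf.pow_const 2)
    fun y => by
      rw [Real.norm_eq_abs, abs_pow]; exact pow_le_pow_left₀ (abs_nonneg _) (hC y) 2
  have h0 : 0 ≤ ∫ y, (f y - c) ^ 2 ∂ν := integral_nonneg fun y => sq_nonneg _
  have e : ∀ y, (f y - c) ^ 2 = f y ^ 2 - 2 * c * f y + c ^ 2 := fun y => by ring
  simp_rw [e] at h0
  have i3 : Integrable (fun y => f y ^ 2 - 2 * c * f y) ν := i2.sub (i1.const_mul _)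
  rw [integral_add i3 (integrable_const _), integral_sub i2 (i1.const_mul _), integral_const_mul, ← hc] at h0
  simp at h0
  nlinarith

/-- Replacing `f₂(y)` by `f₂(x)` costs at most `C₁ ∫ |f₂(x) - f₂(y)|`, which Cauchy–Schwarz bounds
by the mean square difference. -/
theorem isApproxDiagonal_of_tendsto {μ : Measure X}
    {ν : ℕ → Measure (X × X)} (hν : ∀ n, IsCoupling μ (ν n))
    (h : ∀ f : X → ℂ, Measurable f → (∃ C : ℝ, ∀ x, ‖f x‖ ≤ C) →
      Tendsto (fun n => ∫ p, ‖f p.1 - f p.2‖ ^ 2 ∂(ν n)) atTop (𝓝 0)) :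
    IsApproxDiagonal μ ν where
  isProbabilityMeasure n := (hν n).isProbabilityMeasure
  map_fst n := (hν n).map_fst
  map_snd n := (hν n).map_snd
  tendsto_integral f₁ f₂ hf₁ hf₂ hb₁ hb₂ := by
    obtain ⟨C₁, h₁⟩ := hb₁
    obtain ⟨C₂, h₂⟩ := hb₂
    have h0 : Tendsto (fun n => C₁ * √(∫ p, ‖f₂ p.1 - f₂ p.2‖ ^ 2 ∂(ν n))) atTop (𝓝 0) := by
      have := ((Real.continuous_sqrt.tendsto _).comp (h f₂ hf₂ ⟨C₂, h₂⟩)).const_mul C₁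
      simpa [Function.comp_def] using this
    rw [tendsto_iff_norm_sub_tendsto_zero]
    refine squeeze_zero (fun _ => norm_nonneg _) (fun n => ?_) h0
    have := (hν n).isProbabilityMeasure
    have m1 : Measurable fun p : X × X => f₁ p.1 := hf₁.comp measurable_fst
    have m2 : Measurable fun p : X × X => f₂ p.1 := hf₂.comp measurable_fst
    have m3 : Measurable fun p : X × X => f₂ p.2 := hf₂.comp measurable_snd
    have hC₁ : ∀ x : X, 0 ≤ C₁ := fun x => (norm_nonneg _).trans (h₁ x)
    have bm : ∀ x y, ‖f₁ x * f₂ y‖ ≤ C₁ * C₂ := fun x y => by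
      rw [norm_mul]; exact mul_le_mul (h₁ _) (h₂ _) (norm_nonneg _) (hC₁ x)
    rw [← (hν n).integral_fst (f := fun x => f₁ x * f₂ x) (hf₁.mul hf₂)]
    have i1 : Integrable (fun p : X × X => f₁ p.1 * f₂ p.2) (ν n) :=
      integrable_of_bound (m1.mul m3) fun p => bm _ _
    have i2 : Integrable (fun p : X × X => f₁ p.1 * f₂ p.1) (ν n) :=
      integrable_of_bound (m1.mul m2) fun p => bm _ _
    have bn : ∀ p : X × X, |‖f₂ p.1 - f₂ p.2‖| ≤ C₂ + C₂ := fun p => by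
      rw [abs_norm]; exact (norm_sub_le _ _).trans (add_le_add (h₂ _) (h₂ _))
    have i3 : Integrable (fun p : X × X => ‖f₂ p.1 - f₂ p.2‖) (ν n) :=
      integrable_of_bound (m2.sub m3).norm bn
    have hne : Nonempty X := by
      obtain ⟨p⟩ := nonempty_of_isProbabilityMeasure (ν n)
      exact ⟨p.1⟩
    calc ‖(∫ p, f₁ p.1 * f₂ p.2 ∂(ν n)) - ∫ p, f₁ p.1 * f₂ p.1 ∂(ν n)‖
        = ‖∫ p, f₁ p.1 * (f₂ p.2 - f₂ p.1) ∂(ν n)‖ := by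
          rw [← integral_sub i1 i2]; simp_rw [mul_sub]
      _ ≤ ∫ p, C₁ * ‖f₂ p.1 - f₂ p.2‖ ∂(ν n) := by
          refine norm_integral_le_of_norm_le (i3.const_mul _) (Eventually.of_forall fun p => ?_)
          rw [norm_mul, norm_sub_rev]
          exact mul_le_mul_of_nonneg_right (h₁ _) (norm_nonneg _)
      _ ≤ _ := by
          rw [integral_const_mul]
          refine mul_le_mul_of_nonneg_left ?_ (hC₁ hne.some)
          exact Real.le_sqrt_of_sq_le (sq_integral_le (m2.sub m3).norm bn)

end Couplings

/-! ### Closeness to the diagonal measured by a single energy -/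

section Approximation

variable {X : Type u} [MeasurableSpace X] [StandardBorelSpace X]

theorem measurableEmbedding_realCoord : MeasurableEmbedding (realCoord X) :=
  (MeasurableEmbedding.subtype_coe measurableSet_Icc).comp
    (measurableEmbedding_sigmoid_comp_embeddingReal X)

theorem measurable_realCoord : Measurable (realCoord X) := measurableEmbedding_realCoord.measurable

theorem realCoord_mem (x : X) : realCoord X x ∈ Set.Icc (0 : ℝ) 1 := Subtype.coe_prop _

/-- Transports data from the line back to `X`: functions in the density statement below, and later
spectral measures. -/
theorem exists_measurable_leftInverse_realCoord [Nonempty X] :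
    ∃ g : ℝ → X, Measurable g ∧ ∀ x, g (realCoord X x) = x := by
  obtain ⟨g, hg, h⟩ := (measurableEmbedding_realCoord (X := X)).exists_measurable_extend
    measurable_id (fun _ => inferInstance)
  exact ⟨g, hg, fun x => congrFun h x⟩

open Polynomial in
/-- Polynomials in the coordinate are dense in `L²(X, μ)`. -/
theorem exists_polynomial_eLpNorm_sub_le (μ : Measure X) [IsFiniteMeasure μ] {f : X → ℂ}
    (hf : Measurable f) (hf2 : MemLp f 2 μ) {ε : ℝ≥0∞} (hε : ε ≠ 0) :
    ∃ p : ℂ[X], eLpNorm (fun x => f x - p.eval (realCoord X x : ℂ)) 2 μ ≤ ε := by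
  rcases isEmpty_or_nonempty X with hX | hX
  · exact ⟨0, by simp [Measure.eq_zero_of_isEmpty μ]⟩
  obtain ⟨g, hg, hgt⟩ := exists_measurable_leftInverse_realCoord (X := X)
  have ht : MeasurePreserving (realCoord X) μ (μ.map (realCoord X)) :=
    ⟨measurable_realCoord, rfl⟩
  have hcomp : (f ∘ g) ∘ realCoord X = f := funext fun x => congrArg f (hgt x)
  have hfg : MemLp (f ∘ g) 2 (μ.map (realCoord X)) := by
    rw [memLp_map_measure_iff (hf.comp hg).aestronglyMeasurable measurable_realCoord.aemeasurable,
      hcomp]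
    exact hf2
  have hε2 : ε / 2 ≠ 0 := by simpa using hε
  obtain ⟨h, hh, hhm⟩ := hfg.exists_boundedContinuous_eLpNorm_sub_le (by norm_num) hε2
  have h1 : eLpNorm (fun x => f x - h (realCoord X x)) 2 μ ≤ ε / 2 := by
    have := eLpNorm_comp_measurePreserving (p := 2)
      (hfg.aestronglyMeasurable.sub hhm.aestronglyMeasurable) ht
    rw [← this] at hh
    refine le_of_eq_of_le (congrArg (fun k => eLpNorm k 2 μ) (funext fun x => ?_)) hh
    simp [hgt]
  -- Apart from the degenerate cases `μ = 0` and `ε = ∞`, `c` is the constant whose `L²` norm is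
  -- exactly `ε / 2`.
  obtain ⟨c, hc0, hc⟩ : ∃ c : ℝ, 0 < c ∧
      eLpNorm (fun _ : X => (c : ℂ)) 2 μ ≤ ε / 2 := by
    by_cases hμ : μ = 0
    · exact ⟨1, one_pos, by simp [hμ]⟩
    by_cases hε' : ε = ∞
    · exact ⟨1, one_pos, by simp [hε', ENNReal.top_div]⟩
    have hV0 : (μ Set.univ ^ (1 / (2 : ℝ≥0∞).toReal)) ≠ 0 := by simp [hμ]
    have hV : (μ Set.univ ^ (1 / (2 : ℝ≥0∞).toReal)) ≠ ∞ := by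
      simp [ENNReal.rpow_eq_top_iff]
    refine ⟨(ε / 2 / (μ Set.univ ^ (1 / (2 : ℝ≥0∞).toReal))).toReal, ?_, ?_⟩
    · exact ENNReal.toReal_pos (ENNReal.div_ne_zero.2 ⟨hε2, hV⟩)
        (ENNReal.div_ne_top (ENNReal.div_ne_top hε' (by norm_num)) hV0)
    · rw [eLpNorm_const _ (by norm_num) hμ, ← enorm_norm, Complex.norm_real, enorm_norm,
        Real.enorm_eq_ofReal ENNReal.toReal_nonneg, ENNReal.ofReal_toReal
        (ENNReal.div_ne_top (ENNReal.div_ne_top hε' (by norm_num)) hV0)]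
      exact (ENNReal.div_mul_cancel hV0 hV).le
  obtain ⟨p, hp⟩ := exists_polynomial_near_of_continuousOn 0 1 (fun s => (h s).re)
    (Complex.continuous_re.comp h.continuous).continuousOn (c / 2) (by positivity)
  obtain ⟨q, hq⟩ := exists_polynomial_near_of_continuousOn 0 1 (fun s => (h s).im)
    (Complex.continuous_im.comp h.continuous).continuousOn (c / 2) (by positivity)
  refine ⟨p.map Complex.ofRealHom + C Complex.I * q.map Complex.ofRealHom, ?_⟩
  have hev : ∀ s : ℝ, (p.map Complex.ofRealHom + C Complex.I * q.map Complex.ofRealHom).eval (s : ℂ)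
      = ((p.eval s : ℝ) : ℂ) + Complex.I * ((q.eval s : ℝ) : ℂ) := by
    intro s
    have e : ∀ r : ℝ[X], (r.map Complex.ofRealHom).eval (s : ℂ) = ((r.eval s : ℝ) : ℂ) := fun r => by
      rw [eval_map, ← Complex.ofRealHom_eq_coe, eval₂_hom]; rfl
    simp [e]
  have h2 : eLpNorm (fun x => h (realCoord X x) - (p.map Complex.ofRealHom +
      C Complex.I * q.map Complex.ofRealHom).eval (realCoord X x : ℂ)) 2 μ ≤ ε / 2 := by
    refine le_trans (eLpNorm_mono fun x => ?_) hc
    rw [hev]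
    set s := realCoord X x
    have hs := realCoord_mem x
    have e : h s - (((p.eval s : ℝ) : ℂ) + Complex.I * ((q.eval s : ℝ) : ℂ))
        = (((h s).re - p.eval s : ℝ) : ℂ) + Complex.I * (((h s).im - q.eval s : ℝ) : ℂ) := by
      conv_lhs => rw [← Complex.re_add_im (h s)]
      push_cast; ring
    rw [e]
    have := hp s hs
    have := hq s hs
    calc _ ≤ |(h s).re - p.eval s| + |(h s).im - q.eval s| := by
          refine (norm_add_le _ _).trans (le_of_eq ?_)
          rw [norm_mul, Complex.norm_I, one_mul, Complex.norm_real, Complex.norm_real,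
            Real.norm_eq_abs, Real.norm_eq_abs]
      _ ≤ c / 2 + c / 2 := by
          rw [abs_sub_comm, abs_sub_comm (h s).im]
          exact add_le_add (hp s hs).le (hq s hs).le
      _ = ‖(c : ℂ)‖ := by rw [Complex.norm_real, Real.norm_eq_abs, abs_of_pos hc0]; ring
  have hpm : Measurable fun x => (p.map Complex.ofRealHom +
      C Complex.I * q.map Complex.ofRealHom).eval (realCoord X x : ℂ) :=
    (Polynomial.continuous _).measurable.comp (Complex.measurable_ofReal.comp measurable_realCoord)
  have hhm' : Measurable fun x => h (realCoord X x) :=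
    h.continuous.measurable.comp measurable_realCoord
  calc _ = eLpNorm ((fun x => f x - h (realCoord X x)) + fun x => h (realCoord X x) -
        (p.map Complex.ofRealHom +
        C Complex.I * q.map Complex.ofRealHom).eval (realCoord X x : ℂ)) 2 μ := by
        congr 1; ext x; simp
    _ ≤ ε / 2 + ε / 2 := (eLpNorm_add_le (hf.sub hhm').aestronglyMeasurable
        (hhm'.sub hpm).aestronglyMeasurable (by norm_num)).trans (add_le_add h1 h2)
    _ = ε := ENNReal.add_halves ε

theorem integral_norm_sq_eq_eLpNorm {Y : Type u} [MeasurableSpace Y] {μ : Measure Y}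
    [IsFiniteMeasure μ] {f : Y → ℂ} (hf : MemLp f 2 μ) :
    ∫ x, ‖f x‖ ^ 2 ∂μ = (eLpNorm f 2 μ).toReal ^ 2 := by
  have h := hf.eLpNorm_eq_integral_rpow_norm (by norm_num) (by norm_num)
  rw [h, ENNReal.toReal_ofReal (by positivity), ← Real.rpow_natCast, ← Real.rpow_mul (by positivity)]
  simp

open Polynomial in
theorem exists_polynomial_integral_le (μ : Measure X) [IsFiniteMeasure μ] {f : X → ℂ}
    (hf : Measurable f) {C : ℝ} (hC : ∀ x, ‖f x‖ ≤ C) {ε : ℝ} (hε : 0 < ε) :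
    ∃ p : ℂ[X], ∫ x, ‖f x - p.eval (realCoord X x : ℂ)‖ ^ 2 ∂μ ≤ ε := by
  have hf2 : MemLp f 2 μ := MemLp.of_bound hf.aestronglyMeasurable C (Eventually.of_forall hC)
  obtain ⟨p, hp⟩ := exists_polynomial_eLpNorm_sub_le μ hf hf2
    (ε := ENNReal.ofReal (√ε)) (by simpa using hε)
  refine ⟨p, ?_⟩
  have hpm : Measurable fun x => p.eval (realCoord X x : ℂ) :=
    (Polynomial.continuous _).measurable.comp (Complex.measurable_ofReal.comp measurable_realCoord)
  have hm : MemLp (fun x => f x - p.eval (realCoord X x : ℂ)) 2 μ :=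
    ⟨(hf.sub hpm).aestronglyMeasurable, hp.trans_lt ENNReal.ofReal_lt_top⟩
  rw [integral_norm_sq_eq_eLpNorm hm]
  calc _ ≤ (√ε) ^ 2 := by
        refine pow_le_pow_left₀ ENNReal.toReal_nonneg ?_ 2
        exact ENNReal.toReal_le_of_le_ofReal (Real.sqrt_nonneg _) hp
    _ = ε := Real.sq_sqrt hε.le

/-- The mean square of the difference of coordinates. -/
def diagEnergy (ν : Measure (X × X)) : ℝ := ∫ p, (realCoord X p.1 - realCoord X p.2) ^ 2 ∂ν

theorem diagEnergy_nonneg (ν : Measure (X × X)) : 0 ≤ diagEnergy ν :=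
  integral_nonneg fun _ => sq_nonneg _

theorem measurable_coordDiff :
    Measurable fun p : X × X => (realCoord X p.1 - realCoord X p.2) ^ 2 :=
  ((measurable_realCoord.comp measurable_fst).sub (measurable_realCoord.comp measurable_snd)).pow_const 2

theorem coordDiff_le_one (p : X × X) : |(realCoord X p.1 - realCoord X p.2) ^ 2| ≤ 1 := by
  have h1 := realCoord_mem p.1
  have h2 := realCoord_mem p.2
  rw [abs_of_nonneg (sq_nonneg _), sq_le_one_iff_abs_le_one, abs_le]
  constructor <;> linarith [h1.1, h1.2, h2.1, h2.2]

open Polynomial in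
theorem exists_lipschitz_polynomial (p : ℂ[X]) : ∃ Λ : ℝ, 0 < Λ ∧ ∀ s ∈ Set.Icc (0 : ℝ) 1,
    ∀ r ∈ Set.Icc (0 : ℝ) 1, ‖p.eval (s : ℂ) - p.eval (r : ℂ)‖ ^ 2 ≤ Λ * (s - r) ^ 2 := by
  have hd : ContDiff ℝ 1 fun s : ℝ => p.eval (s : ℂ) := by
    have h1 : ContDiff ℂ 1 fun z : ℂ => p.eval z := by
      simpa using (p.contDiff_aeval (𝕜 := ℂ) 1)
    exact (h1.restrict_scalars ℝ).comp Complex.ofRealCLM.contDiff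
  obtain ⟨L, hL⟩ := hd.contDiffOn.exists_lipschitzOnWith (s := Set.Icc (0 : ℝ) 1) (by norm_num)
    (convex_Icc 0 1) isCompact_Icc
  refine ⟨(L : ℝ) ^ 2 + 1, by positivity, fun s hs r hr => ?_⟩
  have := hL.dist_le_mul s hs r hr
  rw [dist_eq_norm, Real.dist_eq] at this
  calc _ ≤ (L * |s - r|) ^ 2 := pow_le_pow_left₀ (norm_nonneg _) this 2
    _ = (L : ℝ) ^ 2 * (s - r) ^ 2 := by rw [mul_pow, sq_abs]
    _ ≤ _ := by nlinarith [sq_nonneg (s - r)]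

/-- A coupling of small energy almost fixes any given bounded function. -/
theorem exists_energy_bound (μ : Measure X) [IsFiniteMeasure μ] {f : X → ℂ}
    (hf : Measurable f) {C : ℝ} (hC : ∀ x, ‖f x‖ ≤ C) {ε : ℝ} (hε : 0 < ε) :
    ∃ δ : ℝ, 0 < δ ∧ ∀ ν : Measure (X × X), IsCoupling μ ν → diagEnergy ν ≤ δ →
      ∫ p, ‖f p.1 - f p.2‖ ^ 2 ∂ν ≤ ε := by
  -- From `(a + b + c)² ≤ 3 (a² + b² + c²)`, the final bound is `3 (ε/12 + ε/12 + Λ · ε/(6Λ)) = ε`: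
  -- two approximation errors, one for each marginal, and one Lipschitz term for the polynomial.
  obtain ⟨p, hp⟩ := exists_polynomial_integral_le μ hf hC (ε := ε / 12) (by positivity)
  obtain ⟨Λ, hΛ, hL⟩ := exists_lipschitz_polynomial p
  refine ⟨ε / (6 * Λ), by positivity, fun ν hν hE => ?_⟩
  have := hν.isProbabilityMeasure
  have hpm : Measurable fun x => p.eval (realCoord X x : ℂ) :=
    (Polynomial.continuous _).measurable.comp (Complex.measurable_ofReal.comp measurable_realCoord)
  set g : X → ℝ := fun x => ‖f x - p.eval (realCoord X x : ℂ)‖ ^ 2 with hgdef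
  have hg : Measurable g := (hf.sub hpm).norm.pow_const 2
  obtain ⟨D, hD⟩ : ∃ D : ℝ, ∀ s ∈ Set.Icc (0 : ℝ) 1, ‖p.eval (s : ℂ)‖ ≤ D :=
    isCompact_Icc.exists_bound_of_continuousOn
      ((Polynomial.continuous p).comp Complex.continuous_ofReal).continuousOn
  have hgb : ∀ x, ‖g x‖ ≤ (C + D) ^ 2 := fun x => by
    rw [Real.norm_eq_abs, abs_of_nonneg (sq_nonneg _)]
    exact pow_le_pow_left₀ (norm_nonneg _)
      ((norm_sub_le _ _).trans (add_le_add (hC x) (hD _ (realCoord_mem x)))) 2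
  have i1 : Integrable (fun q : X × X => g q.1) ν :=
    integrable_of_bound (hg.comp measurable_fst) fun q => hgb _
  have i2 : Integrable (fun q : X × X => g q.2) ν :=
    integrable_of_bound (hg.comp measurable_snd) fun q => hgb _
  have i3 : Integrable (fun q : X × X => Λ * (realCoord X q.1 - realCoord X q.2) ^ 2) ν :=
    (integrable_of_bound measurable_coordDiff coordDiff_le_one).const_mul _
  have hpt : ∀ q : X × X, ‖f q.1 - f q.2‖ ^ 2 ≤
      3 * (g q.1 + g q.2 + Λ * (realCoord X q.1 - realCoord X q.2) ^ 2) := by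
    intro q
    have h1 := hL _ (realCoord_mem q.1) _ (realCoord_mem q.2)
    set a := f q.1 - p.eval (realCoord X q.1 : ℂ)
    set b := f q.2 - p.eval (realCoord X q.2 : ℂ)
    set c := p.eval (realCoord X q.1 : ℂ) - p.eval (realCoord X q.2 : ℂ)
    have e : f q.1 - f q.2 = a - b + c := by simp only [a, b, c]; ring
    have h2 : ‖f q.1 - f q.2‖ ≤ ‖a‖ + ‖b‖ + ‖c‖ := by
      rw [e]; exact (norm_add_le _ _).trans (by gcongr; exact norm_sub_le _ _)
    have h3 : ‖f q.1 - f q.2‖ ^ 2 ≤ (‖a‖ + ‖b‖ + ‖c‖) ^ 2 :=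
      pow_le_pow_left₀ (norm_nonneg _) h2 2
    change _ ≤ 3 * (‖a‖ ^ 2 + ‖b‖ ^ 2 + _)
    nlinarith [sq_nonneg (‖a‖ - ‖b‖), sq_nonneg (‖a‖ - ‖c‖), sq_nonneg (‖b‖ - ‖c‖)]
  calc ∫ q, ‖f q.1 - f q.2‖ ^ 2 ∂ν
      ≤ ∫ q, 3 * (g q.1 + g q.2 + Λ * (realCoord X q.1 - realCoord X q.2) ^ 2) ∂ν :=
        integral_mono_of_nonneg (Eventually.of_forall fun q => sq_nonneg _)
          (((i1.add i2).add i3).const_mul 3) (Eventually.of_forall hpt)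
    _ = 3 * ((∫ x, g x ∂μ) + (∫ x, g x ∂μ) + Λ * diagEnergy ν) := by
        have i12 : Integrable (fun q : X × X => g q.1 + g q.2) ν := i1.add i2
        rw [integral_const_mul, integral_add i12 i3, integral_add i1 i2,
          hν.integral_fst hg, hν.integral_snd hg, integral_const_mul, diagEnergy]
    _ ≤ 3 * (ε / 12 + ε / 12 + Λ * (ε / (6 * Λ))) := by gcongr
    _ = ε := by field_simp; norm_num

/-- One injective coordinate controls all bounded Borel functions, because polynomials in it are
dense in `L²` and both marginals are `μ`. Condition (i) for the sequences constructed later is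
verified through this single number. -/
theorem isApproxDiagonal_of_diagEnergy {μ : Measure X} [IsFiniteMeasure μ]
    {ν : ℕ → Measure (X × X)} (hν : ∀ n, IsCoupling μ (ν n))
    (h : Tendsto (fun n => diagEnergy (ν n)) atTop (𝓝 0)) : IsApproxDiagonal μ ν := by
  refine isApproxDiagonal_of_tendsto hν fun f hf ⟨C, hC⟩ => ?_
  rw [Metric.tendsto_nhds]
  intro ε hε
  obtain ⟨δ, hδ, H⟩ := exists_energy_bound μ hf hC (ε := ε / 2) (by positivity)
  filter_upwards [(Metric.tendsto_nhds.1 h) δ hδ] with n hn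
  rw [Real.dist_eq, sub_zero] at hn ⊢
  have := H (ν n) (hν n) ((le_abs_self _).trans hn.le)
  rw [abs_of_nonneg (integral_nonneg fun _ => sq_nonneg _)]
  linarith

theorem IsApproxDiagonal.tendsto_diagEnergy {μ : Measure X}
    {ν : ℕ → Measure (X × X)} (h : IsApproxDiagonal μ ν) :
    Tendsto (fun n => diagEnergy (ν n)) atTop (𝓝 0) := by
  refine (h.tendsto_integral_norm_sq (f := fun x => (realCoord X x : ℂ))
    (Complex.measurable_ofReal.comp measurable_realCoord) (C := 1) fun x => ?_).congr fun n => ?_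
  · have := realCoord_mem x
    rw [Complex.norm_real, Real.norm_eq_abs, abs_le]
    constructor <;> linarith [this.1, this.2]
  · refine integral_congr_ae (Eventually.of_forall fun p => ?_)
    simp only
    rw [← Complex.ofReal_sub, Complex.norm_real, Real.norm_eq_abs, sq_abs]

end Approximation

/-! ### The Koopman representation of a quasi-invariant measure -/

section QuasiInvariant

variable {Y : Type u} [MeasurableSpace Y] {Γ : Type v} [Group Γ] [MulAction Γ Y]
  [MeasurableConstSMul Γ Y]

/-- The translates of `ν` are absolutely continuous with respect to `ν`. -/
def IsQuasiInvariant (Γ : Type v) [Group Γ] [MulAction Γ Y] (ν : Measure Y) : Prop :=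
  ∀ γ : Γ, ν.map (fun y => γ • y) ≪ ν

theorem map_withDensity_comp {Z : Type w} [MeasurableSpace Z] (ν : Measure Y) {e : Y → Z}
    (he : Measurable e) {f : Z → ℝ≥0∞} (hf : Measurable f) :
    (ν.withDensity (f ∘ e)).map e = (ν.map e).withDensity f := by
  ext A hA
  rw [Measure.map_apply he hA, withDensity_apply _ (he hA), withDensity_apply _ hA,
    setLIntegral_map hA hf he]
  rfl

theorem map_smul_withDensity (ν : Measure Y) (γ : Γ) {f : Y → ℝ≥0∞} (hf : Measurable f) :
    (ν.withDensity f).map (fun y => γ • y)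
      = (ν.map fun y => γ • y).withDensity fun y => f (γ⁻¹ • y) := by
  have h := map_withDensity_comp ν (measurable_const_smul γ)
    (f := fun y => f (γ⁻¹ • y)) (hf.comp (measurable_const_smul γ⁻¹))
  have e : ((fun y => f (γ⁻¹ • y)) ∘ fun y : Y => γ • y) = f := funext fun y => by simp
  rwa [e] at h

/-- The Radon-Nikodym derivative of the translate of `ν` by `γ`. -/
def transDensity (ν : Measure Y) (γ : Γ) : Y → ℝ≥0∞ := (ν.map fun y => γ • y).rnDeriv ν

theorem measurable_transDensity (ν : Measure Y) (γ : Γ) : Measurable (transDensity ν γ) :=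
  Measure.measurable_rnDeriv _ _

/-- The square root of the Radon-Nikodym derivative of the translate of `ν` by `γ`. -/
def sqrtDensity (ν : Measure Y) (γ : Γ) (y : Y) : ℝ := √(transDensity ν γ y).toReal

theorem measurable_sqrtDensity (ν : Measure Y) (γ : Γ) : Measurable (sqrtDensity ν γ) :=
  (measurable_transDensity ν γ).ennreal_toReal.sqrt

variable {ν : Measure Y} [IsFiniteMeasure ν]

instance (γ : Γ) : IsFiniteMeasure (ν.map fun y => γ • y) := Measure.isFiniteMeasure_map _ _

theorem transDensity_lt_top (γ : Γ) : ∀ᵐ y ∂ν, transDensity ν γ y < ∞ :=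
  Measure.rnDeriv_lt_top _ _

theorem enorm_sqrtDensity_sq (γ : Γ) :
    ∀ᵐ y ∂ν, ‖(sqrtDensity ν γ y : ℂ)‖ₑ ^ 2 = transDensity ν γ y := by
  filter_upwards [transDensity_lt_top (ν := ν) γ] with y hy
  rw [← enorm_norm, Complex.norm_real, enorm_norm, sqrtDensity,
    Real.enorm_eq_ofReal (Real.sqrt_nonneg _),
    ← ENNReal.ofReal_pow (Real.sqrt_nonneg _), Real.sq_sqrt ENNReal.toReal_nonneg,
    ENNReal.ofReal_toReal hy.ne]

namespace IsQuasiInvariant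

variable (hq : IsQuasiInvariant Γ ν)
include hq

theorem quasiMeasurePreserving (γ : Γ) : Measure.QuasiMeasurePreserving (fun y : Y => γ • y) ν ν :=
  ⟨measurable_const_smul γ, hq γ⟩

theorem withDensity_transDensity (γ : Γ) :
    ν.withDensity (transDensity ν γ) = ν.map fun y => γ • y :=
  Measure.withDensity_rnDeriv_eq _ _ (hq γ)

/-- The change of variables that makes the weighted translates isometric on `L²(ν)`. -/
theorem lintegral_transDensity_mul (γ : Γ) {f : Y → ℝ≥0∞} (hf : AEMeasurable f ν) :
    ∫⁻ y, transDensity ν γ y * f (γ⁻¹ • y) ∂ν = ∫⁻ y, f y ∂ν := by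
  have hf' : AEMeasurable (fun y => f (γ⁻¹ • y)) ν :=
    hf.comp_quasiMeasurePreserving (hq.quasiMeasurePreserving γ⁻¹)
  rw [transDensity, lintegral_rnDeriv_mul (hq γ) hf', lintegral_map' (hf'.mono_ac (hq γ))
    (measurable_const_smul γ).aemeasurable]
  simp

/-- Uniqueness of densities. The unit, cocycle and flip identities below are all obtained by
checking that the right-hand side is a density of the translated measure. -/
theorem transDensity_eq (γ : Γ) {h : Y → ℝ≥0∞} (hh : Measurable h)
    (e : ν.withDensity h = ν.map fun y => γ • y) : transDensity ν γ =ᵐ[ν] h := by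
  rw [transDensity, ← e]
  exact Measure.rnDeriv_withDensity ν hh

theorem transDensity_one : transDensity ν (1 : Γ) =ᵐ[ν] fun _ => 1 :=
  hq.transDensity_eq 1 measurable_const (by simp)

theorem transDensity_mul (γ δ : Γ) :
    transDensity ν (γ * δ) =ᵐ[ν] fun y => transDensity ν γ y * transDensity ν δ (γ⁻¹ • y) := by
  have hm : Measurable fun y => transDensity ν δ (γ⁻¹ • y) :=
    (measurable_transDensity ν δ).comp (measurable_const_smul γ⁻¹)
  refine hq.transDensity_eq _ ((measurable_transDensity ν γ).mul hm) ?_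
  have h1 : (fun y => transDensity ν γ y * transDensity ν δ (γ⁻¹ • y))
      = transDensity ν γ * fun y => transDensity ν δ (γ⁻¹ • y) := rfl
  rw [h1, withDensity_mul _ (measurable_transDensity ν γ) hm, hq.withDensity_transDensity,
    ← map_smul_withDensity ν γ (measurable_transDensity ν δ), hq.withDensity_transDensity,
    Measure.map_map (measurable_const_smul γ) (measurable_const_smul δ)]
  congr 1
  ext y
  simp [mul_smul]

/-- A symmetry of `ν` that commutes with the action carries each translate of `ν` to itself. For the
flip, this is why the antiunitary `g ↦ conj (g ∘ θ)` commutes with the Koopman representation. -/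
theorem transDensity_comp_involution (γ : Γ) {θ : Y → Y} (hθ : MeasurePreserving θ ν ν)
    (hθ2 : ∀ y, θ (θ y) = y) (hθγ : ∀ y, θ (γ • y) = γ • θ y) :
    transDensity ν γ =ᵐ[ν] fun y => transDensity ν γ (θ y) := by
  refine hq.transDensity_eq _ ((measurable_transDensity ν γ).comp hθ.measurable) ?_
  have h1 := map_withDensity_comp ν hθ.measurable (measurable_transDensity ν γ)
  rw [hθ.map_eq, hq.withDensity_transDensity] at h1
  have h2 := congrArg (Measure.map θ) h1
  rw [Measure.map_map hθ.measurable hθ.measurable,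
    Measure.map_map hθ.measurable (measurable_const_smul γ)] at h2
  have e1 : θ ∘ θ = id := funext hθ2
  have e2 : (θ ∘ fun y => γ • y) = (fun y => γ • y) ∘ θ := funext hθγ
  rw [e1, Measure.map_id, e2, ← Measure.map_map (measurable_const_smul γ) hθ.measurable,
    hθ.map_eq] at h2
  exact h2

omit hq in
/-- The weighted translate of a function. -/
def weightedTranslate (ν : Measure Y) (γ : Γ) (g : Y → ℂ) (y : Y) : ℂ :=
  (sqrtDensity ν γ y : ℂ) * g (γ⁻¹ • y)

theorem weightedTranslate_congr (γ : Γ) {g g' : Y → ℂ} (h : g =ᵐ[ν] g') :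
    weightedTranslate ν γ g =ᵐ[ν] weightedTranslate ν γ g' := by
  filter_upwards [(hq.quasiMeasurePreserving γ⁻¹).ae_eq h] with y hy
  simp only [weightedTranslate]
  rw [show g (γ⁻¹ • y) = g' (γ⁻¹ • y) from hy]

theorem aestronglyMeasurable_weightedTranslate (γ : Γ) {g : Y → ℂ}
    (hg : AEStronglyMeasurable g ν) : AEStronglyMeasurable (weightedTranslate ν γ g) ν :=
  (Complex.measurable_ofReal.comp (measurable_sqrtDensity ν γ)).aestronglyMeasurable.mul
    (hg.comp_quasiMeasurePreserving (hq.quasiMeasurePreserving γ⁻¹))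

theorem enorm_weightedTranslate_sq (γ : Γ) (g : Y → ℂ) :
    ∀ᵐ y ∂ν, ‖weightedTranslate ν γ g y‖ₑ ^ 2 = transDensity ν γ y * ‖g (γ⁻¹ • y)‖ₑ ^ 2 := by
  filter_upwards [enorm_sqrtDensity_sq (ν := ν) γ] with y hy
  rw [weightedTranslate, enorm_mul, mul_pow, hy]

theorem eLpNorm_weightedTranslate (γ : Γ) {g : Y → ℂ} (hg : AEStronglyMeasurable g ν) :
    eLpNorm (weightedTranslate ν γ g) 2 ν = eLpNorm g 2 ν := by
  rw [eLpNorm_eq_lintegral_rpow_enorm_toReal (by norm_num) (by norm_num),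
    eLpNorm_eq_lintegral_rpow_enorm_toReal (by norm_num) (by norm_num)]
  congr 1
  have e : (2 : ℝ≥0∞).toReal = ((2 : ℕ) : ℝ) := by norm_num
  simp_rw [e, ENNReal.rpow_natCast]
  rw [lintegral_congr_ae (hq.enorm_weightedTranslate_sq γ g)]
  exact hq.lintegral_transDensity_mul γ (f := fun y => ‖g y‖ₑ ^ 2) (hg.enorm.pow_const 2)

theorem memLp_weightedTranslate (γ : Γ) (g : Lp ℂ 2 ν) : MemLp (weightedTranslate ν γ g) 2 ν :=
  ⟨hq.aestronglyMeasurable_weightedTranslate γ (Lp.aestronglyMeasurable g), by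
    rw [hq.eLpNorm_weightedTranslate γ (Lp.aestronglyMeasurable g)]; exact Lp.eLpNorm_lt_top g⟩

/-- The Koopman representation `g ↦ √(dγ_*ν/dν) · g ∘ γ⁻¹` on `L²(ν)`. -/
def koopman (γ : Γ) : Lp ℂ 2 ν →ₗᵢ[ℂ] Lp ℂ 2 ν where
  toFun g := (hq.memLp_weightedTranslate γ g).toLp _
  map_add' g h := by
    apply Lp.ext
    filter_upwards [(hq.memLp_weightedTranslate γ (g + h)).coeFn_toLp,
      Lp.coeFn_add ((hq.memLp_weightedTranslate γ g).toLp _)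
        ((hq.memLp_weightedTranslate γ h).toLp _),
      (hq.memLp_weightedTranslate γ g).coeFn_toLp, (hq.memLp_weightedTranslate γ h).coeFn_toLp,
      hq.weightedTranslate_congr γ (Lp.coeFn_add g h)] with y h1 h2 h3 h4 h5
    rw [h1, h2, Pi.add_apply, h3, h4, h5]
    simp [weightedTranslate, mul_add]
  map_smul' c g := by
    apply Lp.ext
    filter_upwards [(hq.memLp_weightedTranslate γ (c • g)).coeFn_toLp,
      Lp.coeFn_smul c ((hq.memLp_weightedTranslate γ g).toLp _),
      (hq.memLp_weightedTranslate γ g).coeFn_toLp,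
      hq.weightedTranslate_congr γ (Lp.coeFn_smul c g)] with y h1 h2 h3 h5
    rw [h1, RingHom.id_apply, h2, Pi.smul_apply, h3, h5]
    simp only [weightedTranslate, Pi.smul_apply, smul_eq_mul]
    ring
  norm_map' g := by
    simp only [LinearMap.coe_mk, AddHom.coe_mk]
    rw [Lp.norm_toLp, hq.eLpNorm_weightedTranslate γ (Lp.aestronglyMeasurable g), Lp.norm_def]

theorem coeFn_koopman (γ : Γ) (g : Lp ℂ 2 ν) :
    hq.koopman γ g =ᵐ[ν] fun y => (sqrtDensity ν γ y : ℂ) * g (γ⁻¹ • y) :=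
  (hq.memLp_weightedTranslate γ g).coeFn_toLp

theorem koopman_one (g : Lp ℂ 2 ν) : hq.koopman (1 : Γ) g = g := by
  apply Lp.ext
  filter_upwards [hq.coeFn_koopman 1 g, hq.transDensity_one] with y h1 h2
  rw [h1, sqrtDensity, h2]
  simp

theorem koopman_mul (γ δ : Γ) (g : Lp ℂ 2 ν) :
    hq.koopman (γ * δ) g = hq.koopman γ (hq.koopman δ g) := by
  apply Lp.ext
  filter_upwards [hq.coeFn_koopman (γ * δ) g, hq.coeFn_koopman γ (hq.koopman δ g),
    hq.transDensity_mul γ δ,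
    hq.weightedTranslate_congr γ (hq.coeFn_koopman δ g)] with y h1 h2 h3 h4
  rw [h1, h2]
  simp only [weightedTranslate] at h4
  rw [h4, sqrtDensity, h3, ENNReal.toReal_mul, Real.sqrt_mul ENNReal.toReal_nonneg,
    ← mul_assoc, mul_inv_rev, mul_smul]
  simp [sqrtDensity]

theorem koopman_inv_apply (γ : Γ) (g : Lp ℂ 2 ν) : hq.koopman γ (hq.koopman γ⁻¹ g) = g := by
  rw [← hq.koopman_mul, mul_inv_cancel, hq.koopman_one]

theorem koopman_apply_inv (γ : Γ) (g : Lp ℂ 2 ν) : hq.koopman γ⁻¹ (hq.koopman γ g) = g := by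
  rw [← hq.koopman_mul, inv_mul_cancel, hq.koopman_one]

theorem inner_koopman (γ : Γ) (g h : Lp ℂ 2 ν) :
    inner ℂ (hq.koopman γ g) h = inner ℂ g (hq.koopman γ⁻¹ h) := by
  conv_lhs => rw [← hq.koopman_inv_apply γ h]
  exact (hq.koopman γ).inner_map_map _ _

theorem koopman_mulL2 (γ : Γ) {F F' : Lp ℂ ∞ ν} (h : F' =ᵐ[ν] fun y => F (γ⁻¹ • y))
    (g : Lp ℂ 2 ν) : hq.koopman γ (mulL2 ν F g) = mulL2 ν F' (hq.koopman γ g) := by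
  apply Lp.ext
  filter_upwards [hq.coeFn_koopman γ (mulL2 ν F g), coeFn_mulL2 ν F' (hq.koopman γ g),
    hq.coeFn_koopman γ g, hq.weightedTranslate_congr γ (coeFn_mulL2 ν F g), h]
    with y h1 h2 h3 h4 h5
  simp only [weightedTranslate] at h4
  rw [h1, h2, h3, h4, h5]
  ring

/-- With `D` the density of the translate, `(√D - 1)² ≤ |D - 1|`, and `∫ |D - 1| dν` is the total
variation distance tested on the sign of `D - 1`. This is the passage from almost invariant measures
to almost invariant vectors. -/
theorem integral_koopman_one_sub_one (γ : Γ) {δ : ℝ}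
    (hδ : TVLe (ν.map fun y => γ • y) ν δ) :
    ‖hq.koopman γ (Lp.const 2 ν 1) - Lp.const 2 ν 1‖ ^ 2 ≤ δ := by
  set D : Y → ℝ := fun y => (transDensity ν γ y).toReal with hD
  have hDm : Measurable D := (measurable_transDensity ν γ).ennreal_toReal
  have hDi : Integrable D ν := Measure.integrable_toReal_rnDeriv
  have hc := Lp.coeFn_const (p := 2) (μ := ν) (1 : ℂ)
  have h1 : ‖hq.koopman γ (Lp.const 2 ν 1) - Lp.const 2 ν 1‖ ^ 2
      = ∫ y, (sqrtDensity ν γ y - 1) ^ 2 ∂ν := by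
    rw [← Complex.ofReal_inj, ← integral_complex_ofReal]
    have := inner_self_eq_norm_sq_to_K (𝕜 := ℂ)
      (hq.koopman γ (Lp.const 2 ν 1) - Lp.const 2 ν 1)
    rw [Complex.ofReal_pow]
    refine Eq.trans this.symm ?_
    rw [L2.inner_def]
    refine integral_congr_ae ?_
    filter_upwards [Lp.coeFn_sub (hq.koopman γ (Lp.const 2 ν 1)) (Lp.const 2 ν (1 : ℂ)),
      hq.coeFn_koopman γ (Lp.const 2 ν 1), hc, hq.weightedTranslate_congr γ hc] with y e1 e2 e3 e4
    simp only [weightedTranslate] at e4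
    rw [e1, Pi.sub_apply, e2, e3, e4, inner_self_eq_norm_sq_to_K]
    simp only [Function.const_apply, mul_one]
    rw [← Complex.ofReal_one, ← Complex.ofReal_sub, Complex.norm_real, Real.norm_eq_abs]
    simp only [Complex.coe_algebraMap]
    rw [← Complex.ofReal_pow, sq_abs]
  set s : Y → ℝ := fun y => if 1 ≤ D y then 1 else -1 with hs
  have hsm : Measurable s :=
    Measurable.ite (measurableSet_le measurable_const hDm) measurable_const measurable_const
  have hs1 : ∀ y, |s y| ≤ 1 := fun y => by simp only [hs]; split_ifs <;> simp
  have h2 : ∫ y, (sqrtDensity ν γ y - 1) ^ 2 ∂ν ≤ ∫ y, (D y * s y - s y) ∂ν := by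
    refine integral_mono_of_nonneg (Eventually.of_forall fun y => sq_nonneg _)
      ((hDi.mul_bdd (c := 1) hsm.aestronglyMeasurable (Eventually.of_forall hs1)).sub
        (integrable_of_bound hsm hs1)) (Eventually.of_forall fun y => ?_)
    have hD0 : 0 ≤ D y := ENNReal.toReal_nonneg
    have e1 : sqrtDensity ν γ y = √(D y) := rfl
    have e2 := Real.sq_sqrt hD0
    have e3 := Real.sqrt_nonneg (D y)
    simp only [hs]
    rw [e1]
    set r := √(D y)
    rw [← e2]
    split_ifs with hh
    · have : 1 ≤ r := by nlinarith
      nlinarith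
    · have : r ≤ 1 := by nlinarith
      nlinarith
  have h3 : ∫ y, D y * s y ∂ν = ∫ y, s y ∂(ν.map fun y => γ • y) := by
    rw [← integral_rnDeriv_smul (hq γ)]
    simp [hD, transDensity]
  calc _ ≤ ∫ y, (D y * s y - s y) ∂ν := h1 ▸ h2
    _ = (∫ y, s y ∂(ν.map fun y => γ • y)) - ∫ y, s y ∂ν := by
        rw [integral_sub (hDi.mul_bdd (c := 1) hsm.aestronglyMeasurable (Eventually.of_forall hs1))
          (integrable_of_bound hsm hs1), h3]
    _ ≤ δ := (le_abs_self _).trans (hδ s hsm hs1)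

/-- Squared moduli in `√D · (h ∘ γ⁻¹) = h` say that the density `|h|²` is preserved. This is the
passage back from invariant vectors to invariant measures, used under property (T). -/
theorem map_smul_withDensity_of_invariant (γ : Γ) {h : Lp ℂ 2 ν}
    (hinv : hq.koopman γ h = h) {k : Y → ℂ} (hk : Measurable k) (hkh : k =ᵐ[ν] h) :
    (ν.withDensity fun y => ‖k y‖ₑ ^ 2).map (fun y => γ • y)
      = ν.withDensity fun y => ‖k y‖ₑ ^ 2 := by
  have hm : Measurable fun y => ‖k (γ⁻¹ • y)‖ₑ ^ 2 :=
    (hk.comp (measurable_const_smul γ⁻¹)).enorm.pow_const 2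
  rw [map_smul_withDensity ν γ (hk.enorm.pow_const 2), ← hq.withDensity_transDensity,
    ← withDensity_mul _ (measurable_transDensity ν γ) hm]
  refine withDensity_congr_ae ?_
  have h1 := hq.coeFn_koopman γ h
  rw [hinv] at h1
  filter_upwards [h1, hkh, hq.weightedTranslate_congr γ hkh, hq.enorm_weightedTranslate_sq γ k]
    with y e1 e2 e3 e4
  rw [Pi.mul_apply, ← e4, e3, e2, e1]
  rfl

end IsQuasiInvariant

/-- `g ↦ conj (g ∘ θ)` as a conjugate-linear map of `L²(ν)`. -/
def conjComp {θ : Y → Y} (hθ : MeasurePreserving θ ν ν) (g : Lp ℂ 2 ν) : Lp ℂ 2 ν :=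
  star (Lp.compMeasurePreserving θ hθ g)

theorem coeFn_conjComp {θ : Y → Y} (hθ : MeasurePreserving θ ν ν) (g : Lp ℂ 2 ν) :
    conjComp hθ g =ᵐ[ν] fun y => starRingEnd ℂ (g (θ y)) := by
  filter_upwards [Lp.coeFn_star (Lp.compMeasurePreserving θ hθ g),
    Lp.coeFn_compMeasurePreserving g hθ] with y h1 h2
  rw [conjComp, h1, Pi.star_apply, h2]
  rfl

theorem conjComp_add {θ : Y → Y} (hθ : MeasurePreserving θ ν ν) (g h : Lp ℂ 2 ν) :
    conjComp hθ (g + h) = conjComp hθ g + conjComp hθ h := by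
  apply Lp.ext
  filter_upwards [coeFn_conjComp hθ (g + h), Lp.coeFn_add (conjComp hθ g) (conjComp hθ h),
    coeFn_conjComp hθ g, coeFn_conjComp hθ h,
    hθ.quasiMeasurePreserving.ae_eq (Lp.coeFn_add g h)] with y h1 h2 h3 h4 h5
  simp only [Function.comp] at h5
  rw [h1, h2, Pi.add_apply, h3, h4, h5, Pi.add_apply, map_add]

theorem conjComp_smul {θ : Y → Y} (hθ : MeasurePreserving θ ν ν) (c : ℂ) (g : Lp ℂ 2 ν) :
    conjComp hθ (c • g) = starRingEnd ℂ c • conjComp hθ g := by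
  apply Lp.ext
  filter_upwards [coeFn_conjComp hθ (c • g), Lp.coeFn_smul (starRingEnd ℂ c) (conjComp hθ g),
    coeFn_conjComp hθ g, hθ.quasiMeasurePreserving.ae_eq (Lp.coeFn_smul c g)] with y h1 h2 h3 h5
  simp only [Function.comp] at h5
  rw [h1, h2, Pi.smul_apply, h3, h5, Pi.smul_apply, smul_eq_mul, smul_eq_mul, map_mul]

theorem conjComp_conjComp {θ : Y → Y} (hθ : MeasurePreserving θ ν ν) (hθ2 : ∀ y, θ (θ y) = y)
    (g : Lp ℂ 2 ν) : conjComp hθ (conjComp hθ g) = g := by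
  apply Lp.ext
  filter_upwards [coeFn_conjComp hθ (conjComp hθ g),
    hθ.quasiMeasurePreserving.ae_eq (coeFn_conjComp hθ g)] with y h1 h2
  simp only [Function.comp] at h2
  rw [h1, h2, hθ2, Complex.conj_conj]

theorem inner_conjComp {θ : Y → Y} (hθ : MeasurePreserving θ ν ν) (g h : Lp ℂ 2 ν) :
    inner ℂ (conjComp hθ g) (conjComp hθ h) = inner ℂ h g := by
  rw [L2.inner_def, L2.inner_def]
  have h0 := (Lp.compMeasurePreservingₗᵢ (p := 2) ℂ θ hθ).inner_map_map h g
  rw [L2.inner_def, L2.inner_def] at h0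
  rw [← h0]
  refine integral_congr_ae ?_
  filter_upwards [coeFn_conjComp hθ g, coeFn_conjComp hθ h, Lp.coeFn_compMeasurePreserving g hθ,
    Lp.coeFn_compMeasurePreserving h hθ] with y h1 h2 h3 h4
  rw [h1, h2]
  change _ = inner ℂ (Lp.compMeasurePreserving θ hθ h y) (Lp.compMeasurePreserving θ hθ g y)
  rw [h3, h4]
  simp [RCLike.inner_apply, mul_comm]

theorem conjComp_mulL2 {θ : Y → Y} (hθ : MeasurePreserving θ ν ν) {F F' : Lp ℂ ∞ ν}
    (h : F' =ᵐ[ν] fun y => starRingEnd ℂ (F (θ y))) (g : Lp ℂ 2 ν) :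
    conjComp hθ (mulL2 ν F g) = mulL2 ν F' (conjComp hθ g) := by
  apply Lp.ext
  filter_upwards [coeFn_conjComp hθ (mulL2 ν F g), coeFn_mulL2 ν F' (conjComp hθ g),
    coeFn_conjComp hθ g, h, hθ.quasiMeasurePreserving.ae_eq (coeFn_mulL2 ν F g)]
    with y h1 h2 h3 h4 h5
  simp only [Function.comp] at h5
  rw [h1, h2, h3, h4, h5, map_mul]

theorem IsQuasiInvariant.conjComp_koopman (hq : IsQuasiInvariant Γ ν) {θ : Y → Y}
    (hθ : MeasurePreserving θ ν ν) (hθ2 : ∀ y, θ (θ y) = y)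
    (hθγ : ∀ (γ : Γ) y, θ (γ • y) = γ • θ y) (γ : Γ) (g : Lp ℂ 2 ν) :
    conjComp hθ (hq.koopman γ g) = hq.koopman γ (conjComp hθ g) := by
  apply Lp.ext
  filter_upwards [coeFn_conjComp hθ (hq.koopman γ g), hq.coeFn_koopman γ (conjComp hθ g),
    hθ.quasiMeasurePreserving.ae_eq (hq.coeFn_koopman γ g),
    hq.weightedTranslate_congr γ (coeFn_conjComp hθ g),
    hq.transDensity_comp_involution γ hθ hθ2 (hθγ γ)] with y h1 h2 h3 h4 h5
  simp only [Function.comp, IsQuasiInvariant.weightedTranslate] at h3 h4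
  rw [h1, h2, h3, h4, map_mul, hθγ, sqrtDensity, sqrtDensity, h5, Complex.conj_ofReal]

end QuasiInvariant

/-! ### Antiunitary involutions and reindexing of `ℓ²`-sums -/

section Antiunitary

open ContinuousLinearMap

variable {K : Type w} [NormedAddCommGroup K] [InnerProductSpace ℂ K] [CompleteSpace K]

/-- A conjugate-linear isometric involution. -/
structure IsAntiunitaryInvolution (C : K → K) : Prop where
  map_add : ∀ x y, C (x + y) = C x + C y
  map_smul : ∀ (c : ℂ) x, C (c • x) = starRingEnd ℂ c • C x
  apply_apply : ∀ x, C (C x) = x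
  inner_map_map : ∀ x y, inner ℂ (C x) (C y) = inner ℂ y x

namespace IsAntiunitaryInvolution

variable {C : K → K} (hC : IsAntiunitaryInvolution C)
include hC

theorem norm_map (x : K) : ‖C x‖ = ‖x‖ := by
  have h := hC.inner_map_map x x
  rw [inner_self_eq_norm_sq_to_K, inner_self_eq_norm_sq_to_K] at h
  have h2 : ‖C x‖ ^ 2 = ‖x‖ ^ 2 := by
    apply Complex.ofReal_injective
    push_cast
    exact h
  exact (pow_left_inj₀ (norm_nonneg _) (norm_nonneg _) two_ne_zero).1 h2

theorem inner_left (x y : K) : inner ℂ (C x) y = inner ℂ (C y) x := by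
  conv_lhs => rw [← hC.apply_apply y]
  exact hC.inner_map_map _ _

theorem inner_right (x y : K) : inner ℂ x (C y) = inner ℂ y (C x) := by
  conv_lhs => rw [← hC.apply_apply x]
  exact hC.inner_map_map _ _

/-- Conjugation of a bounded operator by an antiunitary involution. -/
def conjBy (a : K →L[ℂ] K) : K →L[ℂ] K :=
  LinearMap.mkContinuous
    { toFun := fun x => C (a (C x))
      map_add' := fun x y => by rw [hC.map_add, _root_.map_add, hC.map_add]
      map_smul' := fun c x => by
        rw [hC.map_smul, _root_.map_smul, hC.map_smul, Complex.conj_conj, RingHom.id_apply] }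
    ‖a‖ (fun x => by
      change ‖C (a (C x))‖ ≤ _
      rw [hC.norm_map, ← hC.norm_map x]
      exact a.le_opNorm _)

theorem conjBy_apply (a : K →L[ℂ] K) (x : K) : hC.conjBy a x = C (a (C x)) := rfl

theorem conjBy_mul (a b : K →L[ℂ] K) : hC.conjBy (a * b) = hC.conjBy a * hC.conjBy b := by
  ext x
  simp only [mul_apply_eq_comp, conjBy_apply, hC.apply_apply]

theorem conjBy_one : hC.conjBy 1 = 1 := by
  ext x
  simp only [one_apply_eq_self, conjBy_apply, hC.apply_apply]

theorem map_zero : C 0 = 0 := by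
  have := hC.norm_map 0
  rwa [norm_zero, norm_eq_zero] at this

theorem conjBy_zero : hC.conjBy 0 = 0 := by
  ext x
  simp only [conjBy_apply, zero_apply, hC.map_zero]

theorem conjBy_add (a b : K →L[ℂ] K) : hC.conjBy (a + b) = hC.conjBy a + hC.conjBy b := by
  ext x
  simp only [add_apply, conjBy_apply, hC.map_add]

theorem conjBy_smul (c : ℂ) (a : K →L[ℂ] K) :
    hC.conjBy (c • a) = starRingEnd ℂ c • hC.conjBy a := by
  ext x
  simp only [smul_apply, conjBy_apply, hC.map_smul]

theorem conjBy_star (a : K →L[ℂ] K) : hC.conjBy (star a) = star (hC.conjBy a) := by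
  rw [star_eq_adjoint, star_eq_adjoint, eq_adjoint_iff]
  intro x y
  rw [conjBy_apply, conjBy_apply, hC.inner_left, adjoint_inner_right, hC.inner_right x]

theorem conjBy_conjBy (a : K →L[ℂ] K) : hC.conjBy (hC.conjBy a) = a := by
  ext x
  simp only [conjBy_apply, hC.apply_apply]

/-- Conjugating a commutation relation by the involution moves the conjugation to the other
operator. Commutation of two actions can thus be propagated from generators in one variable at a
time. -/
theorem commute_conjBy_iff {a b : K →L[ℂ] K} :
    Commute (hC.conjBy a) b ↔ Commute a (hC.conjBy b) := by
  have key : ∀ {a b : K →L[ℂ] K}, Commute (hC.conjBy a) b → Commute a (hC.conjBy b) := by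
    intro a b h
    have := congrArg hC.conjBy h.eq
    rwa [hC.conjBy_mul, hC.conjBy_mul, hC.conjBy_conjBy] at this
  refine ⟨key, fun h => ?_⟩
  have := key (a := hC.conjBy a) (b := hC.conjBy b) (by rwa [hC.conjBy_conjBy])
  rwa [hC.conjBy_conjBy] at this

end IsAntiunitaryInvolution

/-- A normal representation together with an antiunitary involution `C` such that `C π(y) C`
commutes with `π(x)` for all `x`, `y` gives a bimodule with right action `x ↦ C π(x*) C`. -/
def HilbertBimodule.ofConj {H : Type u} [NormedAddCommGroup H] [InnerProductSpace ℂ H]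
    [CompleteSpace H] {M : VonNeumannAlgebra H} (π : M.toStarSubalgebra →⋆ₐ[ℂ] (K →L[ℂ] K))
    (hπ : IsNormalMap M (fun x => π x)) {C : K → K} (hC : IsAntiunitaryInvolution C)
    (hcomm : ∀ x y, Commute (π x) (hC.conjBy (π y))) : HilbertBimodule M K where
  left := π
  right :=
    { toFun := fun x => hC.conjBy (π (star x.unop))
      map_one' := by simp [hC.conjBy_one]
      map_mul' := fun x y => by
        rw [MulOpposite.unop_mul, star_mul, map_mul, hC.conjBy_mul]
      map_zero' := by simp [hC.conjBy_zero]
      map_add' := fun x y => by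
        rw [MulOpposite.unop_add, star_add, map_add, hC.conjBy_add]
      commutes' := fun c => by
        rw [MulOpposite.algebraMap_apply, MulOpposite.unop_op, Algebra.algebraMap_eq_smul_one,
          star_smul, star_one, map_smul, map_one, hC.conjBy_smul, hC.conjBy_one,
          Algebra.algebraMap_eq_smul_one]
        simp
      map_star' := fun x => by
        rw [MulOpposite.unop_star, map_star π (star x.unop), hC.conjBy_star] }
  commute := fun x y => hcomm x _
  left_normal := hπ
  right_normal := by
    intro l x hl hw η ζ
    -- The involution exchanges the two vectors, so a coefficient of `C π(y*) C` is a coefficient of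
    -- `π(y)` itself, and normality passes to the right action.
    have h := hπ l x hl hw (C ζ) (C η)
    have e : ∀ y : M.toStarSubalgebra, inner ℂ η (hC.conjBy (π (star y)) ζ)
        = inner ℂ (C ζ) (π y (C η)) := fun y => by
      rw [hC.conjBy_apply, hC.inner_right, map_star, star_eq_adjoint, adjoint_inner_left]
    change Tendsto (fun y => inner ℂ η (hC.conjBy (π (star y)) ζ)) l
      (𝓝 (inner ℂ η (hC.conjBy (π (star x)) ζ)))
    simp_rw [e]
    exact h

end Antiunitary

/-! ### Twisted permutations of ℓ²-sums -/

section Reindex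

variable {Γ : Type v} {L : Type u} [NormedAddCommGroup L] [InnerProductSpace ℂ L]

/-- Reindexing of an `ℓ²`-sum along `e`, twisted by norm-preserving maps. -/
def lpTwist (e : Γ ≃ Γ) (T : Γ → L → L) (hT : ∀ s x, ‖T s x‖ = ‖x‖)
    (k : lp (fun _ : Γ => L) 2) : lp (fun _ : Γ => L) 2 :=
  ⟨fun s => T s (k (e s)), by
    have h := (memℓp_gen_iff (p := 2) (by norm_num)).1 (lp.memℓp k)
    refine (memℓp_gen_iff (p := 2) (by norm_num)).2 ?_
    simpa [Function.comp_def, hT] using e.summable_iff.2 h⟩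

theorem lpTwist_apply (e : Γ ≃ Γ) (T : Γ → L → L) (hT : ∀ s x, ‖T s x‖ = ‖x‖)
    (k : lp (fun _ : Γ => L) 2) (s : Γ) : lpTwist e T hT k s = T s (k (e s)) := rfl

theorem inner_lpTwist_left (e : Γ ≃ Γ) {T T' : Γ → L → L} (hT : ∀ s x, ‖T s x‖ = ‖x‖)
    (hT' : ∀ s x, ‖T' s x‖ = ‖x‖) (h : ∀ s x y, inner ℂ (T s x) y = inner ℂ x (T' (e s) y))
    (k l : lp (fun _ : Γ => L) 2) :
    inner ℂ (lpTwist e T hT k) l = inner ℂ k (lpTwist e.symm T' hT' l) := by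
  rw [lp.inner_eq_tsum, lp.inner_eq_tsum,
    ← e.tsum_eq fun s => inner ℂ (k s) (lpTwist e.symm T' hT' l s)]
  refine tsum_congr fun s => ?_
  rw [lpTwist_apply, lpTwist_apply, h, e.symm_apply_apply]

theorem inner_lpTwist_lpTwist (e : Γ ≃ Γ) {T : Γ → L → L} (hT : ∀ s x, ‖T s x‖ = ‖x‖)
    (h : ∀ s x y, inner ℂ (T s x) (T s y) = inner ℂ y x) (k l : lp (fun _ : Γ => L) 2) :
    inner ℂ (lpTwist e T hT k) (lpTwist e T hT l) = inner ℂ l k := by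
  rw [lp.inner_eq_tsum, lp.inner_eq_tsum, ← e.tsum_eq fun s => inner ℂ (l s) (k s)]
  refine tsum_congr fun s => ?_
  rw [lpTwist_apply, lpTwist_apply, h]

open Classical in
theorem lp_submodule_eq_top {U : Submodule ℂ (lp (fun _ : Γ => L) 2)}
    (hU : IsClosed (U : Set (lp (fun _ : Γ => L) 2)))
    (h : ∀ s a, lp.single 2 s a ∈ U) : U = ⊤ := by
  refine eq_top_iff.2 fun k _ => ?_
  refine hU.mem_of_tendsto (lp.hasSum_single (by norm_num) k) (Eventually.of_forall fun F => ?_)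
  exact U.sum_mem fun s _ => h s _

end Reindex

/-! ### Multiplication operators and total subsets of L² -/

section DenseBounded

variable {Y : Type u} [MeasurableSpace Y]

theorem L2_submodule_eq_top {ν : Measure Y} [IsFiniteMeasure ν] {U : Submodule ℂ (Lp ℂ 2 ν)}
    (hU : IsClosed (U : Set (Lp ℂ 2 ν)))
    (h : ∀ A (hA : MeasurableSet A), indicatorConstLp 2 hA (measure_ne_top ν A) (1 : ℂ) ∈ U) :
    U = ⊤ := by
  refine eq_top_iff.2 fun g _ => ?_
  refine Lp.induction (p := 2) (by norm_num) (motive := fun g => g ∈ U) ?_ ?_ hU g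
  · intro c s hs hμs
    have := U.smul_mem c (h s hs)
    rw [Lp.simpleFunc.coe_indicatorConst]
    convert this using 1
    apply Lp.ext
    filter_upwards [indicatorConstLp_coeFn (p := 2) (hs := hs) (hμs := hμs.ne) (c := c),
      Lp.coeFn_smul c (indicatorConstLp 2 hs (measure_ne_top ν s) (1 : ℂ)),
      indicatorConstLp_coeFn (p := 2) (hs := hs) (hμs := measure_ne_top ν s) (c := (1 : ℂ))]
      with y h1 h2 h3
    rw [h1, h2, Pi.smul_apply, h3]
    by_cases hy : y ∈ s <;> simp [hy]
  · intro f g hf hg _ h1 h2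
    exact U.add_mem h1 h2

theorem mulL2_const_one {ν : Measure Y} [IsFiniteMeasure ν] {A : Set Y} (hA : MeasurableSet A) :
    mulL2 ν (indicatorConstLp ∞ hA (measure_ne_top ν A) (1 : ℂ)) (Lp.const 2 ν 1)
      = indicatorConstLp 2 hA (measure_ne_top ν A) (1 : ℂ) := by
  apply Lp.ext
  filter_upwards [coeFn_mulL2 ν (indicatorConstLp ∞ hA (measure_ne_top ν A) (1 : ℂ))
    (Lp.const 2 ν 1), Lp.coeFn_const (p := 2) (μ := ν) (1 : ℂ),
    indicatorConstLp_coeFn (p := ∞) (hs := hA) (hμs := measure_ne_top ν A) (c := (1 : ℂ)),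
    indicatorConstLp_coeFn (p := 2) (hs := hA) (hμs := measure_ne_top ν A) (c := (1 : ℂ))]
    with y h1 h2 h3 h4
  rw [h1, h2, h3, h4]
  simp

theorem mulL2_comm (ν : Measure Y) (F G : Lp ℂ ∞ ν) (g : Lp ℂ 2 ν) :
    mulL2 ν F (mulL2 ν G g) = mulL2 ν G (mulL2 ν F g) := by
  apply Lp.ext
  filter_upwards [coeFn_mulL2 ν F (mulL2 ν G g), coeFn_mulL2 ν G (mulL2 ν F g),
    coeFn_mulL2 ν F g, coeFn_mulL2 ν G g] with y h1 h2 h3 h4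
  rw [h1, h2, h3, h4]
  ring

theorem star_crossedMul (Γ : Type v) (μ : Measure Y) (f : Lp ℂ ∞ μ) :
    star (crossedMul Γ μ f) = crossedMul Γ μ (star f) := by
  rw [ContinuousLinearMap.star_eq_adjoint, eq_comm, ContinuousLinearMap.eq_adjoint_iff]
  intro ξ ζ
  rw [lp.inner_eq_tsum, lp.inner_eq_tsum]
  refine tsum_congr fun γ => ?_
  rw [crossedMul_apply, crossedMul_apply, L2.inner_def, L2.inner_def]
  refine integral_congr_ae ?_
  filter_upwards [coeFn_mulL2 μ (star f) (ξ γ), coeFn_mulL2 μ f (ζ γ), Lp.coeFn_star f]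
    with x h1 h2 h3
  rw [h1, h2, h3]
  simp [RCLike.inner_apply]
  ring

end DenseBounded

/-! ### The Koopman representation of an invariant measure -/

section KoopmanInvariant

variable {X : Type u} [MeasurableSpace X] {Γ : Type v} [Group Γ] [MulAction Γ X]
  [MeasurableConstSMul Γ X] (μ : Measure X) [SMulInvariantMeasure Γ X μ]

theorem coeFn_koopman (γ : Γ) (g : Lp ℂ 2 μ) : koopman μ γ g =ᵐ[μ] fun x => g (γ⁻¹ • x) :=
  Lp.coeFn_compMeasurePreserving g _

theorem koopman_one (g : Lp ℂ 2 μ) : koopman μ (1 : Γ) g = g := by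
  apply Lp.ext
  filter_upwards [coeFn_koopman μ (1 : Γ) g] with x h
  simp [h]

theorem koopman_mul (γ δ : Γ) (g : Lp ℂ 2 μ) :
    koopman μ (γ * δ) g = koopman μ γ (koopman μ δ g) := by
  apply Lp.ext
  filter_upwards [coeFn_koopman μ (γ * δ) g, coeFn_koopman μ γ (koopman μ δ g),
    (measurePreserving_smul γ⁻¹ μ).quasiMeasurePreserving.ae_eq (coeFn_koopman μ δ g)]
    with x h1 h2 h3
  simp only [Function.comp] at h3
  rw [h1, h2, h3, mul_inv_rev, mul_smul]

theorem inner_koopman (γ : Γ) (g h : Lp ℂ 2 μ) :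
    inner ℂ (koopman μ γ g) h = inner ℂ g (koopman μ γ⁻¹ h) := by
  have : h = koopman μ γ (koopman μ γ⁻¹ h) := by
    rw [← koopman_mul, mul_inv_cancel, koopman_one]
  conv_lhs => rw [this]
  exact (koopman μ γ).inner_map_map _ _

theorem star_crossedUnitary (γ : Γ) : star (crossedUnitary μ γ) = crossedUnitary μ γ⁻¹ := by
  rw [ContinuousLinearMap.star_eq_adjoint, eq_comm, ContinuousLinearMap.eq_adjoint_iff]
  intro ξ ζ
  rw [lp.inner_eq_tsum, lp.inner_eq_tsum, ← (Equiv.mulLeft γ⁻¹).tsum_eq]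
  refine tsum_congr fun s => ?_
  simp only [Equiv.coe_mulLeft, crossedUnitary_apply, inv_inv, mul_inv_cancel_left]
  rw [inner_koopman, inv_inv]

end KoopmanInvariant

/-! ### The bimodule of a symmetric quasi-invariant coupling -/

section CouplingBimodule

variable {X : Type u} [MeasurableSpace X] {Γ : Type v} [Group Γ] [MulAction Γ X]
  [MeasurableConstSMul Γ X]

instance measurableConstSMul_prod : MeasurableConstSMul Γ (X × X) where
  measurable_const_smul γ :=
    ((measurable_const_smul γ).comp measurable_fst).prodMk
      ((measurable_const_smul γ).comp measurable_snd)

/-- The generators of the crossed product. -/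
abbrev crossedGenerators (Γ : Type v) [Group Γ] [MulAction Γ X] [MeasurableConstSMul Γ X]
    (μ : Measure X) [SMulInvariantMeasure Γ X μ] : Set (CrossedL2 Γ μ →L[ℂ] CrossedL2 Γ μ) :=
  Set.range (crossedMul Γ μ) ∪ Set.range (crossedUnitary μ : Γ → _)

/-- The element `L_f` of the crossed product. -/
def crossedMulElem (Γ : Type v) [Group Γ] [MulAction Γ X] [MeasurableConstSMul Γ X]
    (μ : Measure X) [SMulInvariantMeasure Γ X μ] (f : Lp ℂ ∞ μ) :
    (crossedProduct Γ μ).toStarSubalgebra :=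
  ⟨crossedMul Γ μ f, subset_vonNeumannGenerated _ (Or.inl ⟨f, rfl⟩)⟩

/-- The element `u_γ` of the crossed product. -/
def crossedUnitaryElem (μ : Measure X) [SMulInvariantMeasure Γ X μ] (γ : Γ) :
    (crossedProduct Γ μ).toStarSubalgebra :=
  ⟨crossedUnitary μ γ, subset_vonNeumannGenerated _ (Or.inr ⟨γ, rfl⟩)⟩

theorem star_crossedMulElem (μ : Measure X) [SMulInvariantMeasure Γ X μ] (f : Lp ℂ ∞ μ) :
    star (crossedMulElem Γ μ f) = crossedMulElem Γ μ (star f) :=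
  Subtype.ext (star_crossedMul Γ μ f)

theorem star_crossedUnitaryElem (μ : Measure X) [SMulInvariantMeasure Γ X μ] (γ : Γ) :
    star (crossedUnitaryElem μ γ) = crossedUnitaryElem μ γ⁻¹ :=
  Subtype.ext (star_crossedUnitary μ γ)

/-- A symmetric coupling of `μ` with itself, quasi-invariant for the diagonal action. -/
structure IsBimoduleCoupling (Γ : Type v) [Group Γ] [MulAction Γ X]
    (μ : Measure X) (ν : Measure (X × X)) : Prop extends IsCoupling μ ν where
  quasiInvariant : IsQuasiInvariant Γ ν
  measurePreserving_swap : MeasurePreserving Prod.swap ν ν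

namespace IsBimoduleCoupling

variable {μ : Measure X} [SMulInvariantMeasure Γ X μ] {ν : Measure (X × X)} [IsProbabilityMeasure ν]
  (hν : IsBimoduleCoupling Γ μ ν)
include hν

/-- The action of `u_γ` from the left. -/
def leftUnitary (γ : Γ) : CrossedL2 Γ ν →L[ℂ] CrossedL2 Γ ν :=
  LinearMap.mkContinuous
    { toFun := lpTwist (Equiv.mulLeft γ⁻¹) (fun _ => hν.quasiInvariant.koopman γ)
        fun _ => (hν.quasiInvariant.koopman γ).norm_map
      map_add' := fun _ _ => lp.ext (funext fun _ => (hν.quasiInvariant.koopman γ).map_add _ _)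
      map_smul' := fun c _ => lp.ext (funext fun _ => (hν.quasiInvariant.koopman γ).map_smul c _) }
    1 (fun k => by
      have h := inner_lpTwist_left (Equiv.mulLeft γ⁻¹)
        (T := fun _ : Γ => hν.quasiInvariant.koopman γ)
        (T' := fun _ : Γ => hν.quasiInvariant.koopman γ⁻¹)
        (fun _ => (hν.quasiInvariant.koopman γ).norm_map)
        (fun _ => (hν.quasiInvariant.koopman γ⁻¹).norm_map)
        (fun _ => hν.quasiInvariant.inner_koopman γ) k
        (lpTwist (Equiv.mulLeft γ⁻¹) (fun _ => hν.quasiInvariant.koopman γ)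
          (fun _ => (hν.quasiInvariant.koopman γ).norm_map) k)
      have e : lpTwist (Equiv.mulLeft γ⁻¹).symm (fun _ => hν.quasiInvariant.koopman γ⁻¹)
          (fun _ => (hν.quasiInvariant.koopman γ⁻¹).norm_map)
          (lpTwist (Equiv.mulLeft γ⁻¹) (fun _ => hν.quasiInvariant.koopman γ)
          (fun _ => (hν.quasiInvariant.koopman γ).norm_map) k) = k := by
        refine lp.ext (funext fun s => ?_)
        rw [lpTwist_apply, lpTwist_apply, hν.quasiInvariant.koopman_apply_inv,
          Equiv.apply_symm_apply]
      rw [e, inner_self_eq_norm_sq_to_K, inner_self_eq_norm_sq_to_K] at h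
      rw [one_mul]
      refine le_of_eq ((pow_left_inj₀ (norm_nonneg _) (norm_nonneg _) two_ne_zero).1 ?_)
      apply Complex.ofReal_injective
      push_cast
      exact h)

theorem leftUnitary_apply (γ : Γ) (k : CrossedL2 Γ ν) (s : Γ) :
    hν.leftUnitary γ k s = hν.quasiInvariant.koopman γ (k (γ⁻¹ * s)) := rfl

theorem star_leftUnitary (γ : Γ) : star (hν.leftUnitary γ) = hν.leftUnitary γ⁻¹ := by
  rw [ContinuousLinearMap.star_eq_adjoint, eq_comm, ContinuousLinearMap.eq_adjoint_iff]
  intro ξ ζ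
  have h := inner_lpTwist_left (Equiv.mulLeft γ)
        (T := fun _ : Γ => hν.quasiInvariant.koopman γ⁻¹)
        (T' := fun _ : Γ => hν.quasiInvariant.koopman γ)
        (fun _ => (hν.quasiInvariant.koopman γ⁻¹).norm_map)
        (fun _ => (hν.quasiInvariant.koopman γ).norm_map)
        (fun _ x y => by rw [hν.quasiInvariant.inner_koopman, inv_inv]) ξ ζ
  refine Eq.trans (congrArg (fun z => inner ℂ z ζ) ?_) (h.trans (congrArg (inner ℂ ξ) ?_))
  · refine lp.ext (funext fun s => ?_)
    rw [leftUnitary_apply, lpTwist_apply, inv_inv, Equiv.coe_mulLeft]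
  · refine lp.ext (funext fun s => ?_)
    rw [leftUnitary_apply, lpTwist_apply, Equiv.mulLeft_symm_apply]

/-- `f ↦ f ∘ p¹` on essentially bounded functions. -/
def fstFun (f : Lp ℂ ∞ μ) : Lp ℂ ∞ ν := Lp.compMeasurePreserving Prod.fst hν.measurePreserving_fst f

theorem coeFn_fstFun (f : Lp ℂ ∞ μ) : hν.fstFun f =ᵐ[ν] fun p => f p.1 :=
  Lp.coeFn_compMeasurePreserving f _

omit hν in
theorem ae_fst (h : IsCoupling μ ν) {Z : Type*} {f g : X → Z} (hfg : f =ᵐ[μ] g) :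
    ∀ᵐ p ∂ν, f p.1 = g p.1 :=
  h.measurePreserving_fst.quasiMeasurePreserving.ae_eq hfg

omit hν in
theorem ae_snd (h : IsCoupling μ ν) {Z : Type*} {f g : X → Z} (hfg : f =ᵐ[μ] g) :
    ∀ᵐ p ∂ν, f p.2 = g p.2 :=
  h.measurePreserving_snd.quasiMeasurePreserving.ae_eq hfg

theorem star_fstFun (f : Lp ℂ ∞ μ) : star (hν.fstFun f) = hν.fstFun (star f) := by
  apply Lp.ext
  filter_upwards [Lp.coeFn_star (hν.fstFun f), hν.coeFn_fstFun f, hν.coeFn_fstFun (star f),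
    ae_fst hν.toIsCoupling (Lp.coeFn_star f)] with p h1 h2 h3 h4
  rw [h1, Pi.star_apply, h2, h3, h4]
  rfl

theorem fstFun_smul (γ : Γ) (f : Lp ℂ ∞ μ) :
    hν.fstFun (Lp.compMeasurePreserving (fun x => γ⁻¹ • x) (measurePreserving_smul γ⁻¹ μ) f)
      =ᵐ[ν] fun p => hν.fstFun f (γ⁻¹ • p) := by
  filter_upwards [hν.coeFn_fstFun (Lp.compMeasurePreserving (fun x => γ⁻¹ • x)
      (measurePreserving_smul γ⁻¹ μ) f), ae_fst hν.toIsCoupling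
      (Lp.coeFn_compMeasurePreserving f (measurePreserving_smul γ⁻¹ μ)),
      (hν.quasiInvariant.quasiMeasurePreserving γ⁻¹).ae_eq (hν.coeFn_fstFun f)] with p h1 h2 h3
  simp only [Function.comp] at h2 h3
  rw [h1, h2, h3]
  rfl

/-- `v_h g = h · (g ∘ p¹)`. -/
def fstMul (h : Lp ℂ ∞ ν) : Lp ℂ 2 μ →L[ℂ] Lp ℂ 2 ν :=
  mulL2 ν h ∘L
    (Lp.compMeasurePreservingₗᵢ ℂ Prod.fst hν.measurePreserving_fst).toContinuousLinearMap

theorem coeFn_fstMul (h : Lp ℂ ∞ ν) (g : Lp ℂ 2 μ) :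
    hν.fstMul h g =ᵐ[ν] fun p => h p * g p.1 := by
  filter_upwards [coeFn_mulL2 ν h (Lp.compMeasurePreserving Prod.fst hν.measurePreserving_fst g),
    Lp.coeFn_compMeasurePreserving g hν.measurePreserving_fst] with p h1 h2
  simp only [Function.comp] at h2
  rw [← h2]
  exact h1

theorem fstMul_mulL2 (h : Lp ℂ ∞ ν) (f : Lp ℂ ∞ μ) (g : Lp ℂ 2 μ) :
    hν.fstMul h (mulL2 μ f g) = mulL2 ν (hν.fstFun f) (hν.fstMul h g) := by
  apply Lp.ext
  filter_upwards [hν.coeFn_fstMul h (mulL2 μ f g), coeFn_mulL2 ν (hν.fstFun f) (hν.fstMul h g),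
    hν.coeFn_fstMul h g, hν.coeFn_fstFun f, ae_fst hν.toIsCoupling (coeFn_mulL2 μ f g)]
    with p h1 h2 h3 h4 h5
  rw [h1, h2, h3, h4, h5]
  ring

/-- The intertwiner `g ⊗ δ_s ↦ σ_s v_h σ_s⁻¹ g ⊗ δ_s`. -/
def intertwiner (h : Lp ℂ ∞ ν) : CrossedL2 Γ μ →L[ℂ] CrossedL2 Γ ν :=
  lp.mapCLM 2 (fun s : Γ => (hν.quasiInvariant.koopman s).toContinuousLinearMap ∘L hν.fstMul h ∘L
    (koopman μ s⁻¹).toContinuousLinearMap) (norm_nonneg (hν.fstMul h)) (fun s => by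
      refine ContinuousLinearMap.opNorm_le_bound _ (norm_nonneg _) fun g => ?_
      change ‖hν.quasiInvariant.koopman s (hν.fstMul h (koopman μ s⁻¹ g))‖ ≤ _
      rw [LinearIsometry.norm_map]
      refine ((hν.fstMul h).le_opNorm _).trans ?_
      rw [LinearIsometry.norm_map])

theorem intertwiner_apply (h : Lp ℂ ∞ ν) (ξ : CrossedL2 Γ μ) (s : Γ) :
    hν.intertwiner h ξ s = hν.quasiInvariant.koopman s (hν.fstMul h (koopman μ s⁻¹ (ξ s))) := rfl

theorem koopman_mulL2' (γ : Γ) (f : Lp ℂ ∞ μ) (g : Lp ℂ 2 μ) :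
    koopman μ γ (mulL2 μ f g) = mulL2 μ
      (Lp.compMeasurePreserving (fun x => γ⁻¹ • x) (measurePreserving_smul γ⁻¹ μ) f)
      (koopman μ γ g) := by
  apply Lp.ext
  filter_upwards [coeFn_koopman μ γ (mulL2 μ f g), coeFn_mulL2 μ (Lp.compMeasurePreserving
    (fun x => γ⁻¹ • x) (measurePreserving_smul γ⁻¹ μ) f) (koopman μ γ g), coeFn_koopman μ γ g,
    Lp.coeFn_compMeasurePreserving f (measurePreserving_smul γ⁻¹ μ),
    (measurePreserving_smul γ⁻¹ μ).quasiMeasurePreserving.ae_eq (coeFn_mulL2 μ f g)]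
    with x h1 h2 h3 h4 h5
  simp only [Function.comp] at h4 h5
  rw [h1, h2, h3, h4, h5]

/-- Multiplication by `f ∘ p¹` commutes with `v_h`, and equivariance of `p¹` ensures that
conjugation by `σ_s` translates `f` and then translates it back. -/
theorem intertwiner_crossedMul (h : Lp ℂ ∞ ν) (f : Lp ℂ ∞ μ) :
    hν.intertwiner h ∘L crossedMul Γ μ f = crossedMul Γ ν (hν.fstFun f) ∘L hν.intertwiner h := by
  ext1 ξ
  refine lp.ext (funext fun s => ?_)
  change hν.quasiInvariant.koopman s (hν.fstMul h (koopman μ s⁻¹ (mulL2 μ f (ξ s))))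
    = mulL2 ν (hν.fstFun f) (hν.quasiInvariant.koopman s (hν.fstMul h (koopman μ s⁻¹ (ξ s))))
  rw [hν.koopman_mulL2', fstMul_mulL2]
  refine hν.quasiInvariant.koopman_mulL2 s ?_ _
  have h1 := (hν.quasiInvariant.quasiMeasurePreserving s⁻¹).ae_eq (hν.fstFun_smul s⁻¹ f)
  filter_upwards [h1] with p h2
  simp only [Function.comp, inv_inv, smul_inv_smul] at h2
  rw [← h2]
  simp only [inv_inv]

/-- The conjugation of `v_h` by `σ_s` in the coordinate `s` is chosen so that this relation
telescopes; `v_h` itself need not be equivariant. -/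
theorem intertwiner_crossedUnitary (h : Lp ℂ ∞ ν) (γ : Γ) :
    hν.intertwiner h ∘L crossedUnitary μ γ = hν.leftUnitary γ ∘L hν.intertwiner h := by
  ext1 ξ
  refine lp.ext (funext fun s => ?_)
  change hν.quasiInvariant.koopman s (hν.fstMul h (koopman μ s⁻¹ (koopman μ γ (ξ (γ⁻¹ * s)))))
    = hν.quasiInvariant.koopman γ (hν.quasiInvariant.koopman (γ⁻¹ * s)
      (hν.fstMul h (koopman μ (γ⁻¹ * s)⁻¹ (ξ (γ⁻¹ * s)))))
  rw [← koopman_mul, ← IsQuasiInvariant.koopman_mul, mul_inv_cancel_left, mul_inv_rev, inv_inv]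

open Classical in
theorem intertwiner_single (h : Lp ℂ ∞ ν) (s : Γ) (g : Lp ℂ 2 μ) :
    hν.intertwiner h (lp.single 2 s g) =
      lp.single 2 s (hν.quasiInvariant.koopman s (hν.fstMul h (koopman μ s⁻¹ g))) := by
  refine lp.ext (funext fun r => ?_)
  rw [intertwiner_apply]
  by_cases hr : r = s
  · subst hr
    rw [lp.single_apply_self, lp.single_apply_self]
  · rw [lp.single_apply_ne _ _ _ hr, lp.single_apply_ne _ _ _ hr, map_zero, map_zero, map_zero]

/-- Functions of `p¹` alone need not be dense in `L²(ν)`, hence the family over all `h`. For `h =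
1_A`, the vector `σ_s 1 ⊗ δ_s` is sent to `σ_s 1_A ⊗ δ_s`, and these vectors are total. -/
theorem isIntertwiningFamily [IsFiniteMeasure μ] :
    IsIntertwiningFamily (crossedGenerators Γ μ) (fun h : Lp ℂ ∞ ν => hν.intertwiner h) where
  intertwine := by
    rintro _ (⟨f, rfl⟩ | ⟨γ, rfl⟩)
    · refine ⟨crossedMul Γ ν (hν.fstFun f), fun h => ⟨hν.intertwiner_crossedMul h f, ?_⟩⟩
      rw [star_crossedMul, star_crossedMul, hν.star_fstFun]
      exact hν.intertwiner_crossedMul h _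
    · refine ⟨hν.leftUnitary γ, fun h => ⟨hν.intertwiner_crossedUnitary h γ, ?_⟩⟩
      rw [star_crossedUnitary, hν.star_leftUnitary]
      exact hν.intertwiner_crossedUnitary h _
  dense := by
    classical
    intro U hU hmem
    refine lp_submodule_eq_top hU fun s a => ?_
    let φ : Lp ℂ 2 ν →L[ℂ] CrossedL2 Γ ν :=
      (lp.singleContinuousLinearMap ℂ (fun _ : Γ => Lp ℂ 2 ν) 2 s) ∘L
        (hν.quasiInvariant.koopman s).toContinuousLinearMap
    have hφ : ∀ g, φ g = lp.single 2 s (hν.quasiInvariant.koopman s g) := fun g => rfl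
    have htop : U.comap φ.toLinearMap = ⊤ := by
      refine L2_submodule_eq_top (hU.preimage φ.continuous) fun A hA => ?_
      change φ _ ∈ U
      have h1 := hmem (indicatorConstLp ∞ hA (measure_ne_top ν A) (1 : ℂ))
        (lp.single 2 s (koopman μ s (Lp.const 2 μ 1)))
      rw [hν.intertwiner_single, ← koopman_mul, inv_mul_cancel, koopman_one] at h1
      rw [hφ, ← mulL2_const_one hA]
      convert h1 using 4
      change _ = mulL2 ν _ (Lp.compMeasurePreserving Prod.fst hν.measurePreserving_fst
        (Lp.const 2 μ 1))
      congr 1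
    have h2 : hν.quasiInvariant.koopman s⁻¹ a ∈ U.comap φ.toLinearMap := htop ▸ Submodule.mem_top
    have h3 : φ (hν.quasiInvariant.koopman s⁻¹ a) ∈ U := h2
    rwa [hφ, hν.quasiInvariant.koopman_inv_apply] at h3

/-- The conjugation `k ↦ (s ↦ C σ_s k(s⁻¹))`. -/
def conj (k : CrossedL2 Γ ν) : CrossedL2 Γ ν :=
  lpTwist (Equiv.inv Γ)
    (fun s g => conjComp hν.measurePreserving_swap (hν.quasiInvariant.koopman s g))
    (fun s g => by
      have h := inner_conjComp hν.measurePreserving_swap (hν.quasiInvariant.koopman s g)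
        (hν.quasiInvariant.koopman s g)
      rw [inner_self_eq_norm_sq_to_K, inner_self_eq_norm_sq_to_K, LinearIsometry.norm_map] at h
      refine (pow_left_inj₀ (norm_nonneg _) (norm_nonneg _) two_ne_zero).1 ?_
      apply Complex.ofReal_injective
      push_cast
      exact h) k

theorem conj_apply (k : CrossedL2 Γ ν) (s : Γ) : hν.conj k s =
    conjComp hν.measurePreserving_swap (hν.quasiInvariant.koopman s (k s⁻¹)) := rfl

theorem conjComp_koopman (γ : Γ) (g : Lp ℂ 2 ν) :
    conjComp hν.measurePreserving_swap (hν.quasiInvariant.koopman γ g) =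
      hν.quasiInvariant.koopman γ (conjComp hν.measurePreserving_swap g) :=
  hν.quasiInvariant.conjComp_koopman hν.measurePreserving_swap Prod.swap_swap (fun _ _ => rfl) γ g

/-- The flip commutes with the action, so applying the map twice produces `σ_s σ_{s⁻¹}`, which
cancels. -/
theorem isAntiunitaryInvolution_conj : IsAntiunitaryInvolution hν.conj where
  map_add k l := lp.ext (funext fun s => by
    change conjComp _ (hν.quasiInvariant.koopman s (k s⁻¹ + l s⁻¹)) =
      conjComp _ (hν.quasiInvariant.koopman s (k s⁻¹))
        + conjComp _ (hν.quasiInvariant.koopman s (l s⁻¹))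
    rw [map_add, conjComp_add])
  map_smul c k := lp.ext (funext fun s => by
    change conjComp _ (hν.quasiInvariant.koopman s (c • k s⁻¹)) =
      starRingEnd ℂ c • conjComp _ (hν.quasiInvariant.koopman s (k s⁻¹))
    rw [map_smul, conjComp_smul])
  apply_apply k := lp.ext (funext fun s => by
    rw [conj_apply, conj_apply, inv_inv, hν.conjComp_koopman s⁻¹,
      hν.quasiInvariant.koopman_inv_apply, conjComp_conjComp _ Prod.swap_swap])
  inner_map_map k l := inner_lpTwist_lpTwist _ _ (fun s x y => by
    rw [inner_conjComp, LinearIsometry.inner_map_map]) k l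

variable [IsFiniteMeasure μ]

/-- The left representation of the crossed product. -/
def leftRep : (crossedProduct Γ μ).toStarSubalgebra →⋆ₐ[ℂ] (CrossedL2 Γ ν →L[ℂ] CrossedL2 Γ ν) :=
  hν.isIntertwiningFamily.extend

theorem leftRep_intertwiner (x : (crossedProduct Γ μ).toStarSubalgebra) (h : Lp ℂ ∞ ν)
    (ξ : CrossedL2 Γ μ) : hν.leftRep x (hν.intertwiner h ξ) =
      hν.intertwiner h ((x : CrossedL2 Γ μ →L[ℂ] CrossedL2 Γ μ) ξ) :=
  hν.isIntertwiningFamily.extend_apply x h ξ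

theorem leftRep_crossedMul (f : Lp ℂ ∞ μ) :
    hν.leftRep (crossedMulElem Γ μ f) = crossedMul Γ ν (hν.fstFun f) :=
  hν.isIntertwiningFamily.extend_eq _ fun h => hν.intertwiner_crossedMul h f

theorem leftRep_crossedUnitary (γ : Γ) :
    hν.leftRep (crossedUnitaryElem μ γ) = hν.leftUnitary γ :=
  hν.isIntertwiningFamily.extend_eq _ fun h => hν.intertwiner_crossedUnitary h γ

/-- `f ↦ f ∘ s⁻¹ ∘ p²` on essentially bounded functions. -/
def sndFun (s : Γ) (f : Lp ℂ ∞ μ) : Lp ℂ ∞ ν :=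
  Lp.compMeasurePreserving (fun p : X × X => s⁻¹ • p.2)
    ((measurePreserving_smul s⁻¹ μ).comp hν.measurePreserving_snd) f

theorem coeFn_sndFun (s : Γ) (f : Lp ℂ ∞ μ) : hν.sndFun s f =ᵐ[ν] fun p => f (s⁻¹ • p.2) :=
  Lp.coeFn_compMeasurePreserving f
    ((measurePreserving_smul s⁻¹ μ).comp hν.measurePreserving_snd)

/-- The flip turns `p¹` into `p²`, and the twist by `σ_s` turns `f` into `f ∘ s⁻¹`. For the
unitaries in the next lemma all twists cancel and a right translation of `Γ` remains. -/
theorem conjBy_crossedMul_apply (f : Lp ℂ ∞ μ) (k : CrossedL2 Γ ν) (s : Γ) :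
    hν.isAntiunitaryInvolution_conj.conjBy (hν.leftRep (crossedMulElem Γ μ (star f))) k s =
      mulL2 ν (hν.sndFun s f) (k s) := by
  rw [leftRep_crossedMul, IsAntiunitaryInvolution.conjBy_apply]
  change conjComp hν.measurePreserving_swap (hν.quasiInvariant.koopman s
    (mulL2 ν (hν.fstFun (star f)) (conjComp hν.measurePreserving_swap
      (hν.quasiInvariant.koopman s⁻¹ (k (s⁻¹)⁻¹))))) = _
  rw [hν.quasiInvariant.koopman_mulL2 s (hν.fstFun_smul s (star f)),
    conjComp_mulL2 hν.measurePreserving_swap (F' := hν.sndFun s f), ← hν.conjComp_koopman s,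
    hν.quasiInvariant.koopman_inv_apply, conjComp_conjComp _ Prod.swap_swap, inv_inv]
  filter_upwards [hν.coeFn_sndFun s f, hν.measurePreserving_swap.quasiMeasurePreserving.ae_eq
    (hν.coeFn_fstFun (Lp.compMeasurePreserving (fun x => s⁻¹ • x) (measurePreserving_smul s⁻¹ μ)
      (star f))), ae_snd hν.toIsCoupling (Lp.coeFn_compMeasurePreserving (star f)
      (measurePreserving_smul s⁻¹ μ)), ae_snd hν.toIsCoupling
      ((measurePreserving_smul s⁻¹ μ).quasiMeasurePreserving.ae_eq (Lp.coeFn_star f))]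
    with p h1 h2 h3 h4
  simp only [Function.comp, Prod.fst_swap, Pi.star_apply] at h2 h3 h4
  rw [h1, h2, h3, h4, RCLike.star_def, Complex.conj_conj]

theorem conjBy_crossedUnitary_apply (γ : Γ) (k : CrossedL2 Γ ν) (s : Γ) :
    hν.isAntiunitaryInvolution_conj.conjBy (hν.leftRep (crossedUnitaryElem μ γ)) k s =
      k (s * γ) := by
  rw [leftRep_crossedUnitary, IsAntiunitaryInvolution.conjBy_apply]
  change conjComp hν.measurePreserving_swap (hν.quasiInvariant.koopman s
    (hν.quasiInvariant.koopman γ (conjComp hν.measurePreserving_swap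
      (hν.quasiInvariant.koopman (γ⁻¹ * s⁻¹) (k (γ⁻¹ * s⁻¹)⁻¹))))) = _
  rw [hν.conjComp_koopman (γ⁻¹ * s⁻¹), ← hν.quasiInvariant.koopman_mul γ, mul_inv_cancel_left,
    hν.quasiInvariant.koopman_inv_apply, conjComp_conjComp _ Prod.swap_swap, mul_inv_rev, inv_inv,
    inv_inv]

theorem commute_generators {a b : CrossedL2 Γ μ →L[ℂ] CrossedL2 Γ μ}
    (ha : a ∈ crossedGenerators Γ μ) (hb : b ∈ crossedGenerators Γ μ) :
    Commute (hν.leftRep ⟨a, subset_vonNeumannGenerated _ ha⟩)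
      (hν.isAntiunitaryInvolution_conj.conjBy
        (hν.leftRep ⟨b, subset_vonNeumannGenerated _ hb⟩)) := by
  obtain ⟨f, rfl⟩ | ⟨γ, rfl⟩ := ha
  · change Commute (hν.leftRep (crossedMulElem Γ μ f)) _
    rw [leftRep_crossedMul]
    obtain ⟨g, rfl⟩ | ⟨δ, rfl⟩ := hb
    · change Commute _ (hν.isAntiunitaryInvolution_conj.conjBy
        (hν.leftRep (crossedMulElem Γ μ g)))
      obtain ⟨g', rfl⟩ : ∃ g', g = star g' := ⟨star g, (star_star g).symm⟩
      ext1 k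
      refine lp.ext (funext fun s => ?_)
      rw [mul_apply_eq_comp, mul_apply_eq_comp,
        crossedMul_apply, conjBy_crossedMul_apply, conjBy_crossedMul_apply, crossedMul_apply,
        mulL2_comm]
    · change Commute _ (hν.isAntiunitaryInvolution_conj.conjBy
        (hν.leftRep (crossedUnitaryElem μ δ)))
      ext1 k
      refine lp.ext (funext fun s => ?_)
      rw [mul_apply_eq_comp, mul_apply_eq_comp,
        crossedMul_apply, conjBy_crossedUnitary_apply, conjBy_crossedUnitary_apply,
        crossedMul_apply]
  · change Commute (hν.leftRep (crossedUnitaryElem μ γ)) _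
    rw [leftRep_crossedUnitary]
    obtain ⟨g, rfl⟩ | ⟨δ, rfl⟩ := hb
    · change Commute _ (hν.isAntiunitaryInvolution_conj.conjBy
        (hν.leftRep (crossedMulElem Γ μ g)))
      obtain ⟨g', rfl⟩ : ∃ g', g = star g' := ⟨star g, (star_star g).symm⟩
      ext1 k
      refine lp.ext (funext fun s => ?_)
      rw [mul_apply_eq_comp, mul_apply_eq_comp,
        leftUnitary_apply, conjBy_crossedMul_apply, conjBy_crossedMul_apply, leftUnitary_apply]
      refine hν.quasiInvariant.koopman_mulL2 γ ?_ _
      filter_upwards [hν.coeFn_sndFun s g', (hν.quasiInvariant.quasiMeasurePreserving γ⁻¹).ae_eq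
        (hν.coeFn_sndFun (γ⁻¹ * s) g')] with p h1 h2
      simp only [Function.comp] at h2
      rw [h1, h2]
      simp [← mul_smul]
    · change Commute _ (hν.isAntiunitaryInvolution_conj.conjBy
        (hν.leftRep (crossedUnitaryElem μ δ)))
      ext1 k
      refine lp.ext (funext fun s => ?_)
      rw [mul_apply_eq_comp, mul_apply_eq_comp,
        leftUnitary_apply, conjBy_crossedUnitary_apply, conjBy_crossedUnitary_apply,
        leftUnitary_apply, mul_assoc]

omit hν [IsFiniteMeasure μ] in
theorem star_mem_crossedGenerators {a : CrossedL2 Γ μ →L[ℂ] CrossedL2 Γ μ}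
    (ha : a ∈ crossedGenerators Γ μ) : star a ∈ crossedGenerators Γ μ := by
  obtain ⟨f, rfl⟩ | ⟨γ, rfl⟩ := ha
  · exact Or.inl ⟨star f, (star_crossedMul Γ μ f).symm⟩
  · exact Or.inr ⟨γ⁻¹, (star_crossedUnitary μ γ).symm⟩

theorem commute_leftRep_of_generators {c : CrossedL2 Γ ν →L[ℂ] CrossedL2 Γ ν}
    (hc : ∀ a (ha : a ∈ crossedGenerators Γ μ),
      Commute (hν.leftRep ⟨a, subset_vonNeumannGenerated _ ha⟩) c)
    (x : (crossedProduct Γ μ).toStarSubalgebra) : Commute (hν.leftRep x) c := by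
  refine hν.isIntertwiningFamily.commute_extend (fun a ha => ⟨hc a ha, ?_⟩) x
  have h := hc (star a) (star_mem_crossedGenerators ha)
  have e : star (hν.leftRep ⟨a, subset_vonNeumannGenerated _ ha⟩)
      = hν.leftRep ⟨star a, subset_vonNeumannGenerated _ (star_mem_crossedGenerators ha)⟩ :=
    (map_star hν.leftRep _).symm
  rw [← e] at h
  exact h

/-- Generators commute by the explicit formulas. One variable is extended to the whole algebra, the
conjugation is moved to the other side, and the second variable is extended likewise. -/
theorem commute_leftRep (x y : (crossedProduct Γ μ).toStarSubalgebra) :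
    Commute (hν.leftRep x) (hν.isAntiunitaryInvolution_conj.conjBy (hν.leftRep y)) := by
  rw [← IsAntiunitaryInvolution.commute_conjBy_iff]
  refine (hν.commute_leftRep_of_generators (fun b hb => ?_) y).symm
  refine Commute.symm ?_
  rw [IsAntiunitaryInvolution.commute_conjBy_iff]
  exact hν.commute_leftRep_of_generators (fun a ha => hν.commute_generators ha hb) x

/-- The bimodule of a symmetric quasi-invariant coupling. -/
def bimodule : HilbertBimodule (crossedProduct Γ μ) (CrossedL2 Γ ν) :=
  HilbertBimodule.ofConj hν.leftRep hν.isIntertwiningFamily.isNormalMap_extend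
    hν.isAntiunitaryInvolution_conj hν.commute_leftRep

theorem bimodule_left (x : (crossedProduct Γ μ).toStarSubalgebra) :
    hν.bimodule.left x = hν.leftRep x := rfl

theorem bimodule_right (x : (crossedProduct Γ μ).toStarSubalgebra) :
    hν.bimodule.right (MulOpposite.op x) =
      hν.isAntiunitaryInvolution_conj.conjBy (hν.leftRep (star x)) := rfl

theorem left_crossedMul_apply (f : Lp ℂ ∞ μ) (k : CrossedL2 Γ ν) (s : Γ) :
    hν.bimodule.left (crossedMulElem Γ μ f) k s = mulL2 ν (hν.fstFun f) (k s) := by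
  rw [bimodule_left, leftRep_crossedMul, crossedMul_apply]

theorem right_crossedMul_apply (f : Lp ℂ ∞ μ) (k : CrossedL2 Γ ν) (s : Γ) :
    hν.bimodule.right (MulOpposite.op (crossedMulElem Γ μ f)) k s =
      mulL2 ν (hν.sndFun s f) (k s) := by
  rw [bimodule_right, star_crossedMulElem, conjBy_crossedMul_apply]

theorem left_crossedUnitary_apply (γ : Γ) (k : CrossedL2 Γ ν) (s : Γ) :
    hν.bimodule.left (crossedUnitaryElem μ γ) k s =
      hν.quasiInvariant.koopman γ (k (γ⁻¹ * s)) := by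
  rw [bimodule_left, leftRep_crossedUnitary, leftUnitary_apply]

theorem right_crossedUnitary_apply (γ : Γ) (k : CrossedL2 Γ ν) (s : Γ) :
    hν.bimodule.right (MulOpposite.op (crossedUnitaryElem μ γ)) k s = k (s * γ⁻¹) := by
  rw [bimodule_right, star_crossedUnitaryElem, conjBy_crossedUnitary_apply]

theorem norm_vacuum : ‖crossedVacuum Γ ν‖ = 1 := by
  classical
  rw [crossedVacuum, lp.norm_single (by norm_num)]
  refine (Lp.norm_const' (p := 2) (μ := ν) (c := (1 : ℂ)) (by norm_num) (by norm_num)).trans ?_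
  simp

theorem vacuum_one : crossedVacuum Γ ν 1 = Lp.const 2 ν 1 := by
  classical
  rw [crossedVacuum, lp.single_apply_self]

theorem vacuum_ne {s : Γ} (hs : s ≠ 1) : crossedVacuum Γ ν s = 0 := by
  classical
  rw [crossedVacuum, lp.single_apply_ne _ _ _ hs]

theorem conj_vacuum : hν.conj (crossedVacuum Γ ν) = crossedVacuum Γ ν := by
  refine lp.ext (funext fun s => ?_)
  by_cases hs : s = 1
  · subst hs
    rw [conj_apply, inv_one, hν.quasiInvariant.koopman_one, hν.vacuum_one]
    apply Lp.ext
    have hc := Lp.coeFn_const (p := 2) (μ := ν) (1 : ℂ)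
    filter_upwards [coeFn_conjComp hν.measurePreserving_swap (Lp.const 2 ν (1 : ℂ)), hc,
      hν.measurePreserving_swap.quasiMeasurePreserving.ae_eq hc] with p h1 h2 h3
    simp only [Function.comp] at h3
    rw [h1, h3, h2]
    simp
  · have hs' : s⁻¹ ≠ 1 := by simpa using hs
    rw [conj_apply, hν.vacuum_ne hs, hν.vacuum_ne hs', map_zero]
    have := conjComp_smul hν.measurePreserving_swap 0 0
    simpa using this

theorem intertwiner_vacuum [IsProbabilityMeasure μ] :
    hν.intertwiner (Lp.const ∞ ν 1) (crossedVacuum Γ μ) = crossedVacuum Γ ν := by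
  rw [crossedVacuum, intertwiner_single, crossedVacuum, inv_one, koopman_one,
    hν.quasiInvariant.koopman_one]
  congr 1
  apply Lp.ext
  filter_upwards [hν.coeFn_fstMul (Lp.const ∞ ν 1) (Lp.const 2 μ 1),
    Lp.coeFn_const (p := 2) (μ := ν) (1 : ℂ), Lp.coeFn_const (p := ∞) (μ := ν) (1 : ℂ),
    ae_fst hν.toIsCoupling (Lp.coeFn_const (p := 2) (μ := μ) (1 : ℂ))] with p h1 h2 h3 h4
  rw [h1, h2, h3, h4]
  simp

/-- The intertwiner with `h = 1` carries the vacuum of the standard representation to the vacuum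
here, and `p¹` carries `ν` to `μ`. -/
theorem inner_vacuum_left [IsProbabilityMeasure μ] (x : (crossedProduct Γ μ).toStarSubalgebra) :
    inner ℂ (crossedVacuum Γ ν) (hν.bimodule.left x (crossedVacuum Γ ν)) = crossedTrace Γ μ x := by
  rw [bimodule_left, ← hν.intertwiner_vacuum, leftRep_intertwiner, hν.intertwiner_vacuum,
    crossedTrace]
  classical
  set ζ := (x : CrossedL2 Γ μ →L[ℂ] CrossedL2 Γ μ) (crossedVacuum Γ μ)
  rw [crossedVacuum, lp.inner_single_left, crossedVacuum, lp.inner_single_left, intertwiner_apply,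
    inv_one, koopman_one, hν.quasiInvariant.koopman_one, L2.inner_def, L2.inner_def]
  have key : ∀ F : X → ℂ, AEStronglyMeasurable F μ → ∫ x, F x ∂μ = ∫ p, F p.1 ∂ν := by
    intro F hF
    have := integral_map (μ := ν) measurable_fst.aemeasurable (f := F) (by rwa [hν.map_fst])
    rwa [hν.map_fst] at this
  rw [key]
  · refine integral_congr_ae ?_
    filter_upwards [hν.coeFn_fstMul (Lp.const ∞ ν 1) (ζ 1),
      Lp.coeFn_const (p := 2) (μ := ν) (1 : ℂ), Lp.coeFn_const (p := ∞) (μ := ν) (1 : ℂ),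
      ae_fst hν.toIsCoupling (Lp.coeFn_const (p := 2) (μ := μ) (1 : ℂ))] with p h1 h2 h3 h4
    rw [h1, h2, h3, h4]
    simp
  · exact (Lp.aestronglyMeasurable _).inner (Lp.aestronglyMeasurable _)

/-- The antiunitary involution fixes the vacuum, so the right state agrees with the left one. -/
theorem inner_vacuum_right [IsProbabilityMeasure μ] (x : (crossedProduct Γ μ).toStarSubalgebra) :
    inner ℂ (crossedVacuum Γ ν)
      (hν.bimodule.right (MulOpposite.op x) (crossedVacuum Γ ν)) = crossedTrace Γ μ x := by
  rw [← hν.inner_vacuum_left, bimodule_right, bimodule_left, IsAntiunitaryInvolution.conjBy_apply,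
    hν.isAntiunitaryInvolution_conj.inner_right, hν.conj_vacuum, map_star,
    ContinuousLinearMap.star_eq_adjoint, ContinuousLinearMap.adjoint_inner_left]

/-- The commutator is concentrated over `e`, where it is the function `f(x) - f(y)`. Condition (i)
thus means asymptotic commutation with `L^∞`. -/
theorem norm_left_sub_right_crossedMul (f : Lp ℂ ∞ μ) :
    ‖hν.bimodule.left (crossedMulElem Γ μ f) (crossedVacuum Γ ν) -
      hν.bimodule.right (MulOpposite.op (crossedMulElem Γ μ f)) (crossedVacuum Γ ν)‖ ^ 2
      = ∫ p, ‖f p.1 - f p.2‖ ^ 2 ∂ν := by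
  classical
  set g : Lp ℂ 2 ν := mulL2 ν (hν.fstFun f) (Lp.const 2 ν 1) -
    mulL2 ν (hν.sndFun (1 : Γ) f) (Lp.const 2 ν 1) with hg
  have h1 : hν.bimodule.left (crossedMulElem Γ μ f) (crossedVacuum Γ ν) -
      hν.bimodule.right (MulOpposite.op (crossedMulElem Γ μ f)) (crossedVacuum Γ ν)
      = lp.single 2 1 g := by
    refine lp.ext (funext fun s => ?_)
    rw [lp.coeFn_sub, Pi.sub_apply, left_crossedMul_apply, right_crossedMul_apply]
    by_cases hs : s = 1
    · subst hs
      rw [lp.single_apply_self, hν.vacuum_one]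
    · rw [lp.single_apply_ne _ _ _ hs, hν.vacuum_ne hs, map_zero, map_zero, sub_zero]
  rw [h1, lp.norm_single (by norm_num), ← Complex.ofReal_inj, ← integral_complex_ofReal,
    Complex.ofReal_pow]
  refine Eq.trans (inner_self_eq_norm_sq_to_K (𝕜 := ℂ) g).symm ?_
  rw [L2.inner_def]
  refine integral_congr_ae ?_
  filter_upwards [Lp.coeFn_sub (mulL2 ν (hν.fstFun f) (Lp.const 2 ν 1))
    (mulL2 ν (hν.sndFun (1 : Γ) f) (Lp.const 2 ν 1)), coeFn_mulL2 ν (hν.fstFun f) (Lp.const 2 ν 1),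
    coeFn_mulL2 ν (hν.sndFun (1 : Γ) f) (Lp.const 2 ν 1), hν.coeFn_fstFun f,
    hν.coeFn_sndFun (1 : Γ) f, Lp.coeFn_const (p := 2) (μ := ν) (1 : ℂ)] with p e1 e2 e3 e4 e5 e6
  rw [hg, e1, Pi.sub_apply, e2, e3, e4, e5, e6, inner_self_eq_norm_sq_to_K]
  simp

/-- The commutator is concentrated over `γ`, where it is `σ_γ 1 - 1`. Condition (ii) thus gives
asymptotic commutation with the unitaries. -/
theorem norm_left_sub_right_crossedUnitary (γ : Γ) {δ : ℝ}
    (hδ : TVLe (ν.map fun p => γ • p) ν δ) :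
    ‖hν.bimodule.left (crossedUnitaryElem μ γ) (crossedVacuum Γ ν) -
      hν.bimodule.right (MulOpposite.op (crossedUnitaryElem μ γ)) (crossedVacuum Γ ν)‖ ^ 2
      ≤ δ := by
  classical
  have h1 : hν.bimodule.left (crossedUnitaryElem μ γ) (crossedVacuum Γ ν) -
      hν.bimodule.right (MulOpposite.op (crossedUnitaryElem μ γ)) (crossedVacuum Γ ν)
      = lp.single 2 γ (hν.quasiInvariant.koopman γ (Lp.const 2 ν 1) - Lp.const 2 ν 1) := by
    refine lp.ext (funext fun s => ?_)
    rw [lp.coeFn_sub, Pi.sub_apply, left_crossedUnitary_apply, right_crossedUnitary_apply]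
    by_cases hs : s = γ
    · subst hs
      rw [lp.single_apply_self, inv_mul_cancel, mul_inv_cancel, hν.vacuum_one]
    · rw [lp.single_apply_ne _ _ _ hs, hν.vacuum_ne, hν.vacuum_ne, map_zero, sub_zero]
      · rwa [Ne, mul_inv_eq_one]
      · rwa [Ne, inv_mul_eq_one, eq_comm]
  rw [h1, lp.norm_single (by norm_num)]
  exact hν.quasiInvariant.integral_koopman_one_sub_one γ hδ

/-- A vector commuting with `L^∞(X, μ)` and close to the vacuum forces `ν` to charge the
diagonal. -/
theorem measureReal_compl_diagonal_le [StandardBorelSpace X] {η : CrossedL2 Γ ν}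
    (hη : ∀ f : Lp ℂ ∞ μ, hν.bimodule.left (crossedMulElem Γ μ f) η =
      hν.bimodule.right (MulOpposite.op (crossedMulElem Γ μ f)) η) :
    ν.real (Set.diagonal X)ᶜ ≤ ‖η - crossedVacuum Γ ν‖ ^ 2 := by
  have hD : MeasurableSet (Set.diagonal X)ᶜ := measurableSet_diagonal.compl
  have htm : Measurable fun x : X => (realCoord X x : ℂ) :=
    Complex.measurable_ofReal.comp measurable_realCoord
  have ht : MemLp (fun x : X => (realCoord X x : ℂ)) ∞ μ :=
    MemLp.of_bound htm.aestronglyMeasurable 1 (Eventually.of_forall fun x => by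
      have := realCoord_mem x
      rw [Complex.norm_real, Real.norm_eq_abs, abs_le]
      constructor <;> linarith [this.1, this.2])
  have h1 := congrArg (fun k : CrossedL2 Γ ν => k 1) (hη (ht.toLp _))
  simp only [left_crossedMul_apply, right_crossedMul_apply] at h1
  -- Centrality against the coordinate `t` gives `(t(x) - t(y)) η(e) = 0`, and `t` is injective.
  have h2 : ∀ᵐ p ∂ν, p ∉ Set.diagonal X → η 1 p = 0 := by
    have e := coeFn_mulL2 ν (hν.fstFun (ht.toLp _)) (η 1)
    rw [h1] at e
    filter_upwards [e, coeFn_mulL2 ν (hν.sndFun (1 : Γ) (ht.toLp _)) (η 1),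
      hν.coeFn_fstFun (ht.toLp _), hν.coeFn_sndFun (1 : Γ) (ht.toLp _),
      ae_fst hν.toIsCoupling ht.coeFn_toLp, ae_snd hν.toIsCoupling ht.coeFn_toLp]
      with p e1 e2 e3 e4 e5 e6 hp
    rw [e1, e3, e4, e5, inv_one, one_smul, e6, ← sub_eq_zero, ← sub_mul, mul_eq_zero] at e2
    refine e2.resolve_left fun h => hp ?_
    rw [sub_eq_zero, Complex.ofReal_inj] at h
    exact measurableEmbedding_realCoord.injective h
  have h3 : ‖η 1 - Lp.const 2 ν 1‖ ≤ ‖η - crossedVacuum Γ ν‖ := by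
    have := lp.norm_apply_le_norm (p := 2) (by norm_num) (η - crossedVacuum Γ ν) 1
    rwa [lp.coeFn_sub, Pi.sub_apply, hν.vacuum_one] at this
  refine le_trans ?_ (pow_le_pow_left₀ (norm_nonneg _) h3 2)
  have h4 : ‖η 1 - Lp.const 2 ν 1‖ ^ 2 = ∫ p, ‖(η 1 - Lp.const 2 ν 1 : Lp ℂ 2 ν) p‖ ^ 2 ∂ν := by
    rw [integral_norm_sq_eq_eLpNorm (Lp.memLp _), Lp.norm_def]
  rw [h4, ← integral_indicator_one hD]
  refine integral_mono_of_nonneg (Eventually.of_forall fun p => Set.indicator_nonneg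
    (fun _ _ => zero_le_one) _) (Lp.memLp _).integrable_norm_pow' ?_
  filter_upwards [h2, Lp.coeFn_sub (η 1) (Lp.const 2 ν (1 : ℂ)),
    Lp.coeFn_const (p := 2) (μ := ν) (1 : ℂ)] with p e1 e2 e3
  by_cases hp : p ∈ Set.diagonal X
  · rw [Set.indicator_of_notMem (by simpa using hp)]
    positivity
  · rw [Set.indicator_of_mem (by simpa using hp), e2, Pi.sub_apply, e1 hp, e3]
    simp

end IsBimoduleCoupling

end CouplingBimodule

/-! ### Tracial vectors in bimodules -/

section BimoduleCommutator

variable {H : Type u} [NormedAddCommGroup H] [InnerProductSpace ℂ H] [CompleteSpace H]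
  {M : VonNeumannAlgebra H} {K : Type w} [NormedAddCommGroup K] [InnerProductSpace ℂ K]
  [CompleteSpace K]

theorem HilbertBimodule.left_right_comm (β : HilbertBimodule M K)
    (x y : M.toStarSubalgebra) (ξ : K) :
    β.left x (β.right (MulOpposite.op y) ξ) = β.right (MulOpposite.op y) (β.left x ξ) :=
  DFunLike.congr_fun (β.commute x (MulOpposite.op y)).eq ξ

theorem HilbertBimodule.right_op_mul (β : HilbertBimodule M K)
    (x y : M.toStarSubalgebra) (ξ : K) :
    β.right (MulOpposite.op (x * y)) ξ =
      β.right (MulOpposite.op y) (β.right (MulOpposite.op x) ξ) := by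
  rw [MulOpposite.op_mul, map_mul]
  rfl

theorem HilbertBimodule.left_mul (β : HilbertBimodule M K)
    (x y : M.toStarSubalgebra) (ξ : K) :
    β.left (x * y) ξ = β.left x (β.left y ξ) := by
  rw [map_mul]
  rfl

/-- The commutator `x ξ - ξ x`, as a linear function of `x`. -/
def HilbertBimodule.commutator (β : HilbertBimodule M K) (ξ : K) :
    M.toStarSubalgebra →ₗ[ℂ] K where
  toFun x := β.left x ξ - β.right (MulOpposite.op x) ξ
  map_add' x y := by
    rw [MulOpposite.op_add, map_add, map_add, add_apply, add_apply]
    abel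
  map_smul' c x := by
    change β.left (c • x) ξ - β.right (c • MulOpposite.op x) ξ = _
    rw [map_smul, map_smul, smul_apply, smul_apply, RingHom.id_apply, smul_sub]

theorem HilbertBimodule.commutator_apply (β : HilbertBimodule M K) (ξ : K)
    (x : M.toStarSubalgebra) :
    β.commutator ξ x = β.left x ξ - β.right (MulOpposite.op x) ξ := rfl

theorem HilbertBimodule.commutator_mul (β : HilbertBimodule M K) (ξ : K)
    (x y : M.toStarSubalgebra) :
    β.commutator ξ (x * y) = β.left x (β.commutator ξ y) +
      β.right (MulOpposite.op y) (β.commutator ξ x) := by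
  simp only [commutator_apply, left_mul, right_op_mul, map_sub]
  rw [left_right_comm]
  abel

/-- Moving `a` across the inner product and using `a* ξ = ξ a*` turns the two terms into the left
and the right vector states at `a* x`, which agree by hypothesis. -/
theorem HilbertBimodule.inner_left_commutator (β : HilbertBimodule M K) {ξ : K}
    (hξ : ∀ x, inner ℂ ξ (β.left x ξ) = inner ℂ ξ (β.right (MulOpposite.op x) ξ))
    {a : M.toStarSubalgebra} (ha : β.commutator ξ (star a) = 0) (x : M.toStarSubalgebra) :
    inner ℂ (β.left a ξ) (β.commutator ξ x) = 0 := by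
  have ha' : β.left (star a) ξ = β.right (MulOpposite.op (star a)) ξ := sub_eq_zero.1 ha
  have e : ∀ z, inner ℂ (β.left a ξ) z = inner ℂ ξ (β.left (star a) z) := fun z => by
    rw [map_star, ContinuousLinearMap.star_eq_adjoint, ContinuousLinearMap.adjoint_inner_right]
  rw [e, β.commutator_apply, map_sub, inner_sub_right, β.left_right_comm, ha', ← β.right_op_mul,
    ← β.left_mul, hξ, sub_self]

/-- If `x ξ` is orthogonal to the commutator `x ξ - ξ x`, then `‖x ξ‖ ≤ ‖ξ x‖`. -/
theorem HilbertBimodule.norm_left_le_norm_right (β : HilbertBimodule M K) {ξ : K}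
    {x : M.toStarSubalgebra} (h : inner ℂ (β.left x ξ) (β.commutator ξ x) = 0) :
    ‖β.left x ξ‖ ≤ ‖β.right (MulOpposite.op x) ξ‖ := by
  rw [β.commutator_apply, inner_sub_right, sub_eq_zero, inner_self_eq_norm_sq_to_K] at h
  have h3 : ‖β.left x ξ‖ ^ 2 ≤ ‖β.left x ξ‖ * ‖β.right (MulOpposite.op x) ξ‖ := by
    have h4 := norm_inner_le_norm (𝕜 := ℂ) (β.left x ξ) (β.right (MulOpposite.op x) ξ)
    rw [← h] at h4
    simpa using h4
  rcases eq_or_lt_of_le (norm_nonneg (β.left x ξ)) with h5 | h5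
  · rw [← h5]; exact norm_nonneg _
  · rw [sq] at h3
    exact le_of_mul_le_mul_left h3 h5

/-- The elements whose adjoint commutes with `ξ`. -/
def HilbertBimodule.starCommutant (β : HilbertBimodule M K) (ξ : K) :
    Submodule ℂ M.toStarSubalgebra where
  carrier := {a | β.commutator ξ (star a) = 0}
  add_mem' {a b} ha hb := by
    change β.commutator ξ (star (a + b)) = 0
    rw [star_add, map_add, show β.commutator ξ (star a) = 0 from ha,
      show β.commutator ξ (star b) = 0 from hb, add_zero]
  zero_mem' := by
    change β.commutator ξ (star 0) = 0
    rw [star_zero, map_zero]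
  smul_mem' c a ha := by
    change β.commutator ξ (star (c • a)) = 0
    rw [star_smul, map_smul, show β.commutator ξ (star a) = 0 from ha, smul_zero]

theorem HilbertBimodule.norm_left_le_norm_right_of_approx (β : HilbertBimodule M K) {ξ : K}
    (hξ : ∀ x, inner ℂ ξ (β.left x ξ) = inner ℂ ξ (β.right (MulOpposite.op x) ξ))
    {x : M.toStarSubalgebra}
    (h : ∀ ε : ℝ, 0 < ε → ∃ a ∈ β.starCommutant ξ, ‖β.left (x - a) ξ‖ < ε) :
    ‖β.left x ξ‖ ≤ ‖β.right (MulOpposite.op x) ξ‖ := by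
  refine β.norm_left_le_norm_right ?_
  set d := β.commutator ξ x
  rw [← norm_le_zero_iff]
  refine le_of_forall_pos_le_add fun ε hε => ?_
  obtain ⟨a, ha, hlt⟩ := h (ε / (‖d‖ + 1)) (by positivity)
  rw [map_sub, sub_apply] at hlt
  have : inner ℂ (β.left x ξ) d = inner ℂ (β.left x ξ - β.left a ξ) d := by
    rw [inner_sub_left, β.inner_left_commutator hξ ha x, sub_zero]
  rw [this, zero_add]
  refine (norm_inner_le_norm _ _).trans ?_
  calc _ ≤ ε / (‖d‖ + 1) * ‖d‖ := by gcongr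
    _ ≤ ε / (‖d‖ + 1) * (‖d‖ + 1) := by gcongr; linarith
    _ = ε := by field_simp

instance isClosed_vonNeumannAlgebra (M : VonNeumannAlgebra H) :
    IsClosed (M.toStarSubalgebra : Set (H →L[ℂ] H)) := by
  have h := M.centralizer_centralizer'
  change Set.centralizer (Set.centralizer (M.toStarSubalgebra : Set (H →L[ℂ] H))) =
    (M.toStarSubalgebra : Set (H →L[ℂ] H)) at h
  rw [← h]
  exact Set.isClosed_centralizer _

theorem HilbertBimodule.norm_left_le (β : HilbertBimodule M K) (x : M.toStarSubalgebra) (ξ : K) :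
    ‖β.left x ξ‖ ≤ ‖(x : H →L[ℂ] H)‖ * ‖ξ‖ := by
  refine ((β.left x).le_opNorm ξ).trans ?_
  gcongr
  exact NonUnitalStarAlgHom.norm_apply_le β.left x

theorem HilbertBimodule.norm_right_le (β : HilbertBimodule M K) (x : M.toStarSubalgebra) (ξ : K) :
    ‖β.right (MulOpposite.op x) ξ‖ ≤ ‖(x : H →L[ℂ] H)‖ * ‖ξ‖ := by
  refine ((β.right (MulOpposite.op x)).le_opNorm ξ).trans ?_
  gcongr
  exact NonUnitalStarAlgHom.norm_apply_le β.right (MulOpposite.op x)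

end BimoduleCommutator

/-! ### Tracial vectors over the crossed product -/

section TracialVectors

variable {X : Type u} [MeasurableSpace X] {Γ : Type v} [Group Γ] [MulAction Γ X]
  [MeasurableConstSMul Γ X] {μ : Measure X} [IsProbabilityMeasure μ] [SMulInvariantMeasure Γ X μ]

open Classical in
theorem crossedMulElem_mul_crossedUnitaryElem_vacuum (f : Lp ℂ ∞ μ) (γ : Γ) :
    ((crossedMulElem Γ μ f * crossedUnitaryElem μ γ : (crossedProduct Γ μ).toStarSubalgebra) :
      CrossedL2 Γ μ →L[ℂ] CrossedL2 Γ μ) (crossedVacuum Γ μ) =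
      lp.single 2 γ (mulL2 μ f (Lp.const 2 μ 1)) := by
  change crossedMul Γ μ f (crossedUnitary μ γ (crossedVacuum Γ μ)) = _
  refine lp.ext (funext fun s => ?_)
  rw [crossedMul_apply, crossedUnitary_apply, crossedVacuum]
  by_cases hs : s = γ
  · subst hs
    rw [inv_mul_cancel, lp.single_apply_self, lp.single_apply_self]
    refine congrArg (mulL2 μ f) (Lp.ext ?_)
    have hc := Lp.coeFn_const (p := 2) (μ := μ) (1 : ℂ)
    filter_upwards [coeFn_koopman μ s (Lp.const 2 μ (1 : ℂ)), hc,
      (measurePreserving_smul s⁻¹ μ).quasiMeasurePreserving.ae_eq hc] with x h1 h2 h3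
    simp only [Function.comp] at h3
    rw [h1, h2, h3]
    rfl
  · rw [lp.single_apply_ne _ _ _ hs, lp.single_apply_ne, map_zero, map_zero]
    rwa [Ne, inv_mul_eq_one, eq_comm]

/-- A subspace of the crossed product containing all `L_f u_γ` is dense for the norm `‖x Ω‖`. -/
theorem exists_norm_sub_vacuum_lt (P : Submodule ℂ (crossedProduct Γ μ).toStarSubalgebra)
    (hP : ∀ f γ, crossedMulElem Γ μ f * crossedUnitaryElem μ γ ∈ P)
    (x : (crossedProduct Γ μ).toStarSubalgebra) {ε : ℝ} (hε : 0 < ε) :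
    ∃ a ∈ P, ‖((x - a : (crossedProduct Γ μ).toStarSubalgebra) :
      CrossedL2 Γ μ →L[ℂ] CrossedL2 Γ μ) (crossedVacuum Γ μ)‖ < ε := by
  classical
  let ev : (crossedProduct Γ μ).toStarSubalgebra →ₗ[ℂ] CrossedL2 Γ μ :=
    { toFun := fun a => (a : CrossedL2 Γ μ →L[ℂ] CrossedL2 Γ μ) (crossedVacuum Γ μ)
      map_add' := fun _ _ => rfl
      map_smul' := fun _ _ => rfl }
  have htop : (P.map ev).topologicalClosure = ⊤ := by
    refine lp_submodule_eq_top (Submodule.isClosed_topologicalClosure _) fun s a => ?_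
    let φ : Lp ℂ 2 μ →L[ℂ] CrossedL2 Γ μ :=
      lp.singleContinuousLinearMap ℂ (fun _ : Γ => Lp ℂ 2 μ) 2 s
    have h2 : (P.map ev).topologicalClosure.comap φ.toLinearMap = ⊤ := by
      refine L2_submodule_eq_top
        ((Submodule.isClosed_topologicalClosure _).preimage φ.continuous) fun A hA => ?_
      refine Submodule.le_topologicalClosure _ ⟨_, hP (indicatorConstLp ∞ hA
        (measure_ne_top μ A) (1 : ℂ)) s, ?_⟩
      change ((crossedMulElem Γ μ _ * crossedUnitaryElem μ s :
        (crossedProduct Γ μ).toStarSubalgebra) :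
        CrossedL2 Γ μ →L[ℂ] CrossedL2 Γ μ) (crossedVacuum Γ μ) = _
      rw [crossedMulElem_mul_crossedUnitaryElem_vacuum, mulL2_const_one]
      rfl
    have h3 : a ∈ (P.map ev).topologicalClosure.comap φ.toLinearMap := h2 ▸ Submodule.mem_top
    exact h3
  have h1 : ev x ∈ (P.map ev).topologicalClosure := htop ▸ Submodule.mem_top
  obtain ⟨_, ⟨a, ha, rfl⟩, hd⟩ := Metric.mem_closure_iff.1 h1 ε hε
  refine ⟨a, ha, ?_⟩
  rw [dist_eq_norm, ← map_sub] at hd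
  exact hd

section Bimodule

variable {K : Type w} [NormedAddCommGroup K] [InnerProductSpace ℂ K] [CompleteSpace K]

/-- Both vector states of `ξ` on the crossed product equal the trace. -/
def IsTracialVector (β : HilbertBimodule (crossedProduct Γ μ) K) (ξ : K) : Prop :=
  ∀ x, inner ℂ ξ (β.left x ξ) = crossedTrace Γ μ x ∧
    inner ℂ ξ (β.right (MulOpposite.op x) ξ) = crossedTrace Γ μ x

variable {β : HilbertBimodule (crossedProduct Γ μ) K} {ξ : K}

theorem crossedTrace_star_mul_self (x : (crossedProduct Γ μ).toStarSubalgebra) :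
    crossedTrace Γ μ (star x * x) =
      ((‖(x : CrossedL2 Γ μ →L[ℂ] CrossedL2 Γ μ) (crossedVacuum Γ μ)‖ ^ 2 : ℝ) : ℂ) := by
  change inner ℂ (crossedVacuum Γ μ) (star (x : CrossedL2 Γ μ →L[ℂ] CrossedL2 Γ μ)
    ((x : CrossedL2 Γ μ →L[ℂ] CrossedL2 Γ μ) (crossedVacuum Γ μ))) = _
  rw [ContinuousLinearMap.star_eq_adjoint, ContinuousLinearMap.adjoint_inner_right,
    inner_self_eq_norm_sq_to_K]
  push_cast
  rfl

namespace IsTracialVector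

variable (hξ : IsTracialVector β ξ)
include hξ

theorem norm_left (x : (crossedProduct Γ μ).toStarSubalgebra) : ‖β.left x ξ‖ =
    ‖(x : CrossedL2 Γ μ →L[ℂ] CrossedL2 Γ μ) (crossedVacuum Γ μ)‖ := by
  have h := (hξ (star x * x)).1
  rw [crossedTrace_star_mul_self, map_mul, map_star, mul_apply_eq_comp,
    ContinuousLinearMap.star_eq_adjoint, ContinuousLinearMap.adjoint_inner_right,
    inner_self_eq_norm_sq_to_K] at h
  refine (pow_left_inj₀ (norm_nonneg _) (norm_nonneg _) two_ne_zero).1 ?_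
  apply Complex.ofReal_injective
  rw [← h]
  push_cast
  rfl

theorem norm_right (x : (crossedProduct Γ μ).toStarSubalgebra) :
    ‖β.right (MulOpposite.op x) ξ‖ =
    ‖((star x : (crossedProduct Γ μ).toStarSubalgebra) :
      CrossedL2 Γ μ →L[ℂ] CrossedL2 Γ μ) (crossedVacuum Γ μ)‖ := by
  have h := (hξ (star (star x) * star x)).2
  rw [crossedTrace_star_mul_self, MulOpposite.op_mul, map_mul, star_star, MulOpposite.op_star,
    map_star, mul_apply_eq_comp,
    ContinuousLinearMap.star_eq_adjoint, ContinuousLinearMap.adjoint_inner_right,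
    inner_self_eq_norm_sq_to_K] at h
  refine (pow_left_inj₀ (norm_nonneg _) (norm_nonneg _) two_ne_zero).1 ?_
  apply Complex.ofReal_injective
  rw [← h]
  push_cast
  rfl

end IsTracialVector

/-- If some bimodule has a tracial vector which commutes with the generators, then
`‖x Ω‖ ≤ ‖x* Ω‖`. -/
theorem IsTracialVector.norm_left_le_norm_right (hξ : IsTracialVector β ξ)
    (h1 : ∀ f, β.commutator ξ (crossedMulElem Γ μ f) = 0)
    (h2 : ∀ γ, β.commutator ξ (crossedUnitaryElem μ γ) = 0)
    (x : (crossedProduct Γ μ).toStarSubalgebra) :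
    ‖β.left x ξ‖ ≤ ‖β.right (MulOpposite.op x) ξ‖ := by
  refine β.norm_left_le_norm_right_of_approx (fun y => (hξ y).1.trans (hξ y).2.symm)
    fun ε hε => ?_
  have hP : ∀ f γ, crossedMulElem Γ μ f * crossedUnitaryElem μ γ ∈ β.starCommutant ξ := by
    intro f γ
    change β.commutator ξ (star _) = 0
    rw [star_mul, star_crossedMulElem, star_crossedUnitaryElem, β.commutator_mul, h1, h2, map_zero,
      map_zero, add_zero]
  obtain ⟨a, ha, hlt⟩ := exists_norm_sub_vacuum_lt (β.starCommutant ξ) hP x hε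
  refine ⟨a, ha, ?_⟩
  rw [hξ.norm_left]
  exact hlt

end Bimodule

theorem IsBimoduleCoupling.isTracialVector {ν : Measure (X × X)} [IsProbabilityMeasure ν]
    (hν : IsBimoduleCoupling Γ μ ν) : IsTracialVector hν.bimodule (crossedVacuum Γ ν) :=
  fun x => ⟨hν.inner_vacuum_left x, hν.inner_vacuum_right x⟩

/-- The vacuum vector is tracial: `‖x* Ω‖ = ‖x Ω‖`. -/
theorem norm_star_vacuum (x : (crossedProduct Γ μ).toStarSubalgebra) :
    ‖((star x : (crossedProduct Γ μ).toStarSubalgebra) :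
      CrossedL2 Γ μ →L[ℂ] CrossedL2 Γ μ) (crossedVacuum Γ μ)‖ =
    ‖(x : CrossedL2 Γ μ →L[ℂ] CrossedL2 Γ μ) (crossedVacuum Γ μ)‖ := by
  have hd : Measurable fun x : X => (x, x) := measurable_id.prodMk measurable_id
  -- For the diagonal coupling the vacuum of the bimodule commutes exactly with the generators. Then
  -- `x ξ` is orthogonal to `x ξ - ξ x`, so `‖x Ω‖ = ‖x ξ‖ ≤ ‖ξ x‖ = ‖x* Ω‖`; applied to `x` and to
  -- `x*`, this gives traciality of the vacuum.
  set ν : Measure (X × X) := μ.map fun x => (x, x) with hνdef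
  have hP : IsProbabilityMeasure ν := Measure.isProbabilityMeasure_map hd.aemeasurable
  have hinv : ∀ γ : Γ, ν.map (fun p => γ • p) = ν := by
    intro γ
    rw [hνdef, Measure.map_map (measurable_const_smul γ) hd]
    conv_rhs => rw [← (measurePreserving_smul γ μ).map_eq,
      Measure.map_map hd (measurable_const_smul γ)]
    rfl
  have hν : IsBimoduleCoupling Γ μ ν :=
    { isProbabilityMeasure := hP
      map_fst := by
        rw [hνdef, Measure.map_map measurable_fst hd]; exact Measure.map_id
      map_snd := by
        rw [hνdef, Measure.map_map measurable_snd hd]; exact Measure.map_id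
      quasiInvariant := fun γ => by rw [hinv]
      measurePreserving_swap := ⟨measurable_swap, by
        rw [hνdef, Measure.map_map measurable_swap hd]; rfl⟩ }
  have hξ := hν.isTracialVector
  have h1 : ∀ f, hν.bimodule.commutator (crossedVacuum Γ ν) (crossedMulElem Γ μ f) = 0 := by
    intro f
    have h := hν.norm_left_sub_right_crossedMul f
    have hI : ∫ p, ‖f p.1 - f p.2‖ ^ 2 ∂ν = ∫ x, ‖f x - f x‖ ^ 2 ∂μ :=
      integral_map hd.aemeasurable ?_
    · rw [hI] at h
      rw [HilbertBimodule.commutator_apply, ← norm_eq_zero, ← sq_eq_zero_iff, h]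
      simp
    · have hm : AEStronglyMeasurable f μ := Lp.aestronglyMeasurable f
      exact (((hm.comp_measurePreserving hν.measurePreserving_fst).sub
        (hm.comp_measurePreserving hν.measurePreserving_snd)).norm.pow 2)
  have h2 : ∀ γ, hν.bimodule.commutator (crossedVacuum Γ ν) (crossedUnitaryElem μ γ) = 0 := by
    intro γ
    have h := hν.norm_left_sub_right_crossedUnitary γ (δ := 0) (by
      rw [hinv]; exact TVLe.refl ν)
    rw [HilbertBimodule.commutator_apply, ← norm_eq_zero, ← sq_eq_zero_iff]
    exact le_antisymm h (sq_nonneg _)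
  have key : ∀ y : (crossedProduct Γ μ).toStarSubalgebra,
      ‖(y : CrossedL2 Γ μ →L[ℂ] CrossedL2 Γ μ) (crossedVacuum Γ μ)‖ ≤
      ‖((star y : (crossedProduct Γ μ).toStarSubalgebra) :
      CrossedL2 Γ μ →L[ℂ] CrossedL2 Γ μ) (crossedVacuum Γ μ)‖ := by
    intro y
    rw [← hξ.norm_left, ← hξ.norm_right]
    exact hξ.norm_left_le_norm_right h1 h2 y
  refine le_antisymm ?_ (key x)
  have := key (star x)
  rwa [star_star] at this

/-- Tracial vectors which asymptotically commute with the generators asymptotically commute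
with the whole crossed product. -/
theorem tendsto_commutator {K : ℕ → Type w} [∀ n, NormedAddCommGroup (K n)]
    [∀ n, InnerProductSpace ℂ (K n)] [∀ n, CompleteSpace (K n)]
    {β : ∀ n, HilbertBimodule (crossedProduct Γ μ) (K n)} {ξ : ∀ n, K n}
    (hξ : ∀ n, IsTracialVector (β n) (ξ n))
    (h1 : ∀ f, Tendsto (fun n => ‖(β n).commutator (ξ n) (crossedMulElem Γ μ f)‖) atTop (𝓝 0))
    (h2 : ∀ γ, Tendsto (fun n => ‖(β n).commutator (ξ n) (crossedUnitaryElem μ γ)‖) atTop (𝓝 0))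
    (x : (crossedProduct Γ μ).toStarSubalgebra) :
    Tendsto (fun n => ‖(β n).commutator (ξ n) x‖) atTop (𝓝 0) := by
  let P : Submodule ℂ (crossedProduct Γ μ).toStarSubalgebra :=
    { carrier := {a | Tendsto (fun n => ‖(β n).commutator (ξ n) a‖) atTop (𝓝 0)}
      add_mem' := fun {a b} ha hb => by
        have h := Tendsto.add (show Tendsto _ _ _ from ha) (show Tendsto _ _ _ from hb)
        rw [add_zero] at h
        refine squeeze_zero (fun _ => norm_nonneg _) (fun n => ?_) h
        rw [map_add]
        exact norm_add_le _ _
      zero_mem' := by simp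
      smul_mem' := fun c a ha => by
        have h := Tendsto.const_mul ‖c‖ (show Tendsto _ _ _ from ha)
        rw [mul_zero] at h
        change Tendsto _ _ _
        simpa only [map_smul, norm_smul] using h }
  have hP : ∀ f γ, crossedMulElem Γ μ f * crossedUnitaryElem μ γ ∈ P := by
    intro f γ
    have h := ((h2 γ).const_mul ‖crossedMul Γ μ f‖).add ((h1 f).const_mul ‖crossedUnitary μ γ‖)
    rw [mul_zero, mul_zero, add_zero] at h
    refine squeeze_zero (fun _ => norm_nonneg _) (fun n => ?_) h
    rw [(β n).commutator_mul]
    refine (norm_add_le _ _).trans (add_le_add ((β n).norm_left_le _ _) ?_)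
    exact (β n).norm_right_le _ _
  rw [Metric.tendsto_nhds]
  intro ε hε
  obtain ⟨a, ha, hlt⟩ := exists_norm_sub_vacuum_lt P hP x (ε := ε / 3) (by positivity)
  filter_upwards [(Metric.tendsto_nhds.1 (show Tendsto _ _ _ from ha)) (ε / 3) (by positivity)]
    with n hn
  rw [Real.dist_eq, sub_zero, abs_norm] at hn ⊢
  have e : (β n).commutator (ξ n) x = (β n).commutator (ξ n) (x - a) +
      (β n).commutator (ξ n) a := by rw [← map_add, sub_add_cancel]
  -- The approximation controls only `‖(x - a) Ω‖`, whereas the right action sees `‖(x - a)* Ω‖`;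
  -- traciality of the vacuum identifies the two.
  have h3 : ‖(β n).commutator (ξ n) (x - a)‖ ≤ ε / 3 + ε / 3 := by
    rw [HilbertBimodule.commutator_apply]
    refine (norm_sub_le _ _).trans ?_
    rw [(hξ n).norm_left, (hξ n).norm_right, norm_star_vacuum]
    exact add_le_add hlt.le hlt.le
  rw [e]
  refine (norm_add_le _ _).trans_lt ?_
  linarith

end TracialVectors

/-! ### Averaging measures -/

section Averaging

variable {Γ : Type v} [Group Γ]

theorem exists_pos_hasSum_one (Γ : Type v) [Nonempty Γ] [Countable Γ] :
    ∃ a : Γ → NNReal, (∀ γ, 0 < a γ) ∧ HasSum a 1 := by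
  obtain ⟨b, hb, c, hc, -⟩ := NNReal.exists_pos_sum_of_countable one_ne_zero Γ
  have hc0 : c ≠ 0 := by
    rintro rfl
    obtain ⟨γ⟩ := ‹Nonempty Γ›
    have := (hasSum_zero_iff.1 hc)
    exact (hb γ).ne' (this γ)
  refine ⟨fun γ => c⁻¹ * b γ, fun γ => mul_pos (inv_pos.2 (pos_iff_ne_zero.2 hc0)) (hb γ), ?_⟩
  simpa [inv_mul_cancel₀ hc0] using hc.mul_left c⁻¹

/-- The average of the translates of a measure, with weights `a`. -/
def groupAverage {Y : Type u} [MeasurableSpace Y] [MulAction Γ Y] (a : Γ → NNReal)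
    (ν : Measure Y) : Measure Y :=
  Measure.sum fun γ => (a γ : ℝ≥0∞) • ν.map (fun y => γ • y)

variable {Y : Type u} [MeasurableSpace Y] [MulAction Γ Y] [MeasurableConstSMul Γ Y]
  {a : Γ → NNReal} {ν : Measure Y}

theorem groupAverage_apply {s : Set Y} (hs : MeasurableSet s) :
    groupAverage a ν s = ∑' γ, (a γ : ℝ≥0∞) * ν ((fun y => γ • y) ⁻¹' s) := by
  rw [groupAverage, Measure.sum_apply _ hs]
  refine tsum_congr fun γ => ?_
  rw [Measure.smul_apply, Measure.map_apply (measurable_const_smul γ) hs, smul_eq_mul]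

theorem groupAverage_apply_of_invariant (ha : HasSum a 1) {s : Set Y} (hs : MeasurableSet s)
    (h : ∀ γ : Γ, ν ((fun y => γ • y) ⁻¹' s) = ν s) : groupAverage a ν s = ν s := by
  rw [groupAverage_apply hs]
  simp_rw [h]
  rw [ENNReal.tsum_mul_right, (ENNReal.hasSum_coe.2 ha).tsum_eq, ENNReal.coe_one, one_mul]

theorem isProbabilityMeasure_groupAverage (ha : HasSum a 1) [IsProbabilityMeasure ν] :
    IsProbabilityMeasure (groupAverage a ν) :=
  ⟨by rw [groupAverage_apply_of_invariant ha MeasurableSet.univ fun γ => by simp, measure_univ]⟩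

theorem groupAverage_of_invariant (ha : HasSum a 1)
    (h : ∀ γ : Γ, ν.map (fun y => γ • y) = ν) : groupAverage a ν = ν := by
  ext s hs
  refine groupAverage_apply_of_invariant ha hs fun γ => ?_
  rw [← Measure.map_apply (measurable_const_smul γ) hs, h]

/-- All weights being positive, a set is null for the average exactly when it is null for every
translate of `ν`, and translation only permutes these. -/
theorem isQuasiInvariant_groupAverage (ha : ∀ γ, 0 < a γ) :
    IsQuasiInvariant Γ (groupAverage a ν) := by
  intro g
  refine Measure.AbsolutelyContinuous.mk fun s hs h0 => ?_
  rw [Measure.map_apply (measurable_const_smul g) hs,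
    groupAverage_apply (measurable_const_smul g hs), ENNReal.tsum_eq_zero]
  rw [groupAverage_apply hs, ENNReal.tsum_eq_zero] at h0
  intro γ
  have h1 := h0 (g * γ)
  rw [mul_eq_zero, or_iff_right (by simpa using (ha (g * γ)).ne')] at h1
  rw [mul_eq_zero]
  right
  rw [← h1, ← Set.preimage_comp]
  refine congrArg ν (congrArg (· ⁻¹' s) (funext fun y => ?_))
  simp [mul_smul]

theorem map_groupAverage {Z : Type w} [MeasurableSpace Z] [MulAction Γ Z] [MeasurableConstSMul Γ Z]
    {θ : Y → Z} (hθ : Measurable θ) (h : ∀ (γ : Γ) y, θ (γ • y) = γ • θ y) :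
    (groupAverage a ν).map θ = groupAverage a (ν.map θ) := by
  ext s hs
  rw [Measure.map_apply hθ hs, groupAverage_apply (hθ hs), groupAverage_apply hs]
  refine tsum_congr fun γ => ?_
  rw [Measure.map_apply hθ (measurable_const_smul γ hs), ← Set.preimage_comp, ← Set.preimage_comp]
  refine congrArg (fun s => (a γ : ℝ≥0∞) * ν s) (congrArg (· ⁻¹' s) (funext fun y => ?_))
  simp [h]

theorem hasSum_integral_groupAverage (ha : HasSum a 1) [IsProbabilityMeasure ν] {f : Y → ℝ}
    (hf : Measurable f) {C : ℝ} (hC : ∀ y, |f y| ≤ C) :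
    HasSum (fun γ => (a γ : ℝ) * ∫ y, f (γ • y) ∂ν) (∫ y, f y ∂(groupAverage a ν)) := by
  have := isProbabilityMeasure_groupAverage ha (ν := ν)
  have h := hasSum_integral_measure (f := f)
    (μ := fun γ => (a γ : ℝ≥0∞) • ν.map (fun y => γ • y))
    (integrable_of_bound (μ := groupAverage a ν) hf hC)
  refine h.congr_fun fun γ => ?_
  rw [integral_smul_measure, integral_map (measurable_const_smul γ).aemeasurable
    hf.aestronglyMeasurable]
  rfl

theorem tvLe_groupAverage (ha : HasSum a 1) [IsProbabilityMeasure ν] {d : Γ → ℝ}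
    (hd : ∀ γ, TVLe (ν.map fun y => γ • y) ν (d γ)) (hs : Summable fun γ => (a γ : ℝ) * d γ) :
    TVLe (groupAverage a ν) ν (∑' γ, (a γ : ℝ) * d γ) := by
  intro f hf h1
  have h2 := hasSum_integral_groupAverage ha (ν := ν) hf h1
  have h3 : HasSum (fun γ => (a γ : ℝ) * ∫ y, f y ∂ν) (∫ y, f y ∂ν) := by
    simpa using (NNReal.hasSum_coe.2 ha).mul_right (∫ y, f y ∂ν)
  have h4 := h2.sub h3
  rw [← h4.tsum_eq]
  have hb : ∀ γ, ‖(a γ : ℝ) * ∫ y, f (γ • y) ∂ν - (a γ : ℝ) * ∫ y, f y ∂ν‖ ≤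
      (a γ : ℝ) * d γ := fun γ => by
    rw [← mul_sub, norm_mul, Real.norm_eq_abs, NNReal.abs_eq, Real.norm_eq_abs]
    refine mul_le_mul_of_nonneg_left ?_ (a γ).2
    have := hd γ f hf h1
    rwa [integral_map (measurable_const_smul γ).aemeasurable hf.aestronglyMeasurable] at this
  exact tsum_of_norm_bounded hs.hasSum hb

end Averaging

/-! ### Symmetrization under the flip -/

section Symmetrization

variable {X : Type u} [MeasurableSpace X]

/-- The average of a measure on `X × X` and its flip. -/
def symmetrization (ν : Measure (X × X)) : Measure (X × X) :=
  (2 : ℝ≥0∞)⁻¹ • (ν + ν.map Prod.swap)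

variable {ν : Measure (X × X)}

theorem symmetrization_apply {s : Set (X × X)} (hs : MeasurableSet s) :
    symmetrization ν s = (2 : ℝ≥0∞)⁻¹ * (ν s + ν (Prod.swap ⁻¹' s)) := by
  rw [symmetrization, Measure.smul_apply, Measure.add_apply, Measure.map_apply measurable_swap hs,
    smul_eq_mul]

theorem symmetrization_apply_of_symm {s : Set (X × X)} (hs : MeasurableSet s)
    (h : Prod.swap ⁻¹' s = s) : symmetrization ν s = ν s := by
  rw [symmetrization_apply hs, h, ← two_mul, ← mul_assoc,
    ENNReal.inv_mul_cancel two_ne_zero ENNReal.ofNat_ne_top, one_mul]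

theorem map_swap_symmetrization : (symmetrization ν).map Prod.swap = symmetrization ν := by
  ext s hs
  rw [Measure.map_apply measurable_swap hs, symmetrization_apply hs,
    symmetrization_apply (measurable_swap hs), ← Set.preimage_comp, Prod.swap_swap_eq,
    Set.preimage_id, add_comm]

theorem IsCoupling.symmetrization {μ : Measure X} (hν : IsCoupling μ ν) :
    IsCoupling μ (symmetrization ν) where
  isProbabilityMeasure := by
    have := hν.isProbabilityMeasure
    exact ⟨by rw [symmetrization_apply_of_symm MeasurableSet.univ rfl, measure_univ]⟩
  map_fst := by
    ext s hs
    rw [Measure.map_apply measurable_fst hs, symmetrization_apply (measurable_fst hs),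
      ← Set.preimage_comp, ← Measure.map_apply measurable_fst hs, hν.map_fst,
      show (Prod.fst ∘ Prod.swap : X × X → X) = Prod.snd from rfl,
      ← Measure.map_apply measurable_snd hs, hν.map_snd, ← two_mul, ← mul_assoc,
      ENNReal.inv_mul_cancel two_ne_zero ENNReal.ofNat_ne_top, one_mul]
  map_snd := by
    ext s hs
    rw [Measure.map_apply measurable_snd hs, symmetrization_apply (measurable_snd hs),
      ← Set.preimage_comp, ← Measure.map_apply measurable_snd hs, hν.map_snd,
      show (Prod.snd ∘ Prod.swap : X × X → X) = Prod.fst from rfl,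
      ← Measure.map_apply measurable_fst hs, hν.map_fst, ← two_mul, ← mul_assoc,
      ENNReal.inv_mul_cancel two_ne_zero ENNReal.ofNat_ne_top, one_mul]

theorem integral_symmetrization [IsFiniteMeasure ν] {f : X × X → ℝ} (hf : Measurable f) {C : ℝ}
    (hC : ∀ y, |f y| ≤ C) : ∫ p, f p ∂(symmetrization ν) =
      ((∫ p, f p ∂ν) + ∫ p, f p.swap ∂ν) / 2 := by
  rw [symmetrization, integral_smul_measure, integral_add_measure (integrable_of_bound hf hC)
    (integrable_of_bound hf hC), integral_map measurable_swap.aemeasurable hf.aestronglyMeasurable]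
  simp
  ring

theorem TVLe.symmetrization {Γ : Type v} [Group Γ] [MulAction Γ X] [MeasurableConstSMul Γ X]
    [IsFiniteMeasure ν] {γ : Γ} {d : ℝ} (h : TVLe (ν.map fun p => γ • p) ν d) :
    TVLe ((symmetrization ν).map fun p => γ • p) (symmetrization ν) d := by
  intro f hf h1
  have hγ : Measurable fun p : X × X => γ • p := measurable_const_smul γ
  rw [integral_map hγ.aemeasurable hf.aestronglyMeasurable,
    integral_symmetrization hf h1,
    integral_symmetrization (f := fun p => f (γ • p)) (hf.comp hγ) fun y => h1 _]
  have e1 := h f hf h1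
  have e2 := h (fun p => f p.swap) (hf.comp measurable_swap) fun y => h1 _
  rw [integral_map hγ.aemeasurable hf.aestronglyMeasurable] at e1
  rw [integral_map (f := fun p : X × X => f p.swap) hγ.aemeasurable
    (hf.comp measurable_swap).aestronglyMeasurable] at e2
  have e3 : (fun p : X × X => f (γ • p).swap) = fun p => f (γ • p.swap) := rfl
  rw [e3] at e2
  rw [abs_le] at *
  constructor <;> linarith [e1.1, e1.2, e2.1, e2.2]

theorem diagEnergy_symmetrization [StandardBorelSpace X] [IsFiniteMeasure ν] :
    diagEnergy (symmetrization ν) = diagEnergy ν := by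
  rw [diagEnergy, integral_symmetrization measurable_coordDiff coordDiff_le_one, diagEnergy]
  have : ∀ p : X × X, (realCoord X p.swap.1 - realCoord X p.swap.2) ^ 2 =
    (realCoord X p.1 - realCoord X p.2) ^ 2 := fun p => by
      rw [Prod.fst_swap, Prod.snd_swap]; ring
  simp_rw [this]
  ring

end Symmetrization

/-! ### Rigidity forces the mass onto the diagonal -/

section Regularization

variable {X : Type u} [MeasurableSpace X] [StandardBorelSpace X] {Γ : Type v} [Group Γ]
  [Countable Γ] [MulAction Γ X] [MeasurableConstSMul Γ X] {μ : Measure X} [IsProbabilityMeasure μ]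
  [SMulInvariantMeasure Γ X μ]

theorem preimage_smul_diagonal (γ : Γ) :
    (fun p : X × X => γ • p) ⁻¹' Set.diagonal X = Set.diagonal X := by
  ext p
  simp [Set.mem_diagonal_iff]

theorem IsAsymptoticallyInvariant.tvLe {ν : ℕ → Measure (X × X)}
    [∀ n, IsProbabilityMeasure (ν n)] (γ : Γ) (n : ℕ) :
    TVLe ((ν n).map fun p => γ • p) (ν n)
      (measureDist ((ν n).map fun p => (γ • p.1, γ • p.2)) (ν n)) := by
  have : IsProbabilityMeasure ((ν n).map fun p => γ • p) :=
    Measure.isProbabilityMeasure_map (measurable_const_smul γ).aemeasurable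
  exact tvLe_measureDist _ _

theorem TVLe.of_isProbabilityMeasure {Y : Type w} [MeasurableSpace Y] (ν ν' : Measure Y)
    [IsProbabilityMeasure ν] [IsProbabilityMeasure ν'] : TVLe ν ν' 2 := by
  intro f hf h1
  have h : ∀ (ρ : Measure Y) [IsProbabilityMeasure ρ], |∫ y, f y ∂ρ| ≤ 1 := fun ρ _ => by
    simpa using norm_integral_le_of_norm_le_const (μ := ρ) (f := f) (C := 1)
      (Eventually.of_forall h1)
  exact (abs_sub _ _).trans (by linarith [h ν, h ν'])

/-- An asymptotically invariant sequence of couplings concentrating at the diagonal can be made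
symmetric and quasi-invariant without changing the mass of the diagonal. -/
theorem exists_isBimoduleCoupling {ν : ℕ → Measure (X × X)} (hν : IsApproxDiagonal μ ν)
    (hinv : IsAsymptoticallyInvariant Γ ν) :
    ∃ (ν' : ℕ → Measure (X × X)) (d : Γ → ℕ → ℝ), (∀ n, IsBimoduleCoupling Γ μ (ν' n)) ∧
      Tendsto (fun n => diagEnergy (ν' n)) atTop (𝓝 0) ∧
      (∀ γ, Tendsto (d γ) atTop (𝓝 0)) ∧
      (∀ γ n, TVLe ((ν' n).map fun p => γ • p) (ν' n) (d γ n)) ∧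
      ∀ n, ν' n (Set.diagonal X) = ν n (Set.diagonal X) := by
  obtain ⟨a, ha, hsum⟩ := exists_pos_hasSum_one Γ
  have hP := hν.isProbabilityMeasure
  set ρ : ℕ → Measure (X × X) := fun n => symmetrization (ν n) with hρ
  have hρc : ∀ n, IsCoupling μ (ρ n) := fun n => (hν.isCoupling n).symmetrization
  have hρP : ∀ n, IsProbabilityMeasure (ρ n) := fun n => (hρc n).isProbabilityMeasure
  have hρm : ∀ (γ : Γ) n, IsProbabilityMeasure ((ρ n).map fun p => γ • p) := fun γ n =>
    Measure.isProbabilityMeasure_map (measurable_const_smul γ).aemeasurable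
  -- Truncation at `2`, which bounds the distance of any two probability measures, supplies the
  -- summable majorant for dominated convergence over `Γ`.
  set d₀ : Γ → ℕ → ℝ := fun γ n =>
    min (measureDist ((ν n).map fun p => (γ • p.1, γ • p.2)) (ν n)) 2 with hd₀
  have hd₀t : ∀ γ, Tendsto (d₀ γ) atTop (𝓝 0) := fun γ => by
    simpa using (hinv γ).min (tendsto_const_nhds (x := (2 : ℝ)))
  have htv : ∀ γ n, TVLe ((ρ n).map fun p => γ • p) (ρ n) (d₀ γ n) := fun γ n => by
    rcases min_choice (measureDist ((ν n).map fun p => (γ • p.1, γ • p.2)) (ν n)) 2 with h | h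
    · rw [hd₀]; dsimp only; rw [h]
      exact (IsAsymptoticallyInvariant.tvLe γ n).symmetrization
    · rw [hd₀]; dsimp only; rw [h]
      exact TVLe.of_isProbabilityMeasure _ _
  have hd₀n : ∀ γ n, 0 ≤ d₀ γ n := fun γ n => by
    simpa using (abs_nonneg _).trans (htv γ n (fun _ => 0) measurable_const (by simp))
  have hbound : ∀ γ n, ‖(a γ : ℝ) * d₀ γ n‖ ≤ (a γ : ℝ) * 2 := fun γ n => by
    refine (Real.norm_of_nonneg (mul_nonneg (a γ).2 (hd₀n γ n))).trans_le ?_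
    exact mul_le_mul_of_nonneg_left (min_le_right _ _) (a γ).2
  have hs2 : Summable fun γ => (a γ : ℝ) * 2 := (NNReal.hasSum_coe.2 hsum).summable.mul_right 2
  set D : ℕ → ℝ := fun n => ∑' γ, (a γ : ℝ) * d₀ γ n with hD
  have hDt : Tendsto D atTop (𝓝 0) := by
    have := tendsto_tsum_of_dominated_convergence (f := fun n γ => (a γ : ℝ) * d₀ γ n)
      (g := fun _ => (0 : ℝ)) hs2 (fun γ => by simpa using (hd₀t γ).const_mul (a γ : ℝ))
      (Eventually.of_forall fun n γ => hbound γ n)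
    simpa using this
  have hDtv : ∀ n, TVLe (groupAverage a (ρ n)) (ρ n) (D n) := fun n =>
    tvLe_groupAverage hsum (fun γ => htv γ n) (Summable.of_norm_bounded hs2 fun γ => hbound γ n)
  have hμ : ∀ γ : Γ, μ.map (fun x => γ • x) = μ := fun γ => (measurePreserving_smul γ μ).map_eq
  -- The translate of the average is compared with the translate of `ρ n`, then with `ρ n`, then
  -- with the average: `D n`, `d₀ γ n` and `D n` again.
  refine ⟨fun n => groupAverage a (ρ n), fun γ n => D n + (d₀ γ n + D n), fun n => ?_, ?_,
    fun γ => ?_, fun γ n => ?_, fun n => ?_⟩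
  · exact
    { isProbabilityMeasure := isProbabilityMeasure_groupAverage hsum
      map_fst := by
        rw [map_groupAverage measurable_fst fun _ _ => rfl, (hρc n).map_fst,
          groupAverage_of_invariant hsum hμ]
      map_snd := by
        rw [map_groupAverage measurable_snd fun _ _ => rfl, (hρc n).map_snd,
          groupAverage_of_invariant hsum hμ]
      quasiInvariant := isQuasiInvariant_groupAverage ha
      measurePreserving_swap := ⟨measurable_swap, by
        rw [map_groupAverage measurable_swap fun _ _ => rfl, hρ]
        dsimp only
        rw [map_swap_symmetrization]⟩ }
  · have h0 := hν.tendsto_diagEnergy.add hDt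
    rw [add_zero] at h0
    refine squeeze_zero (fun n => diagEnergy_nonneg _) (fun n => ?_) h0
    have h1 := (abs_le.1 (hDtv n _ measurable_coordDiff coordDiff_le_one)).2
    have h2 := diagEnergy_symmetrization (ν := ν n)
    rw [← h2]
    simp only [diagEnergy]
    linarith
  · simpa using hDt.add ((hd₀t γ).add hDt)
  · exact ((hDtv n).map (measurable_const_smul γ)).trans ((htv γ n).trans (hDtv n).symm)
  · rw [groupAverage_apply_of_invariant hsum measurableSet_diagonal fun γ => by
      rw [preimage_smul_diagonal], hρ]
    exact symmetrization_apply_of_symm measurableSet_diagonal (by ext p; simp [eq_comm])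

/-- If the action is rigid, asymptotically invariant couplings concentrating at the diagonal
asymptotically live on the diagonal. -/
theorem IsRigidAction.tendsto_diagonal (h : IsRigidAction Γ μ) {ν : ℕ → Measure (X × X)}
    (hν : IsApproxDiagonal μ ν) (hinv : IsAsymptoticallyInvariant Γ ν) :
    Tendsto (fun n => ν n (Set.diagonal X)) atTop (𝓝 1) := by
  obtain ⟨ν', d, hc, hE, hd, htv, hdiag⟩ := exists_isBimoduleCoupling hν hinv
  have hP : ∀ n, IsProbabilityMeasure (ν' n) := fun n => (hc n).isProbabilityMeasure
  have hap : IsApproxDiagonal μ ν' := isApproxDiagonal_of_diagEnergy (fun n => (hc n).toIsCoupling) hE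
  have h1 : ∀ f, Tendsto (fun n => ‖(hc n).bimodule.commutator (crossedVacuum Γ (ν' n))
      (crossedMulElem Γ μ f)‖) atTop (𝓝 0) := by
    intro f
    -- Condition (i) concerns functions bounded everywhere, so the class `f` is replaced by a
    -- bounded Borel representative.
    have hb : ∀ᵐ x ∂μ, ‖f x‖ ≤ ‖f‖ := by
      filter_upwards [ae_le_eLpNormEssSup (f := f) (μ := μ)] with x hx
      rw [← eLpNorm_exponent_top] at hx
      rw [← toReal_enorm, Lp.norm_def]
      exact ENNReal.toReal_mono (Lp.eLpNorm_ne_top f) hx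
    set g : X → ℂ := {x | ‖f x‖ ≤ ‖f‖}.indicator f with hgdef
    have hfm : Measurable f := (Lp.stronglyMeasurable f).measurable
    have hg : Measurable g := hfm.indicator (measurableSet_le hfm.norm measurable_const)
    have hgf : ∀ᵐ x ∂μ, g x = f x := by
      filter_upwards [hb] with x hx
      exact Set.indicator_of_mem (show x ∈ {x | ‖f x‖ ≤ ‖f‖} from hx) _
    have hgb : ∀ x, ‖g x‖ ≤ ‖f‖ := fun x => by
      by_cases hx : x ∈ {x | ‖f x‖ ≤ ‖f‖}
      · rw [hgdef, Set.indicator_of_mem hx]; exact hx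
      · rw [hgdef, Set.indicator_of_notMem hx, norm_zero]; exact norm_nonneg _
    have h3 := hap.tendsto_integral_norm_sq hg hgb
    have h4 : Tendsto (fun n => √(∫ p, ‖g p.1 - g p.2‖ ^ 2 ∂(ν' n))) atTop (𝓝 0) := by
      simpa [Function.comp_def] using (Real.continuous_sqrt.tendsto _).comp h3
    refine h4.congr fun n => ?_
    have h5 := (hc n).norm_left_sub_right_crossedMul f
    rw [← HilbertBimodule.commutator_apply] at h5
    rw [← Real.sqrt_sq (norm_nonneg ((hc n).bimodule.commutator _ _)), h5]
    refine congrArg Real.sqrt (integral_congr_ae ?_)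
    filter_upwards [IsBimoduleCoupling.ae_fst (hc n).toIsCoupling hgf, IsBimoduleCoupling.ae_snd (hc n).toIsCoupling hgf] with p e1 e2
    rw [e1, e2]
  have h2 : ∀ γ, Tendsto (fun n => ‖(hc n).bimodule.commutator (crossedVacuum Γ (ν' n))
      (crossedUnitaryElem μ γ)‖) atTop (𝓝 0) := by
    intro γ
    have h4 : Tendsto (fun n => √(d γ n)) atTop (𝓝 0) := by
      simpa [Function.comp_def] using (Real.continuous_sqrt.tendsto _).comp (hd γ)
    refine squeeze_zero (fun _ => norm_nonneg _) (fun n => ?_) h4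
    exact Real.le_sqrt_of_sq_le ((hc n).norm_left_sub_right_crossedUnitary γ (htv γ n))
  have hcomm := tendsto_commutator (fun n => (hc n).isTracialVector) h1 h2
  have hcompl : Tendsto (fun n => (ν' n).real (Set.diagonal X)ᶜ) atTop (𝓝 0) := by
    rw [Metric.tendsto_nhds]
    intro ε hε
    -- The off-diagonal mass is at most the squared distance to a central vector, hence the root;
    -- halving makes the final inequality strict.
    obtain ⟨F, δ, hδ, H⟩ := h (√(ε / 2)) (by positivity)
    have hF : ∀ᶠ n in atTop, ∀ x ∈ F,
        ‖(hc n).bimodule.commutator (crossedVacuum Γ (ν' n)) x‖ ≤ δ := by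
      rw [Filter.eventually_all_finset]
      exact fun x _ => (hcomm x).eventually_le_const hδ
    filter_upwards [hF] with n hn
    obtain ⟨η, hη, hle⟩ := H (CrossedL2 Γ (ν' n)) (hc n).bimodule (crossedVacuum Γ (ν' n))
      (hc n).norm_vacuum (hc n).isTracialVector hn
    have h5 := (hc n).measureReal_compl_diagonal_le (η := η) fun f => hη _ ⟨f, rfl⟩
    rw [Real.dist_eq, sub_zero, abs_of_nonneg measureReal_nonneg]
    have h6 : ‖η - crossedVacuum Γ (ν' n)‖ ^ 2 ≤ ε / 2 := by
      rw [← Real.sq_sqrt (show 0 ≤ ε / 2 by positivity)]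
      exact pow_le_pow_left₀ (norm_nonneg _) hle 2
    linarith
  have h7 : Tendsto (fun n => ENNReal.ofReal (1 - (ν' n).real (Set.diagonal X)ᶜ)) atTop
      (𝓝 (ENNReal.ofReal (1 - 0))) := ENNReal.tendsto_ofReal (hcompl.const_sub 1)
  rw [sub_zero, ENNReal.ofReal_one] at h7
  refine h7.congr fun n => ?_
  rw [probReal_compl_eq_one_sub measurableSet_diagonal, sub_sub_cancel, ← hdiag n]
  exact ENNReal.ofReal_toReal (measure_ne_top _ _)

end Regularization

/-! ### Spectral measures of normal operators -/

section SpectralMeasure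

variable {K : Type w} [NormedAddCommGroup K] [InnerProductSpace ℂ K] [CompleteSpace K]

theorem inner_star_mul_self (A : K →L[ℂ] K) (ξ : K) :
    inner ℂ ξ ((star A * A) ξ) = ((‖A ξ‖ ^ 2 : ℝ) : ℂ) := by
  rw [mul_apply_eq_comp, ContinuousLinearMap.star_eq_adjoint,
    ContinuousLinearMap.adjoint_inner_right, inner_self_eq_norm_sq_to_K]
  push_cast
  rfl

theorem inner_im_eq_zero_of_star_eq {A : K →L[ℂ] K} (hA : star A = A) (ξ : K) :
    (inner ℂ ξ (A ξ)).im = 0 := by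
  rw [← Complex.conj_eq_iff_im, inner_conj_symm]
  conv_lhs => rw [← hA]
  rw [ContinuousLinearMap.star_eq_adjoint, ContinuousLinearMap.adjoint_inner_left]

/-- The functional `h ↦ ⟨ξ, φ(h) ξ⟩` is positive, since a nonnegative `f` is the square of `√f` and
yields `‖φ(√f) ξ‖²`. The Riesz–Markov theorem then applies to real functions, and complex ones are
split into real and imaginary parts. -/
theorem exists_measure_of_starHom {S : Type} [TopologicalSpace S] [CompactSpace S] [T2Space S]
    [MeasurableSpace S] [BorelSpace S] (φ : C(S, ℂ) →⋆ₐ[ℂ] (K →L[ℂ] K)) (ξ : K) :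
    ∃ σ : Measure S, IsFiniteMeasure σ ∧ ∀ h : C(S, ℂ), ∫ z, h z ∂σ = inner ℂ ξ (φ h ξ) := by
  let ι : C(S, ℝ) → C(S, ℂ) := fun f => ⟨fun z => (f z : ℂ), by fun_prop⟩
  have hι_star : ∀ f, star (ι f) = ι f := fun f => by ext z; simp [ι]
  let Λ₀ : CompactlySupportedContinuousMap S ℝ →ₗ[ℝ] ℝ :=
    { toFun := fun f => (inner ℂ ξ (φ (ι f.toContinuousMap) ξ)).re
      map_add' := fun f g => by
        rw [show ι (f + g).toContinuousMap = ι f.toContinuousMap + ι g.toContinuousMap from by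
          ext z; simp [ι], map_add, add_apply, inner_add_right, Complex.add_re]
      map_smul' := fun c f => by
        rw [show ι (c • f).toContinuousMap = (c : ℂ) • ι f.toContinuousMap from by
          ext z; simp [ι], map_smul, smul_apply, inner_smul_right, Complex.re_ofReal_mul]
        rfl }
  let Λ : CompactlySupportedContinuousMap S ℝ →ₚ[ℝ] ℝ := PositiveLinearMap.mk₀ Λ₀ fun f hf => by
    let g : C(S, ℝ) := ⟨fun z => √(f z), by fun_prop⟩
    have e : ι f.toContinuousMap = star (ι g) * ι g := by
      rw [hι_star]
      ext z
      have hz : 0 ≤ f z := hf z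
      change ((f z : ℝ) : ℂ) = ((√(f z) : ℝ) : ℂ) * ((√(f z) : ℝ) : ℂ)
      rw [← Complex.ofReal_mul, Real.mul_self_sqrt hz]
    change 0 ≤ (inner ℂ ξ (φ (ι f.toContinuousMap) ξ)).re
    rw [e, map_mul, map_star, inner_star_mul_self, Complex.ofReal_re]
    positivity
  refine ⟨RealRMK.rieszMeasure Λ, inferInstance, fun h => ?_⟩
  have hreal : ∀ f : C(S, ℝ), ((∫ z, f z ∂(RealRMK.rieszMeasure Λ) : ℝ) : ℂ) =
      inner ℂ ξ (φ (ι f) ξ) := fun f => by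
    have h1 := RealRMK.integral_rieszMeasure Λ
      (CompactlySupportedContinuousMap.continuousMapEquiv f)
    have h2 : (∫ z, f z ∂(RealRMK.rieszMeasure Λ)) = (inner ℂ ξ (φ (ι f) ξ)).re := h1
    rw [h2]
    refine Complex.ext (Complex.ofReal_re _) ?_
    rw [Complex.ofReal_im, inner_im_eq_zero_of_star_eq]
    rw [← map_star, hι_star]
  let hr : C(S, ℝ) := ⟨fun z => (h z).re, by fun_prop⟩
  let hi : C(S, ℝ) := ⟨fun z => (h z).im, by fun_prop⟩
  have e : h = ι hr + Complex.I • ι hi := by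
    ext z
    change h z = ((h z).re : ℂ) + Complex.I * ((h z).im : ℂ)
    rw [mul_comm, Complex.re_add_im]
  have hint : Integrable h (RealRMK.rieszMeasure Λ) :=
    Integrable.of_bound h.continuous.aestronglyMeasurable ‖h‖
      (Eventually.of_forall h.norm_coe_le_norm)
  rw [← integral_re_add_im hint]
  conv_rhs => rw [e, map_add, map_smul, add_apply, smul_apply, inner_add_right, inner_smul_right,
    ← hreal, ← hreal]
  rw [mul_comm Complex.I]
  rfl

/-- The spectral measure of a normal operator at a vector. -/
theorem exists_spectralMeasure (N : K →L[ℂ] K) (hN : IsStarNormal N) (ξ : K) :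
    ∃ σ : Measure ℂ, IsFiniteMeasure σ ∧ (∀ᵐ z ∂σ, z ∈ spectrum ℂ N) ∧
      ∀ h : ℂ → ℂ, Continuous h → ∫ z, h z ∂σ = inner ℂ ξ (cfc h N ξ) := by
  have : CompactSpace (spectrum ℂ N) := isCompact_iff_compactSpace.1 (spectrum.isCompact N)
  obtain ⟨σ, hσ, H⟩ := exists_measure_of_starHom (cfcHom hN) ξ
  have hm : MeasurableSet (spectrum ℂ N) := (spectrum.isCompact N).measurableSet
  refine ⟨σ.map Subtype.val, inferInstance, ?_, fun h hh => ?_⟩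
  · refine (ae_map_iff (p := fun z => z ∈ spectrum ℂ N) measurable_subtype_coe.aemeasurable hm).2 ?_
    exact Eventually.of_forall fun z => z.2
  · rw [integral_map measurable_subtype_coe.aemeasurable hh.aestronglyMeasurable,
      cfc_apply h N hN hh.continuousOn, ← H]
    rfl

open Polynomial in
/-- Finite measures on a bounded interval are determined by their moments. -/
theorem measure_eq_of_polynomial {σ τ : Measure ℝ} [IsFiniteMeasure σ] [IsFiniteMeasure τ] {R : ℝ}
    (hσ : ∀ᵐ s ∂σ, s ∈ Set.Icc (-R) R) (hτ : ∀ᵐ s ∂τ, s ∈ Set.Icc (-R) R)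
    (h : ∀ p : ℝ[X], ∫ s, p.eval s ∂σ = ∫ s, p.eval s ∂τ) : σ = τ := by
  refine ext_of_forall_integral_eq_of_IsFiniteMeasure fun f => ?_
  have key : ∀ (ρ : Measure ℝ) [IsFiniteMeasure ρ] (_ : ∀ᵐ s ∂ρ, s ∈ Set.Icc (-R) R) (p : ℝ[X])
      (ε : ℝ) (_ : ∀ s ∈ Set.Icc (-R) R, |p.eval s - f s| < ε),
      |(∫ s, p.eval s ∂ρ) - ∫ s, f s ∂ρ| ≤ ε * ρ.real Set.univ := by
    intro ρ _ hρ p ε hp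
    obtain ⟨C, hC⟩ := (isCompact_Icc (a := -R) (b := R)).exists_bound_of_continuousOn
      p.continuous.continuousOn
    have i1 : Integrable (fun s => p.eval s) ρ :=
      Integrable.of_bound p.continuous.aestronglyMeasurable C (hρ.mono fun s hs => hC s hs)
    rw [← integral_sub i1 (f.integrable ρ)]
    refine norm_integral_le_of_norm_le_const (f := fun s => p.eval s - f s)
      (hρ.mono fun s hs => ?_)
    exact (hp s hs).le
  refine eq_of_abs_sub_nonpos (le_of_forall_pos_le_add fun ε hε => ?_)
  rw [zero_add]
  set M := σ.real Set.univ + τ.real Set.univ + 1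
  have hM : 0 < M := by positivity
  obtain ⟨p, hp⟩ := exists_polynomial_near_of_continuousOn (-R) R f f.continuous.continuousOn
    (ε / M) (by positivity)
  have h1 := key σ hσ p _ hp
  have h2 := key τ hτ p _ hp
  rw [h p] at h1
  have h3 : ε / M * σ.real Set.univ + ε / M * τ.real Set.univ ≤ ε := by
    rw [← mul_add, div_mul_eq_mul_div, div_le_iff₀ hM]
    refine mul_le_mul_of_nonneg_left ?_ hε.le
    linarith
  rw [abs_le] at *
  constructor <;> linarith [h1.1, h1.2, h2.1, h2.2]

/-- Total variation distance can be tested on continuous functions. -/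
theorem tvLe_of_continuous {σ τ : Measure ℂ} [IsFiniteMeasure σ] [IsFiniteMeasure τ] {δ : ℝ}
    (h : ∀ f : ℂ → ℝ, Continuous f → (∀ z, |f z| ≤ 1) → |(∫ z, f z ∂σ) - ∫ z, f z ∂τ| ≤ δ) :
    TVLe σ τ δ := by
  intro f hf h1
  refine le_of_forall_pos_le_add fun ε hε => ?_
  have hf1 : MemLp f 1 (σ + τ) :=
    MemLp.of_bound hf.aestronglyMeasurable 1 (Eventually.of_forall h1)
  obtain ⟨g, hg, hgm⟩ := hf1.exists_boundedContinuous_eLpNorm_sub_le (by norm_num)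
    (ε := ENNReal.ofReal ε) (by simpa using hε)
  -- Truncating to `[-1, 1]` keeps the continuous approximant admissible as a test function and
  -- brings it no farther from `f`.
  set c : ℂ → ℝ := fun z => max (-1) (min 1 (g z)) with hc
  have hcc : Continuous c := by
    have := g.continuous
    fun_prop
  have hc1 : ∀ z, |c z| ≤ 1 := fun z => abs_le.2
    ⟨le_max_left _ _, max_le (by norm_num) (min_le_left _ _)⟩
  have hcf : ∀ z, |f z - c z| ≤ |f z - g z| := fun z => by
    have h2 := abs_le.1 (h1 z)
    simp only [hc]
    rcases le_total 1 (g z) with h3 | h3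
    · rw [min_eq_left h3, max_eq_right (by norm_num), abs_of_nonpos (by linarith),
        abs_of_nonpos (by linarith)]
      linarith
    · rw [min_eq_right h3]
      rcases le_total (-1) (g z) with h4 | h4
      · rw [max_eq_right h4]
      · rw [max_eq_left h4, abs_of_nonneg (by linarith), abs_of_nonneg (by linarith)]
        linarith
  have i1 : ∀ (ρ : Measure ℂ) [IsFiniteMeasure ρ], Integrable f ρ := fun ρ _ =>
    integrable_of_bound hf h1
  have i2 : ∀ (ρ : Measure ℂ) [IsFiniteMeasure ρ], Integrable c ρ := fun ρ _ =>
    integrable_of_bound hcc.measurable hc1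
  have hsmall : ∫ z, |f z - c z| ∂(σ + τ) ≤ ε := by
    have i3 : Integrable (f - ⇑g) (σ + τ) := (hf1.sub hgm).integrable le_rfl
    calc _ ≤ ∫ z, |f z - g z| ∂(σ + τ) :=
          integral_mono ((i1 _).sub (i2 _)).abs i3.abs hcf
      _ = (eLpNorm (f - ⇑g) 1 (σ + τ)).toReal := by
          rw [eLpNorm_one_eq_lintegral_enorm, ← integral_norm_eq_lintegral_enorm i3.1]
          rfl
      _ ≤ ε := ENNReal.toReal_le_of_le_ofReal hε.le hg
  have i4 : ∀ (ρ : Measure ℂ) [IsFiniteMeasure ρ], Integrable (fun z => |f z - c z|) ρ :=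
    fun ρ _ => ((i1 ρ).sub (i2 ρ)).abs
  rw [integral_add_measure (i4 _) (i4 _)] at hsmall
  have h5 : ∀ (ρ : Measure ℂ) [IsFiniteMeasure ρ],
      |(∫ z, f z ∂ρ) - ∫ z, c z ∂ρ| ≤ ∫ z, |f z - c z| ∂ρ := fun ρ _ => by
    rw [← integral_sub (i1 ρ) (i2 ρ)]
    exact abs_integral_le_integral_abs
  have h6 := h c hcc hc1
  have h7 := h5 σ
  have h8 := h5 τ
  rw [abs_le] at *
  constructor <;> linarith [h6.1, h6.2, h7.1, h7.2, h8.1, h8.2]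

end SpectralMeasure

/-! ### Couplings from commuting representations of bounded functions -/

section BoundedMeasurable

variable {X : Type u} [MeasurableSpace X]

/-- The `*`-algebra of bounded measurable functions. -/
def boundedMeasurable (X : Type u) [MeasurableSpace X] : StarSubalgebra ℂ (X → ℂ) where
  carrier := {f | Measurable f ∧ ∃ C : ℝ, ∀ x, ‖f x‖ ≤ C}
  mul_mem' := by
    rintro f g ⟨hf, C, hC⟩ ⟨hg, D, hD⟩
    refine ⟨hf.mul hg, C * D, fun x => ?_⟩
    rw [Pi.mul_apply, norm_mul]
    exact mul_le_mul (hC x) (hD x) (norm_nonneg _) ((norm_nonneg _).trans (hC x))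
  add_mem' := by
    rintro f g ⟨hf, C, hC⟩ ⟨hg, D, hD⟩
    exact ⟨hf.add hg, C + D, fun x => (norm_add_le _ _).trans (add_le_add (hC x) (hD x))⟩
  algebraMap_mem' c := ⟨measurable_const, ‖c‖, fun x => le_rfl⟩
  star_mem' := by
    rintro f ⟨hf, C, hC⟩
    exact ⟨Complex.continuous_conj.measurable.comp hf, C, fun x => by
      rw [Pi.star_apply, norm_star]; exact hC x⟩

theorem boundedMeasurable.measurable (f : boundedMeasurable X) : Measurable (f : X → ℂ) := f.2.1

theorem boundedMeasurable.exists_bound (f : boundedMeasurable X) :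
    ∃ C : ℝ, 0 ≤ C ∧ ∀ x, ‖(f : X → ℂ) x‖ ≤ C := by
  obtain ⟨C, hC⟩ := f.2.2
  exact ⟨|C|, abs_nonneg _, fun x => (hC x).trans (le_abs_self _)⟩

/-- The coordinate as a bounded function. -/
def coordFun (X : Type u) [MeasurableSpace X] [StandardBorelSpace X] : boundedMeasurable X :=
  ⟨fun x => (realCoord X x : ℂ), Complex.measurable_ofReal.comp measurable_realCoord, 1, fun x => by
    have := realCoord_mem x
    rw [Complex.norm_real, Real.norm_eq_abs, abs_le]
    constructor <;> linarith [this.1, this.2]⟩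

theorem star_coordFun [StandardBorelSpace X] : star (coordFun X) = coordFun X := by
  apply Subtype.ext
  ext x
  exact Complex.conj_ofReal _

theorem coe_aeval_coordFun [StandardBorelSpace X] (p : Polynomial ℂ) (x : X) :
    ((Polynomial.aeval (coordFun X) p : boundedMeasurable X) : X → ℂ) x =
      p.eval (realCoord X x : ℂ) := by
  have h := Polynomial.aeval_algHom_apply
    ((Pi.evalAlgHom ℂ (fun _ : X => ℂ) x).comp (boundedMeasurable X).subtype.toAlgHom)
    (coordFun X) p
  refine h.symm.trans ?_
  rw [Polynomial.coe_aeval_eq_eval]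
  rfl

end BoundedMeasurable

section TracialPair

variable {X : Type u} [MeasurableSpace X] {K : Type w} [NormedAddCommGroup K]
  [InnerProductSpace ℂ K] [CompleteSpace K]

/-- Additive maps on the bounded functions which are continuous for the `L²` norm are determined
by their values at the polynomials in the coordinate. -/
theorem eq_zero_of_polynomial [StandardBorelSpace X] {μ : Measure X} [IsFiniteMeasure μ]
    {E : Type*} [NormedAddCommGroup E] (D : boundedMeasurable X →+ E) {C : ℝ}
    (hC : ∀ f, ‖D f‖ ≤ C * √(∫ x, ‖(f : X → ℂ) x‖ ^ 2 ∂μ))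
    (h : ∀ p : Polynomial ℂ, D (Polynomial.aeval (coordFun X) p) = 0) (f : boundedMeasurable X) : D f = 0 := by
  rw [← norm_le_zero_iff]
  refine le_of_forall_pos_le_add fun ε hε => ?_
  obtain ⟨B, -, hB⟩ := boundedMeasurable.exists_bound f
  obtain ⟨p, hp⟩ := exists_polynomial_integral_le μ (boundedMeasurable.measurable f) hB
    (ε := (ε / (|C| + 1)) ^ 2) (by positivity)
  have h1 := hC (f - Polynomial.aeval (coordFun X) p)
  rw [map_sub, h, sub_zero] at h1
  have h2 : √(∫ x, ‖((f - Polynomial.aeval (coordFun X) p : boundedMeasurable X) : X → ℂ) x‖ ^ 2 ∂μ)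
      ≤ ε / (|C| + 1) := by
    refine Real.sqrt_le_iff.2 ⟨by positivity, le_of_eq_of_le ?_ hp⟩
    refine integral_congr_ae (Eventually.of_forall fun x => ?_)
    change ‖(f : X → ℂ) x - ((Polynomial.aeval (coordFun X) p : boundedMeasurable X) : X → ℂ) x‖ ^ 2
      = _
    rw [coe_aeval_coordFun]
  rw [zero_add]
  calc _ ≤ C * √(∫ x, ‖((f - Polynomial.aeval (coordFun X) p : boundedMeasurable X) :
        X → ℂ) x‖ ^ 2 ∂μ) := h1
    _ ≤ (|C| + 1) * (ε / (|C| + 1)) := by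
        refine mul_le_mul (by linarith [le_abs_self C]) h2 (Real.sqrt_nonneg _) (by positivity)
    _ = ε := by field_simp

/-- Two commuting representations of the bounded functions such that both states given by `ξ` are
the integral against `μ`. -/
structure IsTracialPair (μ : Measure X) (l r : boundedMeasurable X →⋆ₐ[ℂ] (K →L[ℂ] K)) (ξ : K) :
    Prop where
  commute : ∀ f g, Commute (l f) (r g)
  inner_left : ∀ f, inner ℂ ξ (l f ξ) = ∫ x, (f : X → ℂ) x ∂μ
  inner_right : ∀ f, inner ℂ ξ (r f ξ) = ∫ x, (f : X → ℂ) x ∂μ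

/-- The normal operator whose real and imaginary parts are the two images of the coordinate. -/
def coordOp [StandardBorelSpace X] (l r : boundedMeasurable X →⋆ₐ[ℂ] (K →L[ℂ] K)) : K →L[ℂ] K :=
  l (coordFun X) + Complex.I • r (coordFun X)

/-- The two coordinates of a point of `X × X` as a complex number. -/
def coordPoint [StandardBorelSpace X] (p : X × X) : ℂ := ⟨realCoord X p.1, realCoord X p.2⟩

/-- The measure on `X × X` which is the joint spectral measure of `ξ`. -/
structure IsSpectralCoupling [StandardBorelSpace X] (μ : Measure X)
    (l r : boundedMeasurable X →⋆ₐ[ℂ] (K →L[ℂ] K)) (ξ : K) (ν : Measure (X × X)) : Prop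
    extends IsCoupling μ ν where
  integral_cfc : ∀ h : ℂ → ℂ, Continuous h →
    ∫ p, h (coordPoint p) ∂ν = inner ℂ ξ (cfc h (coordOp l r) ξ)

variable {μ : Measure X} [IsProbabilityMeasure μ]
  {l r : boundedMeasurable X →⋆ₐ[ℂ] (K →L[ℂ] K)} {ξ : K}

theorem measurable_coordPoint [StandardBorelSpace X] :
    Measurable (coordPoint : X × X → ℂ) := by
  have h : Measurable fun p : X × X =>
      (realCoord X p.1 : ℂ) + (realCoord X p.2 : ℂ) * Complex.I :=
    (Complex.measurable_ofReal.comp (measurable_realCoord.comp measurable_fst)).add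
      ((Complex.measurable_ofReal.comp (measurable_realCoord.comp measurable_snd)).mul_const _)
  have e : (coordPoint : X × X → ℂ) = fun p : X × X =>
      (realCoord X p.1 : ℂ) + (realCoord X p.2 : ℂ) * Complex.I :=
    funext fun p => Complex.mk_eq_add_mul_I _ _
  rwa [e]

namespace IsTracialPair

variable (hp : IsTracialPair μ l r ξ)
include hp

theorem symm : IsTracialPair μ r l ξ :=
  ⟨fun f g => (hp.commute g f).symm, hp.inner_right, hp.inner_left⟩

theorem norm_left_sq (f : boundedMeasurable X) : ‖l f ξ‖ ^ 2 = ∫ x, ‖(f : X → ℂ) x‖ ^ 2 ∂μ := by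
  have h := hp.inner_left (star f * f)
  rw [map_mul, map_star, inner_star_mul_self] at h
  apply Complex.ofReal_injective
  rw [h, ← integral_complex_ofReal]
  refine integral_congr_ae (Eventually.of_forall fun x => ?_)
  change (starRingEnd ℂ) ((f : X → ℂ) x) * (f : X → ℂ) x = _
  rw [← Complex.normSq_eq_conj_mul_self, Complex.normSq_eq_norm_sq]

theorem norm_right_sq (f : boundedMeasurable X) : ‖r f ξ‖ ^ 2 = ∫ x, ‖(f : X → ℂ) x‖ ^ 2 ∂μ :=
  hp.symm.norm_left_sq f

theorem norm_eq_one : ‖ξ‖ = 1 := by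
  have h := hp.norm_left_sq 1
  have e : ∀ x, ‖((1 : boundedMeasurable X) : X → ℂ) x‖ ^ 2 = 1 := fun x => by
    change ‖(1 : ℂ)‖ ^ 2 = 1
    simp
  simp_rw [e] at h
  rw [map_one] at h
  change ‖ξ‖ ^ 2 = _ at h
  simp only [integral_const, probReal_univ, smul_eq_mul, mul_one] at h
  exact (pow_eq_one_iff_of_nonneg (norm_nonneg _) two_ne_zero).1 h

/-- Each of the two terms is separately at most `C ‖f‖₂`, by Cauchy–Schwarz and the marginal
condition. No cancellation is used: the bound serves only as `L²` continuity in `f`, to pass from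
polynomials to all bounded functions. -/
theorem norm_integral_sub_inner_le {ν : Measure (X × X)} (hν : IsCoupling μ ν) (f g : boundedMeasurable X) {C : ℝ}
    (hC : ∀ x, ‖(g : X → ℂ) x‖ ≤ C) :
    ‖(∫ p, (f : X → ℂ) p.1 * (g : X → ℂ) p.2 ∂ν) - inner ℂ ξ (l f (r g ξ))‖ ≤
      2 * C * √(∫ x, ‖(f : X → ℂ) x‖ ^ 2 ∂μ) := by
  have := hν.isProbabilityMeasure
  have hX : Nonempty X := nonempty_of_isProbabilityMeasure μ
  have hC0 : 0 ≤ C := (norm_nonneg _).trans (hC hX.some)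
  obtain ⟨D, hD0, hD⟩ := boundedMeasurable.exists_bound f
  have h1 : ‖∫ p, (f : X → ℂ) p.1 * (g : X → ℂ) p.2 ∂ν‖ ≤
      C * √(∫ x, ‖(f : X → ℂ) x‖ ^ 2 ∂μ) := by
    have hfm : Measurable fun p : X × X => ‖(f : X → ℂ) p.1‖ :=
      ((boundedMeasurable.measurable f).comp measurable_fst).norm
    have hfi : Integrable (fun p : X × X => ‖(f : X → ℂ) p.1‖) ν :=
      integrable_of_bound hfm fun p => by rw [norm_norm]; exact hD _
    calc _ ≤ ∫ p, C * ‖(f : X → ℂ) p.1‖ ∂ν := by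
          refine norm_integral_le_of_norm_le (hfi.const_mul _) (Eventually.of_forall fun p => ?_)
          rw [norm_mul, mul_comm]
          exact mul_le_mul_of_nonneg_right (hC _) (norm_nonneg _)
      _ ≤ _ := by
          rw [integral_const_mul]
          refine mul_le_mul_of_nonneg_left ?_ hC0
          refine Real.le_sqrt_of_sq_le ?_
          rw [← hν.integral_fst ((boundedMeasurable.measurable f).norm.pow_const 2)]
          exact sq_integral_le hfm (C := D) fun p => by rw [abs_norm]; exact hD _
  have h2 : ‖inner ℂ ξ (l f (r g ξ))‖ ≤ C * √(∫ x, ‖(f : X → ℂ) x‖ ^ 2 ∂μ) := by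
    have e : inner ℂ ξ (l f (r g ξ)) = inner ℂ (l (star f) ξ) (r g ξ) := by
      rw [map_star, ContinuousLinearMap.star_eq_adjoint, ContinuousLinearMap.adjoint_inner_left]
    have e1 : ‖l (star f) ξ‖ = √(∫ x, ‖(f : X → ℂ) x‖ ^ 2 ∂μ) := by
      rw [← Real.sqrt_sq (norm_nonneg (l (star f) ξ)), hp.norm_left_sq]
      congr 1
      refine integral_congr_ae (Eventually.of_forall fun x => ?_)
      change ‖star ((f : X → ℂ) x)‖ ^ 2 = _
      rw [norm_star]
    have e2 : ‖r g ξ‖ ≤ C := by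
      refine le_of_sq_le_sq ?_ hC0
      rw [hp.norm_right_sq]
      calc _ ≤ ∫ _, C ^ 2 ∂μ := by
            refine integral_mono_of_nonneg (Eventually.of_forall fun x => sq_nonneg _)
              (integrable_const _) (Eventually.of_forall fun x => ?_)
            exact pow_le_pow_left₀ (norm_nonneg _) (hC x) 2
        _ = C ^ 2 := by simp
    rw [e]
    refine (norm_inner_le_norm _ _).trans ?_
    rw [e1, mul_comm]
    exact mul_le_mul_of_nonneg_right e2 (Real.sqrt_nonneg _)
  refine (norm_sub_le _ _).trans ?_
  linarith

variable [StandardBorelSpace X]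

theorem star_coordOp : star (coordOp l r) = l (coordFun X) - Complex.I • r (coordFun X) := by
  rw [coordOp, star_add, star_smul, ← map_star, ← map_star, star_coordFun, Complex.star_def,
    Complex.conj_I, neg_smul, sub_eq_add_neg]

theorem isStarNormal_coordOp : IsStarNormal (coordOp l r) := by
  rw [isStarNormal_iff, hp.star_coordOp, coordOp]
  have h1 : Commute (l (coordFun X)) (Complex.I • r (coordFun X)) :=
    (hp.commute _ _).smul_right _
  exact ((Commute.refl _).add_right h1).sub_left (h1.symm.add_right (Commute.refl _))

/-- The images of the real coordinate are self-adjoint and commute, so they are the real and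
imaginary parts of the normal operator. Its functional calculus is therefore a joint calculus for
the two actions. -/
theorem cfc_re : cfc (fun z => (z.re : ℂ)) (coordOp l r) = l (coordFun X) := by
  have hN := hp.isStarNormal_coordOp
  have e : (fun z : ℂ => (z.re : ℂ)) = fun z => (1 / 2 : ℂ) * (z + star z) := by
    funext z
    rw [Complex.star_def, Complex.add_conj]
    push_cast
    ring
  rw [e, cfc_const_mul (1 / 2 : ℂ) (fun z : ℂ => z + star z) _ (by fun_prop),
    cfc_add (coordOp l r) (fun z : ℂ => z) (fun z => star z) (by fun_prop) (by fun_prop),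
    cfc_id' ℂ _, cfc_star_id _,
    hp.star_coordOp, coordOp, add_add_sub_cancel, ← two_smul ℂ (l (coordFun X)), smul_smul]
  norm_num

theorem cfc_im : cfc (fun z => (z.im : ℂ)) (coordOp l r) = r (coordFun X) := by
  have hN := hp.isStarNormal_coordOp
  have e : (fun z : ℂ => (z.im : ℂ)) = fun z => (-Complex.I / 2 : ℂ) * (z - star z) := by
    funext z
    rw [Complex.star_def, Complex.sub_conj]
    push_cast
    linear_combination (z.im : ℂ) * Complex.I_sq
  rw [e, cfc_const_mul (-Complex.I / 2 : ℂ) (fun z : ℂ => z - star z) _ (by fun_prop),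
    cfc_sub (fun z : ℂ => z) (fun z => star z) (coordOp l r) (by fun_prop) (by fun_prop),
    cfc_id' ℂ _, cfc_star_id _, hp.star_coordOp, coordOp, add_sub_sub_cancel,
    ← two_smul ℂ, smul_smul, smul_smul]
  rw [show -Complex.I / 2 * 2 * Complex.I = 1 by linear_combination -Complex.I_sq, one_smul]

theorem cfc_polynomial_re (p : Polynomial ℂ) :
    cfc (fun z => p.eval (z.re : ℂ)) (coordOp l r) = l (Polynomial.aeval (coordFun X) p) := by
  rw [cfc_map_polynomial p (fun z => (z.re : ℂ)) _ hp.isStarNormal_coordOp (by fun_prop),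
    hp.cfc_re]
  exact Polynomial.aeval_algHom_apply l.toAlgHom _ _

theorem cfc_polynomial_im (p : Polynomial ℂ) :
    cfc (fun z => p.eval (z.im : ℂ)) (coordOp l r) = r (Polynomial.aeval (coordFun X) p) := by
  rw [cfc_map_polynomial p (fun z => (z.im : ℂ)) _ hp.isStarNormal_coordOp (by fun_prop),
    hp.cfc_im]
  exact Polynomial.aeval_algHom_apply r.toAlgHom _ _

/-- A vector state whose polynomial moments are those of the coordinate has the distribution of
the coordinate. -/
theorem map_eq_of_moments {σ : Measure ℂ} [IsFiniteMeasure σ] {a : ℂ → ℝ} (ha : Continuous a)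
    {R : ℝ} (hR : 1 ≤ R) (hσ : ∀ᵐ z ∂σ, |a z| ≤ R)
    (h : ∀ p : Polynomial ℂ, ∫ z, p.eval (a z : ℂ) ∂σ = ∫ x, p.eval (realCoord X x : ℂ) ∂μ) :
    σ.map a = μ.map (realCoord X) := by
  have ham := ha.measurable
  refine measure_eq_of_polynomial (R := R) ?_ ?_ fun p => ?_
  · refine (ae_map_iff (p := (· ∈ Set.Icc (-R) R)) ham.aemeasurable measurableSet_Icc).2 ?_
    exact hσ.mono fun z hz => abs_le.1 hz
  · refine (ae_map_iff (p := (· ∈ Set.Icc (-R) R)) measurable_realCoord.aemeasurable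
      measurableSet_Icc).2 ?_
    exact Eventually.of_forall fun x =>
      ⟨by linarith [(realCoord_mem x).1], (realCoord_mem x).2.trans hR⟩
  · rw [integral_map ham.aemeasurable p.continuous.aestronglyMeasurable,
      integral_map measurable_realCoord.aemeasurable p.continuous.aestronglyMeasurable]
    have e : ∀ s : ℝ, (p.map Complex.ofRealHom).eval (s : ℂ) = ((p.eval s : ℝ) : ℂ) := fun s => by
      rw [Polynomial.eval_map, ← Complex.ofRealHom_eq_coe, Polynomial.eval₂_hom]; rfl
    have := h (p.map Complex.ofRealHom)
    simp_rw [e] at this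
    rw [integral_complex_ofReal, integral_complex_ofReal] at this
    exact Complex.ofReal_injective this

/-- The real and imaginary parts of the spectral measure at `ξ` have the same moments as the
coordinate under `μ`, hence the same distribution. The spectral measure is therefore carried by the
image of `X × X` in the plane and pulls back to a coupling. -/
theorem exists_isSpectralCoupling : ∃ ν, IsSpectralCoupling μ l r ξ ν := by
  have hX : Nonempty X := nonempty_of_isProbabilityMeasure μ
  obtain ⟨g, hg, hgt⟩ := exists_measurable_leftInverse_realCoord (X := X)
  have hN := hp.isStarNormal_coordOp
  obtain ⟨σ, hσ, hspec, H⟩ := exists_spectralMeasure (coordOp l r) hN ξ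
  -- `R` bounds the spectrum; the summand `1` also ensures that `[-R, R]` contains the range of the
  -- coordinate.
  set R := ‖coordOp l r‖ * ‖(1 : K →L[ℂ] K)‖ + 1
  have hR : 1 ≤ R := by
    have : 0 ≤ ‖coordOp l r‖ * ‖(1 : K →L[ℂ] K)‖ := by positivity
    linarith
  have hb : ∀ᵐ z ∂σ, ‖z‖ ≤ R := hspec.mono fun z hz =>
    (spectrum.norm_le_norm_mul_of_mem hz).trans (by linarith)
  have hre : σ.map Complex.re = μ.map (realCoord X) := by
    refine hp.map_eq_of_moments Complex.continuous_re hR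
      (hb.mono fun z hz => (Complex.abs_re_le_norm z).trans hz) fun p => ?_
    rw [H _ (by fun_prop), hp.cfc_polynomial_re, hp.inner_left]
    simp_rw [coe_aeval_coordFun]
  have him : σ.map Complex.im = μ.map (realCoord X) := by
    refine hp.map_eq_of_moments Complex.continuous_im hR
      (hb.mono fun z hz => (Complex.abs_im_le_norm z).trans hz) fun p => ?_
    rw [H _ (by fun_prop), hp.cfc_polynomial_im, hp.inner_right]
    simp_rw [coe_aeval_coordFun]
  have hset : MeasurableSet {s : ℝ | realCoord X (g s) = s} :=
    measurableSet_eq_fun (measurable_realCoord.comp hg) measurable_id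
  have hinv : ∀ᵐ s ∂(μ.map (realCoord X)), realCoord X (g s) = s := by
    refine (ae_map_iff (p := fun s => realCoord X (g s) = s) measurable_realCoord.aemeasurable
      hset).2 (Eventually.of_forall fun x => ?_)
    rw [hgt]
  have hre' : ∀ᵐ z ∂σ, realCoord X (g z.re) = z.re :=
    ae_of_ae_map Complex.measurable_re.aemeasurable (hre ▸ hinv)
  have him' : ∀ᵐ z ∂σ, realCoord X (g z.im) = z.im :=
    ae_of_ae_map Complex.measurable_im.aemeasurable (him ▸ hinv)
  have hm : Measurable fun z : ℂ => (g z.re, g z.im) :=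
    (hg.comp Complex.measurable_re).prodMk (hg.comp Complex.measurable_im)
  have hμ : (μ.map (realCoord X)).map g = μ := by
    rw [Measure.map_map hg measurable_realCoord]
    convert Measure.map_id
    exact funext hgt
  have hfst : (σ.map fun z : ℂ => (g z.re, g z.im)).map Prod.fst = μ := by
    rw [Measure.map_map measurable_fst hm, ← hμ, ← hre, Measure.map_map hg Complex.measurable_re]
    rfl
  refine ⟨σ.map fun z => (g z.re, g z.im), ⟨⟨?_⟩, hfst, ?_⟩, fun h hh => ?_⟩
  · rw [← Set.preimage_univ (f := Prod.fst), ← Measure.map_apply measurable_fst MeasurableSet.univ,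
      hfst, measure_univ]
  · rw [Measure.map_map measurable_snd hm]
    conv_rhs => rw [← hμ, ← him, Measure.map_map hg Complex.measurable_im]
    rfl
  · rw [integral_map (f := fun p => h (coordPoint p)) hm.aemeasurable
      (hh.measurable.comp measurable_coordPoint).aestronglyMeasurable, ← H h hh]
    refine integral_congr_ae ?_
    filter_upwards [hre', him'] with z h1 h2
    simp only [coordPoint, h1, h2]

end IsTracialPair

namespace IsSpectralCoupling

variable [StandardBorelSpace X] {ν : Measure (X × X)} (hν : IsSpectralCoupling μ l r ξ ν)
  (hp : IsTracialPair μ l r ξ)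
include hν hp

theorem norm_cfc_sq {h : ℂ → ℂ} (hh : Continuous h) :
    ‖cfc h (coordOp l r) ξ‖ ^ 2 = ∫ p, ‖h (coordPoint p)‖ ^ 2 ∂ν := by
  have hN := hp.isStarNormal_coordOp
  have h1 := hν.integral_cfc (fun z => star (h z) * h z) (by fun_prop)
  rw [cfc_mul (fun z => star (h z)) h _ (by fun_prop) (by fun_prop), cfc_star,
    inner_star_mul_self] at h1
  apply Complex.ofReal_injective
  rw [← h1, ← integral_complex_ofReal]
  refine integral_congr_ae (Eventually.of_forall fun p => ?_)
  change (starRingEnd ℂ) (h _) * h _ = _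
  rw [← Complex.normSq_eq_conj_mul_self, Complex.normSq_eq_norm_sq]

/-- The spectral isometry is applied to the function `z ↦ Re z - Im z`, whose value at the normal
operator is the difference of the two actions of the coordinate. -/
theorem diagEnergy_eq : diagEnergy ν = ‖l (coordFun X) ξ - r (coordFun X) ξ‖ ^ 2 := by
  have hN := hp.isStarNormal_coordOp
  have h1 := hν.norm_cfc_sq hp (h := fun z => (z.re : ℂ) - (z.im : ℂ)) (by fun_prop)
  rw [cfc_sub (fun z => (z.re : ℂ)) (fun z => (z.im : ℂ)) _ (by fun_prop) (by fun_prop), hp.cfc_re,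
    hp.cfc_im, sub_apply] at h1
  rw [h1, diagEnergy]
  refine integral_congr_ae (Eventually.of_forall fun p => ?_)
  simp only [coordPoint]
  rw [← Complex.ofReal_sub, Complex.norm_real, Real.norm_eq_abs, sq_abs]

/-- The spectral couplings depend continuously on the vector. -/
theorem tvLe {ξ' : K} {ν' : Measure (X × X)} (hν' : IsSpectralCoupling μ l r ξ' ν')
    (hp' : IsTracialPair μ l r ξ') : TVLe ν' ν (2 * ‖ξ' - ξ‖) := by
  have := hν.isProbabilityMeasure
  have := hν'.isProbabilityMeasure
  have hX : Nonempty X := nonempty_of_isProbabilityMeasure μ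
  obtain ⟨g, hg, hgt⟩ := exists_measurable_leftInverse_realCoord (X := X)
  have hc : TVLe (ν'.map coordPoint) (ν.map coordPoint) (2 * ‖ξ' - ξ‖) := by
    refine tvLe_of_continuous fun f hf h1 => ?_
    rw [integral_map measurable_coordPoint.aemeasurable hf.aestronglyMeasurable,
      integral_map measurable_coordPoint.aemeasurable hf.aestronglyMeasurable,
      ← Real.norm_eq_abs, ← Complex.norm_real, Complex.ofReal_sub, ← integral_complex_ofReal,
      ← integral_complex_ofReal, hν.integral_cfc (fun z => (f z : ℂ)) (by fun_prop),
      hν'.integral_cfc (fun z => (f z : ℂ)) (by fun_prop)]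
    set A := cfc (fun z => (f z : ℂ)) (coordOp l r)
    -- Both measures come from the same operator, so a test function enters only through a
    -- contraction; each of the two unit vectors contributes one `‖ξ' - ξ‖`.
    have hA : ‖A‖ ≤ 1 := norm_cfc_le zero_le_one fun z _ => by simpa using h1 z
    have hAv : ∀ v, ‖A v‖ ≤ ‖v‖ := fun v => by
      simpa using (A.le_opNorm v).trans (mul_le_mul_of_nonneg_right hA (norm_nonneg v))
    have e : inner ℂ ξ' (A ξ') - inner ℂ ξ (A ξ) =
        inner ℂ (ξ' - ξ) (A ξ') + inner ℂ ξ (A (ξ' - ξ)) := by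
      rw [map_sub, inner_sub_left, inner_sub_right]; ring
    rw [e]
    refine (norm_add_le _ _).trans ?_
    have h2 := (norm_inner_le_norm (𝕜 := ℂ) (ξ' - ξ) (A ξ')).trans
      (mul_le_mul_of_nonneg_left (hAv ξ') (norm_nonneg _))
    have h3 := (norm_inner_le_norm (𝕜 := ℂ) ξ (A (ξ' - ξ))).trans
      (mul_le_mul_of_nonneg_left (hAv _) (norm_nonneg _))
    rw [hp'.norm_eq_one, mul_one] at h2
    rw [hp.norm_eq_one, one_mul] at h3
    linarith
  have hG : Measurable fun z : ℂ => (g z.re, g z.im) :=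
    (hg.comp Complex.measurable_re).prodMk (hg.comp Complex.measurable_im)
  have h := hc.map hG
  have hid : (fun z : ℂ => (g z.re, g z.im)) ∘ (coordPoint : X × X → ℂ) = id := by
    funext p
    simp [coordPoint, hgt]
  rwa [Measure.map_map hG measurable_coordPoint, Measure.map_map hG measurable_coordPoint, hid,
    Measure.map_id, Measure.map_id] at h

/-- The integral of `f ⊗ g` against the spectral coupling. -/
theorem integral_mul_eq_inner (f g : boundedMeasurable X) :
    ∫ p, (f : X → ℂ) p.1 * (g : X → ℂ) p.2 ∂ν = inner ℂ ξ (l f (r g ξ)) := by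
  have := hν.isProbabilityMeasure
  have hN := hp.isStarNormal_coordOp
  have hi : ∀ f g : boundedMeasurable X,
      Integrable (fun p : X × X => (f : X → ℂ) p.1 * (g : X → ℂ) p.2) ν := fun f g => by
    obtain ⟨C, hC0, hC⟩ := boundedMeasurable.exists_bound f
    obtain ⟨D, hD0, hD⟩ := boundedMeasurable.exists_bound g
    refine integrable_of_bound (((boundedMeasurable.measurable f).comp measurable_fst).mul
      ((boundedMeasurable.measurable g).comp measurable_snd)) (C := C * D) fun p => ?_
    rw [norm_mul]
    exact mul_le_mul (hC _) (hD _) (norm_nonneg _) hC0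
  -- The defect of the identity is additive and `L²` continuous in each variable and vanishes on
  -- pairs of polynomials. It is killed first in `f`, then in `g`; continuity in `g` comes from the
  -- flipped coupling.
  let D₁ : boundedMeasurable X → boundedMeasurable X →+ ℂ := fun g => AddMonoidHom.mk'
    (fun f => (∫ p, (f : X → ℂ) p.1 * (g : X → ℂ) p.2 ∂ν) - inner ℂ ξ (l f (r g ξ)))
    (fun f f' => by
      have e : ∀ p : X × X, ((f + f' : boundedMeasurable X) : X → ℂ) p.1 * (g : X → ℂ) p.2 =
          (f : X → ℂ) p.1 * (g : X → ℂ) p.2 + (f' : X → ℂ) p.1 * (g : X → ℂ) p.2 := fun p =>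
        add_mul _ _ _
      simp_rw [e]
      rw [integral_add (hi _ _) (hi _ _), map_add, add_apply, inner_add_right]
      ring)
  let D₂ : boundedMeasurable X → boundedMeasurable X →+ ℂ := fun f => AddMonoidHom.mk'
    (fun g => (∫ p, (f : X → ℂ) p.1 * (g : X → ℂ) p.2 ∂ν) - inner ℂ ξ (l f (r g ξ)))
    (fun g g' => by
      have e : ∀ p : X × X, (f : X → ℂ) p.1 * ((g + g' : boundedMeasurable X) : X → ℂ) p.2 =
          (f : X → ℂ) p.1 * (g : X → ℂ) p.2 + (f : X → ℂ) p.1 * (g' : X → ℂ) p.2 := fun p =>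
        mul_add _ _ _
      simp_rw [e]
      rw [integral_add (hi _ _) (hi _ _), map_add, add_apply, map_add, inner_add_right]
      ring)
  have hsw : IsCoupling μ (ν.map Prod.swap) :=
    { isProbabilityMeasure := Measure.isProbabilityMeasure_map measurable_swap.aemeasurable
      map_fst := by
        rw [Measure.map_map measurable_fst measurable_swap]; exact hν.map_snd
      map_snd := by
        rw [Measure.map_map measurable_snd measurable_swap]; exact hν.map_fst }
  have hpoly : ∀ P Q : Polynomial ℂ, D₁ (Polynomial.aeval (coordFun X) Q)
      (Polynomial.aeval (coordFun X) P) = 0 := fun P Q => by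
    have h := hν.integral_cfc (fun z => P.eval (z.re : ℂ) * Q.eval (z.im : ℂ)) (by fun_prop)
    rw [cfc_mul (fun z => P.eval (z.re : ℂ)) (fun z => Q.eval (z.im : ℂ)) _ (by fun_prop)
      (by fun_prop), hp.cfc_polynomial_re, hp.cfc_polynomial_im] at h
    change (∫ p, _ ∂ν) - _ = (0 : ℂ)
    simp_rw [coe_aeval_coordFun]
    rw [sub_eq_zero]
    exact h
  have h1 : ∀ (Q : Polynomial ℂ) f, D₁ (Polynomial.aeval (coordFun X) Q) f = 0 := fun Q f => by
    obtain ⟨C, -, hC⟩ := boundedMeasurable.exists_bound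
      (Polynomial.aeval (coordFun X) Q : boundedMeasurable X)
    exact eq_zero_of_polynomial (μ := μ) _
      (fun f => hp.norm_integral_sub_inner_le hν.toIsCoupling f _ hC) (fun P => hpoly P Q) f
  have h2 : D₂ f g = 0 := by
    obtain ⟨C, -, hC⟩ := boundedMeasurable.exists_bound f
    refine eq_zero_of_polynomial (μ := μ) (C := 2 * C) _ (fun g => ?_) (fun Q => h1 Q f) g
    have h3 := hp.symm.norm_integral_sub_inner_le hsw g f hC
    rw [integral_map (f := fun p : X × X => (g : X → ℂ) p.1 * (f : X → ℂ) p.2)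
      measurable_swap.aemeasurable (((boundedMeasurable.measurable g).comp
      measurable_fst).mul ((boundedMeasurable.measurable f).comp
        measurable_snd)).aestronglyMeasurable] at h3
    have e : l f (r g ξ) = r g (l f ξ) := DFunLike.congr_fun (hp.commute f g).eq ξ
    change ‖(∫ p, (f : X → ℂ) p.1 * (g : X → ℂ) p.2 ∂ν) - inner ℂ ξ (l f (r g ξ))‖ ≤ _
    rw [e]
    simp_rw [mul_comm ((f : X → ℂ) _)]
    exact h3
  exact sub_eq_zero.1 h2

/-- There is a vector on which the two representations agree whose distance to `ξ` is controlled
by the mass of the complement of the diagonal. -/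
theorem exists_central : ∃ η : K, (∀ f, l f η = r f η) ∧
    ‖η - ξ‖ ^ 2 ≤ ν.real (Set.diagonal X)ᶜ := by
  have := hν.isProbabilityMeasure
  have hN := hp.isStarNormal_coordOp
  set N := coordOp l r with hNdef
  -- Continuous functions decreasing to the indicator of the line `Re z = Im z`, so that `Φ k (N) ξ`
  -- converges to the spectral projection of the diagonal applied to `ξ`.
  set Φ : ℕ → ℂ → ℝ := fun k z => max 0 (1 - k * |z.re - z.im|) with hΦ
  have hΦc : ∀ k, Continuous (Φ k) := fun k => by fun_prop
  have hΦ0 : ∀ k z, 0 ≤ Φ k z := fun k z => le_max_left _ _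
  have hΦ1 : ∀ k z, Φ k z ≤ 1 := fun k z => max_le zero_le_one (by
    have : 0 ≤ (k : ℝ) * |z.re - z.im| := by positivity
    linarith)
  have hΦa : ∀ {k m} z, k ≤ m → Φ m z ≤ Φ k z := fun {k m} z hkm => by
    refine max_le_max le_rfl ?_
    have : (k : ℝ) * |z.re - z.im| ≤ m * |z.re - z.im| :=
      mul_le_mul_of_nonneg_right (by exact_mod_cast hkm) (abs_nonneg _)
    linarith
  have hΦd : ∀ k z, z.re = z.im → Φ k z = 1 := fun k z h => by simp [hΦ, h]
  have hdiag : ∀ p : X × X, (coordPoint p).re = (coordPoint p).im ↔ p ∈ Set.diagonal X := fun p =>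
    measurableEmbedding_realCoord.injective.eq_iff
  set ζ : ℕ → K := fun k => cfc (fun z => (Φ k z : ℂ)) N ξ with hζ
  set I : X × X → ℝ := (Set.diagonal X).indicator fun _ => 1 with hI
  have hIm : Measurable I := measurable_const.indicator measurableSet_diagonal
  have hI1 : ∀ k p, I p ≤ Φ k (coordPoint p) := fun k p => by
    by_cases h : p ∈ Set.diagonal X
    · rw [hΦd k _ ((hdiag p).2 h), hI, Set.indicator_of_mem h]
    · rw [hI, Set.indicator_of_notMem h]; exact hΦ0 _ _
  have hI0 : ∀ p, 0 ≤ I p := fun p => Set.indicator_nonneg (fun _ _ => zero_le_one) p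
  have hsub : ∀ k m, ‖ζ k - ζ m‖ ^ 2 = ∫ p, (Φ k (coordPoint p) - Φ m (coordPoint p)) ^ 2 ∂ν := by
    intro k m
    have h := hν.norm_cfc_sq hp (h := fun z => (Φ k z : ℂ) - (Φ m z : ℂ)) (by fun_prop)
    rw [cfc_sub (fun z => (Φ k z : ℂ)) (fun z => (Φ m z : ℂ)) _ (by fun_prop) (by fun_prop),
      sub_apply] at h
    refine h.trans (integral_congr_ae (Eventually.of_forall fun p => ?_))
    simp only
    rw [← Complex.ofReal_sub, Complex.norm_real, Real.norm_eq_abs, sq_abs]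
  have hb : Tendsto (fun k => ∫ p, (Φ k (coordPoint p) - I p) ^ 2 ∂ν) atTop (𝓝 0) := by
    have h := tendsto_integral_of_dominated_convergence (μ := ν)
      (F := fun k p => (Φ k (coordPoint p) - I p) ^ 2) (f := fun _ => 0) (fun _ => (1 : ℝ))
      (fun k => ((((hΦc k).measurable.comp measurable_coordPoint).sub
        hIm).pow_const 2).aestronglyMeasurable) (integrable_const _)
      (fun k => Eventually.of_forall fun p => by
        rw [Real.norm_eq_abs, abs_of_nonneg (sq_nonneg _), sq_le_one_iff_abs_le_one, abs_le]
        constructor <;> linarith [hI1 k p, hI0 p, hΦ1 k (coordPoint p)])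
      (Eventually.of_forall fun p => ?_)
    · simpa using h
    · by_cases hpd : p ∈ Set.diagonal X
      · have e : ∀ k, (Φ k (coordPoint p) - I p) ^ 2 = 0 := fun k => by
          rw [hΦd k _ ((hdiag p).2 hpd), hI, Set.indicator_of_mem hpd]; simp
        simp_rw [e]
        exact tendsto_const_nhds
      · have hne : 0 < |(coordPoint p).re - (coordPoint p).im| :=
          abs_pos.2 (sub_ne_zero.2 fun h => hpd ((hdiag p).1 h))
        refine tendsto_const_nhds.congr' ?_
        obtain ⟨m, hm⟩ := exists_nat_gt (1 / |(coordPoint p).re - (coordPoint p).im|)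
        filter_upwards [eventually_ge_atTop m] with k hk
        have h1 : 1 ≤ (k : ℝ) * |(coordPoint p).re - (coordPoint p).im| := by
          rw [← div_le_iff₀ hne]
          exact hm.le.trans (by exact_mod_cast hk)
        have h2 : Φ k (coordPoint p) = 0 := max_eq_left (by linarith)
        rw [h2, hI, Set.indicator_of_notMem hpd]
        simp
  have hcauchy : CauchySeq ζ := by
    refine cauchySeq_of_le_tendsto_0 (fun k => √(∫ p, (Φ k (coordPoint p) - I p) ^ 2 ∂ν))
      (fun n m k hn hm => ?_) (by simpa [Function.comp_def] using (Real.continuous_sqrt.tendsto _).comp hb)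
    rw [dist_eq_norm]
    refine Real.le_sqrt_of_sq_le ?_
    rw [hsub]
    refine integral_mono_of_nonneg (Eventually.of_forall fun p => sq_nonneg _)
      (integrable_of_bound ((((hΦc k).measurable.comp measurable_coordPoint).sub
        hIm).pow_const 2) (C := 1) fun p => ?_) (Eventually.of_forall fun p => ?_)
    · rw [Real.norm_eq_abs, abs_of_nonneg (sq_nonneg _), sq_le_one_iff_abs_le_one, abs_le]
      constructor <;> linarith [hI1 k p, hI0 p, hΦ1 k (coordPoint p)]
    · refine sq_le_sq' ?_ ?_ <;>
        linarith [hI1 n p, hI1 m p, hΦa (coordPoint p) hn, hΦa (coordPoint p) hm]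
  obtain ⟨η, hη⟩ := cauchySeq_tendsto_of_complete hcauchy
  have hcontr : ∀ k (v : K), ‖cfc (fun z => (Φ k z : ℂ)) N v‖ ≤ ‖v‖ := fun k v => by
    have hA : ‖cfc (fun z => (Φ k z : ℂ)) N‖ ≤ 1 := norm_cfc_le zero_le_one fun z _ => by
      rw [Complex.norm_real, Real.norm_eq_abs, abs_of_nonneg (hΦ0 _ _)]; exact hΦ1 _ _
    simpa using ((cfc (fun z => (Φ k z : ℂ)) N).le_opNorm v).trans
      (mul_le_mul_of_nonneg_right hA (norm_nonneg v))
  have hlcomm : ∀ f f', Commute (l f) (l f') := fun f f' => by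
    change l f * l f' = l f' * l f
    rw [← map_mul, ← map_mul, mul_comm]
  have hrcomm : ∀ f f', Commute (r f) (r f') := fun f f' => by
    change r f * r f' = r f' * r f
    rw [← map_mul, ← map_mul, mul_comm]
  have hNl : ∀ f k, Commute (cfc (fun z => (Φ k z : ℂ)) N) (l f) := fun f k => by
    refine Commute.cfc ?_ ?_ _
    · rw [hNdef, coordOp]
      exact (hlcomm _ _).add_left ((hp.commute f _).symm.smul_left _)
    · rw [hNdef, hp.star_coordOp]
      exact (hlcomm _ _).sub_left ((hp.commute f _).symm.smul_left _)
  have hNr : ∀ f k, Commute (cfc (fun z => (Φ k z : ℂ)) N) (r f) := fun f k => by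
    refine Commute.cfc ?_ ?_ _
    · rw [hNdef, coordOp]
      exact (hp.commute _ f).add_left ((hrcomm _ _).smul_left _)
    · rw [hNdef, hp.star_coordOp]
      exact (hp.commute _ f).sub_left ((hrcomm _ _).smul_left _)
  -- The contractions `Φ k (N)` commute with both actions. Hence `η` inherits the `L²` bounds of
  -- `ξ`, which allows equality of the two actions to be extended from polynomials.
  have hlη : ∀ f, ‖l f η‖ ≤ ‖l f ξ‖ := fun f => by
    refine le_of_tendsto (((l f).continuous.tendsto η).comp hη).norm
      (Eventually.of_forall fun k => ?_)
    have e : l f (ζ k) = cfc (fun z => (Φ k z : ℂ)) N (l f ξ) :=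
      (DFunLike.congr_fun (hNl f k).eq ξ).symm
    simp only [Function.comp, e]
    exact hcontr _ _
  have hrη : ∀ f, ‖r f η‖ ≤ ‖r f ξ‖ := fun f => by
    refine le_of_tendsto (((r f).continuous.tendsto η).comp hη).norm
      (Eventually.of_forall fun k => ?_)
    have e : r f (ζ k) = cfc (fun z => (Φ k z : ℂ)) N (r f ξ) :=
      (DFunLike.congr_fun (hNr f k).eq ξ).symm
    simp only [Function.comp, e]
    exact hcontr _ _
  have hcoord : l (coordFun X) η = r (coordFun X) η := by
    have h1 : Tendsto (fun k => (l (coordFun X) - r (coordFun X)) (ζ k)) atTop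
        (𝓝 ((l (coordFun X) - r (coordFun X)) η)) :=
      ((l (coordFun X) - r (coordFun X)).continuous.tendsto η).comp hη
    -- `Φ k` vanishes as soon as `|Re z - Im z| ≥ 1 / k`, so the product `(Re z - Im z) Φ k` is at
    -- most `1 / k` in modulus.
    have h2 : Tendsto (fun k => (l (coordFun X) - r (coordFun X)) (ζ k)) atTop (𝓝 0) := by
      refine squeeze_zero_norm' (a := fun k : ℕ => 1 / (k : ℝ)) ?_ tendsto_one_div_atTop_nhds_zero_nat
      filter_upwards [eventually_gt_atTop 0] with k hk
      have hk' : (0 : ℝ) < k := by exact_mod_cast hk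
      have e : (l (coordFun X) - r (coordFun X)) (ζ k) =
          cfc (fun z => ((z.re : ℂ) - (z.im : ℂ)) * (Φ k z : ℂ)) N ξ := by
        rw [cfc_mul (fun z => (z.re : ℂ) - (z.im : ℂ)) (fun z => (Φ k z : ℂ)) _ (by fun_prop)
          (by fun_prop), cfc_sub (fun z => (z.re : ℂ)) (fun z => (z.im : ℂ)) _ (by fun_prop)
          (by fun_prop), hp.cfc_re, hp.cfc_im]
        rfl
      rw [e]
      have hA : ‖cfc (fun z => ((z.re : ℂ) - (z.im : ℂ)) * (Φ k z : ℂ)) N‖ ≤ 1 / (k : ℝ) := by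
        refine norm_cfc_le (by positivity) fun z _ => ?_
        rw [norm_mul, ← Complex.ofReal_sub, Complex.norm_real, Complex.norm_real,
          Real.norm_eq_abs, Real.norm_eq_abs, abs_of_nonneg (hΦ0 _ _), le_div_iff₀ hk']
        rcases le_total (1 - k * |z.re - z.im|) 0 with h | h
        · rw [show Φ k z = 0 from max_eq_left h]; simp
        · have h3 : |z.re - z.im| * k ≤ 1 := by linarith
          calc _ = |z.re - z.im| * k * Φ k z := by ring
            _ ≤ 1 * 1 := mul_le_mul h3 (hΦ1 _ _) (hΦ0 _ _) zero_le_one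
            _ = 1 := one_mul 1
      refine ((ContinuousLinearMap.le_opNorm _ ξ).trans
        (mul_le_mul_of_nonneg_right hA (norm_nonneg _))).trans ?_
      rw [hp.norm_eq_one, mul_one]
    exact sub_eq_zero.1 (tendsto_nhds_unique h1 h2)
  have hpoly : ∀ P : Polynomial ℂ, l (Polynomial.aeval (coordFun X) P) η =
      r (Polynomial.aeval (coordFun X) P) η := by
    intro P
    induction P using Polynomial.induction_on' with
    | add P Q hP hQ => rw [map_add, map_add, map_add, add_apply, add_apply, hP, hQ]
    | monomial n c =>
      have h3 : ∀ n, l (coordFun X ^ n) η = r (coordFun X ^ n) η := by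
        intro n
        induction n with
        | zero => rw [pow_zero, map_one, map_one]
        | succ n ih =>
          have e1 : l (coordFun X ^ (n + 1)) η = l (coordFun X ^ n) (l (coordFun X) η) := by
            rw [pow_succ, map_mul]; rfl
          have e2 : r (coordFun X ^ (n + 1)) η = r (coordFun X) (r (coordFun X ^ n) η) := by
            rw [pow_succ', map_mul]; rfl
          rw [e1, e2, hcoord, ← ih]
          exact DFunLike.congr_fun (hp.commute _ _).eq η
      rw [Polynomial.aeval_monomial, ← Algebra.smul_def, map_smul, map_smul, smul_apply,
        smul_apply, h3]
  refine ⟨η, fun f => ?_, ?_⟩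
  · let D : boundedMeasurable X →+ K := AddMonoidHom.mk' (fun f => l f η - r f η) fun f f' => by
      rw [map_add, map_add, add_apply, add_apply]; abel
    refine sub_eq_zero.1 (eq_zero_of_polynomial (μ := μ) (C := 1 + 1) D (fun f => ?_)
      (fun P => sub_eq_zero.2 (hpoly P)) f)
    have e1 : ‖l f ξ‖ = √(∫ x, ‖(f : X → ℂ) x‖ ^ 2 ∂μ) := by
      rw [← hp.norm_left_sq, Real.sqrt_sq (norm_nonneg _)]
    have e2 : ‖r f ξ‖ = √(∫ x, ‖(f : X → ℂ) x‖ ^ 2 ∂μ) := by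
      rw [← hp.norm_right_sq, Real.sqrt_sq (norm_nonneg _)]
    refine (norm_sub_le _ _).trans ?_
    rw [add_mul, one_mul]
    exact add_le_add ((hlη f).trans e1.le) ((hrη f).trans e2.le)
  · refine le_of_tendsto ((hη.sub_const ξ).norm.pow 2) (Eventually.of_forall fun k => ?_)
    -- `Φ 0` is constantly `1`, so `‖ζ k - ξ‖` is an instance of the formula for `‖ζ k - ζ m‖`.
    have e0 : ζ 0 = ξ := by
      have : (fun z => (Φ 0 z : ℂ)) = fun _ => (1 : ℂ) := by
        funext z; simp [hΦ]
      rw [hζ]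
      dsimp only
      rw [this, cfc_const_one ℂ N]
      rfl
    have h4 := hsub k 0
    rw [e0] at h4
    rw [h4, ← integral_indicator_one measurableSet_diagonal.compl]
    refine integral_mono_of_nonneg (Eventually.of_forall fun p => sq_nonneg _)
      ((integrable_const (1 : ℝ)).indicator measurableSet_diagonal.compl)
      (Eventually.of_forall fun p => ?_)
    have e3 : Φ 0 (coordPoint p) = 1 := by simp [hΦ]
    simp only [e3]
    by_cases hpd : p ∈ Set.diagonal X
    · rw [hΦd k _ ((hdiag p).2 hpd), Set.indicator_of_notMem (by simpa using hpd)]; simp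
    · rw [Set.indicator_of_mem (by simpa using hpd), Pi.one_apply, sq_le_one_iff_abs_le_one, abs_le]
      constructor <;> linarith [hΦ0 k (coordPoint p), hΦ1 k (coordPoint p)]

end IsSpectralCoupling

end TracialPair

/-! ### Couplings from bimodules over the crossed product -/

section BimoduleCoupling

variable {X : Type u} [MeasurableSpace X]

theorem boundedMeasurable.memLp (f : boundedMeasurable X) (μ : Measure X) :
    MemLp (f : X → ℂ) ∞ μ := by
  obtain ⟨C, -, hC⟩ := boundedMeasurable.exists_bound f
  exact memLp_top_of_bound (boundedMeasurable.measurable f).aestronglyMeasurable C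
    (Eventually.of_forall hC)

theorem boundedMeasurable.exists_toLp_eq {μ : Measure X} (f : Lp ℂ ∞ μ) :
    ∃ g : boundedMeasurable X, (boundedMeasurable.memLp g μ).toLp g = f := by
  have hb : ∀ᵐ x ∂μ, ‖f x‖ ≤ ‖f‖ := by
    filter_upwards [ae_le_eLpNormEssSup (f := f) (μ := μ)] with x hx
    rw [← eLpNorm_exponent_top] at hx
    rw [← toReal_enorm, Lp.norm_def]
    exact ENNReal.toReal_mono (Lp.eLpNorm_ne_top f) hx
  have hfm : Measurable f := (Lp.stronglyMeasurable f).measurable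
  refine ⟨⟨{x | ‖f x‖ ≤ ‖f‖}.indicator f, hfm.indicator
    (measurableSet_le hfm.norm measurable_const), ‖f‖, fun x => ?_⟩, ?_⟩
  · by_cases hx : x ∈ {x | ‖f x‖ ≤ ‖f‖}
    · rw [Set.indicator_of_mem hx]; exact hx
    · rw [Set.indicator_of_notMem hx, norm_zero]; exact norm_nonneg _
  · apply Lp.ext
    refine (MemLp.coeFn_toLp _).trans ?_
    filter_upwards [hb] with x hx
    exact Set.indicator_of_mem (show x ∈ {x | ‖f x‖ ≤ ‖f‖} from hx) _

/-- A bounded function composed with the action. -/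
def translateBounded {Γ : Type v} [Group Γ] [MulAction Γ X] [MeasurableConstSMul Γ X]
    (γ : Γ) (f : boundedMeasurable X) : boundedMeasurable X :=
  ⟨fun x => (f : X → ℂ) (γ • x), (boundedMeasurable.measurable f).comp (measurable_const_smul γ),
    (boundedMeasurable.exists_bound f).choose,
    fun _ => (boundedMeasurable.exists_bound f).choose_spec.2 _⟩

variable {Γ : Type v} [Group Γ] [MulAction Γ X]
  [MeasurableConstSMul Γ X] {μ : Measure X} [IsProbabilityMeasure μ] [SMulInvariantMeasure Γ X μ]

theorem coeFn_mulL2_toLp {Y : Type u} [MeasurableSpace Y] {μ : Measure Y} (f : boundedMeasurable Y)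
    (g : Lp ℂ 2 μ) :
    mulL2 μ ((boundedMeasurable.memLp f μ).toLp f) g =ᵐ[μ] fun x => (f : Y → ℂ) x * g x := by
  filter_upwards [coeFn_mulL2 μ ((boundedMeasurable.memLp f μ).toLp f) g,
    (boundedMeasurable.memLp f μ).coeFn_toLp] with x h1 h2
  rw [h1, h2]

/-- The representation of the bounded functions in the crossed product. -/
def crossedFun (Γ : Type v) [Group Γ] [MulAction Γ X] [MeasurableConstSMul Γ X]
    (μ : Measure X) [SMulInvariantMeasure Γ X μ] :
    boundedMeasurable X →⋆ₐ[ℂ] (crossedProduct Γ μ).toStarSubalgebra where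
  toFun f := crossedMulElem Γ μ ((boundedMeasurable.memLp f μ).toLp f)
  map_one' := by
    refine Subtype.ext (ContinuousLinearMap.ext fun ξ => lp.ext (funext fun s => Lp.ext ?_))
    refine (coeFn_mulL2_toLp 1 (ξ s)).trans (Eventually.of_forall fun x => ?_)
    exact one_mul _
  map_mul' f g := by
    refine Subtype.ext (ContinuousLinearMap.ext fun ξ => lp.ext (funext fun s => Lp.ext ?_))
    change mulL2 μ _ (ξ s) =ᵐ[μ] mulL2 μ _ (mulL2 μ _ (ξ s))
    filter_upwards [coeFn_mulL2_toLp (f * g) (ξ s), coeFn_mulL2_toLp g (ξ s),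
      coeFn_mulL2_toLp f (mulL2 μ ((boundedMeasurable.memLp g μ).toLp g) (ξ s))] with x h1 h2 h3
    rw [h1, h3, h2, ← mul_assoc]
    rfl
  map_zero' := by
    refine Subtype.ext (ContinuousLinearMap.ext fun ξ => lp.ext (funext fun s => Lp.ext ?_))
    change mulL2 μ _ (ξ s) =ᵐ[μ] (0 : Lp ℂ 2 μ)
    filter_upwards [coeFn_mulL2_toLp 0 (ξ s), Lp.coeFn_zero ℂ 2 μ] with x h1 h2
    rw [h1, h2]
    exact zero_mul _
  map_add' f g := by
    refine Subtype.ext (ContinuousLinearMap.ext fun ξ => lp.ext (funext fun s => Lp.ext ?_))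
    change mulL2 μ _ (ξ s) =ᵐ[μ] (mulL2 μ _ (ξ s) + mulL2 μ _ (ξ s) : Lp ℂ 2 μ)
    filter_upwards [coeFn_mulL2_toLp (f + g) (ξ s), coeFn_mulL2_toLp g (ξ s),
      coeFn_mulL2_toLp f (ξ s), Lp.coeFn_add (mulL2 μ ((boundedMeasurable.memLp f μ).toLp f) (ξ s))
      (mulL2 μ ((boundedMeasurable.memLp g μ).toLp g) (ξ s))] with x h1 h2 h3 h4
    rw [h1, h4, Pi.add_apply, h2, h3, ← add_mul]
    rfl
  commutes' c := by
    refine Subtype.ext (ContinuousLinearMap.ext fun ξ => lp.ext (funext fun s => Lp.ext ?_))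
    change mulL2 μ _ (ξ s) =ᵐ[μ] (c • ξ s : Lp ℂ 2 μ)
    filter_upwards [coeFn_mulL2_toLp (algebraMap ℂ _ c) (ξ s), Lp.coeFn_smul c (ξ s)] with x h1 h2
    rw [h1, h2]
    rfl
  map_star' f := by
    rw [star_crossedMulElem]
    refine congrArg (crossedMulElem Γ μ) (Lp.ext ?_)
    change ((boundedMeasurable.memLp (star f) μ).toLp (star f : X → ℂ) : X → ℂ) =ᵐ[μ]
      (star ((boundedMeasurable.memLp f μ).toLp (f : X → ℂ)) : Lp ℂ ∞ μ)
    filter_upwards [(boundedMeasurable.memLp (star f) μ).coeFn_toLp,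
      (boundedMeasurable.memLp f μ).coeFn_toLp,
      Lp.coeFn_star ((boundedMeasurable.memLp f μ).toLp (f : X → ℂ))] with x h1 h2 h3
    rw [h3, Pi.star_apply, h2]
    exact h1

theorem crossedFun_mul_crossedUnitaryElem (f : boundedMeasurable X) (γ : Γ) :
    crossedFun Γ μ f * crossedUnitaryElem μ γ =
      crossedUnitaryElem μ γ * crossedFun Γ μ (translateBounded γ f) := by
  refine Subtype.ext (ContinuousLinearMap.ext fun ξ => lp.ext (funext fun s => Lp.ext ?_))
  change mulL2 μ _ (koopman μ γ (ξ (γ⁻¹ * s))) =ᵐ[μ] koopman μ γ (mulL2 μ _ (ξ (γ⁻¹ * s)))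
  have h := (measurePreserving_smul γ⁻¹ μ).quasiMeasurePreserving.ae_eq
    (coeFn_mulL2_toLp (μ := μ) (translateBounded γ f) (ξ (γ⁻¹ * s)))
  filter_upwards [coeFn_mulL2_toLp f (koopman μ γ (ξ (γ⁻¹ * s))),
    coeFn_koopman μ γ (ξ (γ⁻¹ * s)), coeFn_koopman μ γ
    (mulL2 μ ((boundedMeasurable.memLp (translateBounded γ f) μ).toLp _) (ξ (γ⁻¹ * s))), h]
    with x h1 h2 h3 h4
  simp only [Function.comp] at h4
  rw [h1, h2, h3, h4]
  congr 1
  change (f : X → ℂ) x = (f : X → ℂ) (γ • γ⁻¹ • x)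
  rw [smul_inv_smul]

theorem crossedTrace_crossedFun (f : boundedMeasurable X) :
    crossedTrace Γ μ (crossedFun Γ μ f) = ∫ x, (f : X → ℂ) x ∂μ := by
  classical
  change inner ℂ (crossedVacuum Γ μ) (crossedMul Γ μ _ (crossedVacuum Γ μ)) = _
  rw [crossedVacuum, lp.inner_single_left, crossedMul_apply, lp.single_apply_self, L2.inner_def]
  refine integral_congr_ae ?_
  filter_upwards [coeFn_mulL2_toLp (μ := μ) f (Lp.const 2 μ (1 : ℂ)),
    Lp.coeFn_const (p := 2) (μ := μ) (1 : ℂ)] with x h1 h2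
  rw [h1, h2]
  simp

theorem crossedUnitaryElem_mul_star (γ : Γ) :
    crossedUnitaryElem μ γ * star (crossedUnitaryElem μ γ) = 1 := by
  rw [star_crossedUnitaryElem]
  refine Subtype.ext (ContinuousLinearMap.ext fun ξ => lp.ext (funext fun s => ?_))
  change koopman μ γ (koopman μ γ⁻¹ (ξ (γ⁻¹⁻¹ * (γ⁻¹ * s)))) = ξ s
  rw [inv_inv, mul_inv_cancel_left, ← koopman_mul, mul_inv_cancel, koopman_one]

theorem star_mul_crossedUnitaryElem (γ : Γ) :
    star (crossedUnitaryElem μ γ) * crossedUnitaryElem μ γ = 1 := by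
  have h := crossedUnitaryElem_mul_star (μ := μ) γ⁻¹
  rwa [← star_crossedUnitaryElem, star_star] at h

end BimoduleCoupling

/-! ### Left, right and conjugation actions on a bimodule -/

section RightRep

variable {H : Type u} [NormedAddCommGroup H] [InnerProductSpace ℂ H] [CompleteSpace H]
  {M : VonNeumannAlgebra H} {K : Type w} [NormedAddCommGroup K] [InnerProductSpace ℂ K]
  [CompleteSpace K] {A : Type v} [CommRing A] [StarRing A] [Algebra ℂ A]

/-- The right action of a commutative algebra represented in `M`. -/
def HilbertBimodule.rightRep (β : HilbertBimodule M K) (φ : A →⋆ₐ[ℂ] M.toStarSubalgebra) :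
    A →⋆ₐ[ℂ] (K →L[ℂ] K) where
  toFun f := β.right (MulOpposite.op (φ f))
  map_one' := by rw [map_one, MulOpposite.op_one, map_one]
  map_mul' f g := by rw [mul_comm f g, map_mul, MulOpposite.op_mul, map_mul]
  map_zero' := by rw [map_zero, MulOpposite.op_zero, map_zero]
  map_add' f g := by rw [map_add, MulOpposite.op_add, map_add]
  commutes' c := by
    rw [AlgHomClass.commutes]
    exact AlgHomClass.commutes β.right c
  map_star' f := by rw [map_star, MulOpposite.op_star, map_star]

/-- The left action of an algebra represented in `M`. -/
def HilbertBimodule.leftRep (β : HilbertBimodule M K) (φ : A →⋆ₐ[ℂ] M.toStarSubalgebra) :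
    A →⋆ₐ[ℂ] (K →L[ℂ] K) := β.left.comp φ

/-- The operator `ξ ↦ u ξ u*`. -/
def HilbertBimodule.conjugate (β : HilbertBimodule M K) (u : M.toStarSubalgebra) (ξ : K) : K :=
  β.left u (β.right (MulOpposite.op (star u)) ξ)

theorem HilbertBimodule.inner_conjugate (β : HilbertBimodule M K) {u : M.toStarSubalgebra}
    (h : star u * u = 1) (ξ ζ : K) :
    inner ℂ (β.conjugate u ξ) (β.conjugate u ζ) = inner ℂ ξ ζ := by
  have h1 : ∀ a b, inner ℂ (β.left u a) (β.left u b) = inner ℂ a b := fun a b => by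
    rw [← ContinuousLinearMap.adjoint_inner_right, ← ContinuousLinearMap.star_eq_adjoint,
      ← map_star, ← β.left_mul, h, map_one]
    rfl
  have h2 : ∀ a b, inner ℂ (β.right (MulOpposite.op (star u)) a)
      (β.right (MulOpposite.op (star u)) b) = inner ℂ a b := fun a b => by
    rw [← ContinuousLinearMap.adjoint_inner_right, ← ContinuousLinearMap.star_eq_adjoint,
      ← map_star, ← MulOpposite.op_star, star_star, ← β.right_op_mul, h, MulOpposite.op_one,
      map_one]
    rfl
  rw [conjugate, conjugate, h1, h2]

/-- Right multiplication by the unitary `u*` is isometric and carries `u ξ - ξ u` to `u ξ u* - ξ`.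
-/
theorem HilbertBimodule.norm_conjugate_sub (β : HilbertBimodule M K) {u : M.toStarSubalgebra}
    (h : star u * u = 1) (h' : u * star u = 1) (ξ : K) :
    ‖β.conjugate u ξ - ξ‖ = ‖β.left u ξ - β.right (MulOpposite.op u) ξ‖ := by
  have e : β.conjugate u ξ - ξ = β.right (MulOpposite.op (star u))
      (β.left u ξ - β.right (MulOpposite.op u) ξ) := by
    rw [map_sub, ← β.right_op_mul, h', MulOpposite.op_one, map_one, conjugate, β.left_right_comm]
    rfl
  have h2 : ∀ a, ‖β.right (MulOpposite.op (star u)) a‖ = ‖a‖ := fun a => by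
    rw [norm_eq_sqrt_re_inner (𝕜 := ℂ), ← ContinuousLinearMap.adjoint_inner_right,
      ← ContinuousLinearMap.star_eq_adjoint,
      ← map_star, ← MulOpposite.op_star, star_star, ← β.right_op_mul, h, MulOpposite.op_one,
      map_one, norm_eq_sqrt_re_inner (𝕜 := ℂ) a]
    rfl
  rw [e, h2]

theorem HilbertBimodule.left_right_conjugate (β : HilbertBimodule M K)
    {u a a' b b' : M.toStarSubalgebra} (ha : a * u = u * a') (hb : star u * b = b' * star u)
    (ξ : K) : β.left a (β.right (MulOpposite.op b) (β.conjugate u ξ)) =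
      β.conjugate u (β.left a' (β.right (MulOpposite.op b') ξ)) := by
  rw [conjugate, conjugate, ← β.left_right_comm u, ← β.right_op_mul, hb, β.right_op_mul,
    ← β.left_mul, ha, β.left_mul, β.left_right_comm a']

end RightRep

/-! ### Couplings produced by a failure of rigidity -/

section NotRigid

variable {X : Type u} [MeasurableSpace X] {Γ : Type v} [Group Γ] [MulAction Γ X]
  [MeasurableConstSMul Γ X] {μ : Measure X} [IsProbabilityMeasure μ] [SMulInvariantMeasure Γ X μ]
  {K : Type w} [NormedAddCommGroup K] [InnerProductSpace ℂ K] [CompleteSpace K]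
  {β : HilbertBimodule (crossedProduct Γ μ) K} {ξ : K}

theorem IsTracialVector.isTracialPair (hξ : IsTracialVector β ξ) :
    IsTracialPair μ (β.leftRep (crossedFun Γ μ)) (β.rightRep (crossedFun Γ μ)) ξ where
  commute f g := β.commute _ _
  inner_left f := by rw [← crossedTrace_crossedFun (Γ := Γ)]; exact (hξ _).1
  inner_right f := by rw [← crossedTrace_crossedFun (Γ := Γ)]; exact (hξ _).2

theorem leftRep_rightRep_conjugate (β : HilbertBimodule (crossedProduct Γ μ) K) (γ : Γ)
    (f g : boundedMeasurable X) (ξ : K) :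
    β.leftRep (crossedFun Γ μ) f (β.rightRep (crossedFun Γ μ) g
      (β.conjugate (crossedUnitaryElem μ γ) ξ)) =
    β.conjugate (crossedUnitaryElem μ γ) (β.leftRep (crossedFun Γ μ) (translateBounded γ f)
      (β.rightRep (crossedFun Γ μ) (translateBounded γ g) ξ)) := by
  have h1 := crossedFun_mul_crossedUnitaryElem (μ := μ) f γ
  have h2 : star (crossedUnitaryElem μ γ) * crossedFun Γ μ g =
      crossedFun Γ μ (translateBounded γ g) * star (crossedUnitaryElem μ γ) := by
    have h := congrArg star (crossedFun_mul_crossedUnitaryElem (μ := μ) (star g) γ)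
    rw [star_mul, star_mul, ← map_star, ← map_star, star_star] at h
    rw [h]
    congr 2
    exact Subtype.ext (funext fun x => star_star _)
  exact β.left_right_conjugate h1 h2 ξ

/-- Moving `u_γ` past a function turns `f` into `f ∘ γ`, whose integral is unchanged because `μ` is
invariant. -/
theorem IsTracialPair.conjugate
    (h : IsTracialPair μ (β.leftRep (crossedFun Γ μ)) (β.rightRep (crossedFun Γ μ)) ξ) (γ : Γ) :
    IsTracialPair μ (β.leftRep (crossedFun Γ μ)) (β.rightRep (crossedFun Γ μ))
      (β.conjugate (crossedUnitaryElem μ γ) ξ) where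
  commute := h.commute
  inner_left f := by
    have h1 := leftRep_rightRep_conjugate β γ f 1 ξ
    have h2 : translateBounded γ (1 : boundedMeasurable X) = 1 := rfl
    rw [h2, map_one, one_apply_eq_self, one_apply_eq_self] at h1
    rw [h1, β.inner_conjugate (star_mul_crossedUnitaryElem γ), h.inner_left]
    exact integral_smul_eq_self (f : X → ℂ)
  inner_right f := by
    have h1 := leftRep_rightRep_conjugate β γ 1 f ξ
    have h2 : translateBounded γ (1 : boundedMeasurable X) = 1 := rfl
    rw [h2, map_one, one_apply_eq_self, one_apply_eq_self] at h1
    rw [h1, β.inner_conjugate (star_mul_crossedUnitaryElem γ), h.inner_right]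
    exact integral_smul_eq_self (f : X → ℂ)

theorem measure_prod_ext {ν ν' : Measure (X × X)} [IsFiniteMeasure ν] [IsFiniteMeasure ν']
    (h : ∀ f g : boundedMeasurable X, ∫ p, (f : X → ℂ) p.1 * (g : X → ℂ) p.2 ∂ν =
      ∫ p, (f : X → ℂ) p.1 * (g : X → ℂ) p.2 ∂ν') : ν = ν' := by
  refine Measure.ext_prod fun {s t} hs ht => ?_
  have hb : ∀ {s : Set X} (_ : MeasurableSet s),
      s.indicator (fun _ => (1 : ℂ)) ∈ boundedMeasurable X := fun {s} hs =>
    ⟨measurable_const.indicator hs, 1, fun x => by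
      by_cases hx : x ∈ s <;> simp [hx]⟩
  have h1 := h ⟨_, hb hs⟩ ⟨_, hb ht⟩
  have e : ∀ p : X × X, s.indicator (fun _ => (1 : ℂ)) p.1 * t.indicator (fun _ => (1 : ℂ)) p.2 =
      (s ×ˢ t).indicator (fun _ => (1 : ℂ)) p := fun p => by
    by_cases h1 : p.1 ∈ s <;> by_cases h2 : p.2 ∈ t <;> simp [h1, h2, Set.indicator]
  simp only [e] at h1
  rw [integral_indicator_const _ (hs.prod ht), integral_indicator_const _ (hs.prod ht)] at h1
  have h2 : ν.real (s ×ˢ t) = ν'.real (s ×ˢ t) := by simpa using h1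
  exact (measureReal_eq_measureReal_iff (measure_ne_top _ _) (measure_ne_top _ _)).1 h2

variable [StandardBorelSpace X]

/-- Both measures are determined by integrals of `f ⊗ g`, and covariance turns these into translates
of one another. Almost invariance of the measure thus reduces to the distance between `ξ` and `u_γ ξ
u_γ*`. -/
theorem IsSpectralCoupling.map_smul {ν ν' : Measure (X × X)} {γ : Γ}
    (hp : IsTracialPair μ (β.leftRep (crossedFun Γ μ)) (β.rightRep (crossedFun Γ μ)) ξ)
    (hν : IsSpectralCoupling μ (β.leftRep (crossedFun Γ μ)) (β.rightRep (crossedFun Γ μ)) ξ ν)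
    (hν' : IsSpectralCoupling μ (β.leftRep (crossedFun Γ μ)) (β.rightRep (crossedFun Γ μ))
      (β.conjugate (crossedUnitaryElem μ γ) ξ) ν') :
    ν.map (fun p => γ • p) = ν' := by
  have := hν.isProbabilityMeasure
  have := hν'.isProbabilityMeasure
  refine measure_prod_ext fun f g => ?_
  rw [hν'.integral_mul_eq_inner (hp.conjugate γ), leftRep_rightRep_conjugate,
    β.inner_conjugate (star_mul_crossedUnitaryElem γ), ← hν.integral_mul_eq_inner hp,
    integral_map (f := fun p : X × X => (f : X → ℂ) p.1 * (g : X → ℂ) p.2)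
      (measurable_const_smul γ).aemeasurable (((boundedMeasurable.measurable f).comp
      measurable_fst).mul ((boundedMeasurable.measurable g).comp
        measurable_snd)).aestronglyMeasurable]
  rfl

/-- If the action is not rigid, there are almost invariant couplings which are close to the
diagonal but whose mass on the diagonal is bounded away from `1`. -/
theorem exists_isCoupling_of_not_isRigidAction (h : ¬ IsRigidAction Γ μ) :
    ∃ ε : ℝ, 0 < ε ∧ ∀ (G : Finset Γ) (δ : ℝ), 0 < δ → ∃ ν : Measure (X × X), IsCoupling μ ν ∧
      (∀ γ ∈ G, TVLe (ν.map fun p => γ • p) ν δ) ∧ diagEnergy ν ≤ δ ∧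
      ε ≤ ν.real (Set.diagonal X)ᶜ := by
  classical
  rw [IsRigidAction, IsRigidInclusion] at h
  push Not at h
  obtain ⟨ε, hε, H⟩ := h
  -- No vector commuting with `L^∞` lies within `ε` of `ξ`, while `exists_central` gives one at
  -- distance at most the root of the off-diagonal mass.
  refine ⟨ε ^ 2, by positivity, fun G δ hδ => ?_⟩
  -- The commutator with the coordinate controls the energy through its square, hence `√δ`; those
  -- with the unitaries control the translates with a factor `2`, hence `δ / 2`.
  obtain ⟨K, i1, i2, i3, β, ξ, h1, hξ, hF, hη⟩ := H
    (insert (crossedFun Γ μ (coordFun X)) (G.image (crossedUnitaryElem μ)))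
    (min (δ / 2) (√δ)) (by positivity)
  have hp := IsTracialVector.isTracialPair (show IsTracialVector β ξ from hξ)
  obtain ⟨ν, hν⟩ := hp.exists_isSpectralCoupling
  refine ⟨ν, hν.toIsCoupling, fun γ hγ => ?_, ?_, ?_⟩
  · obtain ⟨ν', hν'⟩ := (hp.conjugate γ).exists_isSpectralCoupling
    have h2 := hν.tvLe hp hν' (hp.conjugate γ)
    rw [← hν.map_smul hp hν', β.norm_conjugate_sub (star_mul_crossedUnitaryElem γ)
      (crossedUnitaryElem_mul_star γ)] at h2
    refine h2.mono ?_
    have h3 := (hF _ (Finset.mem_insert_of_mem (Finset.mem_image_of_mem _ hγ))).trans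
      (min_le_left _ _)
    linarith
  · rw [hν.diagEnergy_eq hp, ← Real.sq_sqrt hδ.le]
    exact pow_le_pow_left₀ (norm_nonneg _)
      ((hF _ (Finset.mem_insert_self _ _)).trans (min_le_right _ _)) 2
  · obtain ⟨η, hc, hle⟩ := hν.exists_central hp
    have h4 := hη η (fun b hb => by
      obtain ⟨f, hf⟩ := hb
      obtain ⟨g, rfl⟩ := boundedMeasurable.exists_toLp_eq f
      have e : b = crossedFun Γ μ g := Subtype.ext hf.symm
      rw [e]
      exact hc g)
    exact (pow_le_pow_left₀ hε.le h4.le 2).trans hle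

end NotRigid

/-! ### Almost invariant measures below an ergodic measure -/

section Ergodic

variable {X : Type u} [MeasurableSpace X] {Γ : Type v} [Group Γ] [MulAction Γ X]
  [MeasurableConstSMul Γ X] {μ : Measure X} [IsProbabilityMeasure μ]

theorem exists_const_of_forall_smul_ae_eq [ErgodicSMul Γ X μ] {E : Type*} [Nonempty E]
    [MeasurableSpace E] [MeasurableSpace.CountablySeparated E] {f : X → E} (hf : Measurable f)
    (h : ∀ γ : Γ, (fun x => f (γ • x)) =ᵐ[μ] f) : ∃ c, f =ᵐ[μ] Function.const X c := by
  refine exists_eventuallyEq_const_of_forall_separating MeasurableSet fun U hU => ?_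
  have h1 : EventuallyConst (f ⁻¹' U) (ae μ) :=
    aeconst_of_forall_preimage_smul_ae_eq Γ (hf hU).nullMeasurableSet fun γ => by
      filter_upwards [h γ] with x hx
      exact congrArg (· ∈ U) hx
  rcases eventuallyConst_set'.1 h1 with h2 | h2
  · right
    filter_upwards [h2] with x hx
    exact fun hU => by
      have : (f ⁻¹' U) x := hU
      rw [hx] at this
      exact this
  · left
    filter_upwards [h2] with x hx
    have : (Set.univ : Set X) x := trivial
    rw [← hx] at this
    exact this

/-- The error in replacing a measure `θ` by a multiple of `μ`. -/
def meanDefect (μ θ : Measure X) (F : X → ℂ) : ℂ :=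
  (∫ x, F x ∂θ) - (θ.real Set.univ : ℂ) * ∫ x, F x ∂μ

theorem Lp.integrable_of_le {θ : Measure X} (hθ : θ ≤ μ) (F : Lp ℂ 2 μ) : Integrable F θ :=
  ((Lp.memLp F).integrable (by norm_num)).mono_measure hθ

theorem meanDefect_add {θ : Measure X} (hθ : θ ≤ μ) (F G : Lp ℂ 2 μ) :
    meanDefect μ θ (F + G : Lp ℂ 2 μ) = meanDefect μ θ F + meanDefect μ θ G := by
  have e : ∀ ρ : Measure X, ρ ≤ μ → ∫ x, (F + G : Lp ℂ 2 μ) x ∂ρ =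
      (∫ x, F x ∂ρ) + ∫ x, G x ∂ρ := fun ρ hρ => by
    rw [← integral_add (Lp.integrable_of_le hρ F) (Lp.integrable_of_le hρ G)]
    exact integral_congr_ae (ae_mono hρ (Lp.coeFn_add F G))
  rw [meanDefect, meanDefect, meanDefect, e θ hθ, e μ le_rfl]
  ring

theorem meanDefect_smul {θ : Measure X} (hθ : θ ≤ μ) (c : ℂ) (F : Lp ℂ 2 μ) :
    meanDefect μ θ (c • F : Lp ℂ 2 μ) = c * meanDefect μ θ F := by
  have e : ∀ ρ : Measure X, ρ ≤ μ → ∫ x, (c • F : Lp ℂ 2 μ) x ∂ρ = c * ∫ x, F x ∂ρ :=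
      fun ρ hρ => by
    rw [← integral_const_mul]
    exact integral_congr_ae (ae_mono hρ (Lp.coeFn_smul c F))
  rw [meanDefect, meanDefect, e θ hθ, e μ le_rfl]
  ring

theorem measureReal_univ_le_one {θ : Measure X} (hθ : θ ≤ μ) : θ.real Set.univ ≤ 1 := by
  rw [measureReal_def, ← ENNReal.toReal_one]
  refine ENNReal.toReal_mono ENNReal.one_ne_top ((hθ _).trans ?_)
  rw [measure_univ]

theorem norm_meanDefect_le {θ : Measure X} (hθ : θ ≤ μ) (F : Lp ℂ 2 μ) :
    ‖meanDefect μ θ F‖ ≤ 2 * ‖F‖ := by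
  have h1 : ∫ x, ‖F x‖ ∂μ ≤ ‖F‖ := by
    have h2 := eLpNorm_le_eLpNorm_of_exponent_le (p := 1) (q := 2) (by norm_num)
      (Lp.aestronglyMeasurable F)
    rw [integral_norm_eq_lintegral_enorm (Lp.aestronglyMeasurable F), ← eLpNorm_one_eq_lintegral_enorm,
      Lp.norm_def]
    exact ENNReal.toReal_mono (Lp.eLpNorm_ne_top F) h2
  have h3 : ‖∫ x, F x ∂θ‖ ≤ ‖F‖ := (norm_integral_le_integral_norm _).trans
    ((integral_mono_measure hθ (Eventually.of_forall fun x => norm_nonneg _)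
      (Lp.integrable_of_le le_rfl F).norm).trans h1)
  have h4 : ‖∫ x, F x ∂μ‖ ≤ ‖F‖ := (norm_integral_le_integral_norm _).trans h1
  refine (norm_sub_le _ _).trans ?_
  rw [norm_mul, Complex.norm_real, Real.norm_eq_abs, abs_of_nonneg measureReal_nonneg, two_mul]
  refine add_le_add h3 ?_
  calc _ ≤ 1 * ‖F‖ := mul_le_mul (measureReal_univ_le_one hθ) h4 (norm_nonneg _) zero_le_one
    _ = ‖F‖ := one_mul _

/-- The functions whose integrals against almost invariant measures `θ ≤ μ` are almost the same
as against multiples of `μ`. -/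
def almostMean (Γ : Type v) [Group Γ] [MulAction Γ X] [MeasurableConstSMul Γ X] (μ : Measure X)
    [IsProbabilityMeasure μ] : Submodule ℂ (Lp ℂ 2 μ) where
  carrier := {F | ∀ τ : ℝ, 0 < τ → ∃ (G : Finset Γ) (δ : ℝ), 0 < δ ∧ ∀ θ : Measure X, θ ≤ μ →
    (∀ γ ∈ G, TVLe (θ.map fun x => γ • x) θ δ) → ‖meanDefect μ θ F‖ ≤ τ}
  add_mem' {F F'} hF hF' τ hτ := by
    classical
    obtain ⟨G, δ, hδ, h⟩ := hF (τ / 2) (by positivity)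
    obtain ⟨G', δ', hδ', h'⟩ := hF' (τ / 2) (by positivity)
    refine ⟨G ∪ G', min δ δ', lt_min hδ hδ', fun θ hθ hG => ?_⟩
    rw [meanDefect_add hθ]
    refine (norm_add_le _ _).trans ?_
    have h1 := h θ hθ fun γ hγ => (hG γ (Finset.mem_union_left _ hγ)).mono (min_le_left _ _)
    have h2 := h' θ hθ fun γ hγ => (hG γ (Finset.mem_union_right _ hγ)).mono (min_le_right _ _)
    linarith
  zero_mem' τ hτ := ⟨∅, 1, one_pos, fun θ hθ _ => by
    have := norm_meanDefect_le hθ (0 : Lp ℂ 2 μ)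
    rw [norm_zero, mul_zero] at this
    exact this.trans hτ.le⟩
  smul_mem' c F hF τ hτ := by
    obtain ⟨G, δ, hδ, h⟩ := hF (τ / (‖c‖ + 1)) (by positivity)
    refine ⟨G, δ, hδ, fun θ hθ hG => ?_⟩
    rw [meanDefect_smul hθ, norm_mul]
    calc _ ≤ (‖c‖ + 1) * (τ / (‖c‖ + 1)) := mul_le_mul (by linarith) (h θ hθ hG) (norm_nonneg _)
          (by positivity)
      _ = τ := by field_simp

/-- Since `θ ≤ μ`, the defect is `2`-Lipschitz for the `L²(μ)` norm uniformly in `θ`. -/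
theorem isClosed_almostMean : IsClosed (almostMean Γ μ : Set (Lp ℂ 2 μ)) := by
  rw [← isSeqClosed_iff_isClosed]
  intro F F₀ hF hlim τ hτ
  obtain ⟨n, hn⟩ := ((Metric.tendsto_nhds.1 hlim) (τ / 4) (by positivity)).exists
  obtain ⟨G, δ, hδ, h⟩ := hF n (τ / 2) (by positivity)
  refine ⟨G, δ, hδ, fun θ hθ hG => ?_⟩
  have e : meanDefect μ θ F₀ = meanDefect μ θ (F₀ - F n : Lp ℂ 2 μ) + meanDefect μ θ (F n) := by
    rw [← meanDefect_add hθ, sub_add_cancel]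
  rw [e]
  refine (norm_add_le _ _).trans ?_
  have h1 := norm_meanDefect_le hθ (F₀ - F n)
  rw [← dist_eq_norm, dist_comm] at h1
  linarith [h θ hθ hG]

variable [ErgodicSMul Γ X μ]

/-- On a coboundary the integral against `μ` vanishes by invariance, and the integral against `θ` is
bounded by the distance from `θ` to its translate. -/
theorem koopman_sub_mem_almostMean (γ : Γ) {A : Set X} (hA : MeasurableSet A) :
    koopman μ γ (indicatorConstLp 2 hA (measure_ne_top μ A) (1 : ℂ)) -
      indicatorConstLp 2 hA (measure_ne_top μ A) (1 : ℂ) ∈ almostMean Γ μ := by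
  intro τ hτ
  refine ⟨{γ⁻¹}, τ, hτ, fun θ hθ hG => ?_⟩
  have : IsFiniteMeasure θ := isFiniteMeasure_of_le μ hθ
  set f : X → ℂ := A.indicator fun _ => 1
  have hf : Measurable f := measurable_const.indicator hA
  have hf1 : ∀ x, ‖f x‖ ≤ 1 := fun x => by
    by_cases hx : x ∈ A <;> simp [f, hx]
  have hae : (koopman μ γ (indicatorConstLp 2 hA (measure_ne_top μ A) (1 : ℂ)) -
      indicatorConstLp 2 hA (measure_ne_top μ A) (1 : ℂ) : Lp ℂ 2 μ) =ᵐ[μ]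
      fun x => f (γ⁻¹ • x) - f x := by
    have h1 := indicatorConstLp_coeFn (p := 2) (hs := hA) (hμs := measure_ne_top μ A) (c := (1 : ℂ))
    filter_upwards [Lp.coeFn_sub (koopman μ γ (indicatorConstLp 2 hA (measure_ne_top μ A) (1 : ℂ)))
      (indicatorConstLp 2 hA (measure_ne_top μ A) (1 : ℂ)), h1,
      coeFn_koopman μ γ (indicatorConstLp 2 hA (measure_ne_top μ A) (1 : ℂ)),
      (measurePreserving_smul γ⁻¹ μ).quasiMeasurePreserving.ae_eq h1] with x h2 h3 h4 h5
    simp only [Function.comp] at h5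
    rw [h2, Pi.sub_apply, h3, h4, h5]
  have hfγ : Measurable fun x => f (γ⁻¹ • x) := hf.comp (measurable_const_smul γ⁻¹)
  have e : ∀ (ρ : Measure X) [IsFiniteMeasure ρ], ρ ≤ μ →
      ∫ x, (koopman μ γ (indicatorConstLp 2 hA (measure_ne_top μ A) (1 : ℂ)) -
      indicatorConstLp 2 hA (measure_ne_top μ A) (1 : ℂ) : Lp ℂ 2 μ) x ∂ρ =
      (∫ x, f x ∂(ρ.map fun x => γ⁻¹ • x)) - ∫ x, f x ∂ρ := fun ρ _ hρ => by
    rw [integral_map (measurable_const_smul γ⁻¹).aemeasurable hf.aestronglyMeasurable,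
      ← integral_sub (integrable_of_bound hfγ fun x => hf1 _) (integrable_of_bound hf hf1)]
    exact integral_congr_ae (ae_mono hρ hae)
  rw [meanDefect, e θ hθ, e μ le_rfl, (measurePreserving_smul γ⁻¹ μ).map_eq, sub_self, mul_zero,
    sub_zero]
  have hmap : IsFiniteMeasure (θ.map fun x => γ⁻¹ • x) := Measure.isFiniteMeasure_map _ _
  exact (hG γ⁻¹ (Finset.mem_singleton_self _)).norm_integral_sub_le hf hf1

/-- Mean ergodic argument: a vector orthogonal to the coboundaries is invariant, hence constant by
ergodicity, and orthogonality to the constants makes it zero. -/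
theorem almostMean_eq_top : almostMean Γ μ = ⊤ := by
  have hcl := isClosed_almostMean (Γ := Γ) (μ := μ)
  have : CompleteSpace (almostMean Γ μ) := hcl.completeSpace_coe
  rw [← Submodule.orthogonal_eq_bot_iff, Submodule.eq_bot_iff]
  intro v hv
  rw [Submodule.mem_orthogonal] at hv
  have hone : Lp.const 2 μ (1 : ℂ) ∈ almostMean Γ μ := fun τ hτ => by
    refine ⟨∅, 1, one_pos, fun θ hθ _ => ?_⟩
    have e : ∀ ρ : Measure X, ρ ≤ μ → ∫ x, Lp.const 2 μ (1 : ℂ) x ∂ρ = (ρ.real Set.univ : ℂ) :=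
        fun ρ hρ => by
      rw [integral_congr_ae (ae_mono hρ (Lp.coeFn_const (p := 2) (μ := μ) (1 : ℂ)))]
      simp
    rw [meanDefect, e θ hθ, e μ le_rfl]
    simpa using hτ.le
  have hinv : ∀ γ : Γ, koopman μ γ v = v := fun γ => by
    have h1 : ∀ h : Lp ℂ 2 μ, inner ℂ (koopman μ γ⁻¹ h - h) v = 0 := fun h => by
      let φ : Lp ℂ 2 μ →L[ℂ] Lp ℂ 2 μ := (koopman μ γ⁻¹).toContinuousLinearMap - .id ℂ _
      have hP : ((ℂ ∙ v)ᗮ).comap φ.toLinearMap = ⊤ := by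
        refine L2_submodule_eq_top
          ((Submodule.isClosed_orthogonal _).preimage φ.continuous) fun A hA => ?_
        change φ _ ∈ (ℂ ∙ v)ᗮ
        rw [Submodule.mem_orthogonal_singleton_iff_inner_left]
        exact hv _ (koopman_sub_mem_almostMean γ⁻¹ hA)
      have h2 : h ∈ ((ℂ ∙ v)ᗮ).comap φ.toLinearMap := hP ▸ Submodule.mem_top
      exact Submodule.mem_orthogonal_singleton_iff_inner_left.1 h2
    have h2 : ∀ h, inner ℂ h (koopman μ γ v - v) = 0 := fun h => by
      have h3 := h1 h
      have h4 : inner ℂ (koopman μ γ (koopman μ γ⁻¹ h)) (koopman μ γ v) =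
        inner ℂ (koopman μ γ⁻¹ h) v := (koopman μ γ).inner_map_map _ _
      rw [← koopman_mul, mul_inv_cancel, koopman_one] at h4
      rw [inner_sub_left, ← h4] at h3
      rw [inner_sub_right]
      exact h3
    exact sub_eq_zero.1 (inner_self_eq_zero.1 (h2 _))
  obtain ⟨c, hc⟩ := exists_const_of_forall_smul_ae_eq (Γ := Γ) (μ := μ)
    (Lp.stronglyMeasurable v).measurable fun γ => by
      have h1 := coeFn_koopman μ γ⁻¹ v
      rw [hinv, inv_inv] at h1
      exact h1.symm
  have h0 := hv _ hone
  have h1 : inner ℂ (Lp.const 2 μ (1 : ℂ)) v = c := by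
    rw [L2.inner_def]
    have : (fun x => inner ℂ (Lp.const 2 μ (1 : ℂ) x) (v x)) =ᵐ[μ] fun _ => c := by
      filter_upwards [hc, Lp.coeFn_const (p := 2) (μ := μ) (1 : ℂ)] with x h1 h2
      rw [h1, h2]
      simp
    rw [integral_congr_ae this]
    simp
  apply Lp.ext
  rw [h1] at h0
  filter_upwards [hc, Lp.coeFn_zero ℂ 2 μ] with x h2 h3
  rw [h2, h3, h0]
  rfl

/-- Almost invariant measures below an ergodic measure `μ` integrate a given bounded function
almost like a multiple of `μ`. -/
theorem exists_integral_sub_le (Γ : Type v) [Group Γ] [MulAction Γ X] [MeasurableConstSMul Γ X]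
    [ErgodicSMul Γ X μ] {f : X → ℝ} (hf : Measurable f) {C : ℝ} (hC : ∀ x, |f x| ≤ C)
    {τ : ℝ} (hτ : 0 < τ) : ∃ (G : Finset Γ) (δ : ℝ), 0 < δ ∧ ∀ θ : Measure X, θ ≤ μ →
      (∀ γ ∈ G, TVLe (θ.map fun x => γ • x) θ δ) →
      |(∫ x, f x ∂θ) - θ.real Set.univ * ∫ x, f x ∂μ| ≤ τ := by
  have hm : MemLp (fun x => (f x : ℂ)) 2 μ :=
    MemLp.of_bound (Complex.measurable_ofReal.comp hf).aestronglyMeasurable C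
      (Eventually.of_forall fun x => by rw [Complex.norm_real]; exact hC x)
  have hmem : hm.toLp _ ∈ almostMean Γ μ := almostMean_eq_top (Γ := Γ) (μ := μ) ▸ Submodule.mem_top
  obtain ⟨G, δ, hδ, h⟩ := hmem τ hτ
  refine ⟨G, δ, hδ, fun θ hθ hG => ?_⟩
  have h1 := h θ hθ hG
  have e : ∀ ρ : Measure X, ρ ≤ μ → ∫ x, hm.toLp _ x ∂ρ = ((∫ x, f x ∂ρ : ℝ) : ℂ) := fun ρ hρ => by
    rw [← integral_complex_ofReal]
    exact integral_congr_ae (ae_mono hρ hm.coeFn_toLp)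
  rw [meanDefect, e θ hθ, e μ le_rfl, ← Complex.ofReal_mul, ← Complex.ofReal_sub,
    Complex.norm_real] at h1
  exact h1

end Ergodic

/-! ### Moving the mass of couplings off the diagonal -/

section Density

variable {X : Type u} [MeasurableSpace X] {μ : Measure X}

theorem exists_density_of_le [IsFiniteMeasure μ] {θ : Measure X} (hθ : θ ≤ μ) :
    ∃ w : X → ℝ, Measurable w ∧ (∀ x, 0 ≤ w x) ∧ (∀ x, w x ≤ 1) ∧
      θ = μ.withDensity fun x => ENNReal.ofReal (w x) := by
  have : IsFiniteMeasure θ := isFiniteMeasure_of_le μ hθ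
  refine ⟨fun x => min 1 (θ.rnDeriv μ x).toReal,
    measurable_const.min (Measure.measurable_rnDeriv θ μ).ennreal_toReal,
    fun x => le_min zero_le_one ENNReal.toReal_nonneg, fun x => min_le_left _ _, ?_⟩
  conv_lhs => rw [← Measure.withDensity_rnDeriv_eq θ μ (Measure.absolutelyContinuous_of_le hθ)]
  refine withDensity_congr_ae ?_
  filter_upwards [Measure.rnDeriv_le_one_of_le hθ] with x hx
  have h1 : (θ.rnDeriv μ x).toReal ≤ 1 := by
    rw [← ENNReal.toReal_one]
    exact ENNReal.toReal_mono ENNReal.one_ne_top hx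
  rw [min_eq_right h1, ENNReal.ofReal_toReal (ne_top_of_le_ne_top ENNReal.one_ne_top hx)]

theorem integral_withDensity_ofReal {Y : Type u} [MeasurableSpace Y] {ρ : Measure Y} {W : Y → ℝ}
    (hW : Measurable W) (h0 : ∀ y, 0 ≤ W y) (f : Y → ℝ) :
    ∫ y, f y ∂(ρ.withDensity fun y => ENNReal.ofReal (W y)) = ∫ y, W y * f y ∂ρ := by
  rw [integral_withDensity_eq_integral_toReal_smul hW.ennreal_ofReal
    (Eventually.of_forall fun _ => ENNReal.ofReal_lt_top)]
  refine integral_congr_ae (Eventually.of_forall fun y => ?_)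
  simp only [smul_eq_mul]
  rw [ENNReal.toReal_ofReal (h0 y)]

theorem withDensity_ofReal_le {Y : Type u} [MeasurableSpace Y] {ρ : Measure Y} {W : Y → ℝ}
    (h1 : ∀ y, W y ≤ 1) : (ρ.withDensity fun y => ENNReal.ofReal (W y)) ≤ ρ := by
  conv_rhs => rw [← withDensity_one (μ := ρ)]
  refine withDensity_mono (Eventually.of_forall fun y => ?_)
  exact ENNReal.ofReal_le_one.2 (h1 y)

/-- The density of an almost invariant measure is almost invariant in `L¹`. -/
theorem integral_abs_sub_le {Γ : Type v} [Group Γ] [MulAction Γ X] [MeasurableConstSMul Γ X]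
    [IsFiniteMeasure μ] [SMulInvariantMeasure Γ X μ] {w : X → ℝ} (hw : Measurable w)
    (h0 : ∀ x, 0 ≤ w x) (h1 : ∀ x, w x ≤ 1) {γ : Γ} {δ : ℝ}
    (h : TVLe ((μ.withDensity fun x => ENNReal.ofReal (w x)).map fun x => γ • x)
      (μ.withDensity fun x => ENNReal.ofReal (w x)) δ) :
    ∫ x, |w x - w (γ • x)| ∂μ ≤ δ := by
  have hwγ : Measurable fun x => w (γ • x) := hw.comp (measurable_const_smul γ)
  set s : X → ℝ := fun x => if 0 ≤ w x - w (γ • x) then 1 else -1 with hs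
  have hsm : Measurable s :=
    Measurable.ite (measurableSet_le measurable_const (hw.sub hwγ)) measurable_const
      measurable_const
  have hs1 : ∀ x, |s x| ≤ 1 := fun x => by
    simp only [hs]; split_ifs <;> simp
  have hsabs : ∀ x, |w x - w (γ • x)| = w x * s x - w (γ • x) * s x := fun x => by
    simp only [hs]
    split_ifs with h
    · rw [abs_of_nonneg h]; ring
    · rw [abs_of_neg (not_le.1 h)]; ring
  have hsγ : Measurable fun x => s (γ⁻¹ • x) := hsm.comp (measurable_const_smul γ⁻¹)
  -- After the substitution `x ↦ γ x` in one of the two integrals, this test function becomes the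
  -- sign of `w - w ∘ γ`.
  have h2 := h (fun x => s (γ⁻¹ • x)) hsγ fun x => hs1 _
  rw [integral_map (measurable_const_smul γ).aemeasurable hsγ.aestronglyMeasurable,
    integral_withDensity_ofReal hw h0, integral_withDensity_ofReal hw h0] at h2
  have e : ∫ x, w x * s (γ⁻¹ • x) ∂μ = ∫ x, w (γ • x) * s x ∂μ := by
    rw [← integral_smul_eq_self (μ := μ) (fun x => w x * s (γ⁻¹ • x)) (g := γ)]
    simp_rw [inv_smul_smul]
  have hb : ∀ a b : ℝ, 0 ≤ a → a ≤ 1 → |b| ≤ 1 → ‖a * b‖ ≤ 1 := fun a b ha ha1 hb => by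
    rw [norm_mul, Real.norm_eq_abs, Real.norm_eq_abs, abs_of_nonneg ha]
    exact mul_le_one₀ ha1 (abs_nonneg _) hb
  rw [e] at h2
  simp_rw [inv_smul_smul] at h2
  rw [← integral_sub (f := fun x => w x * s x) (g := fun x => w (γ • x) * s x)
    (integrable_of_bound (hw.mul hsm) fun x => hb _ _ (h0 _) (h1 _) (hs1 _))
    (integrable_of_bound (hwγ.mul hsm) fun x => hb _ _ (h0 _) (h1 _) (hs1 _))] at h2
  simp_rw [hsabs]
  exact (le_abs_self _).trans h2

end Density

/-! ### Combining off-diagonal partial couplings -/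

section PartialCoupling

variable {X : Type u} [MeasurableSpace X] [StandardBorelSpace X] {Γ : Type v} [Group Γ]
  [MulAction Γ X] [MeasurableConstSMul Γ X]

/-- A symmetric measure off the diagonal with marginals at most `μ`, almost invariant under `G`
and close to the diagonal. -/
structure IsPartialCoupling (μ : Measure X) (G : Finset Γ) (δ : ℝ) (ρ : Measure (X × X)) :
    Prop where
  map_fst_le : ρ.map Prod.fst ≤ μ
  map_swap : ρ.map Prod.swap = ρ
  diagonal : ρ (Set.diagonal X) = 0
  tvLe : ∀ γ ∈ G, TVLe (ρ.map fun p => γ • p) ρ δ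
  energy : diagEnergy ρ ≤ δ

variable {μ : Measure X} [IsProbabilityMeasure μ] {G : Finset Γ} {δ : ℝ} {ρ : Measure (X × X)}

namespace IsPartialCoupling

theorem isFiniteMeasure (h : IsPartialCoupling μ G δ ρ) : IsFiniteMeasure ρ := by
  refine ⟨?_⟩
  rw [← Set.preimage_univ (f := (Prod.fst : X × X → X)),
    ← Measure.map_apply measurable_fst MeasurableSet.univ]
  exact (h.map_fst_le _).trans_lt (measure_lt_top _ _)

theorem real_univ_map_fst :
    (ρ.map Prod.fst).real Set.univ = ρ.real Set.univ := by
  rw [measureReal_def, Measure.map_apply measurable_fst MeasurableSet.univ]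
  rfl

theorem mass_le_one (h : IsPartialCoupling μ G δ ρ) : ρ.real Set.univ ≤ 1 := by
  rw [← real_univ_map_fst]
  exact measureReal_univ_le_one h.map_fst_le

theorem mono {G' : Finset Γ} {δ' : ℝ} (h : IsPartialCoupling μ G δ ρ) (hG : G' ⊆ G) (hδ : δ ≤ δ') :
    IsPartialCoupling μ G' δ' ρ :=
  ⟨h.map_fst_le, h.map_swap, h.diagonal, fun γ hγ => (h.tvLe γ (hG hγ)).mono hδ, h.energy.trans hδ⟩

theorem tvLe_map_fst (h : IsPartialCoupling μ G δ ρ) {γ : Γ} (hγ : γ ∈ G) :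
    TVLe ((ρ.map Prod.fst).map fun x => γ • x) (ρ.map Prod.fst) δ := by
  have h1 := (h.tvLe γ hγ).map (g := Prod.fst) measurable_fst
  rw [Measure.map_map measurable_fst (measurable_const_smul γ)] at h1
  rw [Measure.map_map (measurable_const_smul γ) measurable_fst]
  exact h1

theorem zero (hδ : 0 ≤ δ) : IsPartialCoupling μ G δ (0 : Measure (X × X)) where
  map_fst_le := by rw [Measure.map_zero]; exact Measure.zero_le _
  map_swap := Measure.map_zero _
  diagonal := rfl
  tvLe γ _ := by rw [Measure.map_zero]; exact (TVLe.refl _).mono hδ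
  energy := by rw [diagEnergy, integral_zero_measure]; exact hδ

/-- The part of a coupling off the diagonal, made symmetric. -/
theorem of_isCoupling {ν : Measure (X × X)} (hν : IsCoupling μ ν)
    (h : ∀ γ ∈ G, TVLe (ν.map fun p => γ • p) ν δ) (hE : diagEnergy ν ≤ δ) :
    IsPartialCoupling μ G δ ((symmetrization ν).restrict (Set.diagonal X)ᶜ) := by
  have := hν.isProbabilityMeasure
  have hs := hν.symmetrization
  have := hs.isProbabilityMeasure
  have hD : MeasurableSet (Set.diagonal X)ᶜ := measurableSet_diagonal.compl
  have hint : ∀ f : X × X → ℝ, ∫ p, f p ∂((symmetrization ν).restrict (Set.diagonal X)ᶜ) =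
      ∫ p, (Set.diagonal X)ᶜ.indicator f p ∂(symmetrization ν) := fun f =>
    (integral_indicator hD).symm
  refine ⟨?_, ?_, ?_, fun γ hγ f hf h1 => ?_, ?_⟩
  · rw [← hs.map_fst]
    exact Measure.map_mono Measure.restrict_le_self measurable_fst
  · conv_rhs => rw [← map_swap_symmetrization, Measure.restrict_map measurable_swap hD]
    congr 2
    ext p
    simp [eq_comm]
  · rw [Measure.restrict_apply measurableSet_diagonal, Set.inter_compl_self, measure_empty]
  · have h2 := (h γ hγ).symmetrization ((Set.diagonal X)ᶜ.indicator f) (hf.indicator hD)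
      fun p => by
        by_cases hp : p ∈ (Set.diagonal X)ᶜ
        · rw [Set.indicator_of_mem hp]; exact h1 p
        · rw [Set.indicator_of_notMem hp]; simp
    have hγm : Measurable fun p : X × X => γ • p := measurable_const_smul γ
    rw [integral_map hγm.aemeasurable (hf.indicator hD).aestronglyMeasurable] at h2
    rw [integral_map hγm.aemeasurable hf.aestronglyMeasurable, hint, hint]
    convert h2 using 5 with p
    have h3 : γ • p ∈ (Set.diagonal X)ᶜ ↔ p ∈ (Set.diagonal X)ᶜ := by
      simp [Set.mem_diagonal_iff]
    by_cases hp : p ∈ (Set.diagonal X)ᶜ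
    · rw [Set.indicator_of_mem hp, Set.indicator_of_mem (h3.2 hp)]
    · rw [Set.indicator_of_notMem hp, Set.indicator_of_notMem fun h => hp (h3.1 h)]
  · refine le_trans ?_ hE
    rw [← diagEnergy_symmetrization (ν := ν)]
    exact integral_mono_measure Measure.restrict_le_self
      (Eventually.of_forall fun p => sq_nonneg _)
      (integrable_of_bound measurable_coordDiff coordDiff_le_one)

theorem mass_of_isCoupling {ν : Measure (X × X)} :
    ((symmetrization ν).restrict (Set.diagonal X)ᶜ).real Set.univ = ν.real (Set.diagonal X)ᶜ := by
  rw [measureReal_def, Measure.restrict_apply MeasurableSet.univ, Set.univ_inter,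
    symmetrization_apply_of_symm measurableSet_diagonal.compl (by ext p; simp [eq_comm])]
  rfl

/-- The density of the missing part of the marginal. -/
theorem exists_complement (h : IsPartialCoupling μ G δ ρ) :
    ∃ w : X → ℝ, Measurable w ∧ (∀ x, 0 ≤ w x) ∧ (∀ x, w x ≤ 1) ∧
      ρ.map Prod.fst + (μ.withDensity fun x => ENNReal.ofReal (w x)) = μ := by
  have := h.isFiniteMeasure
  obtain ⟨w, hw, h0, h1, hwd⟩ := exists_density_of_le (Measure.sub_le (μ := μ) (ν := ρ.map Prod.fst))
  refine ⟨w, hw, h0, h1, ?_⟩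
  rw [← hwd, add_comm]
  exact Measure.sub_add_cancel_of_le h.map_fst_le

variable {w : X → ℝ}

theorem integral_complement (h : IsPartialCoupling μ G δ ρ) (hw : Measurable w)
    (h0 : ∀ x, 0 ≤ w x) (hwμ : ρ.map Prod.fst + (μ.withDensity fun x => ENNReal.ofReal (w x)) = μ)
    {f : X → ℝ} (hf : Measurable f) {C : ℝ} (hC : ∀ x, |f x| ≤ C) :
    ∫ x, w x * f x ∂μ = (∫ x, f x ∂μ) - ∫ x, f x ∂(ρ.map Prod.fst) := by
  have hle : (μ.withDensity fun x => ENNReal.ofReal (w x)) ≤ μ := by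
    conv_rhs => rw [← hwμ]
    exact Measure.le_add_left le_rfl
  have := isFiniteMeasure_of_le μ hle
  have := isFiniteMeasure_of_le μ h.map_fst_le
  have e := integral_add_measure (μ := ρ.map Prod.fst) (integrable_of_bound hf hC)
    (integrable_of_bound (μ := μ.withDensity fun x => ENNReal.ofReal (w x)) hf hC)
  rw [hwμ, integral_withDensity_ofReal hw h0] at e
  linarith

theorem tvLe_complement [SMulInvariantMeasure Γ X μ] (h : IsPartialCoupling μ G δ ρ)
    (hw : Measurable w)
    (h0 : ∀ x, 0 ≤ w x) (hwμ : ρ.map Prod.fst + (μ.withDensity fun x => ENNReal.ofReal (w x)) = μ)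
    {γ : Γ} (hγ : γ ∈ G) : TVLe ((μ.withDensity fun x => ENNReal.ofReal (w x)).map fun x => γ • x)
      (μ.withDensity fun x => ENNReal.ofReal (w x)) δ := by
  intro f hf h1
  have h2 := h.tvLe_map_fst hγ f hf h1
  have hγm : Measurable fun x : X => γ • x := measurable_const_smul γ
  rw [integral_map hγm.aemeasurable hf.aestronglyMeasurable] at h2 ⊢
  rw [integral_withDensity_ofReal hw h0, integral_withDensity_ofReal hw h0,
    h.integral_complement hw h0 hwμ hf h1,
    h.integral_complement (f := fun x => f (γ • x)) hw h0 hwμ (hf.comp hγm) fun x => h1 _,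
    integral_smul_eq_self (μ := μ) f]
  rw [abs_le] at *
  constructor <;> linarith [h2.1, h2.2]

/-- Two partial couplings can be combined into one with a larger mass. -/
theorem add_withDensity [SMulInvariantMeasure Γ X μ] (h : IsPartialCoupling μ G δ ρ)
    (hw : Measurable w) (h0 : ∀ x, 0 ≤ w x) (hw1 : ∀ x, w x ≤ 1)
    (hwμ : ρ.map Prod.fst + (μ.withDensity fun x => ENNReal.ofReal (w x)) = μ) {δ' : ℝ}
    {κ : Measure (X × X)} (hκ : IsPartialCoupling μ G δ' κ) :
    IsPartialCoupling μ G (3 * δ + δ')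
      (ρ + κ.withDensity fun p => ENNReal.ofReal (w p.1 * w p.2)) := by
  have := h.isFiniteMeasure
  have := hκ.isFiniteMeasure
  have hWm : Measurable fun p : X × X => w p.1 * w p.2 :=
    (hw.comp measurable_fst).mul (hw.comp measurable_snd)
  have hW0 : ∀ p : X × X, 0 ≤ w p.1 * w p.2 := fun p => mul_nonneg (h0 _) (h0 _)
  have hW1 : ∀ p : X × X, w p.1 * w p.2 ≤ 1 := fun p => mul_le_one₀ (hw1 _) (h0 _) (hw1 _)
  set κ' := κ.withDensity fun p => ENNReal.ofReal (w p.1 * w p.2) with hκ'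
  have hκ'le : κ' ≤ κ := withDensity_ofReal_le hW1
  have := isFiniteMeasure_of_le κ hκ'le
  have hδ : 0 ≤ δ := (diagEnergy_nonneg ρ).trans h.energy
  refine ⟨?_, ?_, ?_, fun γ hγ => ?_, ?_⟩
  · rw [Measure.map_add _ _ measurable_fst]
    conv_rhs => rw [← hwμ]
    -- Dropping the factor `w(y) ≤ 1` bounds the first marginal of the new part by `w μ`, which is
    -- exactly what is missing from the marginal of `ρ`.
    refine add_le_add le_rfl (Measure.le_iff.2 fun s hs => ?_)
    rw [Measure.map_apply measurable_fst hs, hκ', withDensity_apply _ (measurable_fst hs),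
      withDensity_apply _ hs]
    calc _ ≤ ∫⁻ p in Prod.fst ⁻¹' s, ENNReal.ofReal (w p.1) ∂κ := by
          refine lintegral_mono fun p => ENNReal.ofReal_le_ofReal ?_
          exact mul_le_of_le_one_right (h0 _) (hw1 _)
      _ = ∫⁻ x in s, ENNReal.ofReal (w x) ∂(κ.map Prod.fst) :=
          (setLIntegral_map hs hw.ennreal_ofReal measurable_fst).symm
      _ ≤ _ := lintegral_mono' (Measure.restrict_mono le_rfl hκ.map_fst_le) le_rfl
  · rw [Measure.map_add _ _ measurable_swap, h.map_swap]
    congr 1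
    ext s hs
    rw [Measure.map_apply measurable_swap hs, hκ', withDensity_apply _ (measurable_swap hs),
      withDensity_apply _ hs]
    conv_rhs => rw [← hκ.map_swap, setLIntegral_map hs hWm.ennreal_ofReal measurable_swap]
    refine lintegral_congr fun p => ?_
    rw [Prod.fst_swap, Prod.snd_swap, mul_comm]
  · rw [Measure.add_apply, h.diagonal, zero_add]
    exact le_antisymm ((hκ'le _).trans hκ.diagonal.le) zero_le
  · intro f hf h1
    have hγm : Measurable fun p : X × X => γ • p := measurable_const_smul γ
    have hfγ : Measurable fun p : X × X => f (γ • p) := hf.comp hγm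
    have hWγ : Measurable fun p : X × X => w (γ • p.1) * w (γ • p.2) := hWm.comp hγm
    have b1 : ∀ a b : ℝ, 0 ≤ a → a ≤ 1 → |b| ≤ 1 → |a * b| ≤ 1 := fun a b ha ha1 hb => by
      rw [abs_mul, abs_of_nonneg ha]
      exact mul_le_one₀ ha1 (abs_nonneg _) hb
    rw [integral_map hγm.aemeasurable hf.aestronglyMeasurable,
      integral_add_measure (integrable_of_bound hf h1) (integrable_of_bound hf h1),
      integral_add_measure (integrable_of_bound hfγ fun p => h1 _)
        (integrable_of_bound hfγ fun p => h1 _), integral_withDensity_ofReal hWm hW0,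
      integral_withDensity_ofReal hWm hW0]
    have e1 := h.tvLe γ hγ f hf h1
    rw [integral_map hγm.aemeasurable hf.aestronglyMeasurable] at e1
    have e2 := hκ.tvLe γ hγ (fun p => w p.1 * w p.2 * f p) (hWm.mul hf)
      fun p => b1 _ _ (hW0 p) (hW1 p) (h1 p)
    rw [integral_map (f := fun p : X × X => w p.1 * w p.2 * f p) hγm.aemeasurable
      (hWm.mul hf).aestronglyMeasurable] at e2
    have hd := integral_abs_sub_le hw h0 hw1 (h.tvLe_complement hw h0 hwμ hγ)
    have hdm : Measurable fun x => |w x - w (γ • x)| :=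
      (hw.sub (hw.comp (measurable_const_smul γ))).abs
    have hd1 : ∀ x, |w x - w (γ • x)| ≤ 1 := fun x => abs_le.2
      ⟨by linarith [h0 x, hw1 (γ • x)], by linarith [hw1 x, h0 (γ • x)]⟩
    have hd1' : ∀ x, ‖|w x - w (γ • x)|‖ ≤ 1 := fun x => by rw [norm_abs_eq_norm]; exact hd1 x
    have hfst : ∫ p, |w p.1 - w (γ • p.1)| ∂κ ≤ δ := by
      have e := integral_map (μ := κ) measurable_fst.aemeasurable
        (f := fun x => |w x - w (γ • x)|) hdm.aestronglyMeasurable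
      rw [← e]
      exact (integral_mono_measure hκ.map_fst_le (Eventually.of_forall fun x => abs_nonneg _)
        (integrable_of_bound hdm hd1')).trans hd
    have hsnd : ∫ p, |w p.2 - w (γ • p.2)| ∂κ ≤ δ := by
      have e := integral_map (μ := κ) measurable_swap.aemeasurable
        (f := fun p => |w p.1 - w (γ • p.1)|) (hdm.comp measurable_fst).aestronglyMeasurable
      rw [hκ.map_swap] at e
      exact e.symm.trans_le hfst
    have hi1 : Integrable (fun p : X × X => |w p.1 - w (γ • p.1)|) κ :=
      integrable_of_bound (hdm.comp measurable_fst) fun p => hd1' _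
    have hi2 : Integrable (fun p : X × X => |w p.2 - w (γ • p.2)|) κ :=
      integrable_of_bound (hdm.comp measurable_snd) fun p => hd1' _
    -- Translating each of the two factors `w` costs `δ`. Together with `δ` from `ρ` and `δ'` from
    -- `κ` this makes `3 δ + δ'`.
    have e3 : |(∫ p, w p.1 * w p.2 * f (γ • p) ∂κ) -
        ∫ p, w (γ • p.1) * w (γ • p.2) * f (γ • p) ∂κ| ≤ 2 * δ := by
      rw [← integral_sub (f := fun p => w p.1 * w p.2 * f (γ • p))
        (g := fun p => w (γ • p.1) * w (γ • p.2) * f (γ • p)) (integrable_of_bound (hWm.mul hfγ)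
        fun p => b1 _ _ (hW0 p) (hW1 p) (h1 _)) (integrable_of_bound (hWγ.mul hfγ)
        fun p => b1 _ _ (hW0 (γ • p)) (hW1 (γ • p)) (h1 _)), ← Real.norm_eq_abs]
      calc _ ≤ ∫ p, (|w p.1 - w (γ • p.1)| + |w p.2 - w (γ • p.2)|) ∂κ := by
            refine norm_integral_le_of_norm_le (hi1.add hi2) (Eventually.of_forall fun p => ?_)
            rw [← sub_mul, norm_mul, Real.norm_eq_abs, Real.norm_eq_abs]
            have e4 : w p.1 * w p.2 - w (γ • p.1) * w (γ • p.2) =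
              (w p.1 - w (γ • p.1)) * w p.2 + w (γ • p.1) * (w p.2 - w (γ • p.2)) := by ring
            calc _ ≤ |w p.1 * w p.2 - w (γ • p.1) * w (γ • p.2)| :=
                  mul_le_of_le_one_right (abs_nonneg _) (h1 _)
              _ ≤ |w p.1 - w (γ • p.1)| * w p.2 + w (γ • p.1) * |w p.2 - w (γ • p.2)| := by
                  rw [e4]
                  refine (abs_add_le _ _).trans ?_
                  rw [abs_mul, abs_mul, abs_of_nonneg (h0 p.2), abs_of_nonneg (h0 (γ • p.1))]
              _ ≤ _ := add_le_add (mul_le_of_le_one_right (abs_nonneg _) (hw1 _))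
                  (mul_le_of_le_one_left (abs_nonneg _) (hw1 _))
        _ ≤ 2 * δ := by
            rw [integral_add hi1 hi2]
            linarith
    simp only [Prod.smul_fst, Prod.smul_snd] at e2
    rw [abs_le] at *
    constructor <;> linarith [e1.1, e1.2, e2.1, e2.2, e3.1, e3.2]
  · have hE : diagEnergy (ρ + κ') = diagEnergy ρ + diagEnergy κ' :=
      integral_add_measure (integrable_of_bound measurable_coordDiff coordDiff_le_one)
        (integrable_of_bound measurable_coordDiff coordDiff_le_one)
    have hE' : diagEnergy κ' ≤ diagEnergy κ :=
      integral_mono_measure hκ'le (Eventually.of_forall fun p => sq_nonneg _)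
        (integrable_of_bound measurable_coordDiff coordDiff_le_one)
    rw [hE]
    linarith [h.energy, hκ.energy]

end IsPartialCoupling

end PartialCoupling

/-! ### Couplings without mass on the diagonal -/

/-- A finite measure without atoms has a self-coupling without mass on the diagonal. -/
theorem exists_map_fst_eq_of_nullSingletonClass {X : Type u} [MeasurableSpace X]
    [StandardBorelSpace X] (θ : Measure X) [IsFiniteMeasure θ] [NullSingletonClass θ] :
    ∃ σ : Measure (X × X), σ.map Prod.fst = θ ∧ σ.map Prod.snd = θ ∧ σ (Set.diagonal X) = 0 := by
  rcases eq_or_ne θ 0 with rfl | h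
  · exact ⟨0, by simp, by simp, by simp⟩
  have h1 : θ Set.univ ≠ 0 := by simpa using h
  have h2 : (θ Set.univ)⁻¹ * θ Set.univ = 1 := ENNReal.inv_mul_cancel h1 (measure_ne_top _ _)
  refine ⟨(θ Set.univ)⁻¹ • θ.prod θ, ?_, ?_, ?_⟩
  · rw [Measure.map_smul, Measure.map_fst_prod, smul_smul, h2, one_smul]
  · rw [Measure.map_smul, Measure.map_snd_prod, smul_smul, h2, one_smul]
  · rw [Measure.smul_apply, Measure.prod_apply measurableSet_diagonal]
    have h3 : ∀ x : X, θ (Prod.mk x ⁻¹' Set.diagonal X) = 0 := fun x => by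
      have : Prod.mk x ⁻¹' Set.diagonal X = {x} := by
        ext y; simp [eq_comm]
      rw [this, measure_singleton]
    simp [h3]

section

variable {X : Type u} [MeasurableSpace X] [StandardBorelSpace X] {Γ : Type v} [Group Γ]
  [MulAction Γ X] [MeasurableConstSMul Γ X] {μ : Measure X} [IsProbabilityMeasure μ]

/-- There are partial couplings of mass at least `m` with arbitrary precision. -/
def HasPartialCouplings (Γ : Type v) [Group Γ] [MulAction Γ X] [MeasurableConstSMul Γ X]
    (μ : Measure X) (m : ℝ) : Prop :=
  ∀ (G : Finset Γ) (δ : ℝ), 0 < δ → ∃ ρ, IsPartialCoupling μ G δ ρ ∧ m ≤ ρ.real Set.univ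

theorem integral_abs_fst_sub_snd_le {ν : Measure (X × X)} (hν : IsCoupling μ ν) {w : X → ℝ}
    (hw : Measurable w) (h0 : ∀ x, 0 ≤ w x) (h1 : ∀ x, w x ≤ 1) {τ : ℝ} (hτ : 0 ≤ τ)
    (h : ∫ p, ‖(w p.1 : ℂ) - w p.2‖ ^ 2 ∂ν ≤ τ ^ 2) : ∫ p, |w p.1 - w p.2| ∂ν ≤ τ := by
  have := hν.isProbabilityMeasure
  refine abs_le_of_sq_le_sq' ?_ hτ |>.2
  refine (sq_integral_le (f := fun p : X × X => |w p.1 - w p.2|) (C := 1)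
    ((hw.comp measurable_fst).sub (hw.comp measurable_snd)).abs fun p => ?_).trans ?_
  · rw [abs_abs, abs_le]
    constructor <;> linarith [h0 p.1, h1 p.1, h0 p.2, h1 p.2]
  · refine le_trans (le_of_eq ?_) h
    refine integral_congr_ae (Eventually.of_forall fun p => ?_)
    simp only
    rw [← Complex.ofReal_sub, Complex.norm_real, Real.norm_eq_abs]

namespace HasPartialCouplings

theorem mono {m m' : ℝ} (h : HasPartialCouplings Γ μ m) (hm : m' ≤ m) :
    HasPartialCouplings Γ μ m' := fun G δ hδ =>
  let ⟨ρ, h1, h2⟩ := h G δ hδ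
  ⟨ρ, h1, hm.trans h2⟩

theorem zero : HasPartialCouplings Γ μ 0 := fun _ _ hδ =>
  ⟨0, IsPartialCoupling.zero hδ.le, measureReal_nonneg⟩

/-- Filling up the missing part of the marginal increases the mass by a definite amount. -/
theorem add_mul_sq [ErgodicSMul Γ X μ] {ε : ℝ} (hε : 0 < ε) (hε2 : ε ≤ 1 / 2)
    (H : ∀ (G : Finset Γ) (δ : ℝ), 0 < δ → ∃ ν : Measure (X × X), IsCoupling μ ν ∧
      (∀ γ ∈ G, TVLe (ν.map fun p => γ • p) ν δ) ∧ diagEnergy ν ≤ δ ∧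
      ε ≤ ν.real (Set.diagonal X)ᶜ)
    {m : ℝ} (h0m : 0 ≤ m) (hm1 : m < 1) (h : HasPartialCouplings Γ μ m) :
    HasPartialCouplings Γ μ (m + ε * (1 - m) ^ 2 / 2) := by
  classical
  intro G δ hδ
  -- The combined precision is `3 · δ/6 + δ/2 = δ`.
  obtain ⟨ρ, hρ, hM⟩ := h G (δ / 6) (by positivity)
  have hM1 := hρ.mass_le_one
  obtain ⟨w, hw, w0, w1, hwμ⟩ := hρ.exists_complement
  have hfin := hρ.isFiniteMeasure
  set M := ρ.real Set.univ with hMdef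
  have hwint : ∫ x, w x ∂μ = 1 - M := by
    have e := hρ.integral_complement hw w0 hwμ (f := fun _ => 1) measurable_const (C := 1) (by simp)
    have e2 := IsPartialCoupling.real_univ_map_fst (ρ := ρ)
    rw [measureReal_def] at e2
    rw [hMdef, measureReal_def]
    simpa [measureReal_def, e2] using e
  have hτpos : 0 < ε * (1 - m) ^ 2 / 4 := by
    have : 0 < 1 - m := by linarith
    positivity
  set τ := ε * (1 - m) ^ 2 / 4 with hτ
  have hwsq : ∀ x, |w x ^ 2| ≤ 1 := fun x => by
    rw [abs_of_nonneg (sq_nonneg _)]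
    exact pow_le_one₀ (w0 x) (w1 x)
  -- The precision demanded of the new coupling depends on `w`, hence on `ρ`, and is therefore fixed
  -- only now.
  obtain ⟨G₁, δ₁, hδ₁, H₁⟩ := exists_integral_sub_le Γ (μ := μ) (hw.pow_const 2) hwsq hτpos
  obtain ⟨δ₂, hδ₂, H₂⟩ := exists_energy_bound μ (f := fun x => (w x : ℂ)) (C := 1)
    (Complex.measurable_ofReal.comp hw) (fun x => by
      rw [Complex.norm_real, Real.norm_eq_abs, abs_of_nonneg (w0 x)]; exact w1 x)
    (ε := τ ^ 2) (by positivity)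
  obtain ⟨ν, hν, hνG, hνE, hνm⟩ := H (G ∪ G₁) (min (δ / 2) (min δ₁ δ₂)) (by positivity)
  have hνP := hν.isProbabilityMeasure
  have hs := hν.symmetrization
  have hsP := hs.isProbabilityMeasure
  set κ := (symmetrization ν).restrict (Set.diagonal X)ᶜ with hκ
  have hκp : IsPartialCoupling μ (G ∪ G₁) (min (δ / 2) (min δ₁ δ₂)) κ :=
    IsPartialCoupling.of_isCoupling hν hνG hνE
  have hκf := hκp.isFiniteMeasure
  have hκm : κ.real Set.univ = ν.real (Set.diagonal X)ᶜ := IsPartialCoupling.mass_of_isCoupling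
  have hadd := hρ.add_withDensity hw w0 w1 hwμ
    (hκp.mono Finset.subset_union_left (min_le_left _ _))
  refine ⟨_, hadd.mono subset_rfl (by linarith), ?_⟩
  have hWm : Measurable fun p : X × X => w p.1 * w p.2 :=
    (hw.comp measurable_fst).mul (hw.comp measurable_snd)
  have hW0 : ∀ p : X × X, 0 ≤ w p.1 * w p.2 := fun p => mul_nonneg (w0 _) (w0 _)
  have hW1 : ∀ p : X × X, w p.1 * w p.2 ≤ 1 := fun p => mul_le_one₀ (w1 _) (w0 _) (w1 _)
  set κ' := κ.withDensity fun p => ENNReal.ofReal (w p.1 * w p.2) with hκ'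
  have : IsFiniteMeasure κ' := isFiniteMeasure_of_le κ (withDensity_ofReal_le hW1)
  rw [measureReal_add_apply]
  have hκ'm : κ'.real Set.univ = ∫ p, w p.1 * w p.2 ∂κ := by
    have e := integral_withDensity_ofReal (ρ := κ) hWm hW0 fun _ => 1
    simpa using e
  have i1 : Integrable (fun p : X × X => w p.1 * w p.2) κ := integrable_of_bound (C := 1) hWm
    fun p => by rw [Real.norm_eq_abs, abs_of_nonneg (hW0 p)]; exact hW1 p
  have i2 : Integrable (fun p : X × X => w p.1 ^ 2) κ :=
    integrable_of_bound (C := 1) ((hw.comp measurable_fst).pow_const 2) fun p => hwsq _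
  have hdm : Measurable fun p : X × X => |w p.1 - w p.2| :=
    ((hw.comp measurable_fst).sub (hw.comp measurable_snd)).abs
  have hd1 : ∀ p : X × X, ‖|w p.1 - w p.2|‖ ≤ 1 := fun p => by
    rw [norm_abs_eq_norm, Real.norm_eq_abs, abs_le]
    constructor <;> linarith [w0 p.1, w1 p.1, w0 p.2, w1 p.2]
  have i3 : Integrable (fun p : X × X => |w p.1 - w p.2|) κ := integrable_of_bound hdm hd1
  -- Estimate of the gain. Closeness to the diagonal makes the subtracted term at most `τ`;
  -- ergodicity replaces the first by the mass of `κ` times `∫ w² dμ`, up to another `τ`; and `∫ w²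
  -- dμ ≥ (∫ w dμ)² = (1 - M)²`. The total loss `2 τ` is half of `ε (1 - m)²`.
  have f1 : (∫ p, w p.1 ^ 2 ∂κ) - ∫ p, |w p.1 - w p.2| ∂κ ≤ ∫ p, w p.1 * w p.2 ∂κ := by
    rw [← integral_sub i2 i3]
    refine integral_mono (i2.sub i3) i1 fun p => ?_
    have g1 : w p.1 * (w p.1 - w p.2) ≤ 1 * |w p.1 - w p.2| :=
      (mul_le_mul_of_nonneg_left (le_abs_self _) (w0 _)).trans
        (mul_le_mul_of_nonneg_right (w1 _) (abs_nonneg _))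
    simp only
    nlinarith
  have f2 : ∫ p, |w p.1 - w p.2| ∂κ ≤ τ := by
    refine (integral_mono_measure Measure.restrict_le_self
      (Eventually.of_forall fun x => abs_nonneg _) (integrable_of_bound hdm hd1)).trans ?_
    refine integral_abs_fst_sub_snd_le hs hw w0 w1 hτpos.le (H₂ _ hs ?_)
    rw [diagEnergy_symmetrization]
    exact hνE.trans ((min_le_right _ _).trans (min_le_right _ _))
  have f3 : κ.real Set.univ * ∫ x, w x ^ 2 ∂μ ≤ (∫ p, w p.1 ^ 2 ∂κ) + τ := by
    have e := H₁ (κ.map Prod.fst) hκp.map_fst_le fun γ hγ =>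
      (hκp.tvLe_map_fst (Finset.mem_union_right _ hγ)).mono
        ((min_le_right _ _).trans (min_le_left _ _))
    rw [integral_map measurable_fst.aemeasurable (hw.pow_const 2).aestronglyMeasurable,
      IsPartialCoupling.real_univ_map_fst, abs_le] at e
    linarith [e.1]
  have f4 : (1 - M) ^ 2 ≤ ∫ x, w x ^ 2 ∂μ := by
    rw [← hwint]
    exact sq_integral_le hw (C := 1) fun x => by rw [abs_of_nonneg (w0 x)]; exact w1 x
  have f5 : ε * (1 - M) ^ 2 ≤ κ.real Set.univ * ∫ x, w x ^ 2 ∂μ :=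
    mul_le_mul (hκm ▸ hνm) f4 (sq_nonneg _) measureReal_nonneg
  -- For `ε ≤ 1 / 2` the function `s ↦ s + ε (1 - s)²` is increasing on `[0, 1]`, so the actual mass
  -- `M` may be replaced by its lower bound `m`.
  have f6 : m + ε * (1 - m) ^ 2 ≤ M + ε * (1 - M) ^ 2 := by
    have g : 0 ≤ (M - m) * (1 - ε * (2 - M - m)) :=
      mul_nonneg (by linarith) (by nlinarith)
    nlinarith
  rw [hκ'm]
  linarith

/-- If the supremum of the attainable masses below `1` were less than `1`, a mass just below it
could be raised beyond it, the increment being bounded below. Replacing `ε` by `min ε (1/2)` meets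
the restriction in the increment lemma. -/
theorem of_lt_one [ErgodicSMul Γ X μ] {ε : ℝ} (hε : 0 < ε)
    (H : ∀ (G : Finset Γ) (δ : ℝ), 0 < δ → ∃ ν : Measure (X × X), IsCoupling μ ν ∧
      (∀ γ ∈ G, TVLe (ν.map fun p => γ • p) ν δ) ∧ diagEnergy ν ≤ δ ∧
      ε ≤ ν.real (Set.diagonal X)ᶜ) {m : ℝ} (hm : m < 1) : HasPartialCouplings Γ μ m := by
  set c := min ε (1 / 2) with hc
  have hc0 : 0 < c := by positivity
  have hc2 : c ≤ 1 / 2 := min_le_right _ _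
  have H' : ∀ (G : Finset Γ) (δ : ℝ), 0 < δ → ∃ ν : Measure (X × X), IsCoupling μ ν ∧
      (∀ γ ∈ G, TVLe (ν.map fun p => γ • p) ν δ) ∧ diagEnergy ν ≤ δ ∧
      c ≤ ν.real (Set.diagonal X)ᶜ := fun G δ hδ => by
    obtain ⟨ν, h1, h2, h3, h4⟩ := H G δ hδ
    exact ⟨ν, h1, h2, h3, (min_le_left _ _).trans h4⟩
  set S : Set ℝ := {m | 0 ≤ m ∧ m < 1 ∧ HasPartialCouplings Γ μ m} with hS
  have hS0 : (0 : ℝ) ∈ S := ⟨le_rfl, zero_lt_one, zero⟩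
  have hSb : BddAbove S := ⟨1, fun x hx => hx.2.1.le⟩
  have hs : 1 ≤ sSup S := by
    by_contra! hlt
    have hpos : 0 < c * (1 - sSup S) ^ 2 / 2 := by
      have : 0 < 1 - sSup S := by linarith
      positivity
    obtain ⟨a, ha, hlt'⟩ := exists_lt_of_lt_csSup ⟨0, hS0⟩
      (show sSup S - c * (1 - sSup S) ^ 2 / 2 < sSup S by linarith)
    have hle : a ≤ sSup S := le_csSup hSb ha
    have hmem : a + c * (1 - a) ^ 2 / 2 ∈ S := by
      have ha1 := ha.1
      have ha2 := ha.2.1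
      refine ⟨by positivity, by nlinarith, add_mul_sq hc0 hc2 H' ha.1 ha.2.1 ha.2.2⟩
    have h2 := le_csSup hSb hmem
    have h3 : c * (1 - sSup S) ^ 2 ≤ c * (1 - a) ^ 2 :=
      mul_le_mul_of_nonneg_left (pow_le_pow_left₀ (by linarith) (by linarith) 2) hc0.le
    linarith
  obtain ⟨a, ha, hlt⟩ := exists_lt_of_lt_csSup ⟨0, hS0⟩ (hm.trans_le hs)
  exact ha.2.2.mono hlt.le

/-- The missing marginal has small mass and no atoms, so any off-diagonal self-coupling of it
completes the partial coupling: neither its invariance nor its energy needs control. -/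
theorem exists_isCoupling [SMulInvariantMeasure Γ X μ] [NullSingletonClass μ]
    (h : ∀ m < 1, HasPartialCouplings Γ μ m)
    (G : Finset Γ) {δ : ℝ} (hδ : 0 < δ) : ∃ ν : Measure (X × X), IsCoupling μ ν ∧
      (∀ γ ∈ G, TVLe (ν.map fun p => γ • p) ν δ) ∧ diagEnergy ν ≤ δ ∧ ν (Set.diagonal X) = 0 := by
  -- The added measure has mass at most `δ / 4` and enters the invariance estimate twice: `δ/2 + δ/4
  -- + δ/4 = δ`.
  obtain ⟨ρ, hρ, hM⟩ := h (1 - δ / 4) (by linarith) G (δ / 2) (by positivity)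
  have := hρ.isFiniteMeasure
  obtain ⟨w, hw, w0, w1, hwμ⟩ := hρ.exists_complement
  set θ := μ.withDensity fun x => ENNReal.ofReal (w x) with hθ
  have hle : θ ≤ μ := withDensity_ofReal_le w1
  have := isFiniteMeasure_of_le μ hle
  have : NullSingletonClass θ := ⟨fun x => le_antisymm ((hle _).trans (measure_singleton x).le) bot_le⟩
  obtain ⟨σ, hσ1, hσ2, hσd⟩ := exists_map_fst_eq_of_nullSingletonClass θ
  have hσf : IsFiniteMeasure σ := by
    refine ⟨?_⟩
    rw [← Set.preimage_univ (f := (Prod.fst : X × X → X)),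
      ← Measure.map_apply measurable_fst MeasurableSet.univ, hσ1]
    exact measure_lt_top _ _
  have hmap1 : (ρ + σ).map Prod.fst = μ := by
    rw [Measure.map_add _ _ measurable_fst, hσ1, hwμ]
  have hmap2 : (ρ + σ).map Prod.snd = μ := by
    have e : ρ.map Prod.snd = ρ.map Prod.fst := by
      conv_lhs => rw [← hρ.map_swap, Measure.map_map measurable_snd measurable_swap]
      rfl
    rw [Measure.map_add _ _ measurable_snd, hσ2, e, hwμ]
  have hP : IsProbabilityMeasure (ρ + σ) := by
    refine ⟨?_⟩
    rw [← Set.preimage_univ (f := (Prod.fst : X × X → X)),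
      ← Measure.map_apply measurable_fst MeasurableSet.univ, hmap1, measure_univ]
  have hσm : σ.real Set.univ ≤ δ / 4 := by
    have e : (ρ + σ).real Set.univ = 1 := by simp
    rw [measureReal_add_apply] at e
    linarith
  have hb : ∀ f : X × X → ℝ, (∀ p, |f p| ≤ 1) → |∫ p, f p ∂σ| ≤ δ / 4 := fun f hf => by
    have e := norm_integral_le_of_norm_le_const (μ := σ) (f := f) (C := 1)
      (Eventually.of_forall hf)
    rw [Real.norm_eq_abs, one_mul] at e
    exact e.trans hσm
  refine ⟨ρ + σ, ⟨hP, hmap1, hmap2⟩, fun γ hγ f hf h1 => ?_, ?_, ?_⟩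
  · have hγm : Measurable fun p : X × X => γ • p := measurable_const_smul γ
    have e1 := hρ.tvLe γ hγ f hf h1
    rw [integral_map hγm.aemeasurable hf.aestronglyMeasurable] at e1 ⊢
    rw [integral_add_measure (integrable_of_bound hf h1) (integrable_of_bound hf h1),
      integral_add_measure (integrable_of_bound (f := fun p => f (γ • p)) (hf.comp hγm) fun p => h1 _)
        (integrable_of_bound (f := fun p => f (γ • p)) (hf.comp hγm) fun p => h1 _)]
    have e2 := hb f h1
    have e3 := hb (fun p => f (γ • p)) fun p => h1 _
    rw [abs_le] at *
    constructor <;> linarith [e1.1, e1.2, e2.1, e2.2, e3.1, e3.2]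
  · have hE : diagEnergy (ρ + σ) = diagEnergy ρ + diagEnergy σ :=
      integral_add_measure (integrable_of_bound measurable_coordDiff coordDiff_le_one)
        (integrable_of_bound measurable_coordDiff coordDiff_le_one)
    have e := (le_abs_self _).trans (hb _ coordDiff_le_one)
    rw [hE]
    have e' : diagEnergy σ ≤ δ / 4 := e
    linarith [hρ.energy]
  · rw [Measure.add_apply, hρ.diagonal, hσd, add_zero]

end HasPartialCouplings

/-- If the action is not rigid, there are almost invariant measures close to the diagonal without
mass on the diagonal. -/
theorem exists_seq_of_not_isRigidAction [Countable Γ] [NullSingletonClass μ] [ErgodicSMul Γ X μ]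
    (h : ¬ IsRigidAction Γ μ) : ∃ ν : ℕ → Measure (X × X), IsApproxDiagonal μ ν ∧
      IsAsymptoticallyInvariant Γ ν ∧ ∀ n, ν n (Set.diagonal X) = 0 := by
  classical
  obtain ⟨ε, hε, H⟩ := exists_isCoupling_of_not_isRigidAction h
  obtain ⟨e, he⟩ := exists_surjective_nat Γ
  have hpos : ∀ n : ℕ, (0 : ℝ) < 1 / ((n : ℝ) + 1) := fun n => by positivity
  choose ν hν hG hE hd using fun n : ℕ => HasPartialCouplings.exists_isCoupling
    (fun m hm => HasPartialCouplings.of_lt_one hε H hm)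
    ((Finset.range (n + 1)).image e) (hpos n)
  refine ⟨ν, isApproxDiagonal_of_diagEnergy hν ?_, fun γ => ?_, hd⟩
  · exact squeeze_zero (fun n => diagEnergy_nonneg _) hE tendsto_one_div_add_atTop_nhds_zero_nat
  · obtain ⟨k, rfl⟩ := he γ
    refine squeeze_zero' (Eventually.of_forall fun n => measureDist_nonneg _ _) ?_
      tendsto_one_div_add_atTop_nhds_zero_nat
    filter_upwards [eventually_ge_atTop k] with n hn
    have := (hν n).isProbabilityMeasure
    have hγm : Measurable fun p : X × X => e k • p := measurable_const_smul (e k)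
    have := Measure.isFiniteMeasure_map (ν n) (fun p : X × X => e k • p)
    exact measureDist_le (hG n (e k) (Finset.mem_image_of_mem e (Finset.mem_range.2 (by omega))))

end

/-! ### Property (T) -/

section Kazhdan

variable {Γ : Type v} [Group Γ]

section

variable {K : Type w} [NormedAddCommGroup K] [InnerProductSpace ℂ K] [CompleteSpace K]
  {U : Γ →* (K →L[ℂ] K)} (hU : ∀ γ ξ, ‖U γ ξ‖ = ‖ξ‖)

theorem map_inv_apply_self (U : Γ →* (K →L[ℂ] K)) (γ : Γ) (ξ : K) : U γ (U γ⁻¹ ξ) = ξ := by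
  rw [← mul_apply_eq_comp, ← map_mul, mul_inv_cancel, map_one,
    one_apply_eq_self]

include hU in
theorem inner_map_apply (γ : Γ) (ξ ζ : K) : inner ℂ (U γ ξ) ζ = inner ℂ ξ (U γ⁻¹ ζ) := by
  conv_lhs => rw [← map_inv_apply_self U γ ζ]
  exact (⟨(U γ : K →ₗ[ℂ] K), hU γ⟩ : K →ₗᵢ[ℂ] K).inner_map_map ξ (U γ⁻¹ ζ)

include hU in
theorem mem_unitary_of_norm_map (γ : Γ) : U γ ∈ unitary (K →L[ℂ] K) := by
  have h : star (U γ) = U γ⁻¹ := by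
    rw [ContinuousLinearMap.star_eq_adjoint, eq_comm, ContinuousLinearMap.eq_adjoint_iff]
    intro ξ ζ
    rw [inner_map_apply hU, inv_inv]
  rw [Unitary.mem_iff, h, ← map_mul, ← map_mul, inv_mul_cancel, mul_inv_cancel, map_one]
  exact ⟨rfl, rfl⟩

/-- The space of invariant vectors of a representation. -/
def invariantVectors (U : Γ →* (K →L[ℂ] K)) : Submodule ℂ K where
  carrier := {ξ | ∀ γ, U γ ξ = ξ}
  add_mem' h h' γ := by rw [map_add, h γ, h' γ]
  zero_mem' γ := map_zero _
  smul_mem' c ξ h γ := by rw [map_smul, h γ]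

theorem isClosed_invariantVectors (U : Γ →* (K →L[ℂ] K)) :
    IsClosed (invariantVectors U : Set K) := by
  have : (invariantVectors U : Set K) = ⋂ γ, {ξ | U γ ξ = ξ} := by
    ext ξ; simp [invariantVectors]
  rw [this]
  exact isClosed_iInter fun γ => isClosed_eq (U γ).continuous continuous_id

include hU in
theorem map_mem_orthogonal_invariantVectors (γ : Γ) :
    ∀ ζ ∈ (invariantVectors U)ᗮ, U γ ζ ∈ (invariantVectors U)ᗮ := by
  intro ζ hζ
  rw [Submodule.mem_orthogonal'] at *
  intro η hη
  rw [inner_map_apply hU, hη γ⁻¹]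
  exact hζ η hη

end

/-- In a representation of a group with property (T), almost invariant vectors are close to
invariant ones. -/
theorem HasPropertyT.exists_invariant (hT : HasPropertyT.{v, w} Γ) {K : Type w}
    [NormedAddCommGroup K] [InnerProductSpace ℂ K] [CompleteSpace K] {U : Γ →* (K →L[ℂ] K)}
    (hU : ∀ γ ξ, ‖U γ ξ‖ = ‖ξ‖) : ∃ (F : Finset Γ) (δ : ℝ), 0 < δ ∧ ∀ ξ : K, ∃ η : K,
      (∀ γ, U γ η = η) ∧ ∀ d : ℝ, 0 ≤ d → (∀ γ ∈ F, ‖U γ ξ - ξ‖ ≤ d) → δ * ‖ξ - η‖ ≤ d := by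
  set V : Submodule ℂ K := (invariantVectors U)ᗮ with hV
  have : CompleteSpace (invariantVectors U) :=
    (isClosed_invariantVectors U).completeSpace_coe
  let W : Γ →* (V →L[ℂ] V) :=
    { toFun := fun γ => (U γ).restrict (map_mem_orthogonal_invariantVectors hU γ)
      map_one' := by ext ζ; simp
      map_mul' := fun γ γ' => by ext ζ; simp }
  have hWc : ∀ γ (ζ : V), (W γ ζ : K) = U γ ζ := fun γ ζ => rfl
  have hW : ∀ γ (ζ : V), ‖W γ ζ‖ = ‖ζ‖ := fun γ ζ => hU γ ζ
  -- The orthogonal complement of the invariant vectors has no nonzero invariant vector, so property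
  -- (T) rules out almost invariant ones there. The resulting `F`, `δ` bound the distance from `ξ`
  -- to its projection onto the invariant vectors.
  by_cases hai : ∀ (F : Finset Γ) (ε : ℝ), 0 < ε →
      ∃ ξ : V, ‖ξ‖ = 1 ∧ ∀ γ ∈ F, ‖W γ ξ - ξ‖ < ε
  · exfalso
    obtain ⟨η, hη0, hη⟩ := hT V (W.codRestrict (unitary (V →L[ℂ] V)) (mem_unitary_of_norm_map hW)) hai
    refine hη0 (Subtype.ext ?_)
    have h1 : (η : K) ∈ invariantVectors U := fun γ => congrArg Subtype.val (hη γ)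
    exact inner_self_eq_zero.1 ((Submodule.mem_orthogonal _ _).1 η.2 η h1)
  · push Not at hai
    obtain ⟨F, δ, hδ, H⟩ := hai
    refine ⟨F, δ, hδ, fun ξ => ⟨(invariantVectors U).starProjection ξ, ?_, fun d hd hF => ?_⟩⟩
    · exact Submodule.starProjection_apply_mem (invariantVectors U) ξ
    set η := (invariantVectors U).starProjection ξ with hη
    have hηi : ∀ γ, U γ η = η := Submodule.starProjection_apply_mem (invariantVectors U) ξ
    have hmem : ξ - η ∈ V := Submodule.sub_starProjection_mem_orthogonal ξ
    rcases eq_or_ne (ξ - η) 0 with h0 | h0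
    · rw [h0, norm_zero, mul_zero]; exact hd
    have hn : 0 < ‖ξ - η‖ := norm_pos_iff.2 h0
    obtain ⟨γ, hγ, hle⟩ := H ((‖ξ - η‖⁻¹ : ℂ) • ⟨ξ - η, hmem⟩) (by
      rw [norm_smul, norm_inv, Complex.norm_real, norm_norm]
      exact inv_mul_cancel₀ hn.ne')
    refine le_trans ?_ (hF γ hγ)
    have e : ‖W γ ((‖ξ - η‖⁻¹ : ℂ) • ⟨ξ - η, hmem⟩) - (‖ξ - η‖⁻¹ : ℂ) • ⟨ξ - η, hmem⟩‖ =
        ‖ξ - η‖⁻¹ * ‖U γ ξ - ξ‖ := by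
      rw [map_smul, ← smul_sub, norm_smul, norm_inv, Complex.norm_real, norm_norm]
      congr 1
      change ‖U γ (ξ - η) - (ξ - η)‖ = _
      rw [map_sub, hηi, sub_sub_sub_cancel_right]
    rw [e, inv_mul_eq_div, le_div_iff₀ hn] at hle
    exact hle

/-! ### Direct sums of isometric representations -/

section DirectSum

variable {ι : Type w} {E : ι → Type u} [∀ i, NormedAddCommGroup (E i)]
  [∀ i, InnerProductSpace ℂ (E i)] {U : ∀ i, Γ →* (E i →L[ℂ] E i)}
  (hU : ∀ i γ ξ, ‖U i γ ξ‖ = ‖ξ‖)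

/-- The direct sum of a family of isometric representations. -/
def sumRepresentation (U : ∀ i, Γ →* (E i →L[ℂ] E i)) (hU : ∀ i γ ξ, ‖U i γ ξ‖ = ‖ξ‖) :
    Γ →* (lp E 2 →L[ℂ] lp E 2) where
  toFun γ := lp.mapCLM 2 (fun i => U i γ) zero_le_one fun i =>
    ContinuousLinearMap.opNorm_le_bound _ zero_le_one fun ξ => by rw [hU, one_mul]
  map_one' := by
    ext1 ξ
    refine lp.ext (funext fun i => ?_)
    change U i 1 (ξ i) = ξ i
    rw [map_one]
    rfl
  map_mul' γ γ' := by
    ext1 ξ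
    refine lp.ext (funext fun i => ?_)
    change U i (γ * γ') (ξ i) = U i γ (U i γ' (ξ i))
    rw [map_mul]
    rfl

theorem sumRepresentation_apply (γ : Γ) (ξ : lp E 2) (i : ι) :
    sumRepresentation U hU γ ξ i = U i γ (ξ i) := rfl

theorem norm_sumRepresentation (γ : Γ) (ξ : lp E 2) : ‖sumRepresentation U hU γ ξ‖ = ‖ξ‖ := by
  rw [lp.norm_eq_tsum_rpow (by norm_num), lp.norm_eq_tsum_rpow (by norm_num)]
  simp_rw [sumRepresentation_apply, hU]

theorem sumRepresentation_single [DecidableEq ι] (γ : Γ) (i : ι) (f : E i) :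
    sumRepresentation U hU γ (lp.single 2 i f) = lp.single 2 i (U i γ f) := by
  refine lp.ext (funext fun j => ?_)
  rw [sumRepresentation_apply]
  by_cases hj : j = i
  · subst hj
    rw [lp.single_apply_self, lp.single_apply_self]
  · rw [lp.single_apply_ne _ _ _ hj, lp.single_apply_ne _ _ _ hj, map_zero]

end DirectSum

/-- Vectors in a family of representations that are invariant under a finite subset up to a small
error are uniformly close to invariant vectors. -/
theorem HasPropertyT.exists_invariant_of_family {ι : Type v} {E : ι → Type u}
    (hT : HasPropertyT.{v, max u v} Γ) [∀ i, NormedAddCommGroup (E i)]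
    [∀ i, InnerProductSpace ℂ (E i)] [∀ i, CompleteSpace (E i)] {U : ∀ i, Γ →* (E i →L[ℂ] E i)}
    (hU : ∀ i γ ξ, ‖U i γ ξ‖ = ‖ξ‖) : ∃ (F : Finset Γ) (δ : ℝ), 0 < δ ∧ ∀ i, ∀ f : E i,
      ∃ g : E i, (∀ γ, U i γ g = g) ∧ ∀ d : ℝ, 0 ≤ d → (∀ γ ∈ F, ‖U i γ f - f‖ ≤ d) →
        δ * ‖f - g‖ ≤ d := by
  classical
  -- One pair `F`, `δ` for the direct sum serves all summands, which gives uniformity in `i`.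
  obtain ⟨F, δ, hδ, H⟩ := hT.exists_invariant (norm_sumRepresentation hU)
  refine ⟨F, δ, hδ, fun i f => ?_⟩
  obtain ⟨η, hη, hηd⟩ := H (lp.single 2 i f)
  refine ⟨η i, fun γ => by rw [← sumRepresentation_apply hU γ η i, hη], fun d hd hF => ?_⟩
  have h2 := hηd d hd fun γ hγ => by
    rw [sumRepresentation_single, ← lp.single_sub, lp.norm_single (by norm_num)]
    exact hF γ hγ
  refine le_trans (mul_le_mul_of_nonneg_left ?_ hδ.le) h2
  have h3 := lp.norm_apply_le_norm (p := 2) (by norm_num) (lp.single 2 i f - η) i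
  rwa [lp.coeFn_sub, Pi.sub_apply, lp.single_apply_self] at h3

variable {Y : Type u} [MeasurableSpace Y] [MulAction Γ Y] [MeasurableConstSMul Γ Y]

/-- The Koopman representation as a homomorphism. -/
def IsQuasiInvariant.koopmanHom {ν : Measure Y} [IsFiniteMeasure ν] (hq : IsQuasiInvariant Γ ν) :
    Γ →* (Lp ℂ 2 ν →L[ℂ] Lp ℂ 2 ν) where
  toFun γ := (hq.koopman γ).toContinuousLinearMap
  map_one' := ContinuousLinearMap.ext hq.koopman_one
  map_mul' γ γ' := ContinuousLinearMap.ext (hq.koopman_mul γ γ')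

/-- The spaces `L²(ν n)` vary with `n`, so a finite set and a constant valid for all of them are
needed; `ULift` only places the index set in the universe of `Γ`. -/
theorem HasPropertyT.eventually_exists_koopman_eq (hT : HasPropertyT.{v, max u v} Γ)
    {ν : ℕ → Measure Y} [∀ n, IsFiniteMeasure (ν n)] (hq : ∀ n, IsQuasiInvariant Γ (ν n))
    (f : ∀ n, Lp ℂ 2 (ν n))
    (h : ∀ γ, Tendsto (fun n => ‖(hq n).koopman γ (f n) - f n‖) atTop (𝓝 0)) {ε : ℝ} (hε : 0 < ε) :
    ∀ᶠ n in atTop, ∃ g : Lp ℂ 2 (ν n), (∀ γ, (hq n).koopman γ g = g) ∧ ‖f n - g‖ ≤ ε := by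
  obtain ⟨F, δ, hδ, H⟩ := hT.exists_invariant_of_family
    (U := fun n : ULift.{v} ℕ => (hq n.down).koopmanHom)
    fun n γ ξ => ((hq n.down).koopman γ).norm_map ξ
  have h1 : ∀ᶠ n in atTop, ∀ γ ∈ F, ‖(hq n).koopman γ (f n) - f n‖ ≤ δ * ε :=
    (Finset.eventually_all F).2 fun γ _ => by
      filter_upwards [(h γ).eventually (gt_mem_nhds (show 0 < δ * ε by positivity))] with n hn
      exact hn.le
  filter_upwards [h1] with n hn
  obtain ⟨g, hg, hgd⟩ := H ⟨n⟩ (f n)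
  exact ⟨g, hg, le_of_mul_le_mul_left (hgd (δ * ε) (by positivity) hn) hδ⟩

end Kazhdan

/-! ### Invariant couplings under property (T) -/

section Invariant

/-- An ergodic measure is the only invariant probability measure absolutely continuous with respect
to it. -/
theorem eq_of_absolutelyContinuous_of_map_smul_eq {X : Type u} [MeasurableSpace X] {Γ : Type v}
    [Group Γ] [MulAction Γ X] [MeasurableConstSMul Γ X] {μ θ : Measure X} [IsProbabilityMeasure μ]
    [ErgodicSMul Γ X μ] [IsProbabilityMeasure θ] (hθ : θ ≪ μ)
    (h : ∀ γ : Γ, θ.map (fun x => γ • x) = θ) : θ = μ := by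
  set f := θ.rnDeriv μ with hf
  have hfm : Measurable f := Measure.measurable_rnDeriv _ _
  have hd : μ.withDensity f = θ := Measure.withDensity_rnDeriv_eq _ _ hθ
  have hinv : ∀ γ : Γ, (fun x => f (γ • x)) =ᵐ[μ] f := fun γ => by
    have h1 := map_smul_withDensity μ γ⁻¹ hfm
    rw [hd, h, (measurePreserving_smul γ⁻¹ μ).map_eq, inv_inv, ← hd] at h1
    refine ((withDensity_eq_iff hfm.aemeasurable
      (hfm.comp (measurable_const_smul γ)).aemeasurable ?_).1 h1).symm
    rw [← setLIntegral_univ, ← withDensity_apply _ MeasurableSet.univ, hd]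
    exact measure_ne_top _ _
  obtain ⟨c, hc⟩ := exists_const_of_forall_smul_ae_eq hfm hinv
  have h2 : θ = c • μ := by
    rw [← hd, withDensity_congr_ae hc]
    exact withDensity_const c
  have h3 := congrArg (fun ρ : Measure X => ρ Set.univ) h2
  simp only [Measure.smul_apply, measure_univ, smul_eq_mul, mul_one] at h3
  rw [h2, ← h3, one_smul]

variable {X : Type u} [MeasurableSpace X] [StandardBorelSpace X] {Γ : Type v} [Group Γ]
  [MulAction Γ X] [MeasurableConstSMul Γ X] {μ : Measure X} [IsProbabilityMeasure μ]
  [ErgodicSMul Γ X μ]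

/-- An invariant vector close to `1` yields an invariant coupling. -/
theorem exists_invariant_isCoupling {ν : Measure (X × X)} (hν : IsBimoduleCoupling Γ μ ν)
    [IsProbabilityMeasure ν] {g : Lp ℂ 2 ν} (hg : ∀ γ, hν.quasiInvariant.koopman γ g = g) {ε : ℝ}
    (hε : ε ≤ 1 / 2) (hg1 : ‖Lp.const 2 ν 1 - g‖ ≤ ε) :
    ∃ ν' : Measure (X × X), IsCoupling μ ν' ∧ (∀ γ : Γ, ν'.map (fun p => γ • p) = ν') ∧ ν' ≪ ν ∧
      diagEnergy ν' ≤ 8 * (ε ^ 2 + diagEnergy ν) := by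
  obtain ⟨k, hk, hkg⟩ : ∃ k : X × X → ℂ, Measurable k ∧ k =ᵐ[ν] g :=
    ⟨g, (Lp.stronglyMeasurable g).measurable, Eventually.of_forall fun _ => rfl⟩
  set σ := ν.withDensity fun p => ‖k p‖ₑ ^ 2 with hσ
  have hσr : σ = ν.withDensity fun p => ENNReal.ofReal (‖k p‖ ^ 2) := by
    rw [hσ]
    congr 1
    ext p
    rw [ENNReal.ofReal_pow (norm_nonneg _), ofReal_norm]
  have hσi : ∀ γ : Γ, σ.map (fun p => γ • p) = σ := fun γ =>
    hν.quasiInvariant.map_smul_withDensity_of_invariant γ (hg γ) hk hkg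
  have hσν : σ ≪ ν := withDensity_absolutelyContinuous _ _
  have hkm : MemLp k 2 ν := (memLp_congr_ae hkg).2 (Lp.memLp g)
  have hki : Integrable (fun p => ‖k p‖ ^ 2) ν := by simpa using hkm.integrable_norm_pow (p := 2) (by norm_num)
  have hσf : IsFiniteMeasure σ := by
    rw [hσr]
    exact isFiniteMeasure_withDensity_ofReal hki.2
  have hmass : σ.real Set.univ = ‖g‖ ^ 2 := by
    have e := integral_withDensity_ofReal (ρ := ν) (hk.norm.pow_const 2)
      (fun p => sq_nonneg _) fun _ => 1
    rw [← hσr] at e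
    simp only [integral_const, smul_eq_mul, mul_one] at e
    rw [e, integral_norm_sq_eq_eLpNorm hkm, eLpNorm_congr_ae hkg, Lp.norm_def]
  -- The invariant vector stays away from zero, so its squared modulus has integral at least `1 / 4`
  -- and can be normalized. The constant `8` is this factor `4` times the `2` in `|k|² ≤ 2 |k - 1|²
  -- + 2`.
  have hg2 : 1 / 2 ≤ ‖g‖ := by
    have e : ‖Lp.const 2 ν (1 : ℂ)‖ = 1 := by simp [Lp.norm_const']
    have := norm_sub_norm_le (Lp.const 2 ν (1 : ℂ)) g
    linarith
  have hmass4 : 1 / 4 ≤ σ.real Set.univ := by rw [hmass]; nlinarith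
  have hσ0 : σ Set.univ ≠ 0 := fun h0 => by
    rw [measureReal_def, h0] at hmass4
    norm_num at hmass4
  have hσ0' : σ ≠ 0 := fun h => hσ0 (by rw [h]; rfl)
  have : NeZero σ := ⟨hσ0'⟩
  set ν' := (σ Set.univ)⁻¹ • σ with hν'
  have hP : IsProbabilityMeasure ν' := isProbabilityMeasureSMul
  have hν'i : ∀ γ : Γ, ν'.map (fun p => γ • p) = ν' := fun γ => by
    rw [hν', Measure.map_smul, hσi]
  have hac : ν' ≪ ν := (Measure.smul_absolutelyContinuous).trans hσν
  -- Multiplying by a density may change the marginals, but they remain invariant and absolutely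
  -- continuous with respect to `μ`, so ergodicity returns them to `μ`.
  have hmarg : ∀ q : X × X → X, Measurable q → (∀ (γ : Γ) p, q (γ • p) = γ • q p) → ν.map q = μ →
      ν'.map q = μ := fun q hq hqγ hqμ => by
    have := Measure.isProbabilityMeasure_map (μ := ν') hq.aemeasurable
    refine eq_of_absolutelyContinuous_of_map_smul_eq (Γ := Γ) ?_ fun γ => ?_
    · rw [← hqμ]
      exact hac.map hq
    · conv_rhs => rw [← hν'i γ, Measure.map_map hq (measurable_const_smul γ)]
      rw [Measure.map_map (measurable_const_smul γ) hq]
      congr 1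
      ext p
      exact (hqγ γ p).symm
  refine ⟨ν', ⟨hP, hmarg _ measurable_fst (fun _ _ => rfl) hν.map_fst,
    hmarg _ measurable_snd (fun _ _ => rfl) hν.map_snd⟩, hν'i, hac, ?_⟩
  have hE : diagEnergy ν' = (σ.real Set.univ)⁻¹ * diagEnergy σ := by
    rw [diagEnergy, hν', integral_smul_measure, ENNReal.toReal_inv]
    rfl
  have hEσ : diagEnergy σ ≤ 2 * ε ^ 2 + 2 * diagEnergy ν := by
    have e := integral_withDensity_ofReal (ρ := ν) (hk.norm.pow_const 2)
      (fun p => sq_nonneg _) fun p : X × X => (realCoord X p.1 - realCoord X p.2) ^ 2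
    rw [← hσr] at e
    have hk1 : MemLp (fun p => k p - 1) 2 ν := hkm.sub (memLp_const 1)
    have i1 : Integrable (fun p => ‖k p - 1‖ ^ 2) ν := by
      simpa using hk1.integrable_norm_pow (p := 2) (by norm_num)
    have i2 : Integrable (fun p : X × X => (realCoord X p.1 - realCoord X p.2) ^ 2) ν :=
      integrable_of_bound measurable_coordDiff coordDiff_le_one
    have e1 : ∫ p, ‖k p - 1‖ ^ 2 ∂ν ≤ ε ^ 2 := by
      have e2 : (fun p => k p - 1) =ᵐ[ν] (g - Lp.const 2 ν 1 : Lp ℂ 2 ν) := by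
        filter_upwards [hkg, Lp.coeFn_sub g (Lp.const 2 ν 1), Lp.coeFn_const (p := 2) (μ := ν) (1 : ℂ)]
          with p h1 h2 h3
        rw [h2, Pi.sub_apply, h1, h3]
        rfl
      rw [integral_norm_sq_eq_eLpNorm hk1, eLpNorm_congr_ae e2, ← Lp.norm_def, norm_sub_rev]
      exact pow_le_pow_left₀ (norm_nonneg _) hg1 2
    calc diagEnergy σ = ∫ p, ‖k p‖ ^ 2 * (realCoord X p.1 - realCoord X p.2) ^ 2 ∂ν := e
      _ ≤ ∫ p, (2 * ‖k p - 1‖ ^ 2 + 2 * (realCoord X p.1 - realCoord X p.2) ^ 2) ∂ν := by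
          refine integral_mono_of_nonneg (Eventually.of_forall fun p => by positivity)
            ((i1.const_mul 2).add (i2.const_mul 2)) (Eventually.of_forall fun p => ?_)
          have c0 := sq_nonneg (realCoord X p.1 - realCoord X p.2)
          have c1 := (le_abs_self _).trans (coordDiff_le_one p)
          set c := (realCoord X p.1 - realCoord X p.2) ^ 2
          have t : ‖k p‖ ≤ ‖k p - 1‖ + 1 := by
            have := norm_add_le (k p - 1) 1
            rwa [sub_add_cancel, norm_one] at this
          have t2 : ‖k p‖ ^ 2 ≤ 2 * ‖k p - 1‖ ^ 2 + 2 := by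
            nlinarith [norm_nonneg (k p), sq_nonneg (‖k p - 1‖ - 1)]
          have t3 := mul_le_mul_of_nonneg_right t2 c0
          have t4 := mul_le_mul_of_nonneg_left c1 (sq_nonneg ‖k p - 1‖)
          simp only
          nlinarith
      _ = 2 * (∫ p, ‖k p - 1‖ ^ 2 ∂ν) + 2 * diagEnergy ν := by
          rw [integral_add (i1.const_mul 2) (i2.const_mul 2), integral_const_mul, integral_const_mul]
          rfl
      _ ≤ _ := by linarith
  rw [hE, inv_mul_le_iff₀ (by linarith)]
  have hE0 := diagEnergy_nonneg ν
  nlinarith [sq_nonneg ε]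

/-- If a group with property (T) acts non-rigidly, there are invariant measures close to the diagonal
without mass on the diagonal. -/
theorem exists_invariant_seq_of_not_isRigidAction [Countable Γ] [NullSingletonClass μ]
    (hT : HasPropertyT.{v, max u v} Γ) (h : ¬ IsRigidAction Γ μ) :
    ∃ ν : ℕ → Measure (X × X), IsApproxDiagonal μ ν ∧ IsInvariantSeq Γ ν ∧
      ∀ n, ν n (Set.diagonal X) = 0 := by
  obtain ⟨ν₀, hap, hinv, hdiag⟩ := exists_seq_of_not_isRigidAction h
  obtain ⟨ν, d, hc, hE, hd, htv, hD⟩ := exists_isBimoduleCoupling hap hinv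
  have hP : ∀ n, IsProbabilityMeasure (ν n) := fun n => (hc n).isProbabilityMeasure
  have hK : ∀ γ : Γ, Tendsto (fun n => ‖(hc n).quasiInvariant.koopman γ (Lp.const 2 (ν n) 1) -
      Lp.const 2 (ν n) 1‖) atTop (𝓝 0) := fun γ => by
    refine squeeze_zero (fun n => norm_nonneg _) (fun n => Real.le_sqrt_of_sq_le
      ((hc n).quasiInvariant.integral_koopman_one_sub_one γ (htv γ n))) ?_
    simpa using (hd γ).sqrt
  have main : ∀ n : ℕ, ∃ ν' : Measure (X × X), IsCoupling μ ν' ∧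
      (∀ γ : Γ, ν'.map (fun p => γ • p) = ν') ∧ ν' (Set.diagonal X) = 0 ∧
      diagEnergy ν' ≤ 16 * (1 / ((n : ℝ) + 1)) := fun n => by
    have hpos : (0 : ℝ) < 1 / ((n : ℝ) + 1) := by positivity
    have hle : 1 / ((n : ℝ) + 1) ≤ 1 := by
      rw [div_le_one (by positivity)]
      linarith [(Nat.cast_nonneg n : (0 : ℝ) ≤ n)]
    set t := 1 / ((n : ℝ) + 1) with ht
    -- With distance at most `t / 2` and energy below `t ≤ 1`, the new energy is at most `8 (t²/4 +
    -- t) ≤ 16 t`. Absolute continuity keeps the diagonal null.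
    obtain ⟨m, ⟨g, hg, hg1⟩, hm⟩ := ((hT.eventually_exists_koopman_eq
      (fun n => (hc n).quasiInvariant) (fun n => Lp.const 2 (ν n) 1) hK
      (show 0 < t / 2 by positivity)).and (hE.eventually (gt_mem_nhds hpos))).exists
    obtain ⟨ν', h1, h2, h3, h4⟩ := exists_invariant_isCoupling (hc m) hg (by linarith) hg1
    refine ⟨ν', h1, h2, h3 ((hD m).trans (hdiag m)), h4.trans ?_⟩
    nlinarith
  choose ν' h1 h2 h3 h4 using main
  refine ⟨ν', isApproxDiagonal_of_diagEnergy h1 ?_, fun n γ => h2 n γ, h3⟩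
  refine squeeze_zero (fun n => diagEnergy_nonneg _) h4 ?_
  simpa using tendsto_one_div_add_atTop_nhds_zero_nat (𝕜 := ℝ).const_mul 16

end Invariant

theorem IsInvariantSeq.isAsymptoticallyInvariant {X : Type u} [MeasurableSpace X] {Γ : Type v}
    [Group Γ] [MulAction Γ X] {ν : ℕ → Measure (X × X)} (h : IsInvariantSeq Γ ν) :
    IsAsymptoticallyInvariant Γ ν := fun γ => by
  refine tendsto_const_nhds.congr fun n => ?_
  rw [h n γ, measureDist]
  refine le_antisymm (Real.sSup_nonneg ?_) (csSup_le ⟨_, fun _ => 0, measurable_const, by simp, rfl⟩ ?_)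
  · rintro r ⟨f, -, -, rfl⟩
    exact norm_nonneg _
  · rintro r ⟨f, -, -, rfl⟩
    rw [sub_self, norm_zero]

end

theorem theorem0p3 {X : Type u} {Γ : Type v} [MeasurableSpace X] [StandardBorelSpace X]
    [Group Γ] [Countable Γ] [MulAction Γ X] [MeasurableConstSMul Γ X]
    (μ : Measure X) [IsProbabilityMeasure μ] [NullSingletonClass μ]
    [ErgodicSMul Γ X μ] (hfree : IsFreeAction Γ μ) :
    (IsRigidAction Γ μ ↔
      ¬ ∃ ν : ℕ → Measure (X × X), IsApproxDiagonal μ ν ∧ IsAsymptoticallyInvariant Γ ν ∧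
        ∀ n, ν n (Set.diagonal X) = 0) ∧
    (IsRigidAction Γ μ ↔
      ∀ ν : ℕ → Measure (X × X), IsApproxDiagonal μ ν → IsAsymptoticallyInvariant Γ ν →
        Tendsto (fun n => ν n (Set.diagonal X)) atTop (𝓝 1)) ∧
    (HasPropertyT.{v, max u v} Γ →
      (IsRigidAction Γ μ ↔
        ¬ ∃ ν : ℕ → Measure (X × X), IsApproxDiagonal μ ν ∧ IsInvariantSeq Γ ν ∧
          ∀ n, ν n (Set.diagonal X) = 0) ∧
      (IsRigidAction Γ μ ↔
        ∀ ν : ℕ → Measure (X × X), IsApproxDiagonal μ ν → IsInvariantSeq Γ ν →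
          Tendsto (fun n => ν n (Set.diagonal X)) atTop (𝓝 1))) := by
  have not_tendsto : ∀ {ν : ℕ → Measure (X × X)}, (∀ n, ν n (Set.diagonal X) = 0) →
      ¬ Tendsto (fun n => ν n (Set.diagonal X)) atTop (𝓝 1) := fun h ht => by
    simp_rw [h] at ht
    exact zero_ne_one (tendsto_nhds_unique tendsto_const_nhds ht)
  -- In each equivalence, rigidity yields convergence of the diagonal masses to `1`, while its
  -- failure yields a sequence of diagonal mass `0`; these exclude each other.
  refine ⟨⟨fun h => ?_, fun h => ?_⟩, ⟨fun h ν hν hinv => h.tendsto_diagonal hν hinv, fun h => ?_⟩,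
    fun hT => ⟨⟨fun h => ?_, fun h => ?_⟩, ⟨fun h ν hν hinv => ?_, fun h => ?_⟩⟩⟩
  · rintro ⟨ν, hν, hinv, h0⟩
    exact not_tendsto h0 (h.tendsto_diagonal hν hinv)
  · by_contra hr
    exact h (exists_seq_of_not_isRigidAction hr)
  · by_contra hr
    obtain ⟨ν, hν, hinv, h0⟩ := exists_seq_of_not_isRigidAction hr
    exact not_tendsto h0 (h ν hν hinv)
  · rintro ⟨ν, hν, hinv, h0⟩
    exact not_tendsto h0 (h.tendsto_diagonal hν hinv.isAsymptoticallyInvariant)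
  · by_contra hr
    exact h (exists_invariant_seq_of_not_isRigidAction hT hr)
  · exact h.tendsto_diagonal hν hinv.isAsymptoticallyInvariant
  · by_contra hr
    obtain ⟨ν, hν, hinv, h0⟩ := exists_invariant_seq_of_not_isRigidAction hT hr
    exact not_tendsto h0 (h ν hν hinv)
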